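/- Let $(a,b)$, $-\infty\le a<b\le\infty$, be an open interval and let $\varrho,\varsigma,\chi$ be Borel measures on $(a,b)$ that are finite on compact subintervals, such that $\varrho$ is real-valued, $\varsigma$ is positive, absolutely continuous with respect to Lebesgue measure and supported on the whole interval, $\chi$ is positive and not identically zero, and $\varsigma(\{x\})\chi(\{x\})=\varsigma(\{x\})\varrho(\{x\})=0$ for all $x$. Integrals $\int_\alpha^\beta$ with respect to measures are taken over $[\alpha,\beta)$ (with a minus sign and over $[\beta,\alpha)$ if $\beta<\alpha$). For an interval $(a,d)\subseteq(a,b)$ with $\chi((a,d))\neq0$ let $H^1(a,d)$ be the Hilbert space of all functions $f$ on $(a,d)$ that are locally absolutely continuous with respect to $\varsigma$, i.e. $f(x)=f(x_0)+\int_{x_0}^x f^{[1]}\,d\varsigma$ with $f^{[1]}\in L^1_{\mathrm{loc}}((a,d);\varsigma)$, and satisfy $f\in L^2((a,d);\chi)$, $f^{[1]}\in L^2((a,d);\varsigma)$, with inner product $\langle f,g\rangle=\int_a^d f g^*\,d\chi+\int_a^d f^{[1]}g^{[1]*}\,d\varsigma$. Let $T_{\mathrm{loc}}$ be the set of pairs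 $(f,f_\tau)$ of functions that are locally absolutely continuous with respect to $\varsigma$ on $(a,b)$ and for which $f^{[1]}$ has a (necessarily unique) representative, again denoted $f^{[1]}$, with $-f^{[1]}(x)+\int_{x_0}^x f\,d\chi=-f^{[1]}(x_0)+\int_{x_0}^x f_\tau\,d\varrho$ for all $x_0,x\in(a,b)$; this means $\tau f=f_\tau$ for $\tau f=\frac{d}{d\varrho}\bigl(-\frac{df}{d\varsigma}+\int f\,d\chi\bigr)$. A solution of $(\tau-z)u=0$ is a function $u$ with $(u,zu)\in T_{\mathrm{loc}}$, and it is identified with this pair. Let $T_{\max}$ be the set of pairs in $T_{\mathrm{loc}}$ with both components in $H^1(a,b)$, and put $V(f,g^*)=f_\tau g^{[1]*}-f^{[1]}g_\tau^*$, the values of which at the endpoints are understood as limits. The expression $\tau$ is in the limit-circle case at an endpoint if for every $z\ne0$ all solutions of $(\tau-z)u=0$ lie in $H^1(a,b)$ near this endpoint. Let $v_a,v_b\in T_{\max}$ be such that, if $\tau$ is in the limit-circle case at $a$, then $V(v_a,v_a^*)(a)=0$ and $V(f,v_a^*)(a)\ne0$ for some $f\in T_{\max}$, and analogously for $v_b$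 at $b$. Let $S=\{f\in T_{\max}\mid V(f,v_a^*)(a)=V(f,v_b^*)(b)=0\}$ and assume that $0$ is not an eigenvalue of $S$. Assume that for each $z\in\mathbb C$, $\phi_z$ is a non-trivial solution of $(\tau-z)u=0$ which lies in $H^1(a,b)$ near $a$ and satisfies $V(\phi_z,v_a^*)(a)=0$ if $\tau$ is in the limit-circle case at $a$, and that for each $x\in(a,b)$ the functions $z\mapsto\phi_z(x)$ and $z\mapsto\phi_z^{[1]}(x)$ are entire and real on the real axis. Let $c\in(a,b)$ with $\chi((a,c))\neq0$. Then $E(z,c)=z\phi_z(c)+\mathrm i\,\phi_z^{[1]}(c)$ is a de Branges function, i.e. it is entire and $|E(z,c)|>|E(z^*,c)|$ for $\operatorname{Im}z>0$. Let $B(c)$ be the associated de Branges space, i.e. the Hilbert space of all entire functions $F$ with $\int_{\mathbb R}|F(\lambda)|^2|E(\lambda,c)|^{-2}d\lambda<\infty$ for which $F/E(\cdot,c)$ and $F^\#/E(\cdot,c)$, $F^\#(z)=F(z^*)^*$, are of bounded type in the open upper half-plane (quotients of two bounded analytic functions there) with non-positive mean type $\limsup_{y\to\infty}y^{-1}\ln|N(\mathrm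 iy)|$, equipped with the inner product $\frac1\pi\int_{\mathbb R}F(\lambda)G(\lambda)^*|E(\lambda,c)|^{-2}d\lambda$. The restrictions $\phi_z|_{(a,c)}$ lie in $H^1(a,c)$, and the transformation $f\mapsto\hat f$, $$\hat f(z)=\int_a^c\phi_z f\,d\chi+\int_a^c\phi_z^{[1]}f^{[1]}\,d\varsigma,\qquad z\in\mathbb C,$$ is a partial isometry from $H^1(a,c)$ onto $B(c)$ whose initial subspace (the orthogonal complement of its kernel) is $D(c)=\overline{\operatorname{span}\{\phi_z|_{(a,c)}\mid z\in\mathbb C\}}\subseteq H^1(a,c)$. -/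

import Mathlib

open MeasureTheory Filter Topology Set ComplexConjugate

noncomputable section

namespace LeftDefinite

/-! ### Intervals and functions that are absolutely continuous with respect to a measure -/

/-- The open interval `(a, b)` of real numbers with possibly infinite endpoints. -/
def oi (a b : EReal) : Set ℝ := {x | a < (x : EReal) ∧ (x : EReal) < b}

/-- The oriented integral `∫_c^x h dμ`: over `[c, x)` if `c ≤ x`, and minus the integral over
`[x, c)` if `x < c`. -/
def orientedIntegral (μ : Measure ℝ) (h : ℝ → ℂ) (c x : ℝ) : ℂ :=
  if c ≤ x then ∫ s in Ico c x, h s ∂μ else -∫ s in Ico x c, h s ∂μ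

/-- `h ∈ L¹_loc(I; μ)`. -/
def LocInt (I : Set ℝ) (μ : Measure ℝ) (h : ℝ → ℂ) : Prop :=
  ∀ α ∈ I, ∀ β ∈ I, IntegrableOn h (Icc α β) μ

/-- On the interval `I` the function `f` is (left-continuous and) locally absolutely continuous
with respect to the positive measure `μ`, with Radon--Nikodym derivative `h = df/dμ`. -/
def HasRN (I : Set ℝ) (μ : Measure ℝ) (f h : ℝ → ℂ) : Prop :=
  LocInt I μ h ∧ ∀ c ∈ I, ∀ x ∈ I, f x = f c + orientedIntegral μ h c x

theorem isOpen_oi (a b : EReal) : IsOpen (oi a b) :=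
  (isOpen_Ioo (a := a) (b := b)).preimage continuous_coe_real_ereal

theorem oi_ordConnected (a b : EReal) : (oi a b).OrdConnected := by
  refine ⟨fun x hx y hy z hz => ⟨hx.1.trans_le ?_, lt_of_le_of_lt ?_ hy.2⟩⟩
  · exact_mod_cast hz.1
  · exact_mod_cast hz.2

theorem orientedIntegral_add {I : Set ℝ} {μ : Measure ℝ} {h k : ℝ → ℂ}
    (hh : LocInt I μ h) (hk : LocInt I μ k) {c x : ℝ} (hc : c ∈ I) (hx : x ∈ I) :
    orientedIntegral μ (h + k) c x = orientedIntegral μ h c x + orientedIntegral μ k c x := by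
  unfold orientedIntegral
  split_ifs
  · exact integral_add ((hh c hc x hx).mono_set Ico_subset_Icc_self)
      ((hk c hc x hx).mono_set Ico_subset_Icc_self)
  · rw [← neg_add]
    congr 1
    exact integral_add ((hh x hx c hc).mono_set Ico_subset_Icc_self)
      ((hk x hx c hc).mono_set Ico_subset_Icc_self)

theorem orientedIntegral_smul (μ : Measure ℝ) (r : ℂ) (h : ℝ → ℂ) (c x : ℝ) :
    orientedIntegral μ (r • h) c x = r * orientedIntegral μ h c x := by
  unfold orientedIntegral
  split_ifs
  · simp only [Pi.smul_apply, smul_eq_mul]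
    rw [integral_const_mul]
  · simp only [Pi.smul_apply, smul_eq_mul]
    rw [integral_const_mul, mul_neg]

theorem HasRN.add {a b : EReal} {μ : Measure ℝ} {f g h k : ℝ → ℂ}
    (hf : HasRN (oi a b) μ f h) (hg : HasRN (oi a b) μ g k) :
    HasRN (oi a b) μ (f + g) (h + k) := by
  refine ⟨fun α hα β hβ => (hf.1 α hα β hβ).add (hg.1 α hα β hβ), fun c hc x hx => ?_⟩
  rw [orientedIntegral_add hf.1 hg.1 hc hx, Pi.add_apply, Pi.add_apply,
    hf.2 c hc x hx, hg.2 c hc x hx]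
  ring

theorem HasRN.smul {I : Set ℝ} {μ : Measure ℝ} {f h : ℝ → ℂ} (r : ℂ)
    (hf : HasRN I μ f h) : HasRN I μ (r • f) (r • h) := by
  refine ⟨fun α hα β hβ => (hf.1 α hα β hβ).smul r, fun c hc x hx => ?_⟩
  rw [orientedIntegral_smul, Pi.smul_apply, Pi.smul_apply, hf.2 c hc x hx]
  simp only [smul_eq_mul]
  ring

/-- The Radon--Nikodym derivative is unique almost everywhere. -/
theorem HasRN.ae_eq {a b : EReal} {μ : Measure ℝ} {f h k : ℝ → ℂ}
    (hf : HasRN (oi a b) μ f h) (hg : HasRN (oi a b) μ f k) :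
    h =ᵐ[μ.restrict (oi a b)] k := by
  -- local statement
  have key : ∀ α ∈ oi a b, ∀ β ∈ oi a b, h =ᵐ[μ.restrict (Ico α β)] k := by
    intro α hα β hβ
    have hd : IntegrableOn (h - k) (Ico α β) μ :=
      ((hf.1 α hα β hβ).sub (hg.1 α hα β hβ)).mono_set Ico_subset_Icc_self
    have hzero : ∀ x ∈ oi a b, ∫ s in Ico α x, (h - k) s ∂μ = 0 := by
      intro x hx
      by_cases hαx : α ≤ x
      · have h1 := hf.2 α hα x hx
        have h2 := hg.2 α hα x hx
        simp only [orientedIntegral, if_pos hαx] at h1 h2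
        have h3 := integral_sub ((hf.1 α hα x hx).mono_set Ico_subset_Icc_self)
          ((hg.1 α hα x hx).mono_set Ico_subset_Icc_self)
        simp only [Pi.sub_apply]
        rw [h3]
        have : (∫ s in Ico α x, h s ∂μ) = ∫ s in Ico α x, k s ∂μ := by
          exact add_left_cancel (h1.symm.trans h2)
        rw [this, sub_self]
      · rw [Ico_eq_empty (fun hlt => hαx hlt.le)]
        simp
    have hall : ∀ t, MeasurableSet t → ∫ s in t, (h - k) s ∂(μ.restrict (Ico α β)) = 0 := by
      intro t ht
      induction t, ht using MeasurableSpace.induction_on_inter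
        (borel_eq_generateFrom_Iio ℝ ▸ (BorelSpace.measurable_eq (α := ℝ))) isPiSystem_Iio with
      | empty => simp
      | basic t ht =>
        obtain ⟨y, rfl⟩ := ht
        rw [Measure.restrict_restrict measurableSet_Iio]
        by_cases hy : y ≤ β
        · by_cases hy2 : α ≤ y
          · have : Iio y ∩ Ico α β = Ico α y := by
              ext s
              simp only [mem_inter_iff, mem_Iio, mem_Ico]
              constructor
              · rintro ⟨h1, h2, h3⟩
                exact ⟨h2, h1⟩
              · rintro ⟨h1, h2⟩
                exact ⟨h2, h1, h2.trans_le hy⟩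
            rw [this]
            exact hzero y ((oi_ordConnected a b).out hα hβ ⟨hy2, hy⟩)
          · have : Iio y ∩ Ico α β = ∅ := by
              ext s
              simp only [mem_inter_iff, mem_Iio, mem_Ico, mem_empty_iff_false, iff_false]
              rintro ⟨h1, h2, h3⟩
              exact hy2 (h2.trans h1.le)
            rw [this]
            simp
        · have : Iio y ∩ Ico α β = Ico α β := by
            ext s
            simp only [mem_inter_iff, mem_Iio, mem_Ico, and_iff_right_iff_imp]
            rintro ⟨h1, h2⟩
            exact h2.trans (not_le.mp hy)
          rw [this]
          exact hzero β hβ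
      | compl t ht ih =>
        rw [setIntegral_compl ht hd, ih, hzero β hβ, sub_zero]
      | iUnion t hdisj hm ih =>
        rw [integral_iUnion hm hdisj hd.integrableOn]
        exact (tsum_congr ih).trans tsum_zero
    have := Integrable.ae_eq_zero_of_forall_setIntegral_eq_zero hd (fun t ht _ => hall t ht)
    filter_upwards [this] with s hs
    exact sub_eq_zero.mp hs
  -- countable cover
  let J : Set (ℚ × ℚ) := {p | (p.1 : ℝ) ∈ oi a b ∧ (p.2 : ℝ) ∈ oi a b}
  have hcov : oi a b ⊆ ⋃ p ∈ J, Ico (p.1 : ℝ) (p.2 : ℝ) := by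
    intro x hx
    obtain ⟨ε, hε, hball⟩ := Metric.isOpen_iff.mp (isOpen_oi a b) x hx
    obtain ⟨p, hp1, hp2⟩ := exists_rat_btwn (show x - ε < x by linarith)
    obtain ⟨q, hq1, hq2⟩ := exists_rat_btwn (show x < x + ε by linarith)
    refine mem_iUnion₂.mpr ⟨(p, q), ⟨hball ?_, hball ?_⟩, hp2.le, hq1⟩
    · rw [Real.ball_eq_Ioo]
      exact ⟨hp1, by simp only; linarith⟩
    · rw [Real.ball_eq_Ioo]
      exact ⟨by simp only; linarith, hq2⟩
  refine ae_mono (Measure.restrict_mono hcov le_rfl) ?_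
  exact (ae_restrict_biUnion_iff (fun p : ℚ × ℚ => Ico (p.1 : ℝ) (p.2 : ℝ))
    (Set.to_countable J) _).mpr fun p hp => key _ hp.1 _ hp.2

/-! ### The measure coefficients -/

/-- The coefficients `ϱ`, `ς`, `χ` of a left-definite measure Sturm--Liouville expression on
`(a, b)`. All measures are finite on compact subintervals of `(a, b)` (not necessarily finite near
the endpoints); only their restrictions to `(a, b)` are ever used. The real-valued measure `ϱ` is
given by its Jordan decomposition `ϱ = rhoPos - rhoNeg`. -/
structure Coeff (a b : EReal) where
  /-- the measure `ς` -/
  sigma : Measure ℝ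
  /-- the measure `χ` -/
  chi : Measure ℝ
  /-- the positive part of `ϱ` -/
  rhoPos : Measure ℝ
  /-- the negative part of `ϱ` -/
  rhoNeg : Measure ℝ
  sigma_fin : ∀ α ∈ oi a b, ∀ β ∈ oi a b, sigma (Icc α β) < ⊤
  chi_fin : ∀ α ∈ oi a b, ∀ β ∈ oi a b, chi (Icc α β) < ⊤
  rhoPos_fin : ∀ α ∈ oi a b, ∀ β ∈ oi a b, rhoPos (Icc α β) < ⊤
  rhoNeg_fin : ∀ α ∈ oi a b, ∀ β ∈ oi a b, rhoNeg (Icc α β) < ⊤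
  rho_jordan : (rhoPos.restrict (oi a b)).MutuallySingular (rhoNeg.restrict (oi a b))
  /-- `ς` is supported on the whole interval -/
  sigma_supp : ∀ α ∈ oi a b, ∀ β ∈ oi a b, α < β → sigma (Ioo α β) ≠ 0
  /-- `χ` is not identically zero -/
  chi_ne_zero : chi (oi a b) ≠ 0
  /-- `ς` has no point masses in common with `χ` -/
  sigma_chi : ∀ x ∈ oi a b, sigma {x} * chi {x} = 0
  /-- `ς` has no point masses in common with `ϱ` -/
  sigma_rho : ∀ x ∈ oi a b, sigma {x} * (rhoPos + rhoNeg) {x} = 0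

theorem oi_mono_right {a b : EReal} {c : ℝ} (hc : c ∈ oi a b) : oi a (c : EReal) ⊆ oi a b :=
  fun _ hx => ⟨hx.1, hx.2.trans hc.2⟩

namespace Coeff

variable {a b : EReal}

/-- The restriction of the coefficients to `(a, c)`; it satisfies the requirements on coefficients
precisely when `χ` does not vanish identically on `(a, c)`. -/
def restrict (C : Coeff a b) (c : ℝ) (hc : c ∈ oi a b) (hχ : C.chi (oi a c) ≠ 0) :
    Coeff a (c : EReal) where
  sigma := C.sigma
  chi := C.chi
  rhoPos := C.rhoPos
  rhoNeg := C.rhoNeg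
  sigma_fin α hα β hβ := C.sigma_fin α (oi_mono_right hc hα) β (oi_mono_right hc hβ)
  chi_fin α hα β hβ := C.chi_fin α (oi_mono_right hc hα) β (oi_mono_right hc hβ)
  rhoPos_fin α hα β hβ := C.rhoPos_fin α (oi_mono_right hc hα) β (oi_mono_right hc hβ)
  rhoNeg_fin α hα β hβ := C.rhoNeg_fin α (oi_mono_right hc hα) β (oi_mono_right hc hβ)
  rho_jordan := C.rho_jordan.mono (Measure.restrict_mono (oi_mono_right hc) le_rfl)
    (Measure.restrict_mono (oi_mono_right hc) le_rfl)
  sigma_supp α hα β hβ := C.sigma_supp α (oi_mono_right hc hα) β (oi_mono_right hc hβ)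
  chi_ne_zero := hχ
  sigma_chi x hx := C.sigma_chi x (oi_mono_right hc hx)
  sigma_rho x hx := C.sigma_rho x (oi_mono_right hc hx)

/-- `∫_c^x g dϱ`. -/
def rhoIntegral (C : Coeff a b) (g : ℝ → ℂ) (c x : ℝ) : ℂ :=
  orientedIntegral C.rhoPos g c x - orientedIntegral C.rhoNeg g c x

/-! ### The modified Sobolev space -/

/-- `f ∈ AC_loc((a,b); ς)` is square integrable with respect to `χ` on `J`, and `df/dς` is square
integrable with respect to `ς` on `J`. -/
def MemH1On (C : Coeff a b) (J : Set ℝ) (f : ℝ → ℂ) : Prop :=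
  ∃ h, HasRN (oi a b) C.sigma f h ∧ MemLp f 2 (C.chi.restrict J) ∧ MemLp h 2 (C.sigma.restrict J)

/-- The functions of `H¹(a,b)`. A function on `(a,b)` is represented by its extension by zero. -/
def h1Submodule (C : Coeff a b) : Submodule ℂ (ℝ → ℂ) where
  carrier := {f | (∀ x ∉ oi a b, f x = 0) ∧ C.MemH1On (oi a b) f}
  zero_mem' := by
    refine ⟨fun _ _ => rfl, 0, ⟨fun α _ β _ => integrableOn_zero, fun c _ x _ => ?_⟩, ?_, ?_⟩
    · simp [orientedIntegral]
    · exact MemLp.zero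
    · exact MemLp.zero
  add_mem' := by
    rintro f g ⟨hf0, h, hf, hf1, hf2⟩ ⟨hg0, k, hg, hg1, hg2⟩
    refine ⟨fun x hx => ?_, h + k, hf.add hg, hf1.add hg1, hf2.add hg2⟩
    simp [hf0 x hx, hg0 x hx]
  smul_mem' := by
    rintro r f ⟨hf0, h, hf, hf1, hf2⟩
    refine ⟨fun x hx => ?_, r • h, hf.smul r, hf1.const_smul r, hf2.const_smul r⟩
    simp [hf0 x hx]

/-- The modified Sobolev space `H¹(a,b)`. -/
def H1 (C : Coeff a b) : Type := C.h1Submodule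

instance (C : Coeff a b) : AddCommGroup C.H1 := inferInstanceAs (AddCommGroup C.h1Submodule)

instance (C : Coeff a b) : Module ℂ C.H1 := inferInstanceAs (Module ℂ C.h1Submodule)

instance (C : Coeff a b) : CoeFun C.H1 (fun _ => ℝ → ℂ) := ⟨fun f => f.1⟩

/-- The quasi-derivative `f^{[1]} = df/dς` of `f ∈ H¹(a,b)` (unique up to `ς`-null sets). -/
def H1.deriv {C : Coeff a b} (f : C.H1) : ℝ → ℂ := Classical.choose f.2.2

theorem H1.hasRN {C : Coeff a b} (f : C.H1) : HasRN (oi a b) C.sigma f f.deriv :=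
  (Classical.choose_spec f.2.2).1

theorem H1.memLp {C : Coeff a b} (f : C.H1) : MemLp f 2 (C.chi.restrict (oi a b)) :=
  (Classical.choose_spec f.2.2).2.1

theorem H1.memLp_deriv {C : Coeff a b} (f : C.H1) :
    MemLp f.deriv 2 (C.sigma.restrict (oi a b)) :=
  (Classical.choose_spec f.2.2).2.2

theorem H1.deriv_add {C : Coeff a b} (f g : C.H1) :
    (f + g).deriv =ᵐ[C.sigma.restrict (oi a b)] f.deriv + g.deriv :=
  (f + g).hasRN.ae_eq (f.hasRN.add g.hasRN)

theorem H1.deriv_smul {C : Coeff a b} (r : ℂ) (f : C.H1) :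
    (r • f).deriv =ᵐ[C.sigma.restrict (oi a b)] r • f.deriv :=
  (r • f).hasRN.ae_eq (f.hasRN.smul r)

theorem integrable_conj_mul {μ : Measure ℝ} {f g : ℝ → ℂ} (hf : MemLp f 2 μ) (hg : MemLp g 2 μ) :
    Integrable (fun x => conj (f x) * g x) μ :=
  MemLp.integrable_mul (p := 2) (q := 2) hf.star hg

theorem integral_conj_mul_self_re {μ : Measure ℝ} (f : ℝ → ℂ) :
    ∫ x, conj (f x) * f x ∂μ = ((∫ x, ‖f x‖ ^ 2 ∂μ : ℝ) : ℂ) := by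
  rw [← integral_complex_ofReal]
  congr 1
  ext x
  rw [Complex.conj_mul']
  push_cast
  rfl

/-- The inner product of `H¹(a,b)`; as usual in Mathlib it is conjugate linear in the first
argument. -/
@[reducible] def h1Core (C : Coeff a b) : InnerProductSpace.Core ℂ C.H1 where
  inner f g := (∫ x in oi a b, conj (f x) * g x ∂C.chi)
    + ∫ x in oi a b, conj (f.deriv x) * g.deriv x ∂C.sigma
  conj_inner_symm f g := by
    simp only [map_add]
    rw [← integral_conj, ← integral_conj]
    simp only [map_mul, Complex.conj_conj, mul_comm]
  re_inner_nonneg f := by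
    simp only [integral_conj_mul_self_re]
    rw [← Complex.ofReal_add]
    simp only [RCLike.re_to_complex, Complex.ofReal_re]
    exact add_nonneg (integral_nonneg fun _ => by positivity)
      (integral_nonneg fun _ => by positivity)
  add_left f g k := by
    have e1 : ∫ x in oi a b, conj ((f + g) x) * k x ∂C.chi
        = (∫ x in oi a b, conj (f x) * k x ∂C.chi) + ∫ x in oi a b, conj (g x) * k x ∂C.chi := by
      rw [← integral_add (integrable_conj_mul f.memLp k.memLp)
        (integrable_conj_mul g.memLp k.memLp)]
      congr 1
      ext x
      change conj (f x + g x) * k x = _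
      rw [map_add, add_mul]
    have e2 : ∫ x in oi a b, conj ((f + g).deriv x) * k.deriv x ∂C.sigma
        = (∫ x in oi a b, conj (f.deriv x) * k.deriv x ∂C.sigma)
          + ∫ x in oi a b, conj (g.deriv x) * k.deriv x ∂C.sigma := by
      rw [← integral_add (integrable_conj_mul f.memLp_deriv k.memLp_deriv)
        (integrable_conj_mul g.memLp_deriv k.memLp_deriv)]
      refine integral_congr_ae ?_
      filter_upwards [H1.deriv_add f g] with x hx
      rw [hx, Pi.add_apply, map_add, add_mul]
    rw [e1, e2]
    ring
  smul_left f g r := by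
    have e1 : ∫ x in oi a b, conj ((r • f) x) * g x ∂C.chi
        = conj r * ∫ x in oi a b, conj (f x) * g x ∂C.chi := by
      rw [← integral_const_mul]
      congr 1
      ext x
      change conj (r * f x) * g x = _
      rw [map_mul, mul_assoc]
    have e2 : ∫ x in oi a b, conj ((r • f).deriv x) * g.deriv x ∂C.sigma
        = conj r * ∫ x in oi a b, conj (f.deriv x) * g.deriv x ∂C.sigma := by
      rw [← integral_const_mul]
      refine integral_congr_ae ?_
      filter_upwards [H1.deriv_smul r f] with x hx
      rw [hx, Pi.smul_apply, smul_eq_mul, map_mul, mul_assoc]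
    rw [e1, e2]
    ring
  definite f hf := by
    simp only [integral_conj_mul_self_re] at hf
    rw [← Complex.ofReal_add, Complex.ofReal_eq_zero] at hf
    have i1 : 0 ≤ ∫ x in oi a b, ‖f x‖ ^ 2 ∂C.chi := integral_nonneg fun _ => by positivity
    have i2 : 0 ≤ ∫ x in oi a b, ‖f.deriv x‖ ^ 2 ∂C.sigma := integral_nonneg fun _ => by positivity
    have z1 : ∫ x in oi a b, ‖f x‖ ^ 2 ∂C.chi = 0 := by linarith
    have z2 : ∫ x in oi a b, ‖f.deriv x‖ ^ 2 ∂C.sigma = 0 := by linarith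
    rw [integral_eq_zero_iff_of_nonneg (fun _ => by positivity)
      ((memLp_two_iff_integrable_sq_norm f.memLp.1).mp f.memLp)] at z1
    rw [integral_eq_zero_iff_of_nonneg (fun _ => by positivity)
      ((memLp_two_iff_integrable_sq_norm f.memLp_deriv.1).mp f.memLp_deriv)] at z2
    have hd : ∀ α ∈ oi a b, ∀ β ∈ oi a b, ∫ s in Ico α β, f.deriv s ∂C.sigma = 0 := by
      intro α hα β hβ
      have hsub : Ico α β ⊆ oi a b := Ico_subset_Icc_self.trans ((oi_ordConnected a b).out hα hβ)
      refine integral_eq_zero_of_ae ?_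
      refine ae_mono (Measure.restrict_mono hsub le_rfl) ?_
      filter_upwards [z2] with s hs
      simpa using hs
    have hconst : ∀ c ∈ oi a b, ∀ x ∈ oi a b, f x = f c := by
      intro c hc x hx
      rw [f.hasRN.2 c hc x hx]
      unfold orientedIntegral
      split_ifs
      · rw [hd c hc x hx, add_zero]
      · rw [hd x hx c hc, neg_zero, add_zero]
    apply Subtype.ext
    funext x
    change f x = 0
    by_cases hx : x ∈ oi a b
    · by_contra hne
      apply C.chi_ne_zero
      have hm : MeasurableSet (oi a b) := (isOpen_oi a b).measurableSet
      have := (ae_restrict_iff' hm).mp z1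
      rw [ae_iff] at this
      refine measure_mono_null (fun y hy => ?_) this
      simp only [Set.mem_ofPred_eq, not_forall]
      refine ⟨hy, fun h0 => hne ?_⟩
      rw [← hconst x hx y hy]
      simpa using h0
    · exact f.2.1 x hx

instance (C : Coeff a b) : NormedAddCommGroup C.H1 := C.h1Core.toNormedAddCommGroup

instance (C : Coeff a b) : InnerProductSpace ℂ C.H1 := InnerProductSpace.ofCore C.h1Core.toCore

/-! ### The differential expression, the maximal relation and boundary conditions -/

/-- The pairs `(f, f_τ) ∈ T_loc`, i.e. `f, f_τ ∈ AC_loc((a,b); ς)`, `f ∈ 𝔇_τ` and `τ f = f_τ`.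
The field `qd` is the unique representative `f^{[1]}` of `df/dς` for which
`-f^{[1]} + ∫ f dχ` lies in `AC_loc((a,b); ϱ)`; the derivative of the latter is `f_τ`. -/
structure TLoc (C : Coeff a b) where
  /-- the first component `f` -/
  fn : ℝ → ℂ
  /-- the quasi-derivative `f^{[1]}` -/
  qd : ℝ → ℂ
  /-- the second component `f_τ` -/
  tau : ℝ → ℂ
  fn_deriv : HasRN (oi a b) C.sigma fn qd
  tau_ac : ∃ h, HasRN (oi a b) C.sigma tau h
  tau_eq : ∀ c ∈ oi a b, ∀ x ∈ oi a b,
    -qd x + orientedIntegral C.chi fn c x = -qd c + C.rhoIntegral tau c x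

/-- `u` is a solution of `(τ - z) u = 0`. -/
def IsSolution (C : Coeff a b) (z : ℂ) (u : C.TLoc) : Prop :=
  ∀ x ∈ oi a b, u.tau x = z * u.fn x

/-- The modified Wronskian `V(f, g*)(x) = f_τ(x) g^{[1]}(x)* - f^{[1]}(x) g_τ(x)*`. -/
def wronskian {C : Coeff a b} (f g : C.TLoc) (x : ℝ) : ℂ :=
  f.tau x * conj (g.qd x) - f.qd x * conj (g.tau x)

/-- `(f, f_τ) ∈ T_max`. -/
def MemTmax (C : Coeff a b) (f : C.TLoc) : Prop :=
  C.MemH1On (oi a b) f.fn ∧ C.MemH1On (oi a b) f.tau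

/-- `f` lies in `H¹(a,b)` near the left endpoint `a`. -/
def MemH1NearLeft (C : Coeff a b) (f : ℝ → ℂ) : Prop :=
  ∃ d ∈ oi a b, C.MemH1On (oi a b ∩ Iio d) f

/-- `f` lies in `H¹(a,b)` near the right endpoint `b`. -/
def MemH1NearRight (C : Coeff a b) (f : ℝ → ℂ) : Prop :=
  ∃ d ∈ oi a b, C.MemH1On (oi a b ∩ Ioi d) f

/-- `τ` is in the limit-circle case at `a`. -/
def LimitCircleLeft (C : Coeff a b) : Prop :=
  ∀ z : ℂ, z ≠ 0 → ∀ u : C.TLoc, C.IsSolution z u → C.MemH1NearLeft u.fn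

/-- `τ` is in the limit-circle case at `b`. -/
def LimitCircleRight (C : Coeff a b) : Prop :=
  ∀ z : ℂ, z ≠ 0 → ∀ u : C.TLoc, C.IsSolution z u → C.MemH1NearRight u.fn

/-- The filter of neighbourhoods of the left endpoint `a` within `(a, b)`. -/
def leftEnd (_ : Coeff a b) : Filter ℝ := comap (fun x : ℝ => (x : EReal)) (𝓝[>] a)

/-- The filter of neighbourhoods of the right endpoint `b` within `(a, b)`. -/
def rightEnd (_ : Coeff a b) : Filter ℝ := comap (fun x : ℝ => (x : EReal)) (𝓝[<] b)

/-- `V(f, g*)(a) = 0`. -/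
def WronskianZeroLeft (C : Coeff a b) (f g : C.TLoc) : Prop :=
  Tendsto (wronskian f g) C.leftEnd (𝓝 0)

/-- `V(f, g*)(b) = 0`. -/
def WronskianZeroRight (C : Coeff a b) (f g : C.TLoc) : Prop :=
  Tendsto (wronskian f g) C.rightEnd (𝓝 0)

/-- Separated boundary conditions: elements `v_a, v_b` of `T_max` such that, in the limit-circle
case at `a`, `V(v_a, v_a*)(a) = 0` and `V(f, v_a*)(a) ≠ 0` for some `f ∈ T_max`; likewise at `b`. -/
structure SeparatedBC (C : Coeff a b) where
  /-- the function `v_a` -/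
  va : C.TLoc
  /-- the function `v_b` -/
  vb : C.TLoc
  va_mem : C.MemTmax va
  vb_mem : C.MemTmax vb
  left_lc : C.LimitCircleLeft →
    C.WronskianZeroLeft va va ∧ ∃ f, C.MemTmax f ∧ ¬ C.WronskianZeroLeft f va
  right_lc : C.LimitCircleRight →
    C.WronskianZeroRight vb vb ∧ ∃ f, C.MemTmax f ∧ ¬ C.WronskianZeroRight f vb

/-- The self-adjoint relation
`S = {f ∈ T_max | V(f, v_a*)(a) = V(f, v_b*)(b) = 0}` given by separated boundary conditions. -/
def SeparatedBC.relation {C : Coeff a b} (S : C.SeparatedBC) : Set C.TLoc :=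
  {f | C.MemTmax f ∧ C.WronskianZeroLeft f S.va ∧ C.WronskianZeroRight f S.vb}

/-- `z` is an eigenvalue of `S`: there is a nonzero `f` with `(f, z f) ∈ S`. -/
def SeparatedBC.IsEigenvalue {C : Coeff a b} (S : C.SeparatedBC) (z : ℂ) : Prop :=
  ∃ f ∈ S.relation, C.IsSolution z f ∧ ∃ x ∈ oi a b, f.fn x ≠ 0

/-- The solution `u` lies in `S` near `a`: it lies in `H¹(a,b)` near `a` and satisfies the boundary
condition at `a` if `τ` is in the limit-circle case there. -/
def SeparatedBC.LiesInNearLeft {C : Coeff a b} (S : C.SeparatedBC) (u : C.TLoc) : Prop :=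
  C.MemH1NearLeft u.fn ∧ (C.LimitCircleLeft → C.WronskianZeroLeft u S.va)

end Coeff

/-- An entire function that is real on the real axis. -/
def RealEntire (F : ℂ → ℂ) : Prop := Differentiable ℂ F ∧ ∀ x : ℝ, (F x).im = 0

namespace Coeff

variable {a b : EReal}

/-- `φ_z`, `z ∈ ℂ`, is a real entire family of non-trivial solutions of `(τ - z) u = 0` which lie
in `S` near `a`. -/
structure SeparatedBC.IsRealEntireSolution {C : Coeff a b} (S : C.SeparatedBC)
    (φ : ℂ → C.TLoc) : Prop where
  solution : ∀ z, C.IsSolution z (φ z)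
  nontrivial : ∀ z, ∃ x ∈ oi a b, (φ z).fn x ≠ 0
  near_left : ∀ z, S.LiesInNearLeft (φ z)
  realEntire : ∀ x ∈ oi a b, RealEntire (fun z => (φ z).fn x)
  realEntire_qd : ∀ x ∈ oi a b, RealEntire (fun z => (φ z).qd x)

/-- The function `E(z, c) = z φ_z(c) + i φ_z^{[1]}(c)`. -/
def entireE {C : Coeff a b} (φ : ℂ → C.TLoc) (c : ℝ) (z : ℂ) : ℂ :=
  z * (φ z).fn c + Complex.I * (φ z).qd c

/-- The restriction `u|_{(a,c)}`, extended by zero. -/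
def TLoc.restrictFn {C : Coeff a b} (u : C.TLoc) (c : ℝ) : ℝ → ℂ :=
  (oi a (c : EReal)).indicator u.fn

/-- The transform `f̂(z) = ∫_a^c φ_z f dχ + ∫_a^c φ_z^{[1]} f^{[1]} dς` of `f ∈ H¹(a,c)`. -/
def transform {C : Coeff a b} (φ : ℂ → C.TLoc) (c : ℝ) (hc : c ∈ oi a b)
    (hχ : C.chi (oi a c) ≠ 0) (f : (C.restrict c hc hχ).H1) (z : ℂ) : ℂ :=
  (∫ x in oi a c, (φ z).fn x * f x ∂C.chi) + ∫ x in oi a c, (φ z).qd x * f.deriv x ∂C.sigma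

end Coeff

/-! ### De Branges spaces -/

/-- A de Branges function: entire with `|E(z)| > |E(z*)|` in the open upper half-plane. -/
def IsDeBrangesFunction (E : ℂ → ℂ) : Prop :=
  Differentiable ℂ E ∧ ∀ z : ℂ, 0 < z.im → ‖E (conj z)‖ < ‖E z‖

/-- The open upper half-plane. -/
def upperHalf : Set ℂ := {z | 0 < z.im}

/-- A function on the open upper half-plane is of bounded type if it is the quotient of two bounded
analytic functions. -/
def IsBoundedType (N : ℂ → ℂ) : Prop :=
  ∃ g h : ℂ → ℂ, DifferentiableOn ℂ g upperHalf ∧ DifferentiableOn ℂ h upperHalf ∧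
    (∃ M : ℝ, ∀ z ∈ upperHalf, ‖g z‖ ≤ M ∧ ‖h z‖ ≤ M) ∧
    (∃ z ∈ upperHalf, h z ≠ 0) ∧ ∀ z ∈ upperHalf, N z * h z = g z

/-- The mean type `limsup_{y → ∞} ln |N(i y)| / y`, with `ln 0 = -∞`. -/
def meanType (N : ℂ → ℂ) : EReal :=
  limsup (fun y : ℝ => ENNReal.log ‖N (Complex.I * y)‖ₑ / (y : EReal)) atTop

/-- The function `F^#(z) = F(z*)*`. -/
def sharp (F : ℂ → ℂ) (z : ℂ) : ℂ := conj (F (conj z))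

theorem meanType_nonpos_iff (N : ℂ → ℂ) :
    meanType N ≤ 0 ↔ ∀ ε : ℝ, 0 < ε → ∀ᶠ y : ℝ in atTop,
      ‖N (Complex.I * y)‖ₑ ≤ ENNReal.ofReal (Real.exp (ε * y)) := by
  have hlog : ∀ ε y : ℝ, ENNReal.log (ENNReal.ofReal (Real.exp (ε * y))) = ((ε * y : ℝ) : EReal) :=
    fun ε y => by rw [ENNReal.log_ofReal_of_pos (Real.exp_pos _), Real.log_exp]
  constructor
  · intro h ε hε
    have h1 : meanType N < (ε : EReal) := lt_of_le_of_lt h (by exact_mod_cast hε)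
    filter_upwards [eventually_lt_of_limsup_lt h1, eventually_gt_atTop (0 : ℝ)] with y hy hy0
    rw [← ENNReal.log_le_log_iff, hlog]
    have := (EReal.div_le_iff_le_mul (by exact_mod_cast hy0) (EReal.coe_ne_top y)).mp hy.le
    refine this.trans (le_of_eq ?_)
    rw [EReal.coe_mul, mul_comm]
  · intro h
    refine le_of_forall_gt_imp_ge_of_dense fun t ht => ?_
    obtain ⟨ε, hε0, hεt⟩ := EReal.lt_iff_exists_real_btwn.mp ht
    refine le_trans ?_ hεt.le
    refine limsup_le_of_le (h := ?_)
    filter_upwards [h ε (by exact_mod_cast hε0), eventually_gt_atTop (0 : ℝ)] with y hy hy0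
    rw [← ENNReal.log_le_log_iff, hlog] at hy
    rw [EReal.div_le_iff_le_mul (by exact_mod_cast hy0) (EReal.coe_ne_top y)]
    refine hy.trans (le_of_eq ?_)
    rw [EReal.coe_mul, mul_comm]

theorem isPreconnected_upperHalf : IsPreconnected upperHalf :=
  (convex_halfSpace_im_gt 0).isPreconnected

theorem isOpen_upperHalf : IsOpen upperHalf := isOpen_lt continuous_const Complex.continuous_im

theorem IsBoundedType.add {N₁ N₂ : ℂ → ℂ} (h₁ : IsBoundedType N₁) (h₂ : IsBoundedType N₂) :
    IsBoundedType (N₁ + N₂) := by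
  obtain ⟨g₁, k₁, dg₁, dk₁, ⟨M₁, hM₁⟩, ⟨w₁, hw₁, hk₁⟩, e₁⟩ := h₁
  obtain ⟨g₂, k₂, dg₂, dk₂, ⟨M₂, hM₂⟩, ⟨w₂, hw₂, hk₂⟩, e₂⟩ := h₂
  refine ⟨g₁ * k₂ + g₂ * k₁, k₁ * k₂, (dg₁.mul dk₂).add (dg₂.mul dk₁), dk₁.mul dk₂,
    ⟨M₁ * M₂ + M₂ * M₁, fun z hz => ?_⟩, ?_, fun z hz => ?_⟩
  · obtain ⟨a1, a2⟩ := hM₁ z hz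
    obtain ⟨b1, b2⟩ := hM₂ z hz
    have p1 : 0 ≤ M₁ := (norm_nonneg _).trans a1
    have p2 : 0 ≤ M₂ := (norm_nonneg _).trans b1
    constructor
    · refine (norm_add_le _ _).trans ?_
      simp only [Pi.mul_apply, norm_mul]
      gcongr
    · simp only [Pi.mul_apply, norm_mul]
      have : ‖k₁ z‖ * ‖k₂ z‖ ≤ M₁ * M₂ := by gcongr
      nlinarith [mul_nonneg p1 p2]
  · by_contra hcon
    push Not at hcon
    rcases AnalyticOnNhd.eq_zero_or_eq_zero_of_mul_eq_zero
      (dk₁.analyticOnNhd isOpen_upperHalf) (dk₂.analyticOnNhd isOpen_upperHalf)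
      (fun z hz => hcon z hz) isPreconnected_upperHalf with h | h
    · exact hk₁ (h w₁ hw₁)
    · exact hk₂ (h w₂ hw₂)
  · simp only [Pi.add_apply, Pi.mul_apply]
    rw [← e₁ z hz, ← e₂ z hz]
    ring

theorem IsBoundedType.smul {N : ℂ → ℂ} (r : ℂ) (h : IsBoundedType N) : IsBoundedType (r • N) := by
  obtain ⟨g, k, dg, dk, ⟨M, hM⟩, hk, e⟩ := h
  refine ⟨r • g, k, dg.const_smul r, dk, ⟨max (‖r‖ * M) M, fun z hz => ⟨?_, ?_⟩⟩, hk,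
    fun z hz => ?_⟩
  · simp only [Pi.smul_apply, norm_smul]
    exact le_max_of_le_left (by gcongr; exact (hM z hz).1)
  · exact le_max_of_le_right (hM z hz).2
  · simp only [Pi.smul_apply, smul_eq_mul, ← e z hz]
    ring

theorem meanType_add {N₁ N₂ : ℂ → ℂ} (h₁ : meanType N₁ ≤ 0) (h₂ : meanType N₂ ≤ 0) :
    meanType (N₁ + N₂) ≤ 0 := by
  rw [meanType_nonpos_iff] at *
  intro ε hε
  filter_upwards [h₁ (ε / 2) (by positivity), h₂ (ε / 2) (by positivity),
    eventually_ge_atTop (2 * Real.log 2 / ε)] with y hy₁ hy₂ hy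
  refine (enorm_add_le _ _).trans ((add_le_add hy₁ hy₂).trans ?_)
  rw [← ENNReal.ofReal_add (Real.exp_pos _).le (Real.exp_pos _).le]
  refine ENNReal.ofReal_le_ofReal ?_
  have h2 : (2 : ℝ) ≤ Real.exp (ε / 2 * y) := by
    rw [← Real.log_le_iff_le_exp (by norm_num)]
    rw [div_le_iff₀ hε] at hy
    linarith
  calc Real.exp (ε / 2 * y) + Real.exp (ε / 2 * y) = 2 * Real.exp (ε / 2 * y) := by ring
    _ ≤ Real.exp (ε / 2 * y) * Real.exp (ε / 2 * y) := by gcongr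
    _ = Real.exp (ε * y) := by rw [← Real.exp_add]; congr 1; ring

theorem meanType_smul {N : ℂ → ℂ} (r : ℂ) (h : meanType N ≤ 0) : meanType (r • N) ≤ 0 := by
  rw [meanType_nonpos_iff] at *
  intro ε hε
  filter_upwards [h (ε / 2) (by positivity),
    eventually_ge_atTop (2 * ‖r‖ / ε)] with y hy₁ hy
  rw [Pi.smul_apply, enorm_smul, ← ofReal_norm r]
  refine (mul_le_mul_right hy₁ _).trans ?_
  rw [← ENNReal.ofReal_mul (norm_nonneg r)]
  refine ENNReal.ofReal_le_ofReal ?_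
  have h2 : ‖r‖ ≤ Real.exp (ε / 2 * y) := by
    rw [div_le_iff₀ hε] at hy
    have := Real.add_one_le_exp (ε / 2 * y)
    linarith
  calc ‖r‖ * Real.exp (ε / 2 * y) ≤ Real.exp (ε / 2 * y) * Real.exp (ε / 2 * y) := by gcongr
    _ = Real.exp (ε * y) := by rw [← Real.exp_add]; congr 1; ring

theorem fun_add_div (F G E : ℂ → ℂ) : (F + G) / E = F / E + G / E := by
  ext z
  simp [add_div]

/-- The functions of the de Branges space associated with `E`: the entire functions `F` with
`∫_ℝ |F/E|² < ∞` such that `F/E` and `F^#/E` are of bounded type and of non-positive mean type in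
the upper half-plane. -/
def deBrangesSubmodule (E : ℂ → ℂ) (hE : IsDeBrangesFunction E) : Submodule ℂ (ℂ → ℂ) where
  carrier := {F | Differentiable ℂ F ∧
    Integrable (fun x : ℝ => ‖F x‖ ^ 2 / ‖E x‖ ^ 2) ∧
    (IsBoundedType (F / E) ∧ meanType (F / E) ≤ 0) ∧
    (IsBoundedType (sharp F / E) ∧ meanType (sharp F / E) ≤ 0)}
  zero_mem' := by
    have hs : sharp 0 = 0 := by ext; simp [sharp]
    have hb : IsBoundedType (0 / E) := by
      refine ⟨0, 1, differentiableOn_const 0, differentiableOn_const 1, ⟨1, fun z _ => ?_⟩,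
        ⟨Complex.I, by simp [upperHalf], by simp⟩, fun z _ => by simp⟩
      simp
    have hm : meanType (0 / E) ≤ 0 := by
      rw [meanType_nonpos_iff]
      intro ε _
      simp
    refine ⟨differentiable_const 0, by simp, ⟨hb, hm⟩, ?_⟩
    rw [hs]
    exact ⟨hb, hm⟩
  add_mem' := by
    rintro F G ⟨hF, iF, ⟨bF, mF⟩, bF', mF'⟩ ⟨hG, iG, ⟨bG, mG⟩, bG', mG'⟩
    have hs : sharp (F + G) = sharp F + sharp G := by ext; simp [sharp]
    refine ⟨hF.add hG, ?_, ?_, ?_⟩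
    · refine ((iF.add iG).const_mul 2).mono' ?_ (Eventually.of_forall fun x => ?_)
      · have c1 : Continuous fun x : ℝ => ‖(F + G) x‖ ^ 2 :=
          ((((hF.add hG).continuous).comp Complex.continuous_ofReal).norm).pow 2
        have c2 : Continuous fun x : ℝ => ‖E x‖ ^ 2 :=
          ((hE.1.continuous.comp Complex.continuous_ofReal).norm).pow 2
        exact (c1.measurable.div c2.measurable).aestronglyMeasurable
      · rw [Real.norm_of_nonneg (by positivity)]
        simp only [Pi.add_apply]
        rw [← add_div, mul_div_assoc']
        gcongr
        have := norm_add_le (F x) (G x)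
        nlinarith [sq_nonneg (‖F x‖ - ‖G x‖), norm_nonneg (F x + G x), norm_nonneg (F x),
          norm_nonneg (G x)]
    · rw [fun_add_div]
      exact ⟨bF.add bG, meanType_add mF mG⟩
    · rw [hs, fun_add_div]
      exact ⟨bF'.add bG', meanType_add mF' mG'⟩
  smul_mem' := by
    rintro r F ⟨hF, iF, ⟨bF, mF⟩, bF', mF'⟩
    have hs : sharp (r • F) / E = conj r • (sharp F / E) := by
      ext
      simp [sharp, mul_div_assoc]
    have hs' : (r • F) / E = r • (F / E) := smul_div_assoc r F E
    refine ⟨hF.const_smul r, ?_, ?_, ?_⟩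
    · refine (iF.const_mul (‖r‖ ^ 2)).congr (Eventually.of_forall fun x => ?_)
      simp [mul_pow, mul_div_assoc]
    · rw [hs']
      exact ⟨bF.smul r, meanType_smul r mF⟩
    · rw [hs]
      exact ⟨bF'.smul _, meanType_smul _ mF'⟩

/-- The de Branges space associated with the de Branges function `E`. -/
def DeBrangesSpace (E : ℂ → ℂ) (hE : IsDeBrangesFunction E) : Type := deBrangesSubmodule E hE

namespace DeBrangesSpace

variable {E : ℂ → ℂ} {hE : IsDeBrangesFunction E}

instance : AddCommGroup (DeBrangesSpace E hE) :=
  inferInstanceAs (AddCommGroup (deBrangesSubmodule E hE))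

instance : Module ℂ (DeBrangesSpace E hE) :=
  inferInstanceAs (Module ℂ (deBrangesSubmodule E hE))

instance : CoeFun (DeBrangesSpace E hE) (fun _ => ℂ → ℂ) := ⟨fun F => F.1⟩

theorem memLp (F : DeBrangesSpace E hE) : MemLp (fun x : ℝ => F x / E x) 2 := by
  have m : AEStronglyMeasurable (fun x : ℝ => F x / E x) := by
    have c1 : Continuous fun x : ℝ => F x := F.2.1.continuous.comp Complex.continuous_ofReal
    have c2 : Continuous fun x : ℝ => E x := hE.1.continuous.comp Complex.continuous_ofReal
    exact (c1.measurable.div c2.measurable).aestronglyMeasurable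
  rw [memLp_two_iff_integrable_sq_norm m]
  refine F.2.2.1.congr (Eventually.of_forall fun x => ?_)
  simp [div_pow]

theorem integrand_eq (F G : ℂ → ℂ) (x : ℝ) : conj (F x) * G x / (‖E x‖ : ℂ) ^ 2
    = conj (F x / E x) * (G x / E x) := by
  rw [map_div₀, div_mul_div_comm, Complex.conj_mul']

theorem integrable (F G : DeBrangesSpace E hE) :
    Integrable (fun x : ℝ => conj (F x) * G x / (‖E x‖ : ℂ) ^ 2) := by
  simp only [integrand_eq]
  exact Coeff.integrable_conj_mul F.memLp G.memLp

theorem ae_ne_zero (hE : IsDeBrangesFunction E) : ∀ᵐ x : ℝ, E x ≠ 0 := by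
  have hI : E Complex.I ≠ 0 := by
    have := hE.2 Complex.I (by simp)
    intro h0
    rw [h0, norm_zero] at this
    exact absurd this (not_lt.mpr (norm_nonneg _))
  have han : AnalyticOnNhd ℂ E univ := fun z _ => hE.1.analyticAt z
  have hcod := han.preimage_zero_mem_codiscrete (x := Complex.I) hI
  have hc : (E ⁻¹' {0}).Countable := by
    have := (mem_codiscrete'.mp hcod)
    have h2 : IsDiscrete (E ⁻¹' {0}) := by
      simpa [compl_compl] using this.2
    have := h2.to_subtype
    exact Set.countable_coe_iff.mp (TopologicalSpace.separableSpace_iff_countable.mp inferInstance)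
  have : ((fun x : ℝ => (x : ℂ)) ⁻¹' (E ⁻¹' {0})).Countable :=
    hc.preimage Complex.ofReal_injective
  have h0 := this.measure_zero volume
  rw [ae_iff]
  refine measure_mono_null (fun x hx => ?_) h0
  simpa using hx

/-- The inner product `(1/π) ∫_ℝ F* G / |E|² dλ` of the de Branges space; as usual in Mathlib it is
conjugate linear in the first argument. -/
@[reducible] def core (E : ℂ → ℂ) (hE : IsDeBrangesFunction E) :
    InnerProductSpace.Core ℂ (DeBrangesSpace E hE) where
  inner F G := (1 / Real.pi : ℂ) * ∫ x : ℝ, conj (F x) * G x / (‖E x‖ : ℂ) ^ 2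
  conj_inner_symm F G := by
    rw [map_mul, ← integral_conj]
    simp only [map_mul, map_div₀, map_pow, Complex.conj_conj, Complex.conj_ofReal, map_one,
      mul_comm]
  re_inner_nonneg F := by
    simp only [integrand_eq]
    rw [Coeff.integral_conj_mul_self_re (fun x : ℝ => F x / E x), ← Complex.ofReal_one,
      ← Complex.ofReal_div, ← Complex.ofReal_mul]
    simp only [RCLike.re_to_complex, Complex.ofReal_re]
    exact mul_nonneg (by positivity) (integral_nonneg fun _ => by positivity)
  add_left F G K := by
    rw [← mul_add, ← integral_add (integrable F K) (integrable G K)]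
    congr 2
    ext x
    change conj (F x + G x) * K x / _ = _
    rw [map_add, add_mul, add_div]
  smul_left F G r := by
    have : ∫ x : ℝ, conj ((r • F) x) * G x / (‖E x‖ : ℂ) ^ 2
        = conj r * ∫ x : ℝ, conj (F x) * G x / (‖E x‖ : ℂ) ^ 2 := by
      rw [← integral_const_mul]
      congr 1
      ext x
      change conj (r * F x) * G x / _ = _
      rw [map_mul, mul_assoc, mul_div_assoc]
    rw [this]
    ring
  definite F hF := by
    simp only [integrand_eq] at hF
    rw [Coeff.integral_conj_mul_self_re (fun x : ℝ => F x / E x)] at hF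
    have hpi : (1 / Real.pi : ℂ) ≠ 0 := by
      simp [Real.pi_ne_zero]
    have z := (mul_eq_zero.mp hF).resolve_left hpi
    rw [Complex.ofReal_eq_zero, integral_eq_zero_iff_of_nonneg (fun _ => by positivity)
      ((memLp_two_iff_integrable_sq_norm F.memLp.1).mp F.memLp)] at z
    have hae : (fun x : ℝ => F x) =ᵐ[volume] fun _ => (0 : ℂ) := by
      filter_upwards [z, ae_ne_zero hE] with x hx hx'
      simpa [hx'] using hx
    have hreal : ∀ x : ℝ, F x = 0 := by
      have c1 : Continuous fun x : ℝ => F x := F.2.1.continuous.comp Complex.continuous_ofReal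
      have := (c1.ae_eq_iff_eq volume continuous_const).mp hae
      exact fun x => congrFun this x
    have han : AnalyticOnNhd ℂ F univ := fun z _ => F.2.1.analyticAt z
    have hfreq : ∃ᶠ w in 𝓝[≠] (0 : ℂ), F w = 0 := by
      have ht : Tendsto (fun x : ℝ => (x : ℂ)) (𝓝[≠] 0) (𝓝[≠] (0 : ℂ)) := by
        refine tendsto_nhdsWithin_iff.mpr ⟨?_, ?_⟩
        · have := (Complex.continuous_ofReal.tendsto 0).mono_left
            (nhdsWithin_le_nhds (s := {0}ᶜ))
          simpa using this
        · filter_upwards [self_mem_nhdsWithin] with x hx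
          simpa using hx
      exact ht.frequently (Eventually.of_forall hreal).frequently
    have h0 := han.eqOn_zero_of_preconnected_of_frequently_eq_zero isPreconnected_univ
      (mem_univ 0) hfreq
    apply Subtype.ext
    funext w
    exact h0 (mem_univ w)

instance : NormedAddCommGroup (DeBrangesSpace E hE) := (core E hE).toNormedAddCommGroup

instance : InnerProductSpace ℂ (DeBrangesSpace E hE) := InnerProductSpace.ofCore (core E hE).toCore

end DeBrangesSpace

/-! ### Partial isometries -/

/-- The initial subspace `(ker T)ᗮ` of an operator `T`. -/
def initialSubspace {H K : Type*} [NormedAddCommGroup H] [InnerProductSpace ℂ H]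
    [NormedAddCommGroup K] [InnerProductSpace ℂ K] (T : H →L[ℂ] K) : Submodule ℂ H :=
  (LinearMap.ker (T : H →ₗ[ℂ] K))ᗮ

/-- A partial isometry is an operator that is isometric on the orthogonal complement of its
kernel. -/
def IsPartialIsometry {H K : Type*} [NormedAddCommGroup H] [InnerProductSpace ℂ H]
    [NormedAddCommGroup K] [InnerProductSpace ℂ K] (T : H →L[ℂ] K) : Prop :=
  ∀ f ∈ initialSubspace T, ‖T f‖ = ‖f‖

end LeftDefinite

end

noncomputable section

namespace LeftDefinite

open Metric Complex Real

/-- Continuous real functions on the unit circle are uniformly approximated by real parts of entire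
functions. -/
theorem exists_differentiable_re_approx {u : ℂ → ℝ} (hu : ContinuousOn u (sphere 0 1)) {ε : ℝ}
    (hε : 0 < ε) : ∃ p : ℂ → ℂ, Differentiable ℂ p ∧ ∀ z ∈ sphere (0 : ℂ) 1,
      |(p z).re - u z| < ε := by
  have : Fact (0 < 2 * π) := ⟨by positivity⟩
  have hmem : ∀ x : AddCircle (2 * π), ((AddCircle.toCircle x : Circle) : ℂ) ∈ sphere (0 : ℂ) 1 :=
    fun x => by rw [mem_sphere_zero_iff_norm, Circle.norm_coe]
  let U : C(AddCircle (2 * π), ℂ) := ⟨fun x => (u (AddCircle.toCircle x : Circle) : ℂ), by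
    refine Complex.continuous_ofReal.comp (hu.comp_continuous ?_ hmem)
    exact continuous_subtype_val.comp AddCircle.continuous_toCircle⟩
  have hU : U ∈ (Submodule.span ℂ (range <| @fourier (2 * π))).topologicalClosure := by
    rw [span_fourier_closure_eq_top]
    trivial
  have hU' : U ∈ closure ((Submodule.span ℂ (range <| @fourier (2 * π))) :
    Set C(AddCircle (2 * π), ℂ)) := hU
  obtain ⟨k, hk, hkU⟩ := Metric.mem_closure_iff.mp hU' ε hε
  have key : ∀ k ∈ Submodule.span ℂ (range <| @fourier (2 * π)), ∀ c : ℂ,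
      ∃ p : ℂ → ℂ, Differentiable ℂ p ∧
        ∀ x, (p (AddCircle.toCircle x : Circle)).re = (c * k x).re := by
    intro k hk
    induction hk using Submodule.span_induction with
    | mem k hk =>
      obtain ⟨n, rfl⟩ := hk
      intro c
      obtain ⟨m, rfl | rfl⟩ := n.eq_nat_or_neg
      · refine ⟨fun z => c * z ^ m, by fun_prop, fun x => ?_⟩
        simp [fourier_apply, AddCircle.toCircle_nsmul]
      · refine ⟨fun z => conj c * z ^ m, by fun_prop, fun x => ?_⟩
        rw [← Complex.conj_re]
        simp [fourier_apply, AddCircle.toCircle_nsmul, ← Circle.coe_inv_eq_conj,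
          AddCircle.toCircle_neg]
    | zero => exact fun c => ⟨0, differentiable_const 0, by simp⟩
    | add k l _ _ hk hl =>
      intro c
      obtain ⟨p, hp, hp'⟩ := hk c
      obtain ⟨q, hq, hq'⟩ := hl c
      refine ⟨p + q, hp.add hq, fun x => ?_⟩
      simp [hp', hq', mul_add]
    | smul r k _ hk =>
      intro c
      obtain ⟨p, hp, hp'⟩ := hk (c * r)
      refine ⟨p, hp, fun x => ?_⟩
      simp [hp', mul_assoc]
  obtain ⟨p, hp, hp'⟩ := key k hk 1
  refine ⟨p, hp, fun z hz => ?_⟩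
  obtain ⟨x, hx⟩ : ∃ x : AddCircle (2 * π), ((AddCircle.toCircle x : Circle) : ℂ) = z := by
    refine ⟨((arg z : ℝ) : AddCircle (2 * π)), ?_⟩
    rw [AddCircle.toCircle_apply_mk, div_self (by positivity), one_mul, Circle.coe_exp]
    have := Complex.norm_mul_exp_arg_mul_I z
    rw [mem_sphere_zero_iff_norm.mp hz] at this
    simpa using this
  have h1 := ContinuousMap.dist_apply_le_dist (f := U) (g := k) x
  have h2 : |(U x - k x).re| ≤ ‖U x - k x‖ := Complex.abs_re_le_norm _
  rw [← dist_eq_norm] at h2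
  have h3 : (U x).re = u z := by rw [← hx]; simp [U]
  rw [← hx, hp' x, one_mul, hx, ← h3, abs_sub_comm, ← Complex.sub_re]
  exact (h2.trans h1).trans_lt hkU

theorem poissonKernel_nonneg {w ζ : ℂ} (hw : w ∈ ball (0 : ℂ) 1) (hζ : ζ ∈ sphere (0 : ℂ) 1) :
    0 ≤ poissonKernel 0 w ζ := by
  rw [poissonKernel_def]
  have h1 : ‖ζ‖ = 1 := by simpa using hζ
  have h2 : ‖w‖ < 1 := by simpa using hw
  simp only [sub_zero, h1]
  have : ‖w‖ ^ 2 ≤ 1 := by nlinarith [norm_nonneg w]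
  exact div_nonneg (by linarith) (by positivity)

theorem continuousOn_poissonKernel {w : ℂ} (hw : w ∈ ball (0 : ℂ) 1) :
    ContinuousOn (poissonKernel 0 w) (sphere 0 1) := by
  have h2 : ‖w‖ < 1 := by simpa using hw
  simp only [funext (poissonKernel_def 0 w), sub_zero]
  refine ContinuousOn.div (by fun_prop) (by fun_prop) fun ζ hζ => ?_
  have h1 : ‖ζ‖ = 1 := by simpa using hζ
  have : ζ - w ≠ 0 := by
    rw [sub_ne_zero]
    rintro rfl
    linarith
  positivity

theorem circleIntegrable_of_continuousOn {E : Type*} [NormedAddCommGroup E] {f : ℂ → E}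
    (hf : ContinuousOn f (sphere 0 1)) : CircleIntegrable f 0 1 :=
  hf.circleIntegrable zero_le_one

theorem circleAverage_poissonKernel_re {p : ℂ → ℂ} (hp : Differentiable ℂ p) {w : ℂ}
    (hw : w ∈ ball (0 : ℂ) 1) :
    circleAverage (fun ζ => poissonKernel 0 w ζ * (p ζ).re) 0 1 = (p w).re := by
  have h := hp.diffContOnCl.circleAverage_poissonKernel_smul (R := 1) (c := 0) hw
  have hi : CircleIntegrable (poissonKernel 0 w • p) 0 1 := by
    refine circleIntegrable_of_continuousOn ?_
    exact (continuousOn_poissonKernel hw).smul hp.continuous.continuousOn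
  rw [← h, ← Complex.reCLM_apply, ← Complex.reCLM.circleAverage_comp_comm hi]
  congr 1
  ext ζ
  simp

/-- The Poisson inequality for the subharmonic function `log⁺ ‖f‖`. -/
theorem posLog_norm_le_circleAverage {f : ℂ → ℂ} (hf : DiffContOnCl ℂ f (ball 0 1)) {w : ℂ}
    (hw : w ∈ ball (0 : ℂ) 1) :
    log⁺ ‖f w‖ ≤ circleAverage (fun ζ => poissonKernel 0 w ζ * log⁺ ‖f ζ‖) 0 1 := by
  have hcf : ContinuousOn f (closedBall 0 1) := by
    simpa [closure_ball (0 : ℂ) one_ne_zero] using hf.continuousOn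
  have hc : ContinuousOn (fun ζ => log⁺ ‖f ζ‖) (sphere 0 1) :=
    Real.continuous_posLog.comp_continuousOn (hcf.mono sphere_subset_closedBall).norm
  refine le_of_forall_pos_le_add fun ε hε => ?_
  obtain ⟨p, hp, hpu⟩ := exists_differentiable_re_approx
    (hc.add (continuousOn_const (c := ε / 2))) (half_pos hε)
  have hpos : ∀ ζ ∈ sphere (0 : ℂ) 1, log⁺ ‖f ζ‖ ≤ (p ζ).re ∧ (p ζ).re ≤ log⁺ ‖f ζ‖ + ε := by
    intro ζ hζ
    obtain ⟨h1, h2⟩ := abs_lt.mp (hpu ζ hζ)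
    simp only [Pi.add_apply] at h1 h2
    constructor <;> linarith
  have hle : ‖cexp (-p w) • f w‖ ≤ 1 := by
    refine Complex.norm_le_of_forall_mem_frontier_norm_le (U := ball (0 : ℂ) 1) isBounded_ball
      (hp.neg.cexp.diffContOnCl.smul hf) (fun z hz => ?_) (subset_closure hw)
    · rw [frontier_ball (0 : ℂ) one_ne_zero] at hz
      simp only [Pi.neg_apply]
      rw [norm_smul, mul_comm, Complex.norm_exp, Complex.neg_re]
      by_cases h0 : ‖f z‖ = 0
      · simp [h0]
      · have h1 : 0 < ‖f z‖ := lt_of_le_of_ne (norm_nonneg _) (Ne.symm h0)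
        have h2 : ‖f z‖ ≤ Real.exp (p z).re := by
          rw [← Real.log_le_iff_le_exp h1]
          exact (le_max_right _ _).trans (hpos z hz).1
        calc ‖f z‖ * Real.exp (-(p z).re) ≤ Real.exp (p z).re * Real.exp (-(p z).re) := by gcongr
          _ = 1 := by rw [← Real.exp_add]; simp
  have hav := circleAverage_poissonKernel_re hp hw
  have hPre : ContinuousOn (fun ζ => poissonKernel 0 w ζ * (p ζ).re) (sphere 0 1) :=
    (continuousOn_poissonKernel hw).mul (Complex.continuous_re.comp hp.continuous).continuousOn
  have hPu : ContinuousOn (fun ζ => poissonKernel 0 w ζ * log⁺ ‖f ζ‖) (sphere 0 1) :=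
    (continuousOn_poissonKernel hw).mul hc
  have h0 : 0 ≤ (p w).re := by
    rw [← hav]
    refine circleAverage_nonneg_of_nonneg fun ζ hζ => ?_
    rw [abs_one] at hζ
    exact mul_nonneg (poissonKernel_nonneg hw hζ) (Real.posLog_nonneg.trans (hpos ζ hζ).1)
  have h1 : log⁺ ‖f w‖ ≤ (p w).re := by
    refine max_le h0 ?_
    by_cases hz : ‖f w‖ = 0
    · simpa [hz] using h0
    · rw [Real.log_le_iff_le_exp (lt_of_le_of_ne (norm_nonneg _) (Ne.symm hz))]
      rw [norm_smul, mul_comm, Complex.norm_exp, Complex.neg_re, Real.exp_neg] at hle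
      exact (mul_inv_le_iff₀ (Real.exp_pos _)).mp hle |>.trans (by simp)
  refine h1.trans ?_
  have hone : circleAverage (fun ζ => poissonKernel 0 w ζ * ε) 0 1 = ε := by
    have := circleAverage_poissonKernel_re (differentiable_const (ε : ℂ)) hw
    simpa using this
  rw [← hav]
  conv_rhs => rw [← hone]
  have hPe : ContinuousOn (fun ζ => poissonKernel 0 w ζ * ε) (sphere 0 1) :=
    (continuousOn_poissonKernel hw).mul continuousOn_const
  rw [← circleAverage_fun_add (circleIntegrable_of_continuousOn hPu)
    (circleIntegrable_of_continuousOn hPe)]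
  refine circleAverage_mono (circleIntegrable_of_continuousOn hPre) ?_ fun ζ hζ => ?_
  · exact circleIntegrable_of_continuousOn (hPu.add hPe)
  · rw [abs_one] at hζ
    rw [← mul_add]
    exact mul_le_mul_of_nonneg_left (hpos ζ hζ).2 (poissonKernel_nonneg hw hζ)

end LeftDefinite

end

noncomputable section

namespace LeftDefinite

open Metric Complex Real

/-! ### The Cayley transform and Poisson integrals on the real line -/

/-- The Cayley transform from the upper half-plane to the unit disc. -/
def cay (z : ℂ) : ℂ := (z - I) / (z + I)

/-- The inverse Cayley transform from the unit disc to the upper half-plane. -/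
def icay (ζ : ℂ) : ℂ := I * ((1 + ζ) / (1 - ζ))

theorem icay_zero : icay 0 = I := by simp [icay]

theorem add_I_ne_zero {z : ℂ} (hz : 0 ≤ z.im) : z + I ≠ 0 := by
  intro h
  have := congrArg Complex.im h
  simp at this
  linarith

theorem icay_cay {z : ℂ} (hz : 0 ≤ z.im) : icay (cay z) = z := by
  have h := add_I_ne_zero hz
  have e1 : 1 + cay z = 2 * z / (z + I) := by
    rw [cay]
    field_simp
    ring
  have e2 : 1 - cay z = 2 * I / (z + I) := by
    rw [cay]
    field_simp
    ring
  rw [icay, e1, e2, div_div_div_cancel_right₀ h]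
  field_simp

theorem im_icay (ζ : ℂ) : (icay ζ).im = poissonKernel 0 ζ 1 := by
  rw [poissonKernel_eq_re_herglotzRieszKernel]
  simp [icay, herglotzRieszKernel_def]

theorem im_icay_pos {ζ : ℂ} (hζ : ζ ∈ ball (0 : ℂ) 1) : 0 < (icay ζ).im := by
  have h : ‖ζ‖ < 1 := by simpa using hζ
  rw [im_icay, poissonKernel_def]
  have h1 : (1 : ℂ) - ζ ≠ 0 := by
    rw [sub_ne_zero]
    rintro rfl
    simp at h
  simp only [sub_zero, norm_one]
  refine div_pos ?_ (by positivity)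
  nlinarith [norm_nonneg ζ]

theorem im_icay_nonneg {ζ : ℂ} (hζ : ζ ∈ closedBall (0 : ℂ) 1) : 0 ≤ (icay ζ).im := by
  have h : ‖ζ‖ ≤ 1 := by simpa using hζ
  rw [im_icay, poissonKernel_def]
  simp only [sub_zero, norm_one]
  refine div_nonneg ?_ (by positivity)
  nlinarith [norm_nonneg ζ]

theorem differentiableAt_icay {ζ : ℂ} (hζ : ζ ≠ 1) : DifferentiableAt ℂ icay ζ := by
  have : 1 - ζ ≠ 0 := sub_ne_zero.mpr hζ.symm
  unfold icay
  fun_prop (disch := assumption)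

theorem cay_mem_ball {z : ℂ} (hz : 0 < z.im) : cay z ∈ ball (0 : ℂ) 1 := by
  have h := add_I_ne_zero hz.le
  rw [mem_ball_zero_iff, cay, norm_div, div_lt_one (norm_pos_iff.mpr h)]
  refine lt_of_pow_lt_pow_left₀ 2 (norm_nonneg _) ?_
  rw [← Complex.normSq_eq_norm_sq, ← Complex.normSq_eq_norm_sq, Complex.normSq_apply,
    Complex.normSq_apply]
  simp
  nlinarith

theorem differentiableAt_cay {z : ℂ} (hz : 0 ≤ z.im) : DifferentiableAt ℂ cay z := by
  have h := add_I_ne_zero hz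
  unfold cay
  fun_prop (disch := assumption)

theorem norm_cay_ofReal (t : ℝ) : ‖cay t‖ = 1 := by
  have h : (t : ℂ) + I ≠ 0 := add_I_ne_zero (by simp)
  rw [cay, norm_div, div_eq_one_iff_eq (norm_ne_zero_iff.mpr h)]
  rw [← Complex.norm_conj]
  simp [sub_eq_add_neg]

theorem circleMap_pi_add_arctan (t : ℝ) : circleMap 0 1 (π + 2 * Real.arctan t) = cay t := by
  have h : (t : ℂ) + I ≠ 0 := add_I_ne_zero (by simp)
  have h2 : (0 : ℝ) < 1 + t ^ 2 := by positivity
  have hs : ((√(1 + t ^ 2) : ℝ) : ℂ) ^ 2 = 1 + (t : ℂ) ^ 2 := by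
    rw [← Complex.ofReal_pow, Real.sq_sqrt h2.le]
    push_cast
    rfl
  have hs0 : ((√(1 + t ^ 2) : ℝ) : ℂ) ≠ 0 := by
    exact_mod_cast (Real.sqrt_pos.mpr h2).ne'
  have e : cexp (Real.arctan t * I) = (1 + t * I) / (√(1 + t ^ 2) : ℝ) := by
    rw [Complex.exp_mul_I, ← Complex.ofReal_cos, ← Complex.ofReal_sin, Real.cos_arctan,
      Real.sin_arctan]
    push_cast
    field_simp
  have e2 : cexp (((π + 2 * Real.arctan t : ℝ) : ℂ) * I) = -(cexp (Real.arctan t * I)) ^ 2 := by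
    rw [← Complex.exp_nat_mul]
    push_cast
    rw [add_mul, Complex.exp_add, Complex.exp_pi_mul_I]
    ring_nf
  rw [circleMap, e2, e, div_pow, hs, cay]
  have h3 : (1 : ℂ) + (t : ℂ) ^ 2 = (t + I) * (t - I) := by
    ring_nf
    simp
    ring
  have h4 : (t : ℂ) - I ≠ 0 := by
    intro h0
    have := congrArg Complex.im h0
    simp at this
  rw [h3]
  field_simp
  simp only [ofReal_one, one_mul]
  rw [← sub_eq_zero]
  ring_nf
  simp

theorem image_pi_add_arctan : (fun t : ℝ => π + 2 * Real.arctan t) '' univ = Ioo 0 (2 * π) := by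
  ext θ
  simp only [image_univ, mem_range, mem_Ioo]
  constructor
  · rintro ⟨t, rfl⟩
    constructor <;> linarith [Real.neg_pi_div_two_lt_arctan t, Real.arctan_lt_pi_div_two t]
  · rintro ⟨h1, h2⟩
    refine ⟨Real.tan ((θ - π) / 2), ?_⟩
    rw [Real.arctan_tan (by linarith) (by linarith)]
    ring

theorem hasDerivAt_pi_add_arctan (t : ℝ) :
    HasDerivAt (fun t : ℝ => π + 2 * Real.arctan t) (2 * (1 + t ^ 2)⁻¹) t := by
  simpa [one_div] using ((Real.hasDerivAt_arctan t).const_mul 2).const_add π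

theorem injective_pi_add_arctan : InjOn (fun t : ℝ => π + 2 * Real.arctan t) univ := by
  intro s _ t _ h
  exact Real.arctan_injective (by simpa using h)

theorem integrable_comp_affine {E : Type*} [NormedAddCommGroup E] {g : ℝ → E} (hg : Integrable g)
    (x : ℝ) {y : ℝ} (hy : 0 < y) :
    Integrable fun s : ℝ => g (x + y * s) :=
  (hg.comp_add_left x).comp_mul_left' hy.ne'

variable {E : Type*} [NormedAddCommGroup E] [NormedSpace ℝ E]

theorem circleAverage_eq_integral_cay (F : ℂ → E) :
    circleAverage F 0 1 = π⁻¹ • ∫ t : ℝ, (1 + t ^ 2)⁻¹ • F (cay t) := by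
  rw [circleAverage_def, intervalIntegral.integral_of_le (by positivity),
    integral_Ioc_eq_integral_Ioo, ← image_pi_add_arctan,
    integral_image_eq_integral_abs_deriv_smul MeasurableSet.univ
      (fun t _ => (hasDerivAt_pi_add_arctan t).hasDerivWithinAt) injective_pi_add_arctan]
  simp only [circleMap_pi_add_arctan, setIntegral_univ]
  rw [mul_inv, mul_comm, mul_smul, ← integral_smul]
  congr 2
  ext t
  rw [abs_of_nonneg (by positivity), smul_smul, ← mul_assoc, inv_mul_cancel₀ two_ne_zero, one_mul]

theorem circleIntegrable_iff_integrable_cay (F : ℂ → E) :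
    CircleIntegrable F 0 1 ↔ Integrable (fun t : ℝ => (1 + t ^ 2)⁻¹ • F (cay t)) := by
  rw [CircleIntegrable, intervalIntegrable_iff_integrableOn_Ioo_of_le (by positivity),
    ← image_pi_add_arctan, integrableOn_image_iff_integrableOn_abs_deriv_smul MeasurableSet.univ
      (fun t _ => (hasDerivAt_pi_add_arctan t).hasDerivWithinAt) injective_pi_add_arctan]
  simp only [circleMap_pi_add_arctan, integrableOn_univ]
  have : (fun t : ℝ => |2 * (1 + t ^ 2)⁻¹| • F (cay t))
      = fun t : ℝ => (2 : ℝ) • ((1 + t ^ 2)⁻¹ • F (cay t)) := by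
    ext t
    rw [abs_of_nonneg (by positivity), smul_smul]
  rw [this]
  exact integrable_smul_iff two_ne_zero _

/-- The Poisson integral of a function on the real line. -/
def poissonInt (v : ℝ → E) (z : ℂ) : E :=
  π⁻¹ • ∫ s : ℝ, (1 + s ^ 2)⁻¹ • v (z.re + z.im * s)

theorem integral_comp_affine (g : ℝ → E) (x : ℝ) {y : ℝ} (hy : 0 < y) :
    ∫ s : ℝ, g (x + y * s) = y⁻¹ • ∫ t : ℝ, g t := by
  rw [Measure.integral_comp_mul_left (fun t => g (x + t)) y, integral_add_left_eq_self,
    abs_of_pos (inv_pos.mpr hy)]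

theorem poissonInt_eq (v : ℝ → E) {z : ℂ} (hz : 0 < z.im) :
    poissonInt v z = π⁻¹ • ∫ t : ℝ, (z.im / ((t - z.re) ^ 2 + z.im ^ 2)) • v t := by
  have h := integral_comp_affine (fun t => (z.im / ((t - z.re) ^ 2 + z.im ^ 2)) • v t) z.re hz
  rw [eq_inv_smul_iff₀ hz.ne', ← integral_smul] at h
  rw [poissonInt, ← h]
  congr 2
  ext s
  rw [smul_smul]
  congr 1
  field_simp
  ring

theorem poissonKernel_cay {z : ℂ} (hz : 0 < z.im) (t : ℝ) :
    (1 + t ^ 2)⁻¹ * poissonKernel 0 (cay z) (cay t) = z.im / ((t - z.re) ^ 2 + z.im ^ 2) := by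
  have h1 : (t : ℂ) + I ≠ 0 := add_I_ne_zero (by simp)
  have h2 := add_I_ne_zero hz.le
  have e1 : cay t - cay z = 2 * I * (t - z) / ((t + I) * (z + I)) := by
    rw [cay, cay]
    field_simp
    ring
  have n1 : ‖(t : ℂ) + I‖ ^ 2 = 1 + t ^ 2 := by
    rw [← Complex.normSq_eq_norm_sq, Complex.normSq_apply]
    simp
    ring
  have n2 : ‖z + I‖ ^ 2 = z.re ^ 2 + (z.im + 1) ^ 2 := by
    rw [← Complex.normSq_eq_norm_sq, Complex.normSq_apply]
    simp
    ring
  have n3 : ‖z - I‖ ^ 2 = z.re ^ 2 + (z.im - 1) ^ 2 := by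
    rw [← Complex.normSq_eq_norm_sq, Complex.normSq_apply]
    simp
    ring
  have n4 : ‖(t : ℂ) - z‖ ^ 2 = (t - z.re) ^ 2 + z.im ^ 2 := by
    rw [← Complex.normSq_eq_norm_sq, Complex.normSq_apply]
    simp
    ring
  have p1 : 0 < 1 + t ^ 2 := by positivity
  have p2 : 0 < z.re ^ 2 + (z.im + 1) ^ 2 := by positivity
  have p4 : 0 < (t - z.re) ^ 2 + z.im ^ 2 := by positivity
  rw [poissonKernel_def]
  simp only [sub_zero]
  rw [norm_cay_ofReal, e1, norm_div, div_pow, norm_mul, norm_mul, norm_mul, mul_pow, mul_pow,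
    mul_pow, n1, n2, n4, cay, norm_div, div_pow, n2, n3]
  simp only [Complex.norm_I, Complex.norm_two]
  field_simp
  ring

theorem poissonInt_eq_circleAverage (v : ℝ → E) {z : ℂ} (hz : 0 < z.im) :
    poissonInt v z = circleAverage (fun ζ => poissonKernel 0 (cay z) ζ • v (icay ζ).re) 0 1 := by
  rw [circleAverage_eq_integral_cay, poissonInt_eq v hz]
  congr 2
  ext t
  rw [smul_smul, poissonKernel_cay hz, icay_cay (by simp), Complex.ofReal_re]

theorem cay_icay {ζ : ℂ} (hζ : ζ ≠ 1) : cay (icay ζ) = ζ := by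
  have h : 1 - ζ ≠ 0 := sub_ne_zero.mpr hζ.symm
  rw [cay, icay]
  have e1 : I * ((1 + ζ) / (1 - ζ)) - I = 2 * I * ζ / (1 - ζ) := by
    field_simp
    ring
  have e2 : I * ((1 + ζ) / (1 - ζ)) + I = 2 * I / (1 - ζ) := by
    field_simp
    ring
  rw [e1, e2, div_div_div_cancel_right₀ h]
  field_simp

theorem ne_one_of_mem_ball {ζ : ℂ} (hζ : ζ ∈ ball (0 : ℂ) 1) : ζ ≠ 1 := by
  rintro rfl
  simp at hζ

theorem integrable_inv_one_add_sq_smul {v : ℝ → E} (hv : Integrable v) :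
    Integrable fun t : ℝ => (1 + t ^ 2)⁻¹ • v t := by
  refine hv.bdd_smul 1 ?_ (Eventually.of_forall fun t => ?_)
  · exact (Continuous.inv₀ (by fun_prop) (fun t => by positivity)).aestronglyMeasurable
  · rw [Real.norm_of_nonneg (by positivity)]
    exact inv_le_one_of_one_le₀ (by nlinarith)

/-- The Poisson integral is the real part of an analytic function on the disc. -/
theorem exists_analytic_re_eq_poissonInt {v : ℝ → ℝ}
    (hv : Integrable fun t : ℝ => (1 + t ^ 2)⁻¹ • v t) :
    ∃ Q : ℂ → ℂ, DifferentiableOn ℂ Q (ball 0 1) ∧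
      ∀ ζ ∈ ball (0 : ℂ) 1, (Q ζ).re = poissonInt v (icay ζ) := by
  have hg : CircleIntegrable (fun ζ => v (icay ζ).re) 0 1 := by
    rw [circleIntegrable_iff_integrable_cay]
    refine hv.congr (Eventually.of_forall fun t => ?_)
    simp only
    rw [icay_cay (by simp), Complex.ofReal_re]
  have hg' : CircleIntegrable (fun ζ => (v (icay ζ).re : ℂ)) 0 1 := by
    simp only [CircleIntegrable, intervalIntegrable_iff] at hg ⊢
    exact Complex.ofRealCLM.integrable_comp hg
  refine ⟨_, differentiableOn_circleAverage_herglotzRieszKernel_smul hg', fun ζ hζ => ?_⟩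
  rw [re_circleAverage_herglotzRieszKernel_smul hg hζ,
    poissonInt_eq_circleAverage v (im_icay_pos hζ), cay_icay (ne_one_of_mem_ball hζ),
    poissonKernel_eq_re_herglotzRieszKernel]
  rfl

end LeftDefinite

end

noncomputable section

namespace LeftDefinite

open Metric Complex Real

/-! ### Functions of bounded type on the disc -/

theorem log_norm_le_circleAverage {k : ℂ → ℂ} (hk : DifferentiableOn ℂ k (ball 0 1))
    (hk0 : k 0 ≠ 0) {r : ℝ} (hr0 : 0 < r) (hr1 : r < 1) :
    Real.log ‖k 0‖ ≤ circleAverage (fun ζ => Real.log ‖k ζ‖) 0 r := by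
  have hsub : closedBall (0 : ℂ) |r| ⊆ ball 0 1 := by
    rw [abs_of_pos hr0]
    exact closedBall_subset_ball hr1
  have han : AnalyticOnNhd ℂ k (closedBall 0 |r|) := (hk.analyticOnNhd isOpen_ball).mono hsub
  rw [han.circleAverage_log_norm hr0.ne' hk0]
  refine le_add_of_nonneg_left (finsum_nonneg fun u => ?_)
  by_cases hu : u ∈ closedBall (0 : ℂ) |r|
  · refine mul_nonneg ?_ ?_
    · exact_mod_cast MeromorphicOn.AnalyticOnNhd.divisor_nonneg han u
    · by_cases h0 : u = 0
      · simp [h0]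
      · refine Real.log_nonneg ?_
        rw [zero_sub, norm_neg, ← div_eq_mul_inv, one_le_div (norm_pos_iff.mpr h0)]
        simpa [abs_of_pos hr0] using hu
  · rw [Function.locallyFinsuppWithin.apply_eq_zero_of_notMem _ hu]
    simp

theorem ae_circleMap_ne_zero {k : ℂ → ℂ} (hk : DifferentiableOn ℂ k (ball 0 1))
    (hk0 : k 0 ≠ 0) {r : ℝ} (hr0 : 0 < r) (hr1 : r < 1) :
    ∀ᵐ θ : ℝ, k (circleMap 0 r θ) ≠ 0 := by
  have han : AnalyticOnNhd ℂ k (ball 0 1) := hk.analyticOnNhd isOpen_ball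
  have hcod : k ⁻¹' {0}ᶜ ∈ codiscreteWithin (ball (0 : ℂ) 1) :=
    han.preimage_zero_mem_codiscreteWithin hk0 (by simp)
      ((convex_ball 0 1).isConnected ⟨0, by simp⟩)
  have hsub : sphere (0 : ℂ) |r| ⊆ ball 0 1 := by
    rw [abs_of_pos hr0]
    exact sphere_subset_closedBall.trans (closedBall_subset_ball hr1)
  have h := circleMap_preimage_codiscrete (c := 0) hr0.ne' (codiscreteWithin_mono hsub hcod)
  have h2 := ae_restrict_le_codiscreteWithin (μ := (volume : Measure ℝ)) MeasurableSet.univ h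
  rw [Measure.restrict_univ] at h2
  filter_upwards [h2] with θ hθ
  exact hθ

theorem circleAverage_posLog_le {f k g : ℂ → ℂ} (hf : DifferentiableOn ℂ f (ball 0 1))
    (hk : DifferentiableOn ℂ k (ball 0 1)) (hk0 : k 0 ≠ 0) {M : ℝ}
    (hM : ∀ ζ ∈ ball (0 : ℂ) 1, ‖g ζ‖ ≤ M ∧ ‖k ζ‖ ≤ M)
    (hfk : ∀ ζ ∈ ball (0 : ℂ) 1, f ζ * k ζ = g ζ) {r : ℝ} (hr0 : 0 < r) (hr1 : r < 1) :
    circleAverage (fun ζ => log⁺ ‖f ζ‖) 0 r ≤ Real.log M - Real.log ‖k 0‖ := by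
  have hsub : sphere (0 : ℂ) |r| ⊆ ball 0 1 := by
    rw [abs_of_pos hr0]
    exact sphere_subset_closedBall.trans (closedBall_subset_ball hr1)
  have hi1 : CircleIntegrable (fun ζ => log⁺ ‖f ζ‖) 0 r := by
    refine ContinuousOn.circleIntegrable' ?_
    exact Real.continuous_posLog.comp_continuousOn (hf.continuousOn.mono hsub).norm
  have hi2 : CircleIntegrable (fun ζ => Real.log ‖k ζ‖) 0 r :=
    ((hk.analyticOnNhd isOpen_ball).mono hsub).meromorphicOn.circleIntegrable_log_norm
  have hMk : 0 < M := (norm_pos_iff.mpr hk0).trans_le (hM 0 (by simp)).2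
  have h1 : circleAverage (fun ζ => log⁺ ‖f ζ‖) 0 r
      ≤ circleAverage (fun ζ => Real.log M - Real.log ‖k ζ‖) 0 r := by
    rw [circleAverage_def, circleAverage_def]
    refine smul_le_smul_of_nonneg_left ?_ (by positivity)
    refine intervalIntegral.integral_mono_ae (by positivity) hi1
      ((circleIntegrable_const _ _ _).sub hi2) ?_
    filter_upwards [ae_circleMap_ne_zero hk hk0 hr0 hr1] with θ hθ
    have hmem : circleMap 0 r θ ∈ ball (0 : ℂ) 1 := hsub (circleMap_mem_sphere' _ _ _)
    set ζ := circleMap 0 r θ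
    have hkp : 0 < ‖k ζ‖ := norm_pos_iff.mpr hθ
    obtain ⟨hg1, hk1⟩ := hM ζ hmem
    rw [← Real.log_div hMk.ne' hkp.ne']
    refine max_le (Real.log_nonneg ((one_le_div hkp).mpr hk1)) ?_
    by_cases h0 : ‖f ζ‖ = 0
    · rw [h0, Real.log_zero]
      exact Real.log_nonneg ((one_le_div hkp).mpr hk1)
    · refine Real.log_le_log (lt_of_le_of_ne (norm_nonneg _) (Ne.symm h0)) ?_
      rw [le_div_iff₀ hkp, ← norm_mul, hfk ζ hmem]
      exact hg1
  refine h1.trans ?_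
  rw [circleAverage_fun_sub (circleIntegrable_const _ _ _) hi2, circleAverage_const]
  exact sub_le_sub_left (log_norm_le_circleAverage hk hk0 hr0 hr1) _

/-- A function on the disc with bounded averages of `log⁺ ‖f‖` that is continuous up to the boundary
except at the point `1` satisfies the Poisson inequality up to a multiple of the Poisson kernel
at `1`. -/
theorem posLog_norm_le_circleAverage_add {f : ℂ → ℂ} (hf : DifferentiableOn ℂ f (ball 0 1))
    (hfc : ContinuousOn f (closedBall 0 1 \ {1})) {C : ℝ}
    (hC : ∀ r : ℝ, 0 < r → r < 1 → circleAverage (fun ζ => log⁺ ‖f ζ‖) 0 r ≤ C)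
    (hfi : CircleIntegrable (fun ζ => log⁺ ‖f ζ‖) 0 1) {w : ℂ} (hw : w ∈ ball (0 : ℂ) 1) :
    log⁺ ‖f w‖ ≤ circleAverage (fun ζ => poissonKernel 0 w ζ * log⁺ ‖f ζ‖) 0 1
      + C * poissonKernel 0 w 1 := by
  have hone : (1 : ℂ) ∈ sphere (0 : ℂ) 1 := by simp
  set u : ℂ → ℝ := fun ζ => log⁺ ‖f ζ‖ with hu
  have hunn : ∀ ζ, 0 ≤ u ζ := fun ζ => Real.posLog_nonneg
  have huc : ContinuousOn u (closedBall 0 1 \ {1}) :=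
    Real.continuous_posLog.comp_continuousOn hfc.norm
  have hCnn : 0 ≤ C := (circleAverage_nonneg_of_nonneg fun ζ _ => hunn ζ).trans
    (hC (1 / 2) (by norm_num) (by norm_num))
  have hsc : ∀ r : ℝ, 0 < r → r < 1 → ∀ ζ ∈ closedBall (0 : ℂ) 1, (r : ℂ) * ζ ∈ ball (0 : ℂ) 1 := by
    intro r hr0 hr1 ζ hζ
    have : ‖ζ‖ ≤ 1 := by simpa using hζ
    rw [mem_ball_zero_iff, norm_mul, Complex.norm_real, Real.norm_of_nonneg hr0.le]
    nlinarith [norm_nonneg ζ]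
  have hPi : CircleIntegrable (fun ζ => poissonKernel 0 w ζ * u ζ) 0 1 := by
    have hPc : Continuous fun θ : ℝ => poissonKernel 0 w (circleMap 0 1 θ) :=
      (continuousOn_poissonKernel hw).comp_continuous (continuous_circleMap 0 1)
        (fun θ => circleMap_mem_sphere 0 zero_le_one θ)
    exact IntervalIntegrable.continuousOn_mul hfi hPc.continuousOn
  suffices H : ∀ η : ℝ, 0 < η → u w ≤ circleAverage (fun ζ => poissonKernel 0 w ζ * u ζ) 0 1
      + C * (poissonKernel 0 w 1 + η) by
    have ht : Tendsto (fun η : ℝ => circleAverage (fun ζ => poissonKernel 0 w ζ * u ζ) 0 1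
        + C * (poissonKernel 0 w 1 + η)) (𝓝[>] 0)
        (𝓝 (circleAverage (fun ζ => poissonKernel 0 w ζ * u ζ) 0 1
          + C * (poissonKernel 0 w 1 + 0))) :=
      (Continuous.tendsto (by fun_prop) _).mono_left nhdsWithin_le_nhds
    rw [add_zero] at ht
    exact ge_of_tendsto ht (eventually_nhdsWithin_of_forall H)
  intro η hη
  obtain ⟨δ, hδ, hδP⟩ := Metric.continuousOn_iff.mp (continuousOn_poissonKernel hw) 1 hone η hη
  set S : Set ℂ := {ζ | δ ≤ ‖ζ - 1‖} with hS
  have hSm : IsClosed S := isClosed_le continuous_const (by fun_prop)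
  have hcirc : ∀ θ : ℝ, circleMap 0 1 θ ∈ sphere (0 : ℂ) 1 :=
    fun θ => circleMap_mem_sphere 0 zero_le_one θ
  set A : ℝ → ℝ → ℝ := fun r θ => (circleMap 0 1 ⁻¹' S).indicator
    (fun θ => poissonKernel 0 w (circleMap 0 1 θ) * u (r * circleMap 0 1 θ)) θ with hA
  have hPcm : Continuous fun θ : ℝ => poissonKernel 0 w (circleMap 0 1 θ) :=
    (continuousOn_poissonKernel hw).comp_continuous (continuous_circleMap 0 1) hcirc
  have hucm : ∀ r : ℝ, 0 < r → r < 1 → Continuous fun θ : ℝ => u (r * circleMap 0 1 θ) := by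
    intro r hr0 hr1
    refine huc.comp_continuous (by fun_prop) fun θ => ?_
    have := hsc r hr0 hr1 _ (sphere_subset_closedBall (hcirc θ))
    exact ⟨ball_subset_closedBall this, ne_one_of_mem_ball this⟩
  have hAm : ∀ r : ℝ, 0 < r → r < 1 → AEStronglyMeasurable (A r) := fun r hr0 hr1 =>
    ((hPcm.mul (hucm r hr0 hr1)).aestronglyMeasurable).indicator
      (hSm.preimage (continuous_circleMap 0 1)).measurableSet
  -- the interior estimate
  have hinteg : ∀ r : ℝ, 0 < r → r < 1 →
      u (r * w) ≤ (2 * π)⁻¹ * (∫ θ in 0..2 * π, A r θ) + C * (poissonKernel 0 w 1 + η) := by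
    intro r hr0 hr1
    have hd : DiffContOnCl ℂ (fun ζ => f (r * ζ)) (ball 0 1) := by
      refine DifferentiableOn.diffContOnCl ?_
      rw [closure_ball (0 : ℂ) one_ne_zero]
      exact hf.comp (by fun_prop) fun ζ hζ => hsc r hr0 hr1 ζ hζ
    have h1 := posLog_norm_le_circleAverage hd hw
    have hav : circleAverage (fun ζ => u (r * ζ)) 0 1 = circleAverage u 0 r := by
      rw [circleAverage_eq_circleAverage_zero_one (f := u)]
      simp
    have h2 := hC r hr0 hr1
    rw [← hav] at h2
    refine h1.trans ?_
    have hPnn : 0 ≤ poissonKernel 0 w 1 + η := by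
      linarith [poissonKernel_nonneg hw hone]
    refine le_trans ?_ (add_le_add_right (mul_le_mul_of_nonneg_right h2 hPnn) _)
    have hAi : IntervalIntegrable (A r) volume 0 (2 * π) := by
      refine IntervalIntegrable.mono_fun ((hPcm.mul (hucm r hr0 hr1)).intervalIntegrable _ _)
        (hAm r hr0 hr1).restrict (Eventually.of_forall fun θ => ?_)
      exact norm_indicator_le_norm_self _ _
    rw [circleAverage_def, circleAverage_def, smul_eq_mul, smul_eq_mul, mul_assoc, ← mul_add]
    refine mul_le_mul_of_nonneg_left ?_ (by positivity)
    have hci : IntervalIntegrable (fun θ => u (r * circleMap 0 1 θ) * (poissonKernel 0 w 1 + η))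
        volume 0 (2 * π) := ((hucm r hr0 hr1).mul continuous_const).intervalIntegrable _ _
    rw [← intervalIntegral.integral_mul_const, ← intervalIntegral.integral_add hAi hci]
    refine intervalIntegral.integral_mono (by positivity)
      ((hPcm.mul (hucm r hr0 hr1)).intervalIntegrable _ _)
      (hAi.add hci) fun θ => ?_
    by_cases hθ : circleMap 0 1 θ ∈ S
    · simp only [A, indicator_of_mem (show θ ∈ circleMap 0 1 ⁻¹' S from hθ)]
      exact le_add_of_nonneg_right (mul_nonneg (hunn _) hPnn)
    · simp only [A, indicator_of_notMem (show θ ∉ circleMap 0 1 ⁻¹' S from hθ), zero_add]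
      rw [mul_comm]
      refine mul_le_mul_of_nonneg_left ?_ (hunn _)
      have := hδP _ (hcirc θ) (by simpa [hS, dist_eq_norm] using hθ)
      rw [Real.dist_eq] at this
      linarith [(abs_lt.mp this).2]
  -- passage to the boundary
  have hcpt : IsCompact ((fun p : ℝ × ℂ => (p.1 : ℂ) * p.2) '' (Icc 0 1 ×ˢ (sphere 0 1 ∩ S))) :=
    (isCompact_Icc.prod ((isCompact_sphere 0 1).inter_right hSm)).image (by fun_prop)
  have hcsub : ((fun p : ℝ × ℂ => (p.1 : ℂ) * p.2) '' (Icc 0 1 ×ˢ (sphere 0 1 ∩ S)))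
      ⊆ closedBall 0 1 \ {1} := by
    rintro _ ⟨⟨r, ζ⟩, ⟨⟨hr0, hr1⟩, hζ, hζS⟩, rfl⟩
    have hn : ‖ζ‖ = 1 := by simpa using hζ
    have hnr : ‖(r : ℂ) * ζ‖ = r := by
      rw [norm_mul, hn, Complex.norm_real, Real.norm_of_nonneg hr0, mul_one]
    refine ⟨by simpa [hnr, hn, abs_of_nonneg hr0] using hr1, fun h => ?_⟩
    have h' : (r : ℂ) * ζ = 1 := h
    have hr : r = 1 := by rw [← hnr, h', norm_one]
    rw [hr, Complex.ofReal_one, one_mul] at h'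
    rw [hS, h'] at hζS
    simp at hζS
    linarith
  obtain ⟨B, hB⟩ := hcpt.exists_bound_of_continuousOn (huc.mono hcsub)
  obtain ⟨P, hP⟩ := (isCompact_sphere (0 : ℂ) 1).exists_bound_of_continuousOn
    (continuousOn_poissonKernel hw)
  have hlim : Tendsto (fun r : ℝ => ∫ θ in 0..2 * π, A r θ) (𝓝[<] 1)
      (𝓝 (∫ θ in 0..2 * π, A 1 θ)) := by
    have hr : ∀ᶠ r : ℝ in 𝓝[<] 1, r ∈ Ioo (0 : ℝ) 1 := Ioo_mem_nhdsLT zero_lt_one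
    refine intervalIntegral.tendsto_integral_filter_of_dominated_convergence (fun _ => |P| * |B|)
      ?_ ?_ (by simp) ?_
    · filter_upwards [hr] with r hr using (hAm r hr.1 hr.2).restrict
    · filter_upwards [hr] with r hr
      refine Eventually.of_forall fun θ _ => ?_
      by_cases hθ : circleMap 0 1 θ ∈ S
      · simp only [A, indicator_of_mem (show θ ∈ circleMap 0 1 ⁻¹' S from hθ)]
        rw [norm_mul]
        have hP0 := hP _ (hcirc θ)
        have hB0 := hB _ ⟨(r, circleMap 0 1 θ), ⟨⟨hr.1.le, hr.2.le⟩, hcirc θ, hθ⟩, rfl⟩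
        exact mul_le_mul (hP0.trans (le_abs_self P)) (hB0.trans (le_abs_self B)) (norm_nonneg _)
          (abs_nonneg P)
      · simp only [A, indicator_of_notMem (show θ ∉ circleMap 0 1 ⁻¹' S from hθ), norm_zero]
        positivity
    · refine Eventually.of_forall fun θ _ => ?_
      by_cases hθ : circleMap 0 1 θ ∈ S
      · simp only [A, indicator_of_mem (show θ ∈ circleMap 0 1 ⁻¹' S from hθ)]
        refine Tendsto.const_mul _ ?_
        have hm1 : circleMap 0 1 θ ∈ closedBall (0 : ℂ) 1 \ {1} := by
          refine ⟨sphere_subset_closedBall (hcirc θ), fun h => ?_⟩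
          rw [mem_singleton_iff.mp h] at hθ
          simp [hS] at hθ
          linarith
        have hcw : ContinuousWithinAt u (closedBall 0 1 \ {1}) (((1 : ℝ) : ℂ) * circleMap 0 1 θ) := by
          rw [Complex.ofReal_one, one_mul]
          exact huc _ hm1
        refine hcw.tendsto.comp (tendsto_nhdsWithin_iff.mpr ⟨?_, ?_⟩)
        · exact (Continuous.tendsto (by fun_prop) _).mono_left nhdsWithin_le_nhds
        · filter_upwards [hr] with r hr
          have := hsc r hr.1 hr.2 _ (sphere_subset_closedBall (hcirc θ))
          exact ⟨ball_subset_closedBall this, ne_one_of_mem_ball this⟩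
      · simp only [A, indicator_of_notMem (show θ ∉ circleMap 0 1 ⁻¹' S from hθ)]
        exact tendsto_const_nhds
  have hlu : Tendsto (fun r : ℝ => u (r * w)) (𝓝[<] 1) (𝓝 (u w)) := by
    have hwc : ContinuousAt u (((1 : ℝ) : ℂ) * w) := by
      rw [Complex.ofReal_one, one_mul]
      exact Real.continuous_posLog.continuousAt.comp
        (hf.continuousOn.continuousAt (isOpen_ball.mem_nhds hw)).norm
    have := hwc.tendsto.comp ((Continuous.tendsto (f := fun r : ℝ => (r : ℂ) * w)
      (by fun_prop) 1).mono_left (nhdsWithin_le_nhds (s := Iio 1)))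
    rw [Complex.ofReal_one, one_mul] at this
    exact this
  have hfin := le_of_tendsto_of_tendsto hlu ((hlim.const_mul (2 * π)⁻¹).add_const
    (C * (poissonKernel 0 w 1 + η))) (by
      filter_upwards [Ioo_mem_nhdsLT (zero_lt_one' ℝ)] with r hr using hinteg r hr.1 hr.2)
  refine hfin.trans (add_le_add_left ?_ _)
  rw [circleAverage_def, smul_eq_mul]
  refine mul_le_mul_of_nonneg_left ?_ (by positivity)
  have hle : ∀ θ, A 1 θ ≤ poissonKernel 0 w (circleMap 0 1 θ) * u (circleMap 0 1 θ) := by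
    intro θ
    simp only [A, Complex.ofReal_one, one_mul]
    exact indicator_le_self' (fun _ _ => mul_nonneg (poissonKernel_nonneg hw (hcirc θ)) (hunn _)) θ
  refine intervalIntegral.integral_mono (by positivity) ?_ hPi hle
  refine IntervalIntegrable.mono_fun hPi ?_ (Eventually.of_forall fun θ => ?_)
  · simp only [A, Complex.ofReal_one, one_mul]
    exact (intervalIntegrable_iff.mp hPi).aestronglyMeasurable.indicator
      (hSm.preimage (continuous_circleMap 0 1)).measurableSet
  · simp only [A, Complex.ofReal_one, one_mul]
    exact norm_indicator_le_norm_self _ _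

end LeftDefinite

end

noncomputable section

namespace LeftDefinite

open Metric Complex Real

/-! ### Functions of bounded type on the upper half-plane -/

/-- The closed upper half-plane. -/
def closedUpperHalf : Set ℂ := {z | 0 ≤ z.im}

theorem upperHalf_subset_closedUpperHalf : upperHalf ⊆ closedUpperHalf :=
  fun z hz => le_of_lt (show 0 < z.im from hz)

theorem ofReal_mem_closedUpperHalf (t : ℝ) : (t : ℂ) ∈ closedUpperHalf := by
  simp [closedUpperHalf]

theorem poissonInt_affine {E : Type*} [NormedAddCommGroup E] [NormedSpace ℝ E] (v : ℝ → E)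
    (x y : ℝ) (z : ℂ) :
    poissonInt (fun t => v (x + y * t)) z = poissonInt v (x + y * z) := by
  rw [poissonInt, poissonInt]
  congr 3
  ext s
  congr 2
  simp
  ring

theorem posLog_le_sq {x : ℝ} (hx : 0 ≤ x) : log⁺ x ≤ x ^ 2 := by
  refine max_le (by positivity) ?_
  rcases hx.eq_or_lt with rfl | h
  · simp
  · nlinarith [Real.log_le_sub_one_of_pos h]

theorem continuous_comp_ofReal {N : ℂ → ℂ} (hN : ContinuousOn N closedUpperHalf) :
    Continuous fun t : ℝ => N t :=
  hN.comp_continuous Complex.continuous_ofReal ofReal_mem_closedUpperHalf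

theorem integrable_posLog_norm {N : ℂ → ℂ} (hN : ContinuousOn N closedUpperHalf)
    (hi : Integrable fun t : ℝ => ‖N t‖ ^ 2) : Integrable fun t : ℝ => log⁺ ‖N t‖ := by
  refine hi.mono' ?_ (Eventually.of_forall fun t => ?_)
  · exact (Real.continuous_posLog.comp (continuous_comp_ofReal hN).norm).aestronglyMeasurable
  · rw [Real.norm_of_nonneg Real.posLog_nonneg]
    exact posLog_le_sq (norm_nonneg _)

theorem posLog_norm_le_poissonInt_of_ne_zero {N g h : ℂ → ℂ} (hN : DifferentiableOn ℂ N upperHalf)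
    (hNc : ContinuousOn N closedUpperHalf) (hi : Integrable fun t : ℝ => ‖N t‖ ^ 2)
    (hh : DifferentiableOn ℂ h upperHalf) {M : ℝ}
    (hM : ∀ z ∈ upperHalf, ‖g z‖ ≤ M ∧ ‖h z‖ ≤ M) (hhI : h I ≠ 0)
    (hNh : ∀ z ∈ upperHalf, N z * h z = g z) {z : ℂ} (hz : z ∈ upperHalf) :
    log⁺ ‖N z‖ ≤ poissonInt (fun t => log⁺ ‖N t‖) z
      + (Real.log M - Real.log ‖h I‖) * z.im := by
  have hmaps : MapsTo icay (ball 0 1) upperHalf := fun ζ hζ => im_icay_pos hζ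
  have hdi : DifferentiableOn ℂ icay (ball 0 1) := fun ζ hζ =>
    (differentiableAt_icay (ne_one_of_mem_ball hζ)).differentiableWithinAt
  have hf : DifferentiableOn ℂ (N ∘ icay) (ball 0 1) := hN.comp hdi hmaps
  have hfc : ContinuousOn (N ∘ icay) (closedBall 0 1 \ {1}) := by
    refine hNc.comp (fun ζ hζ => ?_) (fun ζ hζ => im_icay_nonneg hζ.1)
    exact (differentiableAt_icay hζ.2).continuousAt.continuousWithinAt
  have hfi : CircleIntegrable (fun ζ => log⁺ ‖(N ∘ icay) ζ‖) 0 1 := by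
    rw [circleIntegrable_iff_integrable_cay]
    refine (integrable_inv_one_add_sq_smul (integrable_posLog_norm hNc hi)).congr
      (Eventually.of_forall fun t => ?_)
    simp only [Function.comp]
    rw [icay_cay (by simp)]
  have key := posLog_norm_le_circleAverage_add hf hfc (fun r hr0 hr1 =>
    circleAverage_posLog_le hf (hh.comp hdi hmaps) (k := h ∘ icay) (g := g ∘ icay)
      (by simpa [icay_zero] using hhI) (fun ζ hζ => hM _ (hmaps hζ))
      (fun ζ hζ => hNh _ (hmaps hζ)) hr0 hr1) hfi (cay_mem_ball hz)
  simp only [Function.comp, icay_cay (le_of_lt (show 0 < z.im from hz)), icay_zero] at key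
  refine key.trans (le_of_eq ?_)
  rw [poissonInt_eq_circleAverage _ hz, ← im_icay, icay_cay (le_of_lt hz)]
  congr 1
  rw [circleAverage_eq_integral_cay, circleAverage_eq_integral_cay]
  congr 2
  ext t
  rw [icay_cay (by simp)]
  simp

/-- The Nevanlinna inequality for functions of bounded type that are continuous up to the real
line. -/
theorem exists_posLog_norm_le_poissonInt {N : ℂ → ℂ} (hN : DifferentiableOn ℂ N upperHalf)
    (hNc : ContinuousOn N closedUpperHalf) (hi : Integrable fun t : ℝ => ‖N t‖ ^ 2)
    (hb : IsBoundedType N) :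
    ∃ C : ℝ, 0 ≤ C ∧ ∀ z ∈ upperHalf,
      log⁺ ‖N z‖ ≤ poissonInt (fun t => log⁺ ‖N t‖) z + C * z.im := by
  obtain ⟨g, h, -, hh, ⟨M, hM⟩, ⟨w, hw, hhw⟩, e⟩ := hb
  have hy : 0 < w.im := hw
  set A : ℂ → ℂ := fun z => w.re + w.im * z with hA
  have hmaps : MapsTo A upperHalf upperHalf := by
    intro z hz
    have hz' : 0 < z.im := hz
    simp [hA, upperHalf]
    positivity
  have hmapsc : MapsTo A closedUpperHalf closedUpperHalf := by
    intro z hz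
    have hz' : 0 ≤ z.im := hz
    simp [hA, closedUpperHalf]
    positivity
  have hAd : Differentiable ℂ A := by fun_prop
  have hAI : A I = w := by
    apply Complex.ext <;> simp [hA]
  have hAr : ∀ t : ℝ, A t = ((w.re + w.im * t : ℝ) : ℂ) := by
    intro t
    simp [hA]
  have hMw := hM w hw
  have hC : 0 ≤ Real.log M - Real.log ‖h w‖ :=
    sub_nonneg.mpr (Real.log_le_log (norm_pos_iff.mpr hhw) hMw.2)
  refine ⟨(Real.log M - Real.log ‖h w‖) / w.im, by positivity, fun z hz => ?_⟩
  have key := posLog_norm_le_poissonInt_of_ne_zero (N := N ∘ A) (g := g ∘ A) (h := h ∘ A) (M := M)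
    (hN.comp hAd.differentiableOn hmaps) (hNc.comp hAd.continuous.continuousOn hmapsc) ?_
    (hh.comp hAd.differentiableOn hmaps) (fun z hz => hM _ (hmaps hz))
    (by simpa [hAI] using hhw) (fun z hz => e _ (hmaps hz)) (z := (z - w.re) / w.im) ?_
  · have hAz : A ((z - w.re) / w.im) = z := by
      have : (w.im : ℂ) ≠ 0 := by exact_mod_cast hy.ne'
      simp only [hA]
      field_simp
      ring
    simp only [Function.comp, hAz, hAI] at key
    refine key.trans (le_of_eq ?_)
    congr 1
    · have := poissonInt_affine (fun t => log⁺ ‖N t‖) w.re w.im ((z - w.re) / w.im)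
      simp only [hA] at hAz
      rw [hAz] at this
      rw [← this]
      simp only [hAr]
    · simp only [Complex.div_ofReal_im, Complex.sub_im, Complex.ofReal_im, sub_zero]
      field_simp
  · have := integrable_comp_affine hi w.re hy
    refine this.congr (Eventually.of_forall fun t => ?_)
    simp only [Function.comp, hAr]
  · have hz' : 0 < z.im := hz
    simp only [upperHalf, mem_ofPred_eq, Complex.div_ofReal_im, Complex.sub_im, Complex.ofReal_im,
      sub_zero]
    positivity

theorem poissonInt_le_integral_div {v : ℝ → ℝ} (hv : Integrable v) (hv0 : ∀ t, 0 ≤ v t) {z : ℂ}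
    (hz : z ∈ upperHalf) : poissonInt v z ≤ (∫ t, v t) / z.im := by
  have hy : 0 < z.im := hz
  have h1 := integrable_comp_affine hv z.re hy
  have h2 : ∫ s : ℝ, (1 + s ^ 2)⁻¹ • v (z.re + z.im * s) ≤ ∫ s : ℝ, v (z.re + z.im * s) := by
    refine integral_mono_of_nonneg (Eventually.of_forall fun s => ?_) h1
      (Eventually.of_forall fun s => ?_)
    · exact mul_nonneg (by positivity) (hv0 _)
    · exact mul_le_of_le_one_left (hv0 _) (inv_le_one_of_one_le₀ (by nlinarith))
  rw [integral_comp_affine v z.re hy] at h2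
  have h3 : 0 ≤ ∫ t, v t := integral_nonneg hv0
  have hpi : π⁻¹ ≤ 1 := inv_le_one_of_one_le₀ (by linarith [Real.pi_gt_three])
  calc poissonInt v z ≤ π⁻¹ * (z.im⁻¹ • ∫ t, v t) :=
        mul_le_mul_of_nonneg_left h2 (by positivity)
    _ ≤ 1 * (z.im⁻¹ • ∫ t, v t) := mul_le_mul_of_nonneg_right hpi (by
        rw [smul_eq_mul]
        positivity)
    _ = _ := by rw [smul_eq_mul]; field_simp

theorem norm_le_exp_posLog (x : ℂ) : ‖x‖ ≤ Real.exp (log⁺ ‖x‖) := by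
  rcases (norm_nonneg x).eq_or_lt with h | h
  · rw [← h]
    positivity
  · rw [← Real.log_le_iff_le_exp h]
    exact le_max_right _ _

/-- A function of bounded type and non-positive mean type with square integrable boundary values is
bounded on half-planes `Im z ≥ 1`. -/
theorem exists_bound_of_meanType {N : ℂ → ℂ} (hN : DifferentiableOn ℂ N upperHalf)
    (hNc : ContinuousOn N closedUpperHalf) (hi : Integrable fun t : ℝ => ‖N t‖ ^ 2)
    (hb : IsBoundedType N) (hm : meanType N ≤ 0) :
    ∃ K : ℝ, ∀ z : ℂ, 1 ≤ z.im → ‖N z‖ ≤ K := by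
  obtain ⟨C, hC0, hC⟩ := exists_posLog_norm_le_poissonInt hN hNc hi hb
  set A := ∫ t : ℝ, log⁺ ‖N t‖ with hA
  have hA0 : 0 ≤ A := integral_nonneg fun _ => Real.posLog_nonneg
  have hgrow : ∀ z : ℂ, 1 ≤ z.im → ‖N z‖ ≤ Real.exp (A + C * z.im) := by
    intro z hz
    have hz' : z ∈ upperHalf := lt_of_lt_of_le one_pos hz
    refine (norm_le_exp_posLog _).trans (Real.exp_le_exp.mpr ((hC z hz').trans ?_))
    refine add_le_add_left ?_ _
    refine (poissonInt_le_integral_div (integrable_posLog_norm hNc hi)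
      (fun _ => Real.posLog_nonneg) hz').trans ?_
    exact div_le_self hA0 hz
  refine ⟨Real.exp (A + C), fun z hz => ?_⟩
  rw [meanType_nonpos_iff] at hm
  suffices H : ∀ ε : ℝ, 0 < ε → ‖cexp (ε * (I * (z - I))) * N z‖ ≤ Real.exp (A + C) by
    have ht : Tendsto (fun ε : ℝ => ‖cexp (ε * (I * (z - I))) * N z‖) (𝓝[>] 0)
        (𝓝 ‖cexp ((0 : ℝ) * (I * (z - I))) * N z‖) :=
      (Continuous.tendsto (by fun_prop) _).mono_left nhdsWithin_le_nhds
    simp only [Complex.ofReal_zero, zero_mul, Complex.exp_zero, one_mul] at ht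
    exact le_of_tendsto ht (eventually_nhdsWithin_of_forall H)
  intro ε hε
  set f : ℂ → ℂ := fun ζ => cexp (-ε * ζ) * N (I * ζ + I) with hf
  have him : ∀ ζ : ℂ, (I * ζ + I).im = ζ.re + 1 := by
    intro ζ
    simp
  have hfd : DifferentiableOn ℂ f {ζ | -1 < ζ.re} := by
    refine DifferentiableOn.mul (by fun_prop) (hN.comp (by fun_prop) fun ζ hζ => ?_)
    have : -1 < ζ.re := hζ
    change 0 < (I * ζ + I).im
    rw [him]
    linarith
  have hcl : closure {ζ : ℂ | 0 < ζ.re} ⊆ {ζ | -1 < ζ.re} := by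
    rw [Complex.closure_setOfPred_lt_re]
    intro ζ hζ
    have : 0 ≤ ζ.re := hζ
    change -1 < ζ.re
    linarith
  have hfb : ∀ ζ : ℂ, 0 ≤ ζ.re → ‖f ζ‖ ≤ Real.exp (A + C + C * ζ.re) * Real.exp (-ε * ζ.re) := by
    intro ζ hζ
    simp only [hf]
    rw [norm_mul, Complex.norm_exp, mul_comm]
    have h1 := hgrow (I * ζ + I) (by rw [him]; linarith)
    rw [him] at h1
    refine mul_le_mul (h1.trans (Real.exp_le_exp.mpr (by linarith))) (le_of_eq ?_)
      (Real.exp_pos _).le (Real.exp_pos _).le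
    simp
  have hmain := PhragmenLindelof.right_half_plane_of_bounded_on_real (f := f)
    (C := Real.exp (A + C)) (z := -I * (z - I)) (hfd.mono hcl).diffContOnCl ?_ ?_ ?_ ?_
  · have e1 : I * (-I * (z - I)) + I = z := by
      ring_nf
      simp
    have e2 : -(ε : ℂ) * (-I * (z - I)) = ε * (I * (z - I)) := by ring
    simp only [hf, e1, e2] at hmain
    exact hmain
  · refine ⟨1, by norm_num, C, ?_⟩
    refine Asymptotics.IsBigO.of_bound (Real.exp (A + C)) ?_
    refine eventually_inf_principal.mpr (Eventually.of_forall fun ζ hζ => ?_)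
    have h0 : 0 < ζ.re := hζ
    refine (hfb ζ h0.le).trans ?_
    rw [Real.norm_of_nonneg (Real.exp_pos _).le, Real.rpow_one, ← Real.exp_add, ← Real.exp_add]
    refine Real.exp_le_exp.mpr ?_
    have h1 : C * ζ.re ≤ C * ‖ζ‖ := mul_le_mul_of_nonneg_left (Complex.re_le_norm ζ) hC0
    nlinarith
  · refine ⟨Real.exp ε, ?_⟩
    have ht : Tendsto (fun x : ℝ => x + 1) atTop atTop :=
      tendsto_atTop_add_const_right _ _ tendsto_id
    refine eventually_map.mpr ?_
    filter_upwards [ht.eventually (hm ε hε)] with x hx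
    have hx' : ‖N (I * ((x + 1 : ℝ) : ℂ))‖ ≤ Real.exp (ε * (x + 1)) := by
      rw [← ofReal_norm] at hx
      exact (ENNReal.ofReal_le_ofReal_iff (Real.exp_pos _).le).mp hx
    simp only [hf]
    have e1 : I * (x : ℂ) + I = I * ((x + 1 : ℝ) : ℂ) := by
      push_cast
      ring
    rw [e1, norm_mul, Complex.norm_exp]
    have e2 : (-(ε : ℂ) * x).re = -ε * x := by simp
    rw [e2]
    calc Real.exp (-ε * x) * ‖N (I * ((x + 1 : ℝ) : ℂ))‖
        ≤ Real.exp (-ε * x) * Real.exp (ε * (x + 1)) := by gcongr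
      _ = Real.exp ε := by rw [← Real.exp_add]; ring_nf
  · intro x
    refine (hfb (x * I) (by simp)).trans (le_of_eq ?_)
    simp
  · simpa using hz

end LeftDefinite

end

noncomputable section

namespace LeftDefinite

open Metric Complex Real

theorem integrable_poisson_affine {E : Type*} [NormedAddCommGroup E] [NormedSpace ℝ E] {v : ℝ → E}
    (hv : Integrable v) {z : ℂ} (hz : z ∈ upperHalf) :
    Integrable fun s : ℝ => (1 + s ^ 2)⁻¹ • v (z.re + z.im * s) :=
  integrable_inv_one_add_sq_smul (integrable_comp_affine hv z.re hz)

theorem poissonInt_nonneg {v : ℝ → ℝ} (hv0 : ∀ t, 0 ≤ v t) (z : ℂ) : 0 ≤ poissonInt v z :=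
  mul_nonneg (by positivity) (integral_nonneg fun s => mul_nonneg (by positivity) (hv0 _))

theorem exp_two_mul_posLog_le {x : ℝ} (hx : 0 ≤ x) : Real.exp (2 * log⁺ x) ≤ 1 + x ^ 2 := by
  rcases le_total x 1 with h | h
  · rw [(Real.posLog_eq_zero_iff x).mpr (by rwa [abs_of_nonneg hx])]
    simp
    positivity
  · rw [Real.posLog_eq_log (by rwa [abs_of_nonneg hx]), two_mul, Real.exp_add,
      Real.exp_log (by linarith)]
    nlinarith

/-- Jensen's inequality for the Poisson integral of `log⁺ ‖N‖`. -/
theorem exp_poissonInt_posLog_le {N : ℂ → ℂ} (hNc : ContinuousOn N closedUpperHalf)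
    (hi : Integrable fun t : ℝ => ‖N t‖ ^ 2) {z : ℂ} (hz : z ∈ upperHalf) :
    Real.exp (2 * poissonInt (fun t => log⁺ ‖N t‖) z) ≤ 1 + poissonInt (fun t => ‖N t‖ ^ 2) z := by
  set m := poissonInt (fun t => log⁺ ‖N t‖) z with hm
  set e := Real.exp (2 * m) with he
  have i0 := integrable_inv_one_add_sq
  have i1 := integrable_poisson_affine (integrable_posLog_norm hNc hi) hz
  have i2 := integrable_poisson_affine hi hz
  have hpt : ∀ s : ℝ, e * (1 - 2 * m) * (1 + s ^ 2)⁻¹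
      + 2 * e * ((1 + s ^ 2)⁻¹ • log⁺ ‖N ((z.re + z.im * s : ℝ) : ℂ)‖)
      ≤ (1 + s ^ 2)⁻¹ + (1 + s ^ 2)⁻¹ • ‖N ((z.re + z.im * s : ℝ) : ℂ)‖ ^ 2 := by
    intro s
    set x := ‖N ((z.re + z.im * s : ℝ) : ℂ)‖
    have h1 := exp_two_mul_posLog_le (norm_nonneg (N ((z.re + z.im * s : ℝ) : ℂ)))
    have h2 := Real.add_one_le_exp (2 * log⁺ x - 2 * m)
    have h3 : e * (1 - 2 * m + 2 * log⁺ x) ≤ 1 + x ^ 2 := by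
      refine le_trans ?_ h1
      calc e * (1 - 2 * m + 2 * log⁺ x) ≤ e * Real.exp (2 * log⁺ x - 2 * m) := by
            refine mul_le_mul_of_nonneg_left (by linarith) (Real.exp_pos _).le
        _ = Real.exp (2 * log⁺ x) := by
            rw [he, ← Real.exp_add]
            ring_nf
    have h4 : (0 : ℝ) ≤ (1 + s ^ 2)⁻¹ := by positivity
    have := mul_le_mul_of_nonneg_left h3 h4
    simp only [smul_eq_mul]
    linarith
  have h := integral_mono ((i0.const_mul _).add (i1.const_mul _)) (i0.add i2) hpt
  simp only [Pi.add_apply] at h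
  rw [integral_add (i0.const_mul _) (i1.const_mul _), integral_add i0 i2, integral_const_mul,
    integral_const_mul, integral_univ_inv_one_add_sq] at h
  have hp := mul_le_mul_of_nonneg_left h (inv_pos.mpr Real.pi_pos).le
  rw [mul_add, mul_add, inv_mul_cancel₀ Real.pi_ne_zero] at hp
  have e1 : π⁻¹ * ∫ s : ℝ, (1 + s ^ 2)⁻¹ • log⁺ ‖N ((z.re + z.im * s : ℝ) : ℂ)‖ = m := rfl
  have e2 : π⁻¹ * ∫ s : ℝ, (1 + s ^ 2)⁻¹ • ‖N ((z.re + z.im * s : ℝ) : ℂ)‖ ^ 2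
    = poissonInt (fun t => ‖N t‖ ^ 2) z := rfl
  rw [e2, mul_left_comm, inv_mul_cancel₀ Real.pi_ne_zero, mul_left_comm, e1] at hp
  linarith

/-- A function of bounded type and non-positive mean type with square integrable boundary values has
a harmonic majorant of `‖N‖ ^ 2`. -/
theorem exists_sq_norm_le_poissonInt {N : ℂ → ℂ} (hN : DifferentiableOn ℂ N upperHalf)
    (hNc : ContinuousOn N closedUpperHalf) (hi : Integrable fun t : ℝ => ‖N t‖ ^ 2)
    (hb : IsBoundedType N) (hm : meanType N ≤ 0) :
    ∃ A B : ℝ, 0 ≤ B ∧ ∀ z ∈ upperHalf, ‖N z‖ ^ 2 ≤ A + B * poissonInt (fun t => ‖N t‖ ^ 2) z := by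
  obtain ⟨C, hC0, hC⟩ := exists_posLog_norm_le_poissonInt hN hNc hi hb
  obtain ⟨K, hK⟩ := exists_bound_of_meanType hN hNc hi hb hm
  have hB0 : 0 ≤ Real.exp (2 * C) := (Real.exp_pos _).le
  refine ⟨K ^ 2 + Real.exp (2 * C), Real.exp (2 * C), hB0, fun z hz => ?_⟩
  have hP := poissonInt_nonneg (v := fun t : ℝ => ‖N t‖ ^ 2) (fun t => by positivity) z
  rcases le_total 1 z.im with h | h
  · have := hK z h
    have h2 : ‖N z‖ ^ 2 ≤ K ^ 2 := pow_le_pow_left₀ (norm_nonneg _) this 2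
    nlinarith [mul_nonneg hB0 hP]
  · have h1 : ‖N z‖ ^ 2 ≤ Real.exp (2 * log⁺ ‖N z‖) := by
      rw [two_mul, Real.exp_add, ← sq]
      exact pow_le_pow_left₀ (norm_nonneg _) (norm_le_exp_posLog _) 2
    have h2 : 2 * log⁺ ‖N z‖ ≤ 2 * C + 2 * poissonInt (fun t => log⁺ ‖N t‖) z := by
      have := hC z hz
      nlinarith [mul_le_mul_of_nonneg_left h hC0]
    have h3 := exp_poissonInt_posLog_le hNc hi hz
    calc ‖N z‖ ^ 2 ≤ Real.exp (2 * C) * Real.exp (2 * poissonInt (fun t => log⁺ ‖N t‖) z) := by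
          rw [← Real.exp_add]
          exact h1.trans (Real.exp_le_exp.mpr h2)
      _ ≤ Real.exp (2 * C) * (1 + poissonInt (fun t => ‖N t‖ ^ 2) z) := by gcongr
      _ ≤ _ := by nlinarith [sq_nonneg K]

theorem unifIntegrable_of_eLpNorm_two_le {α : Type*} [MeasurableSpace α] {μ : Measure α}
    [IsFiniteMeasure μ] {f : ℕ → α → ℂ} (hf : ∀ n, AEStronglyMeasurable (f n) μ) {M : NNReal}
    (hM : ∀ n, eLpNorm (f n) 2 μ ≤ M) : UnifIntegrable f 1 μ := by
  intro ε hε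
  refine ⟨(ε / (M + 1)) ^ 2, by positivity, fun n s hs hμ => ?_⟩
  rw [eLpNorm_indicator_eq_eLpNorm_restrict hs]
  refine (eLpNorm_le_eLpNorm_mul_rpow_measure_univ (q := 2) (by norm_num)
    (hf n).restrict).trans ?_
  have h1 : eLpNorm (f n) 2 (μ.restrict s) ≤ M :=
    (eLpNorm_mono_measure _ Measure.restrict_le_self).trans (hM n)
  have h2 : (μ.restrict s univ) ^ (1 / (1 : ENNReal).toReal - 1 / (2 : ENNReal).toReal)
      ≤ ENNReal.ofReal (ε / (M + 1)) := by
    rw [Measure.restrict_apply_univ]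
    have e : (1 / (1 : ENNReal).toReal - 1 / (2 : ENNReal).toReal) = 1 / 2 := by norm_num
    rw [e]
    refine (ENNReal.rpow_le_rpow hμ (by norm_num)).trans (le_of_eq ?_)
    rw [ENNReal.ofReal_rpow_of_nonneg (by positivity) (by norm_num), ← Real.sqrt_eq_rpow,
      Real.sqrt_sq (by positivity)]
  refine (mul_le_mul' h1 h2).trans ?_
  rw [← ENNReal.ofReal_coe_nnreal, ← ENNReal.ofReal_mul (by positivity)]
  refine ENNReal.ofReal_le_ofReal ?_
  rw [mul_div_assoc', div_le_iff₀ (by positivity)]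
  nlinarith [M.2]

theorem tendsto_integral_of_eLpNorm_two_le {α : Type*} [MeasurableSpace α] {μ : Measure α}
    [IsFiniteMeasure μ] {f : ℕ → α → ℂ} {g : α → ℂ} (hf : ∀ n, AEStronglyMeasurable (f n) μ)
    {M : NNReal} (hM : ∀ n, eLpNorm (f n) 2 μ ≤ M)
    (hfg : ∀ᵐ x ∂μ, Tendsto (fun n => f n x) atTop (𝓝 (g x))) :
    Tendsto (fun n => ∫ x, f n x ∂μ) atTop (𝓝 (∫ x, g x ∂μ)) := by
  have hgm : AEStronglyMeasurable g μ := aestronglyMeasurable_of_tendsto_ae _ hf hfg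
  have hg2 : MemLp g 2 μ := by
    refine ⟨hgm, (Lp.eLpNorm_lim_le_liminf_eLpNorm hf g hfg).trans_lt ?_⟩
    refine lt_of_le_of_lt (liminf_le_of_le (a := (M : ENNReal)) (by isBoundedDefault)
      fun b hb => ?_) ENNReal.coe_lt_top
    obtain ⟨n, hn⟩ := hb.exists
    exact hn.trans (hM n)
  have hg1 : MemLp g 1 μ := hg2.mono_exponent (by norm_num)
  have hf1 : ∀ n, Integrable (f n) μ := fun n =>
    MemLp.integrable (q := 2) (by norm_num) ⟨hf n, (hM n).trans_lt ENNReal.coe_lt_top⟩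
  have ht := tendsto_Lp_finite_of_tendsto_ae le_rfl (by norm_num) hf hg1
    (unifIntegrable_of_eLpNorm_two_le hf hM) hfg
  exact tendsto_integral_of_L1' g hgm
    (Eventually.of_forall hf1) ht

theorem circleAverage_poissonInt_icay {ψ : ℝ → ℝ} (hψ : Integrable ψ) {r : ℝ} (hr0 : 0 < r)
    (hr1 : r < 1) : CircleIntegrable (fun ζ => poissonInt ψ (icay ζ)) 0 r ∧
      circleAverage (fun ζ => poissonInt ψ (icay ζ)) 0 r = poissonInt ψ I := by
  obtain ⟨Q, hQ, hQr⟩ := exists_analytic_re_eq_poissonInt (integrable_inv_one_add_sq_smul hψ)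
  have hsub : closedBall (0 : ℂ) |r| ⊆ ball 0 1 := by
    rw [abs_of_pos hr0]
    exact closedBall_subset_ball hr1
  have hQi : CircleIntegrable Q 0 r :=
    ContinuousOn.circleIntegrable' (hQ.continuousOn.mono (sphere_subset_closedBall.trans hsub))
  have heq : EqOn (fun ζ => (Q ζ).re) (fun ζ => poissonInt ψ (icay ζ)) (sphere 0 |r|) :=
    fun ζ hζ => hQr ζ (hsub (sphere_subset_closedBall hζ))
  have hrei : CircleIntegrable (fun ζ => (Q ζ).re) 0 r := by
    refine ContinuousOn.circleIntegrable' ?_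
    exact Complex.continuous_re.comp_continuousOn
      (hQ.continuousOn.mono (sphere_subset_closedBall.trans hsub))
  have hav : circleAverage Q 0 r = Q 0 := by
    refine DiffContOnCl.circleAverage (DifferentiableOn.diffContOnCl (hQ.mono ?_))
    exact closure_ball_subset_closedBall.trans hsub
  refine ⟨?_, ?_⟩
  · exact (circleIntegrable_congr heq).mp hrei
  · rw [← circleAverage_congr_sphere heq, ← icay_zero, ← hQr 0 (by simp), ← hav,
      ← Complex.reCLM_apply, ← Complex.reCLM.circleAverage_comp_comm hQi]
    rfl

/-- The mean value property on the boundary for analytic functions whose square has a harmonic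
majorant. -/
theorem apply_I_eq_poissonInt {G : ℂ → ℂ} (hG : DifferentiableOn ℂ G upperHalf)
    (hGc : ContinuousOn G closedUpperHalf) {ψ : ℝ → ℝ} (hψ : Integrable ψ) {A B : ℝ}
    (hGb : ∀ z ∈ upperHalf, ‖G z‖ ^ 2 ≤ A + B * poissonInt ψ z) :
    G I = poissonInt (fun t => G t) I := by
  have hmaps : MapsTo icay (ball 0 1) upperHalf := fun ζ hζ => im_icay_pos hζ
  have hdi : DifferentiableOn ℂ icay (ball 0 1) := fun ζ hζ =>
    (differentiableAt_icay (ne_one_of_mem_ball hζ)).differentiableWithinAt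
  have hf : DifferentiableOn ℂ (G ∘ icay) (ball 0 1) := hG.comp hdi hmaps
  have hfc : ContinuousOn (G ∘ icay) (closedBall 0 1 \ {1}) := by
    refine hGc.comp (fun ζ hζ => ?_) (fun ζ hζ => im_icay_nonneg hζ.1)
    exact (differentiableAt_icay hζ.2).continuousAt.continuousWithinAt
  set f := G ∘ icay with hfdef
  set r : ℕ → ℝ := fun n => 1 - 1 / (n + 2) with hr
  have hr0 : ∀ n, 0 < r n := fun n => by
    simp only [hr, sub_pos]
    rw [div_lt_one (by positivity)]
    have : (0 : ℝ) ≤ n := n.cast_nonneg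
    linarith
  have hr1 : ∀ n, r n < 1 := fun n => by
    simp only [hr]
    have : (0 : ℝ) < 1 / (n + 2) := by positivity
    linarith
  have hrt : Tendsto r atTop (𝓝 1) := by
    have : Tendsto (fun n : ℕ => (1 : ℝ) - 1 / ((n : ℝ) + 2)) atTop (𝓝 (1 - 0)) :=
      tendsto_const_nhds.sub (tendsto_const_nhds.div_atTop
        (tendsto_atTop_add_const_right _ _ tendsto_natCast_atTop_atTop))
    rwa [sub_zero] at this
  have hsub : ∀ n, closedBall (0 : ℂ) |r n| ⊆ ball 0 1 := fun n => by
    rw [abs_of_pos (hr0 n)]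
    exact closedBall_subset_ball (hr1 n)
  have hcm : ∀ n, Continuous fun θ => f (circleMap 0 (r n) θ) := fun n =>
    hf.continuousOn.comp_continuous (continuous_circleMap 0 (r n))
      fun θ => hsub n (sphere_subset_closedBall (circleMap_mem_sphere' 0 (r n) θ))
  have hav : ∀ n, circleAverage f 0 (r n) = G I := fun n => by
    have : circleAverage f 0 (r n) = f 0 :=
      DiffContOnCl.circleAverage (DifferentiableOn.diffContOnCl
        (hf.mono (closure_ball_subset_closedBall.trans (hsub n))))
    rw [this, hfdef, Function.comp, icay_zero]
  set μ : Measure ℝ := volume.restrict (Ioc 0 (2 * π)) with hμ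
  set M : ℝ := 2 * π * (A + B * poissonInt ψ I) with hM
  have hsq : ∀ n, ∫ θ, ‖f (circleMap 0 (r n) θ)‖ ^ 2 ∂μ ≤ M := by
    intro n
    obtain ⟨i1, e1⟩ := circleAverage_poissonInt_icay hψ (hr0 n) (hr1 n)
    have h1 : circleAverage (fun ζ => ‖f ζ‖ ^ 2) 0 (r n)
        ≤ circleAverage (fun ζ => A + B * poissonInt ψ (icay ζ)) 0 (r n) := by
      refine circleAverage_mono ?_ ((circleIntegrable_const A 0 (r n)).add (i1.const_mul B)) ?_
      · exact ((hcm n).norm.pow 2).intervalIntegrable _ _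
      · intro ζ hζ
        exact hGb _ (hmaps (hsub n (sphere_subset_closedBall hζ)))
    have h2 : circleAverage (fun ζ => A + B * poissonInt ψ (icay ζ)) 0 (r n)
        = A + B * poissonInt ψ I := by
      have i2 : CircleIntegrable (fun ζ => B * poissonInt ψ (icay ζ)) 0 (r n) := i1.const_mul B
      rw [circleAverage_fun_add (circleIntegrable_const A 0 (r n)) i2,
        circleAverage_const]
      have := circleAverage_fun_smul (f := fun ζ => poissonInt ψ (icay ζ)) (a := B) (c := 0)
        (R := r n)
      simp only [smul_eq_mul] at this
      rw [this, e1]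
    rw [h2, circleAverage_def, intervalIntegral.integral_of_le (by positivity), smul_eq_mul,
      inv_mul_le_iff₀ (by positivity)] at h1
    exact h1
  have hL2 : ∀ n, eLpNorm (fun θ => f (circleMap 0 (r n) θ)) 2 μ
      ≤ (Real.toNNReal (√M) : ENNReal) := by
    intro n
    have hi2 : Integrable (fun θ => ‖f (circleMap 0 (r n) θ)‖ ^ 2) μ :=
      (((hcm n).norm.pow 2).integrableOn_Icc (a := 0) (b := 2 * π)).mono_set Ioc_subset_Icc_self
    rw [MemLp.eLpNorm_eq_integral_rpow_norm (by norm_num) (by norm_num)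
      ((memLp_two_iff_integrable_sq_norm (hcm n).aestronglyMeasurable).mpr hi2)]
    refine ENNReal.ofReal_le_ofReal ?_
    simp only [ENNReal.toReal_ofNat, Real.rpow_ofNat]
    rw [Real.sqrt_eq_rpow, one_div]
    exact Real.rpow_le_rpow (integral_nonneg fun _ => by positivity) (hsq n) (by norm_num)
  have ht := tendsto_integral_of_eLpNorm_two_le (μ := μ) (g := fun θ => f (circleMap 0 1 θ))
    (fun n => (hcm n).aestronglyMeasurable) hL2 ?_
  · have hconst : ∀ n, ∫ θ, f (circleMap 0 (r n) θ) ∂μ = (2 * π : ℝ) • G I := by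
      intro n
      rw [← hav n, circleAverage_def, intervalIntegral.integral_of_le (by positivity),
        smul_inv_smul₀ (by positivity)]
    simp only [hconst] at ht
    have := tendsto_nhds_unique tendsto_const_nhds ht
    have h2 : circleAverage f 0 1 = G I := by
      rw [circleAverage_def, intervalIntegral.integral_of_le (by positivity), ← this,
        inv_smul_smul₀ (by positivity)]
    rw [← h2, circleAverage_eq_integral_cay, poissonInt]
    congr 2
    ext t
    rw [hfdef, Function.comp, icay_cay (by simp)]
    simp
  · have hne : ∀ᵐ θ ∂μ, θ ≠ 2 * π := by
      refine ae_restrict_of_ae ?_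
      rw [ae_iff]
      simp
    filter_upwards [hne, ae_restrict_mem measurableSet_Ioc] with θ h1 h2
    have hc1 : circleMap 0 1 θ ≠ 1 := by
      intro h
      rw [circleMap, zero_add, Complex.ofReal_one, one_mul, Complex.exp_eq_one_iff] at h
      obtain ⟨k, hk⟩ := h
      have hk' : θ = k * (2 * π) := by
        have := mul_right_cancel₀ Complex.I_ne_zero
          (show (θ : ℂ) * I = (k * (2 * π)) * I by rw [hk]; ring)
        exact_mod_cast this
      have hpi := Real.pi_pos
      have k0 : 0 < k := by
        by_contra hcon
        have : (k : ℝ) ≤ 0 := by exact_mod_cast not_lt.mp hcon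
        have := h2.1
        nlinarith
      have k1 : k < 2 := by
        by_contra hcon
        have : (2 : ℝ) ≤ k := by exact_mod_cast not_lt.mp hcon
        have := h2.2
        nlinarith
      have : k = 1 := by omega
      rw [this] at hk'
      apply h1
      rw [hk']
      simp
    have hm1 : circleMap 0 1 θ ∈ closedBall (0 : ℂ) 1 \ {1} :=
      ⟨sphere_subset_closedBall (circleMap_mem_sphere 0 zero_le_one θ), hc1⟩
    refine (hfc _ hm1).tendsto.comp (tendsto_nhdsWithin_iff.mpr ⟨?_, Eventually.of_forall fun n => ?_⟩)
    · exact (Continuous.tendsto (f := fun r : ℝ => circleMap 0 r θ)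
        (by unfold circleMap; fun_prop) 1).comp hrt
    · have := hsub n (sphere_subset_closedBall (circleMap_mem_sphere' 0 (r n) θ))
      exact ⟨ball_subset_closedBall this, ne_one_of_mem_ball this⟩

end LeftDefinite

end

noncomputable section

namespace LeftDefinite

open Metric Complex Real

/-! ### Cauchy and Poisson formulas for square integrable boundary values -/

theorem eq_poissonInt_of_isBoundedType {N : ℂ → ℂ} (hN : DifferentiableOn ℂ N upperHalf)
    (hNc : ContinuousOn N closedUpperHalf) (hi : Integrable fun t : ℝ => ‖N t‖ ^ 2)
    (hb : IsBoundedType N) (hm : meanType N ≤ 0) {w : ℂ} (hw : w ∈ upperHalf) {R : ℂ → ℂ}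
    (hR : DifferentiableOn ℂ R upperHalf) (hRc : ContinuousOn R closedUpperHalf) {L : ℝ}
    (hRL : ∀ z ∈ upperHalf, ‖R z‖ ≤ L) :
    N w * R I = poissonInt (fun t => N ((w.re + w.im * t : ℝ) : ℂ) * R t) I := by
  have hy : 0 < w.im := hw
  obtain ⟨A, B, hB, hAB⟩ := exists_sq_norm_le_poissonInt hN hNc hi hb hm
  set Aff : ℂ → ℂ := fun z => w.re + w.im * z with hAff
  have hmaps : MapsTo Aff upperHalf upperHalf := by
    intro z hz
    have hz' : 0 < z.im := hz
    simp [hAff, upperHalf]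
    positivity
  have hmapsc : MapsTo Aff closedUpperHalf closedUpperHalf := by
    intro z hz
    have hz' : 0 ≤ z.im := hz
    simp [hAff, closedUpperHalf]
    positivity
  have hAd : Differentiable ℂ Aff := by fun_prop
  have hAI : Aff I = w := by
    apply Complex.ext <;> simp [hAff]
  have hAr : ∀ t : ℝ, Aff t = ((w.re + w.im * t : ℝ) : ℂ) := by
    intro t
    simp [hAff]
  have hL : 0 ≤ L := (norm_nonneg _).trans (hRL I (by simp [upperHalf]))
  have key := apply_I_eq_poissonInt (G := fun z => N (Aff z) * R z)
    ((hN.comp hAd.differentiableOn hmaps).mul hR)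
    ((hNc.comp hAd.continuous.continuousOn hmapsc).mul hRc)
    (integrable_comp_affine hi w.re hy) (A := L ^ 2 * A) (B := L ^ 2 * B) ?_
  · simpa only [hAI, hAr] using key
  · intro z hz
    rw [norm_mul, mul_pow]
    have h1 := hAB (Aff z) (hmaps hz)
    have h2 := poissonInt_affine (fun t : ℝ => ‖N t‖ ^ 2) w.re w.im z
    rw [h2]
    calc ‖N (Aff z)‖ ^ 2 * ‖R z‖ ^ 2
        ≤ (A + B * poissonInt (fun t => ‖N t‖ ^ 2) (Aff z)) * L ^ 2 := by
          exact mul_le_mul h1 (pow_le_pow_left₀ (norm_nonneg _) (hRL z hz) 2) (by positivity)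
            ((sq_nonneg _).trans h1)
      _ = _ := by
          rw [hAff]
          ring

/-- The Poisson formula. -/
theorem poisson_formula {N : ℂ → ℂ} (hN : DifferentiableOn ℂ N upperHalf)
    (hNc : ContinuousOn N closedUpperHalf) (hi : Integrable fun t : ℝ => ‖N t‖ ^ 2)
    (hb : IsBoundedType N) (hm : meanType N ≤ 0) {w : ℂ} (hw : w ∈ upperHalf) :
    N w = poissonInt (fun t => N t) w := by
  have := eq_poissonInt_of_isBoundedType hN hNc hi hb hm hw (R := fun _ => 1) (L := 1)
    (differentiableOn_const 1) continuousOn_const (by simp)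
  simp only [mul_one] at this
  rw [this, poissonInt_affine (fun t : ℝ => N t)]
  congr 1
  apply Complex.ext <;> simp

theorem sub_ne_zero_of_im_ne_zero {w : ℂ} (hw : w.im ≠ 0) (t : ℝ) : (t : ℂ) - w ≠ 0 := by
  intro h
  apply hw
  simpa using congrArg Complex.im h

theorem norm_ofReal_sub_sq (w : ℂ) (t : ℝ) :
    ‖(t : ℂ) - w‖ ^ 2 = (t - w.re) ^ 2 + w.im ^ 2 := by
  rw [← Complex.normSq_eq_norm_sq, Complex.normSq_apply]
  simp
  ring

theorem memLp_inv_sub {w : ℂ} (hw : w.im ≠ 0) : MemLp (fun t : ℝ => ((t : ℂ) - w)⁻¹) 2 := by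
  have hc : Continuous fun t : ℝ => ((t : ℂ) - w)⁻¹ :=
    Continuous.inv₀ (by fun_prop) (sub_ne_zero_of_im_ne_zero hw)
  rw [memLp_two_iff_integrable_sq_norm hc.aestronglyMeasurable]
  have hy : 0 < |w.im| := abs_pos.mpr hw
  have h := (integrable_comp_affine integrable_inv_one_add_sq (-w.re / |w.im|)
    (inv_pos.mpr hy)).const_mul (w.im ^ 2)⁻¹
  refine h.congr (Eventually.of_forall fun t => ?_)
  simp only
  rw [norm_inv, inv_pow, norm_ofReal_sub_sq, ← mul_inv]
  congr 1
  have : -w.re / |w.im| + |w.im|⁻¹ * t = (t - w.re) / |w.im| := by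
    field_simp
    ring
  rw [this, div_pow, sq_abs]
  field_simp
  ring

theorem memLp_of_integrable_sq {N : ℂ → ℂ} (hNc : ContinuousOn N closedUpperHalf)
    (hi : Integrable fun t : ℝ => ‖N t‖ ^ 2) : MemLp (fun t : ℝ => N t) 2 :=
  (memLp_two_iff_integrable_sq_norm (continuous_comp_ofReal hNc).aestronglyMeasurable).mpr hi

theorem integrable_div_sub {M : ℝ → ℂ} (hM : MemLp M 2) {w : ℂ} (hw : w.im ≠ 0) :
    Integrable fun t : ℝ => M t / (t - w) :=
  MemLp.integrable_mul (p := 2) (q := 2) hM (memLp_inv_sub hw)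

theorem one_add_sq_inv_mul_sub_I (t : ℝ) :
    ((1 + t ^ 2 : ℝ)⁻¹ : ℂ) * ((t : ℂ) - I) = ((t : ℂ) + I)⁻¹ := by
  have h1 : (t : ℂ) + I ≠ 0 := add_I_ne_zero (by simp)
  have h2 : ((1 + t ^ 2 : ℝ) : ℂ) = (t + I) * (t - I) := by
    push_cast
    ring_nf
    simp
    ring
  have h3 : (t : ℂ) - I ≠ 0 := sub_ne_zero_of_im_ne_zero (by simp) t
  rw [h2]
  field_simp

/-- Cauchy's theorem: the Cauchy integral vanishes in the lower half-plane. -/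
theorem integral_div_sub_conj_eq_zero {N : ℂ → ℂ} (hN : DifferentiableOn ℂ N upperHalf)
    (hNc : ContinuousOn N closedUpperHalf) (hi : Integrable fun t : ℝ => ‖N t‖ ^ 2)
    (hb : IsBoundedType N) (hm : meanType N ≤ 0) {w : ℂ} (hw : w ∈ upperHalf) :
    ∫ t : ℝ, N t / (t - conj w) = 0 := by
  have hy : 0 < w.im := hw
  have hden : ∀ (n : ℕ) (z : ℂ), 0 ≤ z.im → z + (n + 1) * I ≠ 0 := by
    intro n z hz h
    have := congrArg Complex.im h
    simp at this
    have h2 : (0 : ℝ) ≤ n := n.cast_nonneg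
    linarith
  have hle : ∀ (n : ℕ) (z : ℂ), 0 ≤ z.im → ‖z - I‖ ≤ ‖z + (n + 1) * I‖ := by
    intro n z hz
    refine le_of_sq_le_sq ?_ (norm_nonneg _)
    rw [← Complex.normSq_eq_norm_sq, ← Complex.normSq_eq_norm_sq, Complex.normSq_apply,
      Complex.normSq_apply]
    simp
    have h2 : (0 : ℝ) ≤ n := n.cast_nonneg
    nlinarith
  set R : ℕ → ℂ → ℂ := fun n z => (z - I) * ((n + 1) * I / (z + (n + 1) * I)) with hR
  have hzero : ∀ n : ℕ, ∫ t : ℝ, N ((w.re + w.im * t : ℝ) : ℂ) / (t + I)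
      * ((n + 1) * I / (t + (n + 1) * I)) = 0 := by
    intro n
    have key := eq_poissonInt_of_isBoundedType hN hNc hi hb hm hw (R := R n) (L := n + 1) ?_ ?_ ?_
    · rw [show R n I = 0 by simp [hR], mul_zero, poissonInt, eq_comm,
        smul_eq_zero_iff_right (inv_ne_zero Real.pi_ne_zero)] at key
      rw [← key]
      congr 1
      ext t
      rw [Complex.real_smul]
      simp only [Complex.I_re, Complex.I_im, one_mul, zero_add, hR]
      have := one_add_sq_inv_mul_sub_I t
      rw [div_eq_mul_inv (N _), ← this]
      push_cast
      ring
    · intro z hz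
      have := hden n z (le_of_lt hz)
      refine DifferentiableAt.differentiableWithinAt ?_
      simp only [hR]
      fun_prop (disch := assumption)
    · intro z hz
      have := hden n z hz
      refine ContinuousAt.continuousWithinAt ?_
      simp only [hR]
      fun_prop (disch := assumption)
    · intro z hz
      have h0 := hden n z (le_of_lt hz)
      have h1 := hle n z (le_of_lt hz)
      simp only [hR]
      rw [norm_mul, norm_div, mul_div_assoc', div_le_iff₀ (norm_pos_iff.mpr h0)]
      have h2 : ‖((n : ℂ) + 1) * I‖ = n + 1 := by
        rw [norm_mul, Complex.norm_I, mul_one]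
        exact_mod_cast Complex.norm_natCast (n + 1)
      rw [h2, mul_comm]
      exact mul_le_mul_of_nonneg_left h1 (by positivity)
  have hInt : Integrable fun t : ℝ => N ((w.re + w.im * t : ℝ) : ℂ) / (t + I) := by
    have h1 : MemLp (fun t : ℝ => N ((w.re + w.im * t : ℝ) : ℂ)) 2 := by
      rw [memLp_two_iff_integrable_sq_norm]
      · exact integrable_comp_affine hi w.re hy
      · exact ((continuous_comp_ofReal hNc).comp (by fun_prop)).aestronglyMeasurable
    have := integrable_div_sub h1 (w := -I) (by simp)
    simpa using this
  have hlim : Tendsto (fun n : ℕ => ∫ t : ℝ, N ((w.re + w.im * t : ℝ) : ℂ) / (t + I)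
      * ((n + 1) * I / (t + (n + 1) * I))) atTop
      (𝓝 (∫ t : ℝ, N ((w.re + w.im * t : ℝ) : ℂ) / (t + I))) := by
    refine tendsto_integral_of_dominated_convergence
      (fun t : ℝ => ‖N ((w.re + w.im * t : ℝ) : ℂ) / (t + I)‖) (fun n => ?_) hInt.norm
      (fun n => Eventually.of_forall fun t => ?_) (Eventually.of_forall fun t => ?_)
    · refine hInt.1.mul (Continuous.aestronglyMeasurable ?_)
      exact Continuous.div (by fun_prop) (by fun_prop) fun t => hden n t (by simp)
    · rw [norm_mul]
      refine mul_le_of_le_one_right (norm_nonneg _) ?_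
      rw [norm_div]
      refine div_le_one_of_le₀ ?_ (norm_nonneg _)
      refine le_of_sq_le_sq ?_ (norm_nonneg _)
      rw [← Complex.normSq_eq_norm_sq, ← Complex.normSq_eq_norm_sq, Complex.normSq_apply,
        Complex.normSq_apply]
      simp
      nlinarith
    · have h1 : Tendsto (fun n : ℕ => ((n : ℂ) + 1) * I / (t + (n + 1) * I)) atTop (𝓝 1) := by
        have h2 : ∀ n : ℕ, ((n : ℂ) + 1) * I / (t + (n + 1) * I)
            = 1 - t / (t + (n + 1) * I) := by
          intro n
          have := hden n t (by simp)
          field_simp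
          ring
        simp only [h2]
        have h3 : Tendsto (fun n : ℕ => (t : ℂ) / (t + (n + 1) * I)) atTop (𝓝 0) := by
          refine squeeze_zero_norm (a := fun n : ℕ => |t| / ((n : ℝ) + 1)) (fun n => ?_) ?_
          · rw [norm_div, Complex.norm_real, Real.norm_eq_abs]
            refine div_le_div_of_nonneg_left (abs_nonneg t) (by positivity) ?_
            have := Complex.abs_im_le_norm ((t : ℂ) + (n + 1) * I)
            simp at this
            rwa [abs_of_nonneg (by positivity)] at this
          · exact tendsto_const_nhds.div_atTop
              (tendsto_atTop_add_const_right _ _ tendsto_natCast_atTop_atTop)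
        simpa using tendsto_const_nhds.sub h3
      simpa using h1.const_mul (N ((w.re + w.im * t : ℝ) : ℂ) / (t + I))
  simp only [hzero] at hlim
  have h0 := tendsto_nhds_unique tendsto_const_nhds hlim
  have h1 := integral_comp_affine (fun t : ℝ => N t / (t - conj w)) w.re hy
  rw [eq_inv_smul_iff₀ hy.ne', ← integral_smul] at h1
  rw [← h1, h0]
  congr 1
  ext t
  have e : (((w.re + w.im * t : ℝ) : ℂ) - conj w) = w.im * (t + I) := by
    apply Complex.ext <;> simp
  have hyc : (w.im : ℂ) ≠ 0 := by exact_mod_cast hy.ne'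
  rw [e, Complex.real_smul]
  field_simp

theorem integrable_poisson_affine_of_memLp {M : ℝ → ℂ} (hM : MemLp M 2) {z : ℂ}
    (hz : z ∈ upperHalf) : Integrable fun s : ℝ => (1 + s ^ 2)⁻¹ • M (z.re + z.im * s) := by
  have hi2 : Integrable fun t => ‖M t‖ ^ 2 := (memLp_two_iff_integrable_sq_norm hM.1).mp hM
  have hy : 0 < z.im := hz
  have i0 := integrable_inv_one_add_sq
  have i2 := integrable_poisson_affine hi2 hz
  have hmeas : AEStronglyMeasurable (fun s : ℝ => M (z.re + z.im * s)) := by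
    have hq : Measure.QuasiMeasurePreserving (fun s : ℝ => z.re + z.im * s) volume volume := by
      refine (quasiMeasurePreserving_add_left volume z.re).comp ?_
      refine ⟨by fun_prop, ?_⟩
      rw [Real.map_volume_mul_left hy.ne']
      exact Measure.smul_absolutelyContinuous
    exact hM.1.comp_quasiMeasurePreserving hq
  refine (i0.add i2).mono' (i0.1.smul hmeas) (Eventually.of_forall fun s => ?_)
  have h0 : (0 : ℝ) ≤ (1 + s ^ 2)⁻¹ := by positivity
  rw [norm_smul, Real.norm_of_nonneg h0, Pi.add_apply, smul_eq_mul]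
  nlinarith [mul_nonneg h0 (add_nonneg (sq_nonneg (‖M (z.re + z.im * s)‖ - 1))
      (norm_nonneg (M (z.re + z.im * s))))]

/-- Cauchy's integral formula. -/
theorem integral_div_sub_eq {N : ℂ → ℂ} (hN : DifferentiableOn ℂ N upperHalf)
    (hNc : ContinuousOn N closedUpperHalf) (hi : Integrable fun t : ℝ => ‖N t‖ ^ 2)
    (hb : IsBoundedType N) (hm : meanType N ≤ 0) {w : ℂ} (hw : w ∈ upperHalf) :
    ∫ t : ℝ, N t / (t - w) = 2 * π * I * N w := by
  have hy : 0 < w.im := hw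
  have hL := memLp_of_integrable_sq hNc hi
  have h0 := integral_div_sub_conj_eq_zero hN hNc hi hb hm hw
  have i1 := integrable_div_sub hL (w := w) hy.ne'
  have i2 := integrable_div_sub hL (w := conj w) (by simpa using hy.ne')
  have h1 : ∫ t : ℝ, N t / (t - w) = ∫ t : ℝ, (N t / (t - w) - N t / (t - conj w)) := by
    rw [integral_sub i1 i2, h0, sub_zero]
  have hp := poisson_formula hN hNc hi hb hm hw
  rw [poissonInt_eq _ hy, eq_inv_smul_iff₀ Real.pi_ne_zero] at hp
  have h2 : ∀ t : ℝ, N t / (t - w) - N t / (t - conj w)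
      = 2 * I * ((w.im / ((t - w.re) ^ 2 + w.im ^ 2)) • N t) := by
    intro t
    have n1 := sub_ne_zero_of_im_ne_zero hy.ne' t
    have n2 := sub_ne_zero_of_im_ne_zero (w := conj w) (by simpa using hy.ne') t
    have e1 : (((t - w.re) ^ 2 + w.im ^ 2 : ℝ) : ℂ) = (t - w) * (t - conj w) := by
      have e3 : (t : ℂ) - conj w = conj ((t : ℂ) - w) := by simp
      rw [e3, Complex.mul_conj', ← norm_ofReal_sub_sq]
      push_cast
      rfl
    have e2 : (2 * I * w.im : ℂ) = w - conj w := by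
      rw [Complex.sub_conj]
      push_cast
      ring
    rw [Complex.real_smul, Complex.ofReal_div, e1]
    field_simp
    linear_combination -(N t) * e2
  simp only [h1, h2]
  rw [integral_const_mul, ← hp, Complex.real_smul]
  ring

/-! ### Poisson integrals are of bounded type -/

theorem sq_norm_poissonInt_le {M : ℝ → ℂ} (hM : MemLp M 2) {z : ℂ} (hz : z ∈ upperHalf) :
    ‖poissonInt M z‖ ^ 2 ≤ poissonInt (fun t => ‖M t‖ ^ 2) z := by
  have hi2 : Integrable fun t => ‖M t‖ ^ 2 := (memLp_two_iff_integrable_sq_norm hM.1).mp hM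
  have hy : 0 < z.im := hz
  have i0 := integrable_inv_one_add_sq
  have i2 := integrable_poisson_affine hi2 hz
  have i1 : Integrable fun s : ℝ => (1 + s ^ 2)⁻¹ * ‖M (z.re + z.im * s)‖ := by
    refine (integrable_poisson_affine_of_memLp hM hz).norm.congr (Eventually.of_forall fun s => ?_)
    simp only
    rw [norm_smul, Real.norm_of_nonneg (by positivity)]
  set a : ℝ := π⁻¹ * ∫ s : ℝ, (1 + s ^ 2)⁻¹ * ‖M (z.re + z.im * s)‖ with ha
  have h1 : ‖poissonInt M z‖ ≤ a := by
    rw [poissonInt, norm_smul, Real.norm_of_nonneg (by positivity)]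
    refine mul_le_mul_of_nonneg_left ((norm_integral_le_integral_norm _).trans (le_of_eq ?_))
      (by positivity)
    congr 1
    ext s
    rw [norm_smul, Real.norm_of_nonneg (by positivity)]
  have h2 : 0 ≤ ∫ s : ℝ, ((1 + s ^ 2)⁻¹ • ‖M (z.re + z.im * s)‖ ^ 2
      + ((-2 * a) * ((1 + s ^ 2)⁻¹ * ‖M (z.re + z.im * s)‖) + a ^ 2 * (1 + s ^ 2)⁻¹)) := by
    refine integral_nonneg fun s => ?_
    have : (1 + s ^ 2)⁻¹ • ‖M (z.re + z.im * s)‖ ^ 2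
      + ((-2 * a) * ((1 + s ^ 2)⁻¹ * ‖M (z.re + z.im * s)‖) + a ^ 2 * (1 + s ^ 2)⁻¹)
      = (1 + s ^ 2)⁻¹ * (‖M (z.re + z.im * s)‖ - a) ^ 2 := by
      rw [smul_eq_mul]
      ring
    rw [this]
    positivity
  have i3 : Integrable fun s : ℝ => (-2 * a) * ((1 + s ^ 2)⁻¹ * ‖M (z.re + z.im * s)‖)
      + a ^ 2 * (1 + s ^ 2)⁻¹ := (i1.const_mul _).add (i0.const_mul _)
  rw [integral_add i2 i3,
    integral_add (i1.const_mul _) (i0.const_mul _), integral_const_mul, integral_const_mul,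
    integral_univ_inv_one_add_sq] at h2
  have h3 := mul_le_mul_of_nonneg_left h2 (inv_pos.mpr Real.pi_pos).le
  have e1 : π⁻¹ * ((∫ s : ℝ, (1 + s ^ 2)⁻¹ • ‖M (z.re + z.im * s)‖ ^ 2)
      + (-2 * a * (∫ s : ℝ, (1 + s ^ 2)⁻¹ * ‖M (z.re + z.im * s)‖) + a ^ 2 * π))
      = poissonInt (fun t => ‖M t‖ ^ 2) z - a ^ 2 := by
    have e2 : poissonInt (fun t => ‖M t‖ ^ 2) z
      = π⁻¹ * ∫ s : ℝ, (1 + s ^ 2)⁻¹ • ‖M (z.re + z.im * s)‖ ^ 2 := rfl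
    have e3 : ∫ s : ℝ, (1 + s ^ 2)⁻¹ * ‖M (z.re + z.im * s)‖ = π * a := by
      rw [ha, mul_inv_cancel_left₀ Real.pi_ne_zero]
    rw [e2, e3]
    generalize ∫ s : ℝ, (1 + s ^ 2)⁻¹ • ‖M (z.re + z.im * s)‖ ^ 2 = J
    field_simp
    ring
  rw [e1] at h3
  have h4 : ‖poissonInt M z‖ ^ 2 ≤ a ^ 2 := pow_le_pow_left₀ (norm_nonneg _) h1 2
  linarith

theorem meanType_nonpos_of_bounded {N : ℂ → ℂ} {K : ℝ} (hK : ∀ᶠ y : ℝ in atTop, ‖N (I * y)‖ ≤ K) :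
    meanType N ≤ 0 := by
  rw [meanType_nonpos_iff]
  intro ε hε
  filter_upwards [hK, eventually_ge_atTop (K / ε)] with y hy hy2
  rw [← ofReal_norm]
  refine ENNReal.ofReal_le_ofReal (hy.trans ?_)
  rw [div_le_iff₀ hε] at hy2
  linarith [Real.add_one_le_exp (ε * y)]

/-- Analytic functions that are Poisson integrals of square integrable functions are of bounded type
and of non-positive mean type. -/
theorem isBoundedType_of_eq_poissonInt {N : ℂ → ℂ} (hN : DifferentiableOn ℂ N upperHalf)
    {M : ℝ → ℂ} (hM : MemLp M 2) (hNM : ∀ z ∈ upperHalf, N z = poissonInt M z) :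
    IsBoundedType N ∧ meanType N ≤ 0 := by
  have hi2 : Integrable fun t => ‖M t‖ ^ 2 := (memLp_two_iff_integrable_sq_norm hM.1).mp hM
  have hle : ∀ z ∈ upperHalf, ‖N z‖ ^ 2 ≤ poissonInt (fun t => ‖M t‖ ^ 2) z := fun z hz => by
    rw [hNM z hz]
    exact sq_norm_poissonInt_le hM hz
  constructor
  · obtain ⟨Q, hQ, hQr⟩ := exists_analytic_re_eq_poissonInt (integrable_inv_one_add_sq_smul hi2)
    have hmaps : MapsTo cay upperHalf (ball 0 1) := fun z hz => cay_mem_ball hz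
    have hQd : DifferentiableOn ℂ (fun z => 1 + Q (cay z)) upperHalf := by
      refine (differentiableOn_const 1).add (hQ.comp (fun z hz => ?_) hmaps)
      exact (differentiableAt_cay (le_of_lt hz)).differentiableWithinAt
    have hre : ∀ z ∈ upperHalf, (Q (cay z)).re = poissonInt (fun t => ‖M t‖ ^ 2) z := fun z hz => by
      rw [hQr _ (hmaps hz), icay_cay (le_of_lt hz)]
    have hnn : ∀ z ∈ upperHalf, 0 ≤ (Q (cay z)).re := fun z hz => by
      rw [hre z hz]
      exact poissonInt_nonneg (fun t => by positivity) z
    have hnorm : ∀ z ∈ upperHalf, 1 + (Q (cay z)).re ≤ ‖1 + Q (cay z)‖ := fun z hz => by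
      refine le_trans (le_of_eq ?_) (Complex.re_le_norm _)
      simp
    have hpos : ∀ z ∈ upperHalf, 0 < ‖1 + Q (cay z)‖ := fun z hz =>
      lt_of_lt_of_le (by linarith [hnn z hz]) (hnorm z hz)
    have hne : ∀ z ∈ upperHalf, 1 + Q (cay z) ≠ 0 := fun z hz => norm_pos_iff.mp (hpos z hz)
    refine ⟨fun z => N z / (1 + Q (cay z)), fun z => 1 / (1 + Q (cay z)), hN.div hQd hne,
      (differentiableOn_const 1).div hQd hne, ⟨1, fun z hz => ⟨?_, ?_⟩⟩,
      ⟨I, by simp [upperHalf], one_div_ne_zero (hne I (by simp [upperHalf]))⟩, fun z hz => ?_⟩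
    · rw [norm_div, div_le_one (hpos z hz)]
      refine le_trans ?_ (hnorm z hz)
      have h1 := hle z hz
      rw [← hre z hz] at h1
      nlinarith [norm_nonneg (N z), hnn z hz]
    · rw [norm_div, norm_one, div_le_one (hpos z hz)]
      linarith [hnorm z hz, hnn z hz]
    · rw [mul_one_div]
  · refine meanType_nonpos_of_bounded (K := 1 + ∫ t, ‖M t‖ ^ 2) ?_
    filter_upwards [eventually_ge_atTop 1] with y hy
    have hz : I * y ∈ upperHalf := by
      simp [upperHalf]
      linarith
    have h1 := (hle _ hz).trans (poissonInt_le_integral_div hi2 (fun t => by positivity) hz)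
    have h2 : 0 ≤ ∫ t, ‖M t‖ ^ 2 := integral_nonneg fun t => by positivity
    have h3 : (∫ t, ‖M t‖ ^ 2) / (I * y).im ≤ ∫ t, ‖M t‖ ^ 2 := by
      refine div_le_self h2 ?_
      simpa using hy
    nlinarith [norm_nonneg (N (I * y)), sq_nonneg (‖N (I * y)‖ - 1)]

end LeftDefinite

end

noncomputable section

namespace LeftDefinite

open Metric Complex Real

/-! ### De Branges functions -/

theorem sharp_sharp (F : ℂ → ℂ) : sharp (sharp F) = F := by
  ext z
  simp [sharp]

theorem sharp_ofReal (F : ℂ → ℂ) (x : ℝ) : sharp F x = conj (F x) := by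
  simp [sharp]

theorem sharp_conj (F : ℂ → ℂ) (z : ℂ) : sharp F (conj z) = conj (F z) := by
  simp [sharp]

theorem norm_sharp (F : ℂ → ℂ) (z : ℂ) : ‖sharp F z‖ = ‖F (conj z)‖ := by
  simp [sharp]

theorem differentiable_sharp {F : ℂ → ℂ} (hF : Differentiable ℂ F) :
    Differentiable ℂ (sharp F) := by
  intro z
  have h := (hF (conj z)).conj_conj
  rw [Complex.conj_conj] at h
  exact h

section

variable {E : ℂ → ℂ}

theorem IsDeBrangesFunction.ne_zero_of_im_pos (hE : IsDeBrangesFunction E) {z : ℂ} (hz : 0 < z.im) :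
    E z ≠ 0 := by
  intro h
  have := hE.2 z hz
  rw [h, norm_zero] at this
  exact absurd this (not_lt.mpr (norm_nonneg _))

theorem IsDeBrangesFunction.ne_zero (hE : IsDeBrangesFunction E)
    (hE0 : ∀ x : ℝ, E x ≠ 0) {z : ℂ} (hz : z ∈ closedUpperHalf) : E z ≠ 0 := by
  rcases (show 0 ≤ z.im from hz).lt_or_eq with h | h
  · exact hE.ne_zero_of_im_pos h
  · have : z = (z.re : ℂ) := Complex.ext rfl (by simp [← h])
    rw [this]
    exact hE0 _

theorem differentiableOn_div (hE : IsDeBrangesFunction E)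
    (hE0 : ∀ x : ℝ, E x ≠ 0) {F : ℂ → ℂ} (hF : Differentiable ℂ F) :
    DifferentiableOn ℂ (F / E) upperHalf :=
  hF.differentiableOn.div hE.1.differentiableOn fun _ hz =>
    hE.ne_zero hE0 (upperHalf_subset_closedUpperHalf hz)

theorem continuousOn_div (hE : IsDeBrangesFunction E)
    (hE0 : ∀ x : ℝ, E x ≠ 0) {F : ℂ → ℂ} (hF : Differentiable ℂ F) :
    ContinuousOn (F / E) closedUpperHalf :=
  hF.continuous.continuousOn.div hE.1.continuous.continuousOn fun _ hz => hE.ne_zero hE0 hz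

theorem continuous_div_ofReal (hE : IsDeBrangesFunction E)
    (hE0 : ∀ x : ℝ, E x ≠ 0) {F : ℂ → ℂ} (hF : Differentiable ℂ F) :
    Continuous fun x : ℝ => F x / E x :=
  continuous_comp_ofReal (continuousOn_div hE hE0 hF)

/-- An entire function `k` is a reproducing kernel at `w` if
`2i(w* - z) k(z) = E(z) E(w)* - E^#(z) E^#(w)*`. -/
def IsKernel (E : ℂ → ℂ) (w : ℂ) (k : ℂ → ℂ) : Prop :=
  Differentiable ℂ k ∧ ∀ z, 2 * I * (conj w - z) * k z
    = E z * conj (E w) - sharp E z * conj (sharp E w)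

theorem exists_isKernel (hE : IsDeBrangesFunction E) (w : ℂ) : ∃ k, IsKernel E w k := by
  set num : ℂ → ℂ := fun z => E z * conj (E w) - sharp E z * conj (sharp E w) with hnum
  have hd : Differentiable ℂ num :=
    (hE.1.mul_const _).sub ((differentiable_sharp hE.1).mul_const _)
  have h0 : num (conj w) = 0 := by
    simp [hnum, sharp]
    ring
  refine ⟨fun z => I / 2 * dslope num (conj w) z, ?_, fun z => ?_⟩
  · have : DifferentiableOn ℂ (dslope num (conj w)) univ :=
      (Complex.differentiableOn_dslope univ_mem).mpr hd.differentiableOn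
    exact (differentiableOn_univ.mp this).const_mul _
  · have h1 : (z - conj w) * dslope num (conj w) z = num z := by
      have := sub_smul_dslope num (conj w) z
      rwa [h0, sub_zero, smul_eq_mul] at this
    change _ = num z
    rw [← h1]
    linear_combination (-(z - conj w) * dslope num (conj w) z) * I_sq

theorem IsKernel.sharp_kernel {w : ℂ} {k : ℂ → ℂ} (hk : IsKernel E w k) :
    IsKernel E (conj w) (sharp k) := by
  refine ⟨differentiable_sharp hk.1, fun z => ?_⟩
  have h := congrArg conj (hk.2 (conj z))
  simp only [map_mul, map_sub, Complex.conj_conj, conj_I, map_ofNat] at h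
  simp only [sharp, Complex.conj_conj] at h ⊢
  linear_combination -h

theorem kernel_apply_self {w k : ℂ} (h : 2 * I * (conj w - w) * k
    = E w * conj (E w) - sharp E w * conj (sharp E w)) :
    ((4 * w.im : ℝ) : ℂ) * k = ((‖E w‖ ^ 2 - ‖E (conj w)‖ ^ 2 : ℝ) : ℂ) := by
  rw [Complex.mul_conj', Complex.mul_conj', norm_sharp] at h
  push_cast
  rw [← h]
  have : conj w - w = -2 * I * w.im := by
    apply Complex.ext <;> simp
    ring
  rw [this]
  linear_combination (4 * w.im * k) * I_sq

theorem IsKernel.norm_div_mul_le {w : ℂ} {k : ℂ → ℂ} (hk : IsKernel E w k)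
    (hE : IsDeBrangesFunction E) (hE0 : ∀ x : ℝ, E x ≠ 0) {z : ℂ}
    (hz : z ∈ closedUpperHalf) : ‖k z / E z‖ * ‖z - conj w‖ ≤ ‖E w‖ + ‖sharp E w‖ := by
  have hne := hE.ne_zero hE0 hz
  have hle : ‖sharp E z‖ ≤ ‖E z‖ := by
    rcases (show 0 ≤ z.im from hz).lt_or_eq with h | h
    · rw [norm_sharp]
      exact (hE.2 z h).le
    · have : conj z = z := Complex.ext rfl (by simp [← h])
      rw [norm_sharp, this]
  have h := congrArg norm (hk.2 z)
  simp only [norm_mul, norm_I, RCLike.norm_ofNat] at h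
  have h2 : ‖E z * conj (E w) - sharp E z * conj (sharp E w)‖ ≤ ‖E z‖ * (‖E w‖ + ‖sharp E w‖) := by
    refine (norm_sub_le _ _).trans ?_
    rw [norm_mul, norm_mul, RCLike.norm_conj, RCLike.norm_conj, mul_add]
    gcongr
  rw [← h, norm_sub_rev] at h2
  rw [norm_div, div_mul_eq_mul_div, div_le_iff₀ (norm_pos_iff.mpr hne)]
  nlinarith [norm_nonneg (k z), norm_nonneg (z - conj w),
    mul_nonneg (norm_nonneg (z - conj w)) (norm_nonneg (k z))]

theorem IsKernel.memLp {w : ℂ} {k : ℂ → ℂ} (hk : IsKernel E w k)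
    (hE : IsDeBrangesFunction E) (hE0 : ∀ x : ℝ, E x ≠ 0) (hw : w.im ≠ 0) :
    MemLp (fun x : ℝ => k x / E x) 2 := by
  have hw' : (conj w).im ≠ 0 := by simpa using hw
  refine MemLp.of_le_mul (memLp_inv_sub hw')
    (continuous_div_ofReal hE hE0 hk.1).aestronglyMeasurable (c := ‖E w‖ + ‖sharp E w‖)
    (Eventually.of_forall fun x => ?_)
  rw [norm_inv, ← div_eq_mul_inv,
    le_div_iff₀ (norm_pos_iff.mpr (sub_ne_zero_of_im_ne_zero hw' x))]
  exact hk.norm_div_mul_le hE hE0 (ofReal_mem_closedUpperHalf x)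

theorem IsKernel.isBoundedType {w : ℂ} {k : ℂ → ℂ} (hk : IsKernel E w k)
    (hE : IsDeBrangesFunction E) (hE0 : ∀ x : ℝ, E x ≠ 0) :
    IsBoundedType (k / E) ∧ meanType (k / E) ≤ 0 := by
  have hden : ∀ z ∈ upperHalf, 1 ≤ ‖z + I‖ := by
    intro z hz
    have h1 := abs_im_le_norm (z + I)
    have hz' : 0 < z.im := hz
    simp only [add_im, I_im] at h1
    exact le_trans (by rw [abs_of_pos (by linarith)]; linarith) h1
  have hne : ∀ z ∈ upperHalf, z + I ≠ 0 := fun z hz =>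
    norm_pos_iff.mp (zero_lt_one.trans_le (hden z hz))
  constructor
  · have dh : DifferentiableOn ℂ (fun z => (z - conj w) / (z + I)) upperHalf :=
      DifferentiableOn.div (by fun_prop) (by fun_prop) hne
    refine ⟨fun z => (k / E) z * ((z - conj w) / (z + I)), fun z => (z - conj w) / (z + I),
      (differentiableOn_div hE hE0 hk.1).mul dh, dh,
      ⟨max (‖E w‖ + ‖sharp E w‖) (1 + ‖conj w + I‖), fun z hz => ⟨?_, ?_⟩⟩, ?_, fun z _ => rfl⟩
    · refine le_max_of_le_left ?_
      rw [norm_mul, norm_div, ← mul_div_assoc,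
        div_le_iff₀ (zero_lt_one.trans_le (hden z hz))]
      refine (hk.norm_div_mul_le hE hE0 (upperHalf_subset_closedUpperHalf hz)).trans ?_
      exact le_mul_of_one_le_right (by positivity) (hden z hz)
    · refine le_max_of_le_right ?_
      rw [norm_div, div_le_iff₀ (zero_lt_one.trans_le (hden z hz))]
      have : z - conj w = (z + I) - (conj w + I) := by ring
      rw [this]
      refine (norm_sub_le _ _).trans ?_
      nlinarith [hden z hz, norm_nonneg (conj w + I)]
    · refine ⟨((|w.im| + 1 : ℝ) : ℂ) * I, ?_, div_ne_zero ?_ (hne _ ?_)⟩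
      · simp [upperHalf]
        positivity
      · intro h
        have := congrArg Complex.im h
        simp at this
        linarith [neg_abs_le w.im]
      · simp [upperHalf]
        positivity
  · refine meanType_nonpos_of_bounded (K := ‖E w‖ + ‖sharp E w‖) ?_
    filter_upwards [eventually_ge_atTop (|w.im| + 1)] with y hy
    have hy0 : 0 < y := by linarith [abs_nonneg w.im]
    have hz : I * (y : ℂ) ∈ closedUpperHalf := by
      simp [closedUpperHalf, hy0.le]
    refine le_trans ?_ (hk.norm_div_mul_le hE hE0 hz)
    refine le_mul_of_one_le_right (norm_nonneg _) ?_
    have h1 := abs_im_le_norm (I * y - conj w)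
    simp only [sub_im, mul_im, I_im, I_re, ofReal_im, ofReal_re, conj_im] at h1
    have h2 := le_abs_self (0 * (0 : ℝ) + 1 * y - -w.im)
    linarith [neg_abs_le w.im]

theorem IsKernel.mem {w : ℂ} {k : ℂ → ℂ} (hk : IsKernel E w k)
    (hE : IsDeBrangesFunction E) (hE0 : ∀ x : ℝ, E x ≠ 0) (hw : w.im ≠ 0) :
    k ∈ deBrangesSubmodule E hE := by
  refine ⟨hk.1, ?_, hk.isBoundedType hE hE0, hk.sharp_kernel.isBoundedType hE hE0⟩
  have h := hk.memLp hE hE0 hw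
  refine ((memLp_two_iff_integrable_sq_norm h.1).mp h).congr (Eventually.of_forall fun x => ?_)
  simp [div_pow]

end

end LeftDefinite

end

noncomputable section

namespace LeftDefinite

open Metric Complex Real

theorem sq_norm_toLp {α : Type*} [MeasurableSpace α] {μ : Measure α} {f : α → ℂ}
    (hf : MemLp f 2 μ) : ‖hf.toLp f‖ ^ 2 = ∫ x, ‖f x‖ ^ 2 ∂μ := by
  rw [← inner_self_eq_norm_sq (𝕜 := ℂ), L2.inner_def]
  have : ∫ x, inner ℂ (hf.toLp f x) (hf.toLp f x) ∂μ = ∫ x, ((‖f x‖ ^ 2 : ℝ) : ℂ) ∂μ := by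
    refine integral_congr_ae ?_
    filter_upwards [hf.coeFn_toLp] with x hx
    rw [hx, inner_self_eq_norm_sq_to_K]
    push_cast
    rfl
  rw [this, integral_complex_ofReal]
  simp

namespace DeBrangesSpace

variable {E : ℂ → ℂ} {hE : IsDeBrangesFunction E}

theorem inner_def (F G : DeBrangesSpace E hE) :
    inner ℂ F G = (1 / Real.pi : ℂ) * ∫ x : ℝ, conj (F x) * G x / (‖E x‖ : ℂ) ^ 2 := rfl

theorem integrable_sq (F : DeBrangesSpace E hE) : Integrable fun x : ℝ => ‖(F / E : ℂ → ℂ) x‖ ^ 2 :=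
  (memLp_two_iff_integrable_sq_norm F.memLp.1).mp F.memLp

/-- An element of a de Branges space from its defining properties. -/
def ofMem {F : ℂ → ℂ} (h : F ∈ deBrangesSubmodule E hE) : DeBrangesSpace E hE := ⟨F, h⟩

/-- The involution `F ↦ F^#` of a de Branges space. -/
def sharp (F : DeBrangesSpace E hE) : DeBrangesSpace E hE :=
  ⟨LeftDefinite.sharp F, differentiable_sharp F.2.1, by
    simpa [norm_sharp] using F.2.2.1, F.2.2.2.2, by
    rw [sharp_sharp]
    exact F.2.2.2.1⟩

theorem sharp_apply (F : DeBrangesSpace E hE) (z : ℂ) : F.sharp z = conj (F (conj z)) := rfl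

theorem norm_sq_eq (F : DeBrangesSpace E hE) :
    ‖F‖ ^ 2 = (1 / π) * ∫ x : ℝ, ‖F x / E x‖ ^ 2 := by
  rw [← inner_self_eq_norm_sq (𝕜 := ℂ) F, inner_def]
  simp only [integrand_eq]
  rw [Coeff.integral_conj_mul_self_re (fun x : ℝ => F x / E x), ← Complex.ofReal_one,
      ← Complex.ofReal_div, ← Complex.ofReal_mul]
  simp

theorem sub_apply (F G : DeBrangesSpace E hE) (z : ℂ) : (F - G) z = F z - G z := rfl

/-- The kernel reproduces the values of the functions in a de Branges space. -/
theorem inner_kernel (hE0 : ∀ x : ℝ, E x ≠ 0) {w : ℂ} (hw : w.im ≠ 0) {k : DeBrangesSpace E hE}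
    (hk : IsKernel E w k) (F : DeBrangesSpace E hE) : inner ℂ k F = F w := by
  have hd := differentiableOn_div hE hE0 F.2.1
  have hc := continuousOn_div hE hE0 F.2.1
  have hds := differentiableOn_div hE hE0 F.sharp.2.1
  have hcs := continuousOn_div hE hE0 F.sharp.2.1
  have i1 := integrable_div_sub F.memLp hw
  have hw' : (conj w).im ≠ 0 := by simpa using hw
  have i2 := integrable_div_sub F.sharp.memLp hw'
  have hpt : ∀ t : ℝ, conj (k t) * F t / (‖E t‖ : ℂ) ^ 2
      = E w / (2 * I) * (F t / E t / (t - w))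
        - LeftDefinite.sharp E w / (2 * I) * conj (F.sharp t / E t / (t - conj w)) := by
    intro t
    have h := congrArg conj (hk.2 t)
    simp only [map_mul, map_sub, Complex.conj_conj, conj_I, map_ofNat, sharp_ofReal,
      conj_ofReal] at h
    rw [sharp_apply, conj_ofReal, map_div₀, map_div₀, map_sub, Complex.conj_conj, Complex.conj_conj,
      conj_ofReal, ← Complex.mul_conj']
    have n1 := hE0 t
    have n2 : conj (E t) ≠ 0 := by simpa using n1
    have n3 := sub_ne_zero_of_im_ne_zero hw t
    have n4 := I_ne_zero
    have hk' : conj (k t) = (conj (E t) * E w - E t * LeftDefinite.sharp E w) / (2 * I * (t - w)) := by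
      rw [eq_div_iff (by simp [n3, n4])]
      linear_combination h
    rw [hk']
    field_simp
  have hsplit : ∫ t : ℝ, conj (k t) * F t / (‖E t‖ : ℂ) ^ 2
      = E w / (2 * I) * (∫ t : ℝ, F t / E t / (t - w))
        - LeftDefinite.sharp E w / (2 * I) * conj (∫ t : ℝ, F.sharp t / E t / (t - conj w)) := by
    have i2' : Integrable fun t : ℝ => conj (F.sharp t / E t / (t - conj w)) :=
      Complex.conjCLE.toContinuousLinearMap.integrable_comp i2
    simp only [hpt]
    rw [integral_sub (i1.const_mul _) (i2'.const_mul _), integral_const_mul, integral_const_mul,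
      integral_conj]
  rw [inner_def, hsplit]
  have hpi : (π : ℂ) ≠ 0 := by exact_mod_cast Real.pi_ne_zero
  rcases lt_or_gt_of_ne hw with h | h
  · have hu : conj w ∈ upperHalf := by simpa [upperHalf] using h
    have e1 := integral_div_sub_conj_eq_zero hd hc F.integrable_sq F.2.2.2.1.1 F.2.2.2.1.2 hu
    have e2 := integral_div_sub_eq hds hcs F.sharp.integrable_sq F.2.2.2.2.1 F.2.2.2.2.2 hu
    simp only [Pi.div_apply, Complex.conj_conj] at e1 e2
    rw [e1, e2, sharp_apply]
    have hne := hE.ne_zero_of_im_pos hu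
    have hne' : conj (E (conj w)) ≠ 0 := by simpa using hne
    simp only [map_mul, map_div₀, Complex.conj_conj, conj_I, map_ofNat, conj_ofReal,
      LeftDefinite.sharp]
    field_simp [I_ne_zero]
    ring
  · have hu : w ∈ upperHalf := h
    have e1 := integral_div_sub_eq hd hc F.integrable_sq F.2.2.2.1.1 F.2.2.2.1.2 hu
    have e2 := integral_div_sub_conj_eq_zero hds hcs F.sharp.integrable_sq F.2.2.2.2.1 F.2.2.2.2.2
      hu
    simp only [Pi.div_apply] at e1 e2
    rw [e1, e2]
    have hne := hE.ne_zero_of_im_pos hu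
    simp only [map_zero, mul_zero, sub_zero]
    field_simp [I_ne_zero]

theorem exists_abs_sq_norm_sub_le (hE : Differentiable ℂ E) (R : ℝ) :
    ∃ K, ∀ w : ℂ, ‖w‖ ≤ R → |‖E w‖ ^ 2 - ‖E (conj w)‖ ^ 2| ≤ K * |w.im| := by
  obtain ⟨M, hM⟩ := (isCompact_closedBall (0 : ℂ) R).exists_bound_of_continuousOn
    hE.continuous.continuousOn
  obtain ⟨M', hM'⟩ := (isCompact_closedBall (0 : ℂ) R).exists_bound_of_continuousOn
    (hE.contDiff (n := 1)).continuous_deriv_one.continuousOn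
  refine ⟨M' * 2 * (2 * M), fun w hw => ?_⟩
  have hw1 : w ∈ closedBall (0 : ℂ) R := by simpa using hw
  have hw2 : conj w ∈ closedBall (0 : ℂ) R := by simpa using hw
  have h1 := (convex_closedBall (0 : ℂ) R).norm_image_sub_le_of_norm_deriv_le
    (fun x _ => hE x) hM' hw2 hw1
  have h2 : ‖w - conj w‖ = 2 * |w.im| := by
    have : w - conj w = ((2 * w.im : ℝ) : ℂ) * I := by
      apply Complex.ext <;> simp
      ring
    rw [this, norm_mul, norm_I, mul_one, norm_real, Real.norm_eq_abs, abs_mul, abs_two]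
  rw [h2] at h1
  have h3 : |‖E w‖ - ‖E (conj w)‖| ≤ M' * (2 * |w.im|) := (abs_norm_sub_norm_le _ _).trans h1
  have h4 : ‖E w‖ + ‖E (conj w)‖ ≤ 2 * M := by linarith [hM _ hw1, hM _ hw2]
  have : ‖E w‖ ^ 2 - ‖E (conj w)‖ ^ 2 = (‖E w‖ - ‖E (conj w)‖) * (‖E w‖ + ‖E (conj w)‖) := by ring
  rw [this, abs_mul, abs_of_nonneg (by positivity : 0 ≤ ‖E w‖ + ‖E (conj w)‖)]
  calc _ ≤ M' * (2 * |w.im|) * (2 * M) := by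
        exact mul_le_mul h3 h4 (by positivity) ((abs_nonneg _).trans h3)
    _ = _ := by ring

/-- Point evaluations are locally uniformly bounded. -/
theorem exists_norm_apply_le (hE0 : ∀ x : ℝ, E x ≠ 0) (R : ℝ) :
    ∃ K, 0 ≤ K ∧ ∀ (F : DeBrangesSpace E hE) (w : ℂ), ‖w‖ ≤ R → ‖F w‖ ≤ K * ‖F‖ := by
  obtain ⟨K, hK⟩ := exists_abs_sq_norm_sub_le hE.1 (R + 1)
  have key : ∀ (F : DeBrangesSpace E hE) (w : ℂ), ‖w‖ ≤ R + 1 → w.im ≠ 0 →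
      ‖F w‖ ≤ √(K / 4) * ‖F‖ := by
    intro F w hwR hw
    obtain ⟨k, hk⟩ := exists_isKernel hE w
    set k' : DeBrangesSpace E hE := ofMem (hk.mem hE hE0 hw) with hk'
    have hkk : IsKernel E w k' := hk
    rw [← inner_kernel hE0 hw hkk F]
    refine (norm_inner_le_norm _ _).trans (mul_le_mul_of_nonneg_right ?_ (norm_nonneg _))
    have h1 : ‖k'‖ ^ 2 = (k' w).re := by
      rw [← inner_kernel hE0 hw hkk k', ← inner_self_eq_norm_sq (𝕜 := ℂ)]
      rfl
    have h2 := congrArg Complex.re (kernel_apply_self (hkk.2 w))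
    rw [Complex.re_ofReal_mul, Complex.ofReal_re, ← h1] at h2
    have h3 := hK w hwR
    rw [← h2, abs_mul, abs_mul, abs_of_nonneg (sq_nonneg ‖k'‖)] at h3
    refine Real.le_sqrt_of_sq_le ?_
    have h4 : 0 < |w.im| := abs_pos.mpr hw
    rw [abs_of_pos (by norm_num : (0 : ℝ) < 4)] at h3
    nlinarith
  refine ⟨√(K / 4), Real.sqrt_nonneg _, fun F w hw => ?_⟩
  by_cases him : w.im = 0
  · have ht : Tendsto (fun ε : ℝ => F (w + ε * I)) (𝓝[>] 0) (𝓝 (F w)) := by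
      have : Continuous fun ε : ℝ => F (w + ε * I) := F.2.1.continuous.comp (by fun_prop)
      have h := (this.tendsto 0).mono_left (nhdsWithin_le_nhds (s := Ioi 0))
      simpa using h
    refine le_of_tendsto ht.norm ?_
    filter_upwards [Ioo_mem_nhdsGT (zero_lt_one' ℝ)] with ε hε
    refine key F _ ((norm_add_le _ _).trans ?_) ?_
    · rw [norm_mul, norm_I, mul_one, norm_real, Real.norm_of_nonneg hε.1.le]
      linarith [hε.2]
    · simp [him, hε.1.ne']
  · exact key F w (by linarith) him

/-- If functions in a de Branges space converge pointwise to an entire function and their boundary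
values converge in `L²`, then the quotient of the limit by `E` is of bounded type and of
non-positive mean type. -/
theorem isBoundedType_of_tendsto (hE0 : ∀ x : ℝ, E x ≠ 0) {u : ℕ → DeBrangesSpace E hE} {F : ℂ → ℂ}
    (hF : Differentiable ℂ F) (hL : MemLp (fun x : ℝ => F x / E x) 2)
    (hu : ∀ z, Tendsto (fun n => u n z) atTop (𝓝 (F z)))
    (hi : Tendsto (fun n => ∫ x : ℝ, ‖u n x / E x - F x / E x‖ ^ 2) atTop (𝓝 0)) :
    IsBoundedType (F / E) ∧ meanType (F / E) ≤ 0 := by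
  refine isBoundedType_of_eq_poissonInt (differentiableOn_div hE hE0 hF) hL fun z hz => ?_
  have hy : 0 < z.im := hz
  have h1 : Tendsto (fun n => u n z / E z) atTop (𝓝 (F z / E z)) := (hu z).div_const _
  refine tendsto_nhds_unique h1 ?_
  have h2 : ∀ n, u n z / E z = poissonInt (fun t : ℝ => u n t / E t) z := fun n =>
    poisson_formula (differentiableOn_div hE hE0 (u n).2.1) (continuousOn_div hE hE0 (u n).2.1)
      (u n).integrable_sq (u n).2.2.2.1.1 (u n).2.2.2.1.2 hz
  rw [tendsto_iff_norm_sub_tendsto_zero]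
  have h3 : ∀ n, ‖u n z / E z - poissonInt (fun t : ℝ => F t / E t) z‖ ^ 2
      ≤ (∫ x : ℝ, ‖u n x / E x - F x / E x‖ ^ 2) / z.im := by
    intro n
    have hm : MemLp (fun t : ℝ => u n t / E t - F t / E t) 2 := (u n).memLp.sub hL
    have e : u n z / E z - poissonInt (fun t : ℝ => F t / E t) z
        = poissonInt (fun t : ℝ => u n t / E t - F t / E t) z := by
      rw [h2 n]
      unfold poissonInt
      rw [← smul_sub, ← integral_sub (integrable_poisson_affine_of_memLp (u n).memLp hz)
        (integrable_poisson_affine_of_memLp hL hz)]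
      simp only [smul_sub]
    rw [e]
    exact (sq_norm_poissonInt_le hm hz).trans (poissonInt_le_integral_div
      ((memLp_two_iff_integrable_sq_norm hm.1).mp hm) (fun t => sq_nonneg _) hz)
  have h4 := squeeze_zero (fun n => sq_nonneg _) h3 (by simpa using hi.div_const z.im)
  have h5 := h4.sqrt
  simpa [Real.sqrt_sq (norm_nonneg _)] using h5

/-- The embedding `F ↦ F/E` of a de Branges space into `L²(ℝ)`. -/
def toLp (F : DeBrangesSpace E hE) : Lp ℂ 2 (volume : Measure ℝ) := F.memLp.toLp _

theorem toLp_sub (F G : DeBrangesSpace E hE) : toLp (F - G) = toLp F - toLp G := by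
  unfold toLp
  rw [← MemLp.toLp_sub]
  congr 1
  ext x
  simp [sub_apply, sub_div]

theorem norm_toLp (F : DeBrangesSpace E hE) : ‖toLp F‖ = √π * ‖F‖ := by
  rw [← sq_eq_sq₀ (norm_nonneg _) (by positivity), mul_pow, Real.sq_sqrt Real.pi_pos.le,
    norm_sq_eq, toLp, sq_norm_toLp]
  field_simp

/-- A de Branges space is complete. -/
theorem completeSpace (hE0 : ∀ x : ℝ, E x ≠ 0) : CompleteSpace (DeBrangesSpace E hE) := by
  refine Metric.complete_of_cauchySeq_tendsto fun u hu => ?_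
  have hcz : ∀ z, CauchySeq fun n => u n z := by
    intro z
    obtain ⟨K, hK0, hK⟩ := exists_norm_apply_le (hE := hE) hE0 ‖z‖
    rw [Metric.cauchySeq_iff] at hu ⊢
    intro ε hε
    obtain ⟨n, hn⟩ := hu (ε / (K + 1)) (by positivity)
    refine ⟨n, fun p hp q hq => ?_⟩
    have h1 := hn p hp q hq
    rw [dist_eq_norm] at h1 ⊢
    rw [lt_div_iff₀ (by positivity)] at h1
    have h2 := hK (u p - u q) z le_rfl
    rw [sub_apply] at h2
    nlinarith [norm_nonneg (u p - u q)]
  choose F hF using fun z => cauchySeq_tendsto_of_complete (hcz z)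
  have hloc : TendstoLocallyUniformlyOn (fun n z => u n z) F atTop univ := by
    rw [tendstoLocallyUniformlyOn_iff_forall_isCompact isOpen_univ]
    intro S _ hS
    obtain ⟨R, hR⟩ := hS.isBounded.exists_norm_le
    obtain ⟨K, hK0, hK⟩ := exists_norm_apply_le (hE := hE) hE0 R
    refine UniformCauchySeqOn.tendstoUniformlyOn_of_tendsto ?_ fun z _ => hF z
    rw [Metric.uniformCauchySeqOn_iff]
    rw [Metric.cauchySeq_iff] at hu
    intro ε hε
    obtain ⟨n, hn⟩ := hu (ε / (K + 1)) (by positivity)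
    refine ⟨n, fun p hp q hq z hz => ?_⟩
    have h1 := hn p hp q hq
    rw [dist_eq_norm] at h1 ⊢
    rw [lt_div_iff₀ (by positivity)] at h1
    have h2 := hK (u p - u q) z (hR z hz)
    rw [sub_apply] at h2
    nlinarith [norm_nonneg (u p - u q)]
  have hFd : Differentiable ℂ F := by
    rw [← differentiableOn_univ]
    exact hloc.differentiableOn (Eventually.of_forall fun n => (u n).2.1.differentiableOn)
      isOpen_univ
  have hcL : CauchySeq fun n => toLp (u n) := by
    rw [Metric.cauchySeq_iff] at hu ⊢
    intro ε hε
    obtain ⟨n, hn⟩ := hu (ε / √π) (by positivity)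
    refine ⟨n, fun p hp q hq => ?_⟩
    have h1 := hn p hp q hq
    rw [dist_eq_norm] at h1 ⊢
    rw [← toLp_sub, norm_toLp]
    rw [lt_div_iff₀ (by positivity)] at h1
    linarith
  obtain ⟨M, hM⟩ := cauchySeq_tendsto_of_complete hcL
  have hFM : (fun x : ℝ => F x / E x) =ᵐ[volume] M := by
    obtain ⟨ns, hns, hae⟩ := (tendstoInMeasure_of_tendsto_Lp hM).exists_seq_tendsto_ae
    have hall : ∀ᵐ x : ℝ, ∀ n, toLp (u n) x = u n x / E x :=
      ae_all_iff.mpr fun n => (u n).memLp.coeFn_toLp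
    filter_upwards [hae, hall] with x hx hx2
    simp only [hx2] at hx
    exact tendsto_nhds_unique (((hF x).comp hns.tendsto_atTop).div_const _) hx
  have hL : MemLp (fun x : ℝ => F x / E x) 2 := (memLp_congr_ae hFM).mpr (Lp.memLp M)
  have hML : M = hL.toLp _ := by
    rw [← Lp.toLp_coeFn M (Lp.memLp M)]
    exact MemLp.toLp_congr _ _ hFM.symm
  have hi : Tendsto (fun n => ∫ x : ℝ, ‖u n x / E x - F x / E x‖ ^ 2) atTop (𝓝 0) := by
    have h1 := (tendsto_iff_norm_sub_tendsto_zero.mp hM).pow 2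
    rw [zero_pow two_ne_zero] at h1
    refine h1.congr fun n => ?_
    rw [hML, toLp, ← MemLp.toLp_sub, sq_norm_toLp]
    rfl
  have hFB : F ∈ deBrangesSubmodule E hE := by
    refine ⟨hFd, ?_, isBoundedType_of_tendsto hE0 hFd hL hF hi,
      isBoundedType_of_tendsto hE0 (u := fun n => (u n).sharp) (differentiable_sharp hFd) ?_ ?_ ?_⟩
    · refine ((memLp_two_iff_integrable_sq_norm hL.1).mp hL).congr
        (Eventually.of_forall fun x => ?_)
      simp [div_pow]
    · refine hL.of_le (continuous_div_ofReal hE hE0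
        (differentiable_sharp hFd)).aestronglyMeasurable (Eventually.of_forall fun x => ?_)
      simp [norm_sharp]
    · intro z
      exact (Complex.continuous_conj.tendsto _).comp (hF (conj z))
    · refine hi.congr fun n => ?_
      congr 1
      ext x
      rw [sharp_apply, sharp_ofReal, conj_ofReal, ← sub_div, ← sub_div, ← map_sub, norm_div,
        norm_div, RCLike.norm_conj]
  refine ⟨ofMem hFB, ?_⟩
  rw [tendsto_iff_norm_sub_tendsto_zero]
  have h1 := (tendsto_iff_norm_sub_tendsto_zero.mp hM).div_const √π
  rw [zero_div] at h1
  refine h1.congr fun n => ?_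
  have : M = toLp (ofMem hFB) := hML
  rw [this, ← toLp_sub, norm_toLp]
  field_simp

end DeBrangesSpace

end LeftDefinite

end

noncomputable section

namespace LeftDefinite

/-! ### Preliminaries on square integrable functions -/

theorem sq_norm_integral_le {α : Type*} [MeasurableSpace α] {μ : Measure α} [IsFiniteMeasure μ]
    {h : α → ℂ} (hh : MemLp h 2 μ) : ‖∫ x, h x ∂μ‖ ^ 2 ≤ μ.real univ * ∫ x, ‖h x‖ ^ 2 ∂μ := by
  have i1 : Integrable (fun x => ‖h x‖) μ := (hh.integrable (by norm_num)).norm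
  have i2 : Integrable (fun x => ‖h x‖ ^ 2) μ := (memLp_two_iff_integrable_sq_norm hh.1).mp hh
  set A := ∫ x, ‖h x‖ ∂μ with hA
  set m := μ.real univ with hm
  have hA0 : 0 ≤ A := integral_nonneg fun _ => norm_nonneg _
  have hm0 : 0 ≤ m := measureReal_nonneg
  have h1 : ‖∫ x, h x ∂μ‖ ^ 2 ≤ A ^ 2 :=
    pow_le_pow_left₀ (norm_nonneg _) (norm_integral_le_integral_norm _) 2
  refine h1.trans ?_
  have h2 : 0 ≤ ∫ x, (m ^ 2 * ‖h x‖ ^ 2 + ((-2 * m * A) * ‖h x‖ + A ^ 2)) ∂μ := by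
    refine integral_nonneg fun x => ?_
    have : m ^ 2 * ‖h x‖ ^ 2 + ((-2 * m * A) * ‖h x‖ + A ^ 2) = (m * ‖h x‖ - A) ^ 2 := by ring
    simp only [Pi.zero_apply, this]
    positivity
  have i3 : Integrable (fun x => (-2 * m * A) * ‖h x‖ + A ^ 2) μ :=
    (i1.const_mul _).add (integrable_const _)
  rw [integral_add (i2.const_mul _) i3, integral_add (i1.const_mul _) (integrable_const _),
    integral_const_mul, integral_const_mul, integral_const, smul_eq_mul, ← hA, ← hm] at h2
  rcases hm0.lt_or_eq with hpos | h0
  · by_contra hcon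
    nlinarith [mul_pos hpos (sub_pos.mpr (not_le.mp hcon))]
  · have : μ = 0 := by
      have h0' : μ.real univ = 0 := by rw [← hm, ← h0]
      rwa [measureReal_def, ENNReal.toReal_eq_zero_iff, or_iff_left (measure_ne_top _ _),
        Measure.measure_univ_eq_zero] at h0'
    rw [← h0]
    simp [hA, this]

theorem measurableSet_oi (a b : EReal) : MeasurableSet (oi a b) := (isOpen_oi a b).measurableSet

theorem Icc_subset_oi {a b : EReal} {α β : ℝ} (hα : α ∈ oi a b) (hβ : β ∈ oi a b) :
    Icc α β ⊆ oi a b := (oi_ordConnected a b).out hα hβ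

theorem Ico_subset_oi {a b : EReal} {α β : ℝ} (hα : α ∈ oi a b) (hβ : β ∈ oi a b) :
    Ico α β ⊆ oi a b := Ico_subset_Icc_self.trans (Icc_subset_oi hα hβ)

/-- A set of positive measure in `(a, b)` meets some compact subinterval in positive measure. -/
theorem exists_measure_Icc_ne_zero {a b : EReal} {μ : Measure ℝ} (hμ : μ (oi a b) ≠ 0) :
    ∃ α ∈ oi a b, ∃ β ∈ oi a b, μ (Icc α β) ≠ 0 := by
  by_contra! hcon
  apply hμ
  let J : Set (ℚ × ℚ) := {p | (p.1 : ℝ) ∈ oi a b ∧ (p.2 : ℝ) ∈ oi a b}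
  have hcov : oi a b ⊆ ⋃ p ∈ J, Icc (p.1 : ℝ) (p.2 : ℝ) := by
    intro x hx
    obtain ⟨ε, hε, hball⟩ := Metric.isOpen_iff.mp (isOpen_oi a b) x hx
    obtain ⟨p, hp1, hp2⟩ := exists_rat_btwn (show x - ε < x by linarith)
    obtain ⟨q, hq1, hq2⟩ := exists_rat_btwn (show x < x + ε by linarith)
    refine mem_iUnion₂.mpr ⟨(p, q), ⟨hball ?_, hball ?_⟩, hp2.le, hq1.le⟩
    · rw [Real.ball_eq_Ioo]
      exact ⟨hp1, by simp only; linarith⟩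
    · rw [Real.ball_eq_Ioo]
      exact ⟨by simp only; linarith, hq2⟩
  refine measure_mono_null hcov ?_
  rw [measure_biUnion_null_iff (Set.to_countable J)]
  exact fun p hp => hcon _ hp.1 _ hp.2

theorem orientedIntegral_of_le {μ : Measure ℝ} {h : ℝ → ℂ} {c x : ℝ} (hcx : c ≤ x) :
    orientedIntegral μ h c x = ∫ s in Ico c x, h s ∂μ := if_pos hcx

theorem HasRN.sub_eq {I : Set ℝ} {μ : Measure ℝ} {f h : ℝ → ℂ} (hf : HasRN I μ f h) {x y : ℝ}
    (hx : x ∈ I) (hy : y ∈ I) (hxy : x ≤ y) : f y - f x = ∫ s in Ico x y, h s ∂μ := by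
  rw [hf.2 x hx y hy, orientedIntegral_of_le hxy, add_sub_cancel_left]

/-- The defining identity of `HasRN` only has to be checked for `x ≤ y`. -/
theorem hasRN_of_le {I : Set ℝ} {μ : Measure ℝ} {f h : ℝ → ℂ} (hh : LocInt I μ h)
    (H : ∀ x ∈ I, ∀ y ∈ I, x ≤ y → f y - f x = ∫ s in Ico x y, h s ∂μ) : HasRN I μ f h := by
  refine ⟨hh, fun c hc x hx => ?_⟩
  unfold orientedIntegral
  split_ifs with hcx
  · rw [← H c hc x hx hcx]
    ring
  · rw [← H x hx c hc (not_le.mp hcx).le]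
    ring

/-! ### The space `H¹` -/

namespace Coeff

variable {a b : EReal} {C : Coeff a b}

theorem H1.inner_def (f g : C.H1) : inner ℂ f g = (∫ x in oi a b, conj (f x) * g x ∂C.chi)
    + ∫ x in oi a b, conj (f.deriv x) * g.deriv x ∂C.sigma := rfl

theorem H1.sub_apply (f g : C.H1) (x : ℝ) : (f - g) x = f x - g x := rfl

theorem H1.add_apply (f g : C.H1) (x : ℝ) : (f + g) x = f x + g x := rfl

theorem H1.smul_apply (r : ℂ) (f : C.H1) (x : ℝ) : (r • f) x = r * f x := rfl

/-- An element of `H¹(a,b)` from its defining properties. -/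
def H1.ofMem {f : ℝ → ℂ} (hf : f ∈ C.h1Submodule) : C.H1 := ⟨f, hf⟩

theorem H1.ext_of_forall {f g : C.H1} (h : ∀ x ∈ oi a b, f x = g x) : f = g := by
  apply Subtype.ext
  funext x
  by_cases hx : x ∈ oi a b
  · exact h x hx
  · exact (f.2.1 x hx).trans (g.2.1 x hx).symm

theorem H1.norm_sq_eq (f : C.H1) : ‖f‖ ^ 2 = (∫ x in oi a b, ‖f x‖ ^ 2 ∂C.chi)
    + ∫ x in oi a b, ‖f.deriv x‖ ^ 2 ∂C.sigma := by
  rw [← inner_self_eq_norm_sq (𝕜 := ℂ) f, H1.inner_def]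
  rw [integral_conj_mul_self_re (fun x : ℝ => f x), integral_conj_mul_self_re f.deriv,
    ← Complex.ofReal_add]
  simp

theorem H1.deriv_sub (f g : C.H1) :
    (f - g).deriv =ᵐ[C.sigma.restrict (oi a b)] f.deriv - g.deriv := by
  have h := f.hasRN.add (g.hasRN.smul (-1))
  have e : (f : ℝ → ℂ) + (-1 : ℂ) • (g : ℝ → ℂ) = (f - g : C.H1) := by
    ext x
    rw [H1.sub_apply]
    simp
    ring
  rw [e] at h
  filter_upwards [(f - g).hasRN.ae_eq h] with x hx
  rw [hx]
  simp
  ring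

/-- The class of `f` in `L²(χ)`. -/
def H1.toLpChi (f : C.H1) : Lp ℂ 2 (C.chi.restrict (oi a b)) := f.memLp.toLp f

/-- The class of `f^{[1]}` in `L²(ς)`. -/
def H1.toLpSigma (f : C.H1) : Lp ℂ 2 (C.sigma.restrict (oi a b)) := f.memLp_deriv.toLp f.deriv

theorem H1.toLpChi_sub (f g : C.H1) : (f - g).toLpChi = f.toLpChi - g.toLpChi := by
  unfold H1.toLpChi
  rw [← MemLp.toLp_sub]
  rfl

theorem H1.toLpSigma_sub (f g : C.H1) : (f - g).toLpSigma = f.toLpSigma - g.toLpSigma := by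
  unfold H1.toLpSigma
  rw [← MemLp.toLp_sub]
  exact MemLp.toLp_congr _ _ (H1.deriv_sub f g)

theorem H1.norm_sq_eq_toLp (f : C.H1) : ‖f‖ ^ 2 = ‖f.toLpChi‖ ^ 2 + ‖f.toLpSigma‖ ^ 2 := by
  rw [H1.norm_sq_eq, H1.toLpChi, H1.toLpSigma, sq_norm_toLp, sq_norm_toLp]

theorem H1.norm_toLpChi_le (f : C.H1) : ‖f.toLpChi‖ ≤ ‖f‖ := by
  refine (pow_le_pow_iff_left₀ (norm_nonneg _) (norm_nonneg _) two_ne_zero).mp ?_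
  rw [H1.norm_sq_eq_toLp f]
  linarith [sq_nonneg ‖f.toLpSigma‖]

theorem H1.norm_toLpSigma_le (f : C.H1) : ‖f.toLpSigma‖ ≤ ‖f‖ := by
  refine (pow_le_pow_iff_left₀ (norm_nonneg _) (norm_nonneg _) two_ne_zero).mp ?_
  rw [H1.norm_sq_eq_toLp f]
  linarith [sq_nonneg ‖f.toLpChi‖]

theorem sq_norm_setIntegral_sigma_le {h : ℝ → ℂ} (hh : MemLp h 2 (C.sigma.restrict (oi a b)))
    {α β x y : ℝ} (hα : α ∈ oi a b) (hβ : β ∈ oi a b) (hx : α ≤ x) (hy : y ≤ β) :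
    ‖∫ s in Ico x y, h s ∂C.sigma‖ ^ 2
      ≤ C.sigma.real (Icc α β) * ∫ s in oi a b, ‖h s‖ ^ 2 ∂C.sigma := by
  have hsub : Ico x y ⊆ Icc α β := fun s hs => ⟨hx.trans hs.1, hs.2.le.trans hy⟩
  have hsub' : Ico x y ⊆ oi a b := hsub.trans (Icc_subset_oi hα hβ)
  have hfin : C.sigma (Icc α β) ≠ ⊤ := (C.sigma_fin α hα β hβ).ne
  have : IsFiniteMeasure (C.sigma.restrict (Ico x y)) :=
    ⟨by rw [Measure.restrict_apply_univ]; exact (measure_mono hsub).trans_lt (C.sigma_fin α hα β hβ)⟩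
  have h1 := sq_norm_integral_le (hh.mono_measure (Measure.restrict_mono hsub' le_rfl))
  refine h1.trans ?_
  rw [measureReal_restrict_apply_univ]
  refine mul_le_mul (measureReal_mono hsub hfin) ?_ (integral_nonneg fun _ => sq_nonneg _)
    measureReal_nonneg
  exact setIntegral_mono_set ((memLp_two_iff_integrable_sq_norm hh.1).mp hh)
    (Eventually.of_forall fun _ => sq_nonneg _) (Eventually.of_forall hsub')

theorem H1.sq_norm_sub_le (f : C.H1) {α β x y : ℝ} (hα : α ∈ oi a b) (hβ : β ∈ oi a b)
    (hx : x ∈ Icc α β) (hy : y ∈ Icc α β) :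
    ‖f x - f y‖ ^ 2 ≤ C.sigma.real (Icc α β) * ‖f‖ ^ 2 := by
  wlog hxy : y ≤ x generalizing x y
  · rw [norm_sub_rev]
    exact this hy hx (not_le.mp hxy).le
  rw [f.hasRN.sub_eq (Icc_subset_oi hα hβ hy) (Icc_subset_oi hα hβ hx) hxy]
  refine (sq_norm_setIntegral_sigma_le f.memLp_deriv hα hβ hy.1 hx.2).trans ?_
  refine mul_le_mul_of_nonneg_left ?_ measureReal_nonneg
  rw [H1.norm_sq_eq f]
  linarith [show 0 ≤ ∫ x in oi a b, ‖f x‖ ^ 2 ∂C.chi from integral_nonneg fun _ => sq_nonneg _]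

variable (C) in
/-- Point evaluations on `H¹` are bounded. -/
theorem H1.exists_norm_apply_le {x : ℝ} (hx : x ∈ oi a b) :
    ∃ K, 0 ≤ K ∧ ∀ f : C.H1, ‖f x‖ ≤ K * ‖f‖ := by
  obtain ⟨α', hα', β', hβ', hne'⟩ := exists_measure_Icc_ne_zero C.chi_ne_zero
  obtain ⟨α, hα, β, hβ, hxI, hne⟩ : ∃ α ∈ oi a b, ∃ β ∈ oi a b, x ∈ Icc α β ∧
      C.chi (Icc α β) ≠ 0 := by
    refine ⟨min α' x, ?_, max β' x, ?_, ⟨min_le_right _ _, le_max_right _ _⟩, fun h => hne' ?_⟩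
    · rcases min_choice α' x with h | h <;> rw [h] <;> assumption
    · rcases max_choice β' x with h | h <;> rw [h] <;> assumption
    · exact measure_mono_null (Icc_subset_Icc (min_le_left _ _) (le_max_left _ _)) h
  set m := C.chi.real (Icc α β) with hm
  have hm0 : 0 < m := ENNReal.toReal_pos hne (C.chi_fin α hα β hβ).ne
  set s := C.sigma.real (Icc α β) with hs
  have hs0 : 0 ≤ s := measureReal_nonneg
  have hfin : IsFiniteMeasure (C.chi.restrict (Icc α β)) :=
    ⟨by rw [Measure.restrict_apply_univ]; exact C.chi_fin α hα β hβ⟩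
  refine ⟨√((2 + 2 * s * m) / m), Real.sqrt_nonneg _, fun f => ?_⟩
  refine (pow_le_pow_iff_left₀ (norm_nonneg _) (by positivity) two_ne_zero).mp ?_
  rw [mul_pow, Real.sq_sqrt (by positivity), div_mul_eq_mul_div, le_div_iff₀ hm0]
  have hsub : Icc α β ⊆ oi a b := Icc_subset_oi hα hβ
  have hi : Integrable (fun y => ‖f y‖ ^ 2) (C.chi.restrict (oi a b)) :=
    (memLp_two_iff_integrable_sq_norm f.memLp.1).mp f.memLp
  have hi' : Integrable (fun y => ‖f y‖ ^ 2) (C.chi.restrict (Icc α β)) :=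
    hi.mono_measure (Measure.restrict_mono hsub le_rfl)
  have h1 : ∫ y in Icc α β, ‖f x‖ ^ 2 ∂C.chi
      ≤ ∫ y in Icc α β, (2 * ‖f y‖ ^ 2 + 2 * (s * ‖f‖ ^ 2)) ∂C.chi := by
    refine setIntegral_mono_on (integrable_const _) ((hi'.const_mul 2).add (integrable_const _))
      measurableSet_Icc fun y hy => ?_
    have h2 := f.sq_norm_sub_le hα hβ hxI hy
    have h3 : ‖f x‖ ≤ ‖f y‖ + ‖f x - f y‖ := by
      have := norm_add_le (f y) (f x - f y)
      simpa using this
    nlinarith [sq_nonneg (‖f y‖ - ‖f x - f y‖), norm_nonneg (f x), norm_nonneg (f y)]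
  rw [integral_add (hi'.const_mul 2) (integrable_const _), integral_const_mul, integral_const,
    integral_const, measureReal_restrict_apply_univ, ← hm, smul_eq_mul, smul_eq_mul] at h1
  have h4 : ∫ y in Icc α β, ‖f y‖ ^ 2 ∂C.chi ≤ ‖f‖ ^ 2 := by
    refine (setIntegral_mono_set hi (Eventually.of_forall fun _ => sq_nonneg _)
      (Eventually.of_forall hsub)).trans ?_
    rw [H1.norm_sq_eq f]
    linarith [show 0 ≤ ∫ x in oi a b, ‖f.deriv x‖ ^ 2 ∂C.sigma from
      integral_nonneg fun _ => sq_nonneg _]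
  nlinarith

theorem tendsto_setIntegral_of_tendsto_Lp {u : ℕ → Lp ℂ 2 (C.sigma.restrict (oi a b))}
    {h : Lp ℂ 2 (C.sigma.restrict (oi a b))} (hu : Tendsto u atTop (𝓝 h)) {x y : ℝ}
    (hx : x ∈ oi a b) (hy : y ∈ oi a b) :
    Tendsto (fun n => ∫ s in Ico x y, u n s ∂C.sigma) atTop (𝓝 (∫ s in Ico x y, h s ∂C.sigma)) := by
  have hsub : Ico x y ⊆ oi a b := Ico_subset_oi hx hy
  have hr : ∀ g : ℝ → ℂ, ∫ s in Ico x y, g s ∂(C.sigma.restrict (oi a b))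
      = ∫ s in Ico x y, g s ∂C.sigma := fun g => by
    rw [Measure.restrict_restrict measurableSet_Ico, inter_eq_self_of_subset_left hsub]
  have hfin : C.sigma.restrict (oi a b) (Ico x y) ≠ ⊤ := by
    rw [Measure.restrict_apply measurableSet_Ico, inter_eq_self_of_subset_left hsub]
    exact ((measure_mono Ico_subset_Icc_self).trans_lt (C.sigma_fin x hx y hy)).ne
  have hinteg : ∀ g : Lp ℂ 2 (C.sigma.restrict (oi a b)), ∫ s in Ico x y, g s ∂C.sigma
      = inner ℂ (indicatorConstLp 2 (measurableSet_Ico (a := x) (b := y)) hfin (1 : ℂ)) g := by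
    intro g
    rw [L2.inner_indicatorConstLp_one, hr]
  simp only [hinteg]
  exact tendsto_const_nhds.inner hu

variable (C) in
/-- The modified Sobolev space is complete. -/
theorem H1.completeSpace : CompleteSpace C.H1 := by
  refine Metric.complete_of_cauchySeq_tendsto fun u hu => ?_
  have hcau : ∀ {X : Type} [NormedAddCommGroup X] (J : C.H1 → X) (K : ℝ), 0 ≤ K →
      (∀ f g, ‖J f - J g‖ ≤ K * ‖f - g‖) → CauchySeq fun n => J (u n) := by
    intro X _ J K hK0 hJ
    rw [Metric.cauchySeq_iff] at hu ⊢
    intro ε hε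
    obtain ⟨n, hn⟩ := hu (ε / (K + 1)) (by positivity)
    refine ⟨n, fun p hp q hq => ?_⟩
    have h1 := hn p hp q hq
    rw [dist_eq_norm] at h1 ⊢
    rw [lt_div_iff₀ (by positivity)] at h1
    nlinarith [hJ (u p) (u q), norm_nonneg (u p - u q)]
  obtain ⟨g, hg⟩ := cauchySeq_tendsto_of_complete (hcau H1.toLpChi 1 zero_le_one fun f g => by
    rw [← H1.toLpChi_sub, one_mul]
    exact H1.norm_toLpChi_le _)
  obtain ⟨h, hh⟩ := cauchySeq_tendsto_of_complete (hcau H1.toLpSigma 1 zero_le_one fun f g => by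
    rw [← H1.toLpSigma_sub, one_mul]
    exact H1.norm_toLpSigma_le _)
  have hpt : ∀ x, ∃ y, Tendsto (fun n => u n x) atTop (𝓝 y) := by
    intro x
    by_cases hx : x ∈ oi a b
    · obtain ⟨K, hK0, hK⟩ := H1.exists_norm_apply_le C hx
      exact cauchySeq_tendsto_of_complete (hcau (fun f => f x) K hK0 fun f g => hK (f - g))
    · refine ⟨0, tendsto_const_nhds.congr fun n => ((u n).2.1 x hx).symm⟩
  choose f hf using hpt
  have hf0 : ∀ x ∉ oi a b, f x = 0 := fun x hx =>
    tendsto_nhds_unique (hf x) (tendsto_const_nhds.congr fun n => ((u n).2.1 x hx).symm)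
  have hfg : f =ᵐ[C.chi.restrict (oi a b)] g := by
    obtain ⟨ns, hns, hae⟩ := (tendstoInMeasure_of_tendsto_Lp hg).exists_seq_tendsto_ae
    have hall : ∀ᵐ x ∂(C.chi.restrict (oi a b)), ∀ n, (u n).toLpChi x = u n x :=
      ae_all_iff.mpr fun n => (u n).memLp.coeFn_toLp
    filter_upwards [hae, hall] with x hx hx2
    simp only [hx2] at hx
    exact tendsto_nhds_unique ((hf x).comp hns.tendsto_atTop) hx
  have hfL : MemLp f 2 (C.chi.restrict (oi a b)) := (memLp_congr_ae hfg).mpr (Lp.memLp g)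
  have hloc : LocInt (oi a b) C.sigma h := by
    intro α hα β hβ
    have hfin : IsFiniteMeasure (C.sigma.restrict (Icc α β)) :=
      ⟨by rw [Measure.restrict_apply_univ]; exact C.sigma_fin α hα β hβ⟩
    exact ((Lp.memLp h).mono_measure (Measure.restrict_mono (Icc_subset_oi hα hβ) le_rfl)).integrable
      (by norm_num)
  have hRN : HasRN (oi a b) C.sigma f h := by
    refine hasRN_of_le hloc fun x hx y hy hxy => ?_
    refine tendsto_nhds_unique ((hf y).sub (hf x)) ?_
    refine (tendsto_setIntegral_of_tendsto_Lp hh hx hy).congr fun n => ?_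
    rw [(u n).hasRN.sub_eq hx hy hxy]
    refine integral_congr_ae (ae_mono (Measure.restrict_mono (Ico_subset_oi hx hy) le_rfl) ?_)
    exact (u n).memLp_deriv.coeFn_toLp
  have hmem : f ∈ C.h1Submodule := ⟨hf0, h, hRN, hfL, Lp.memLp h⟩
  refine ⟨H1.ofMem hmem, ?_⟩
  have e1 : (H1.ofMem hmem).toLpChi = g := by
    rw [← Lp.toLp_coeFn g (Lp.memLp g)]
    exact MemLp.toLp_congr _ _ hfg
  have e2 : (H1.ofMem hmem).toLpSigma = h := by
    rw [← Lp.toLp_coeFn h (Lp.memLp h)]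
    exact MemLp.toLp_congr _ _ ((H1.ofMem hmem).hasRN.ae_eq hRN)
  rw [tendsto_iff_norm_sub_tendsto_zero]
  have t1 := (tendsto_iff_norm_sub_tendsto_zero.mp hg).pow 2
  have t2 := (tendsto_iff_norm_sub_tendsto_zero.mp hh).pow 2
  have t3 := (t1.add t2).sqrt
  simp only [ne_eq, OfNat.ofNat_ne_zero, not_false_eq_true, zero_pow, add_zero,
    Real.sqrt_zero] at t3
  refine t3.congr fun n => ?_
  rw [← e1, ← e2, ← H1.toLpChi_sub, ← H1.toLpSigma_sub, ← H1.norm_sq_eq_toLp,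
    Real.sqrt_sq (norm_nonneg _)]

end Coeff

end LeftDefinite

end

noncomputable section

namespace LeftDefinite

/-! ### Weakly convergent and weakly analytic families in a Hilbert space -/

section Hilbert

variable {H : Type*} [NormedAddCommGroup H] [InnerProductSpace ℂ H]

theorem norm_le_of_tendsto_inner {S : Set H} (hS : (Submodule.span ℂ S).topologicalClosure = ⊤)
    {u : ℕ → H} {f : H} {K : ℝ} (hK : ∀ n, ‖u n‖ ≤ K)
    (hu : ∀ s ∈ S, Tendsto (fun n => inner ℂ s (u n)) atTop (𝓝 (inner ℂ s f))) : ‖f‖ ≤ K := by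
  have hK0 : 0 ≤ K := (norm_nonneg _).trans (hK 0)
  have h1 : ∀ v ∈ Submodule.span ℂ S,
      Tendsto (fun n => inner ℂ v (u n)) atTop (𝓝 (inner ℂ v f)) := by
    intro v hv
    induction hv using Submodule.span_induction with
    | mem s hs => exact hu s hs
    | zero => simp
    | add v w _ _ hv hw => simpa only [inner_add_left] using hv.add hw
    | smul r v _ hv => simpa only [inner_smul_left] using hv.const_mul _
  have h2 : ∀ v ∈ Submodule.span ℂ S, ‖inner ℂ v f‖ ≤ ‖v‖ * K := fun v hv =>
    le_of_tendsto (h1 v hv).norm (Eventually.of_forall fun n =>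
      (norm_inner_le_norm _ _).trans (mul_le_mul_of_nonneg_left (hK n) (norm_nonneg _)))
  have h3 : ∀ v : H, ‖inner ℂ v f‖ ≤ ‖v‖ * K := by
    intro v
    have hv : v ∈ closure (Submodule.span ℂ S : Set H) := by
      rw [← Submodule.topologicalClosure_coe, hS]
      trivial
    refine closure_minimal (t := {v | ‖inner ℂ v f‖ ≤ ‖v‖ * K}) h2 ?_ hv
    exact isClosed_le (by fun_prop) (by fun_prop)
  have h4 := h3 f
  rw [inner_self_eq_norm_sq_to_K, norm_pow, RCLike.norm_ofReal, abs_norm, sq] at h4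
  rcases (norm_nonneg f).lt_or_eq with h | h
  · exact le_of_mul_le_mul_left h4 h
  · rw [← h]
    exact hK0

theorem differentiable_inner_of_dense {S : Set H}
    (hS : (Submodule.span ℂ S).topologicalClosure = ⊤) {ψ : ℂ → H}
    (hb : ∀ R : ℝ, ∃ K, ∀ z : ℂ, ‖z‖ ≤ R → ‖ψ z‖ ≤ K)
    (hd : ∀ s ∈ S, Differentiable ℂ fun z => inner ℂ s (ψ z)) (f : H) :
    Differentiable ℂ fun z => inner ℂ f (ψ z) := by
  have h1 : ∀ v ∈ Submodule.span ℂ S, Differentiable ℂ fun z => inner ℂ v (ψ z) := by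
    intro v hv
    induction hv using Submodule.span_induction with
    | mem s hs => exact hd s hs
    | zero => simp
    | add v w _ _ hv hw =>
      simp only [inner_add_left]
      exact Differentiable.fun_add hv hw
    | smul r v _ hv =>
      simp only [inner_smul_left]
      exact Differentiable.const_mul hv _
  have hf : f ∈ closure (Submodule.span ℂ S : Set H) := by
    rw [← Submodule.topologicalClosure_coe, hS]
    trivial
  obtain ⟨v, hv, hvf⟩ := mem_closure_iff_seq_limit.mp hf
  have hloc : TendstoLocallyUniformlyOn (fun n z => inner ℂ (v n) (ψ z))
      (fun z => inner ℂ f (ψ z)) atTop univ := by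
    rw [tendstoLocallyUniformlyOn_iff_forall_isCompact isOpen_univ]
    intro T _ hT
    obtain ⟨R, hR⟩ := hT.isBounded.exists_norm_le
    obtain ⟨K, hK⟩ := hb R
    rw [Metric.tendstoUniformlyOn_iff]
    intro ε hε
    have h2 := (Metric.tendsto_nhds.mp hvf) (ε / (|K| + 1)) (by positivity)
    filter_upwards [h2] with n hn z hz
    rw [dist_eq_norm, lt_div_iff₀ (by positivity)] at hn
    rw [dist_eq_norm, ← inner_sub_left]
    refine (norm_inner_le_norm _ _).trans_lt ?_
    rw [norm_sub_rev]
    have h3 := (hK z (hR z hz)).trans (le_abs_self K)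
    nlinarith [norm_nonneg (v n - f)]
  rw [← differentiableOn_univ]
  exact hloc.differentiableOn (Eventually.of_forall fun n => (h1 _ (hv n)).differentiableOn)
    isOpen_univ

end Hilbert

namespace Coeff

variable {a b : EReal} (C : Coeff a b)

/-- Point evaluations are represented by elements of `H¹`. -/
theorem H1.exists_representer {x : ℝ} (hx : x ∈ oi a b) :
    ∃ e : C.H1, ∀ f : C.H1, inner ℂ e f = f x := by
  have := H1.completeSpace C
  obtain ⟨K, -, hK⟩ := H1.exists_norm_apply_le C hx
  let L : C.H1 →ₗ[ℂ] ℂ :=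
    { toFun := fun f => f x
      map_add' := fun f g => H1.add_apply f g x
      map_smul' := fun r f => H1.smul_apply r f x }
  refine ⟨(InnerProductSpace.toDual ℂ C.H1).symm (L.mkContinuous K hK), fun f => ?_⟩
  rw [InnerProductSpace.toDual_symm_apply]
  rfl

/-- The representers of point evaluations. -/
def H1.representers : Set C.H1 := {e | ∃ x ∈ oi a b, ∀ f : C.H1, inner ℂ e f = f x}

theorem H1.closure_span_representers :
    (Submodule.span ℂ (H1.representers C)).topologicalClosure = ⊤ := by
  have := H1.completeSpace C
  rw [Submodule.topologicalClosure_eq_top_iff, Submodule.eq_bot_iff]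
  intro v hv
  refine H1.ext_of_forall fun x hx => ?_
  obtain ⟨e, he⟩ := H1.exists_representer C hx
  rw [← he v]
  exact (Submodule.mem_orthogonal _ _).mp hv e (Submodule.subset_span ⟨x, hx, he⟩)

variable {C}

theorem H1.norm_le_of_tendsto {u : ℕ → C.H1} {f : C.H1} {K : ℝ} (hK : ∀ n, ‖u n‖ ≤ K)
    (hu : ∀ x ∈ oi a b, Tendsto (fun n => u n x) atTop (𝓝 (f x))) : ‖f‖ ≤ K := by
  refine norm_le_of_tendsto_inner (H1.closure_span_representers C) hK ?_
  rintro s ⟨x, hx, hs⟩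
  simpa only [hs] using hu x hx

theorem H1.differentiable_inner {ψ : ℂ → C.H1}
    (hb : ∀ R : ℝ, ∃ K, ∀ z : ℂ, ‖z‖ ≤ R → ‖ψ z‖ ≤ K)
    (hd : ∀ x ∈ oi a b, Differentiable ℂ fun z => ψ z x) (f : C.H1) :
    Differentiable ℂ fun z => inner ℂ f (ψ z) := by
  refine differentiable_inner_of_dense (H1.closure_span_representers C) hb ?_ f
  rintro s ⟨x, hx, hs⟩
  simpa only [hs] using hd x hx

end Coeff

end LeftDefinite

end

noncomputable section

namespace LeftDefinite

/-! ### Integration by parts for measures -/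

theorem integrable_mul_setIntegral_Iio {μ ν : Measure ℝ} [IsFiniteMeasure μ] [IsFiniteMeasure ν]
    {h g : ℝ → ℂ} (hh : Integrable h μ) (hg : Integrable g ν) :
    Integrable (fun s => h s * ∫ t in Iio s, g t ∂ν) μ ∧
    ∫ s, h s * (∫ t in Iio s, g t ∂ν) ∂μ = ∫ t, g t * (∫ s in Ioi t, h s ∂μ) ∂ν := by
  set k : ℝ → ℝ → ℂ := fun s t => {p : ℝ × ℝ | p.2 < p.1}.indicator (fun p => h p.1 * g p.2) (s, t)
    with hk
  have hinteg : Integrable (Function.uncurry k) (μ.prod ν) :=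
    (hh.mul_prod hg).indicator (measurableSet_lt measurable_snd measurable_fst)
  have e1 : ∀ s, ∫ t, k s t ∂ν = h s * ∫ t in Iio s, g t ∂ν := by
    intro s
    rw [← integral_const_mul, ← integral_indicator measurableSet_Iio]
    congr 1
  have e2 : ∀ t, ∫ s, k s t ∂μ = g t * ∫ s in Ioi t, h s ∂μ := by
    intro t
    rw [← integral_const_mul, ← integral_indicator measurableSet_Ioi]
    congr 1
    ext s
    by_cases hs : t < s <;> simp [hk, hs, mul_comm]
  constructor
  · have := hinteg.integral_prod_left
    simpa only [Function.uncurry_apply_pair, e1] using this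
  · have := integral_integral_swap hinteg
    simpa only [e1, e2] using this

theorem nullSingletonClass_restrict {a b : EReal} {μ : Measure ℝ}
    (hμ : ∀ x ∈ oi a b, μ {x} = 0) : NullSingletonClass (μ.restrict (oi a b)) := by
  refine ⟨fun x => ?_⟩
  by_cases hx : x ∈ oi a b
  · exact Measure.restrict_le_self.absolutelyContinuous (hμ x hx)
  · rw [Measure.restrict_apply (measurableSet_singleton x),
      disjoint_iff_inter_eq_empty.mp (disjoint_singleton_left.mpr hx), measure_empty]

theorem setIntegral_restrict_oi {a b : EReal} (μ : Measure ℝ) (h : ℝ → ℂ) {s : Set ℝ}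
    (hs : MeasurableSet s) (hsub : s ⊆ oi a b) :
    ∫ t in s, h t ∂(μ.restrict (oi a b)) = ∫ t in s, h t ∂μ := by
  rw [Measure.restrict_restrict hs, inter_eq_self_of_subset_left hsub]

theorem isFiniteMeasure_restrict_Ico {μ : Measure ℝ} {x y : ℝ} (h : μ (Icc x y) < ⊤) :
    IsFiniteMeasure (μ.restrict (Ico x y)) :=
  ⟨by rw [Measure.restrict_apply_univ]; exact (measure_mono Ico_subset_Icc_self).trans_lt h⟩

theorem HasRN.continuousOn {a b : EReal} {μ : Measure ℝ} (hμ : ∀ x ∈ oi a b, μ {x} = 0)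
    {f h : ℝ → ℂ} (hf : HasRN (oi a b) μ f h) : ContinuousOn f (oi a b) := by
  have := nullSingletonClass_restrict hμ
  intro x hx
  obtain ⟨ε, hε, hball⟩ := Metric.isOpen_iff.mp (isOpen_oi a b) x hx
  have hα : x - ε / 2 ∈ oi a b := hball (by
    rw [Real.ball_eq_Ioo]
    constructor <;> linarith)
  have hβ : x + ε / 2 ∈ oi a b := hball (by
    rw [Real.ball_eq_Ioo]
    constructor <;> linarith)
  have hsub := Icc_subset_oi hα hβ
  have hinteg : IntegrableOn h (Icc (x - ε / 2) (x + ε / 2)) (μ.restrict (oi a b)) := by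
    rw [IntegrableOn, Measure.restrict_restrict measurableSet_Icc,
      inter_eq_self_of_subset_left hsub]
    exact hf.1 _ hα _ hβ
  have hc := (intervalIntegral.continuousOn_primitive hinteg).const_add (f (x - ε / 2))
  have heq : EqOn f (fun y => f (x - ε / 2) + ∫ t in Ioc (x - ε / 2) y, h t ∂(μ.restrict (oi a b)))
      (Icc (x - ε / 2) (x + ε / 2)) := by
    intro y hy
    simp only
    rw [← integral_Ico_eq_integral_Ioc, setIntegral_restrict_oi μ h measurableSet_Ico
      (Ico_subset_oi hα (hsub hy)), ← hf.sub_eq hα (hsub hy) hy.1]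
    ring
  have hnhds : Icc (x - ε / 2) (x + ε / 2) ∈ 𝓝 x := Icc_mem_nhds (by linarith) (by linarith)
  exact ((hc.congr heq).continuousAt hnhds).continuousWithinAt

theorem _root_.ContinuousOn.integrableOn_Icc_oi {a b : EReal} {f : ℝ → ℂ}
    (hf : ContinuousOn f (oi a b)) {μ : Measure ℝ} {α β : ℝ} (hα : α ∈ oi a b) (hβ : β ∈ oi a b)
    (hμ : μ (Icc α β) < ⊤) : IntegrableOn f (Icc α β) μ :=
  (hf.mono (Icc_subset_oi hα hβ)).integrableOn_of_subset_isCompact isCompact_Icc measurableSet_Icc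
    subset_rfl hμ.ne

theorem HasRN.conj {I : Set ℝ} {μ : Measure ℝ} {f h : ℝ → ℂ} (hf : HasRN I μ f h) :
    HasRN I μ (fun x => conj (f x)) (fun x => conj (h x)) := by
  refine hasRN_of_le (fun α hα β hβ =>
    Complex.conjCLE.toContinuousLinearMap.integrable_comp (hf.1 α hα β hβ))
    fun x hx y hy hxy => ?_
  rw [← map_sub, hf.sub_eq hx hy hxy, integral_conj]

/-- Fubini's theorem on a triangle. -/
theorem HasRN.integral_mul_primitive {a b : EReal} {μ ν : Measure ℝ}
    (hμ : ∀ x ∈ oi a b, μ {x} = 0) {f h : ℝ → ℂ} (hf : HasRN (oi a b) μ f h) {x y : ℝ}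
    (hx : x ∈ oi a b) (hy : y ∈ oi a b) (hμf : μ (Icc x y) < ⊤) (hνf : ν (Icc x y) < ⊤)
    {g : ℝ → ℂ} (hg : IntegrableOn g (Icc x y) ν) :
    IntegrableOn (fun s => h s * ∫ t in Ico x s, g t ∂ν) (Ico x y) μ ∧
    ∫ s in Ico x y, h s * (∫ t in Ico x s, g t ∂ν) ∂μ = ∫ t in Ico x y, g t * (f y - f t) ∂ν := by
  have := nullSingletonClass_restrict hμ
  have := isFiniteMeasure_restrict_Ico hμf
  have := isFiniteMeasure_restrict_Ico hνf
  obtain ⟨h1, h2⟩ := integrable_mul_setIntegral_Iio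
    ((hf.1 x hx y hy).mono_set Ico_subset_Icc_self) (hg.mono_set Ico_subset_Icc_self)
  have e1 : ∀ s ∈ Ico x y, ∫ t in Iio s, g t ∂(ν.restrict (Ico x y)) = ∫ t in Ico x s, g t ∂ν := by
    intro s hs
    rw [Measure.restrict_restrict measurableSet_Iio]
    congr 2
    ext t
    simp only [mem_inter_iff, mem_Iio, mem_Ico]
    exact ⟨fun h => ⟨h.2.1, h.1⟩, fun h => ⟨h.2, h.1, h.2.trans hs.2⟩⟩
  have e2 : ∀ t ∈ Ico x y, ∫ s in Ioi t, h s ∂(μ.restrict (Ico x y)) = f y - f t := by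
    intro t ht
    have htI : t ∈ oi a b := Ico_subset_oi hx hy ht
    rw [hf.sub_eq htI hy ht.2.le, Measure.restrict_restrict measurableSet_Ioi]
    have : Ioi t ∩ Ico x y = Ioo t y := by
      ext s
      simp only [mem_inter_iff, mem_Ioi, mem_Ico, mem_Ioo]
      exact ⟨fun h => ⟨h.1, h.2.2⟩, fun h => ⟨h.1, ht.1.trans h.1.le, h.2⟩⟩
    rw [this, ← setIntegral_restrict_oi μ h measurableSet_Ioo
      (Ioo_subset_Ico_self.trans (Ico_subset_oi htI hy)),
      ← setIntegral_restrict_oi μ h measurableSet_Ico (Ico_subset_oi htI hy),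
      integral_Ico_eq_integral_Ioo]
  constructor
  · refine IntegrableOn.congr_fun h1 (fun s hs => ?_) measurableSet_Ico
    simp only [e1 s hs]
  · refine (setIntegral_congr_fun measurableSet_Ico (fun s hs => ?_)).trans (h2.trans ?_)
    · simp only [e1 s hs]
    exact setIntegral_congr_fun measurableSet_Ico (fun t ht => by simp only [e2 t ht])

namespace Coeff

variable {a b : EReal} {C : Coeff a b}

variable (C) in
/-- `ς` has no point masses in `(a, b)`. -/
def Atomless : Prop := ∀ x ∈ oi a b, C.sigma {x} = 0

theorem atomless_of_absolutelyContinuous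
    (hς : (C.sigma.restrict (oi a b)).AbsolutelyContinuous volume) : C.Atomless := by
  intro x hx
  have h := hς (Real.volume_singleton (a := x))
  rwa [Measure.restrict_apply (measurableSet_singleton x),
    inter_eq_self_of_subset_left (singleton_subset_iff.mpr hx)] at h

namespace TLoc

theorem continuousOn_fn (hn : C.Atomless) (u : C.TLoc) : ContinuousOn u.fn (oi a b) :=
  u.fn_deriv.continuousOn hn

theorem continuousOn_tau (hn : C.Atomless) (u : C.TLoc) : ContinuousOn u.tau (oi a b) := by
  obtain ⟨h, hh⟩ := u.tau_ac
  exact hh.continuousOn hn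

theorem qd_sub_eq (u : C.TLoc) {x y : ℝ} (hx : x ∈ oi a b) (hy : y ∈ oi a b) (hxy : x ≤ y) :
    u.qd y - u.qd x = (∫ s in Ico x y, u.fn s ∂C.chi)
      - ((∫ s in Ico x y, u.tau s ∂C.rhoPos) - ∫ s in Ico x y, u.tau s ∂C.rhoNeg) := by
  have h := u.tau_eq x hx y hy
  rw [rhoIntegral, orientedIntegral_of_le hxy, orientedIntegral_of_le hxy,
    orientedIntegral_of_le hxy] at h
  linear_combination -h

theorem exists_norm_qd_le (hn : C.Atomless) (u : C.TLoc) {α β : ℝ} (hα : α ∈ oi a b)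
    (hβ : β ∈ oi a b) : ∃ K, ∀ x ∈ Icc α β, ‖u.qd x‖ ≤ K := by
  have hbound : ∀ {μ : Measure ℝ} {f : ℝ → ℂ}, IntegrableOn f (Icc α β) μ → ∀ x ∈ Icc α β,
      ‖∫ s in Ico α x, f s ∂μ‖ ≤ ∫ s in Icc α β, ‖f s‖ ∂μ := by
    intro μ f hf x hx
    refine (norm_integral_le_integral_norm _).trans ?_
    exact setIntegral_mono_set hf.norm (Eventually.of_forall fun _ => norm_nonneg _)
      (Eventually.of_forall fun s hs => ⟨hs.1, hs.2.le.trans hx.2⟩)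
  have i1 := (u.continuousOn_fn hn).integrableOn_Icc_oi hα hβ (C.chi_fin α hα β hβ)
  have i2 := (u.continuousOn_tau hn).integrableOn_Icc_oi hα hβ (C.rhoPos_fin α hα β hβ)
  have i3 := (u.continuousOn_tau hn).integrableOn_Icc_oi hα hβ (C.rhoNeg_fin α hα β hβ)
  refine ⟨‖u.qd α‖ + ((∫ s in Icc α β, ‖u.fn s‖ ∂C.chi) + ((∫ s in Icc α β, ‖u.tau s‖ ∂C.rhoPos)
    + ∫ s in Icc α β, ‖u.tau s‖ ∂C.rhoNeg)), fun x hx => ?_⟩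
  have h := u.qd_sub_eq hα (Icc_subset_oi hα hβ hx) hx.1
  rw [sub_eq_iff_eq_add'] at h
  rw [h]
  refine (norm_add_le _ _).trans (add_le_add_right ((norm_sub_le _ _).trans
    (add_le_add (hbound i1 x hx) ((norm_sub_le _ _).trans
      (add_le_add (hbound i2 x hx) (hbound i3 x hx))))) _)

theorem integrableOn_mul_qd (hn : C.Atomless) (u : C.TLoc) {h : ℝ → ℂ}
    (hh : LocInt (oi a b) C.sigma h) {α β : ℝ} (hα : α ∈ oi a b) (hβ : β ∈ oi a b) :
    IntegrableOn (fun s => h s * u.qd s) (Icc α β) C.sigma := by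
  obtain ⟨K, hK⟩ := u.exists_norm_qd_le hn hα hβ
  refine Integrable.mono' ((hh α hα β hβ).norm.mul_const K)
    ((hh α hα β hβ).1.mul (u.fn_deriv.1 α hα β hβ).1) ?_
  filter_upwards [ae_restrict_mem measurableSet_Icc] with s hs
  rw [norm_mul]
  exact mul_le_mul_of_nonneg_left (hK s hs) (norm_nonneg _)

/-- Integration by parts. -/
theorem mul_qd_sub_eq (hn : C.Atomless) (u : C.TLoc) {f h : ℝ → ℂ}
    (hf : HasRN (oi a b) C.sigma f h) {x y : ℝ} (hx : x ∈ oi a b) (hy : y ∈ oi a b) (hxy : x ≤ y) :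
    f y * u.qd y - f x * u.qd x = (∫ s in Ico x y, h s * u.qd s ∂C.sigma)
      + (∫ s in Ico x y, f s * u.fn s ∂C.chi)
      - ((∫ s in Ico x y, f s * u.tau s ∂C.rhoPos) - ∫ s in Ico x y, f s * u.tau s ∂C.rhoNeg) := by
  have hfc := hf.continuousOn hn
  have part : ∀ {ν : Measure ℝ} {g : ℝ → ℂ}, ν (Icc x y) < ⊤ → ContinuousOn g (oi a b) →
      IntegrableOn (fun s => h s * ∫ t in Ico x s, g t ∂ν) (Ico x y) C.sigma ∧
      ∫ s in Ico x y, h s * (∫ t in Ico x s, g t ∂ν) ∂C.sigma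
        = f y * (∫ t in Ico x y, g t ∂ν) - ∫ t in Ico x y, f t * g t ∂ν := by
    intro ν g hν hg
    have ig := hg.integrableOn_Icc_oi hx hy hν
    have ifg : IntegrableOn (fun t => f t * g t) (Icc x y) ν :=
      (hfc.mul hg).integrableOn_Icc_oi hx hy hν
    obtain ⟨p1, p2⟩ := hf.integral_mul_primitive hn hx hy (C.sigma_fin x hx y hy) hν ig
    refine ⟨p1, ?_⟩
    rw [p2, ← integral_const_mul, ← integral_sub
      ((ig.mono_set Ico_subset_Icc_self).const_mul _) (ifg.mono_set Ico_subset_Icc_self)]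
    congr 1
    ext t
    ring
  obtain ⟨a1, a2⟩ := part (C.chi_fin x hx y hy) (u.continuousOn_fn hn)
  obtain ⟨b1, b2⟩ := part (C.rhoPos_fin x hx y hy) (u.continuousOn_tau hn)
  obtain ⟨c1, c2⟩ := part (C.rhoNeg_fin x hx y hy) (u.continuousOn_tau hn)
  have ih : IntegrableOn (fun s => h s * u.qd x) (Ico x y) C.sigma :=
    ((hf.1 x hx y hy).mono_set Ico_subset_Icc_self).mul_const _
  have e : ∫ s in Ico x y, h s * u.qd s ∂C.sigma
      = ∫ s in Ico x y, (h s * u.qd x + (h s * (∫ t in Ico x s, u.fn t ∂C.chi)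
        - (h s * (∫ t in Ico x s, u.tau t ∂C.rhoPos)
          - h s * (∫ t in Ico x s, u.tau t ∂C.rhoNeg)))) ∂C.sigma := by
    refine setIntegral_congr_fun measurableSet_Ico fun s hs => ?_
    have := u.qd_sub_eq hx (Ico_subset_oi hx hy hs) hs.1
    linear_combination h s * this
  have i2 : IntegrableOn (fun s => h s * (∫ t in Ico x s, u.tau t ∂C.rhoPos)
          - h s * (∫ t in Ico x s, u.tau t ∂C.rhoNeg)) (Ico x y) C.sigma := b1.sub c1
  have i3 : IntegrableOn (fun s => h s * (∫ t in Ico x s, u.fn t ∂C.chi)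
        - (h s * (∫ t in Ico x s, u.tau t ∂C.rhoPos)
          - h s * (∫ t in Ico x s, u.tau t ∂C.rhoNeg))) (Ico x y) C.sigma := a1.sub i2
  rw [e, integral_add ih i3, integral_sub a1 i2, integral_sub b1 c1, a2, b2, c2,
    integral_mul_const, ← hf.sub_eq hx hy hxy]
  linear_combination f y * u.qd_sub_eq hx hy hxy

/-- The bilinear Wronskian `V(f, g) = f_τ g^{[1]} - f^{[1]} g_τ`. -/
def bilinWronskian (f g : C.TLoc) (x : ℝ) : ℂ := f.tau x * g.qd x - f.qd x * g.tau x

/-- The Lagrange identity. -/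
theorem bilinWronskian_sub_eq (hn : C.Atomless) (f g : C.TLoc) {f' g' : ℝ → ℂ}
    (hf : HasRN (oi a b) C.sigma f.tau f') (hg : HasRN (oi a b) C.sigma g.tau g') {x y : ℝ}
    (hx : x ∈ oi a b) (hy : y ∈ oi a b) (hxy : x ≤ y) :
    bilinWronskian f g y - bilinWronskian f g x
      = (∫ s in Ico x y, (f.tau s * g.fn s - f.fn s * g.tau s) ∂C.chi)
        + ∫ s in Ico x y, (f' s * g.qd s - f.qd s * g' s) ∂C.sigma := by
  have h1 := g.mul_qd_sub_eq hn hf hx hy hxy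
  have h2 := f.mul_qd_sub_eq hn hg hx hy hxy
  have j1 : IntegrableOn (fun s => f.tau s * g.fn s) (Ico x y) C.chi :=
    (((f.continuousOn_tau hn).mul (g.continuousOn_fn hn)).integrableOn_Icc_oi hx hy
    (C.chi_fin x hx y hy)).mono_set Ico_subset_Icc_self
  have j2 : IntegrableOn (fun s => g.tau s * f.fn s) (Ico x y) C.chi :=
    (((g.continuousOn_tau hn).mul (f.continuousOn_fn hn)).integrableOn_Icc_oi hx hy
    (C.chi_fin x hx y hy)).mono_set Ico_subset_Icc_self
  have j3 := (g.integrableOn_mul_qd hn hf.1 hx hy).mono_set Ico_subset_Icc_self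
  have j4 := (f.integrableOn_mul_qd hn hg.1 hx hy).mono_set Ico_subset_Icc_self
  have e1 : ∫ s in Ico x y, (f.tau s * g.fn s - f.fn s * g.tau s) ∂C.chi
      = (∫ s in Ico x y, f.tau s * g.fn s ∂C.chi) - ∫ s in Ico x y, g.tau s * f.fn s ∂C.chi := by
    rw [← integral_sub j1 j2]
    simp only [mul_comm]
  have e2 : ∫ s in Ico x y, (f' s * g.qd s - f.qd s * g' s) ∂C.sigma
      = (∫ s in Ico x y, f' s * g.qd s ∂C.sigma) - ∫ s in Ico x y, g' s * f.qd s ∂C.sigma := by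
    rw [← integral_sub j3 j4]
    simp only [mul_comm]
  have e3 : ∀ μ : Measure ℝ, ∫ s in Ico x y, g.tau s * f.tau s ∂μ
      = ∫ s in Ico x y, f.tau s * g.tau s ∂μ := fun μ => by simp only [mul_comm]
  rw [e3, e3] at h2
  rw [e1, e2]
  unfold bilinWronskian
  linear_combination h1 - h2

/-! ### Uniqueness of solutions -/

theorem eq_zero_on_Icc (hn : C.Atomless) {z : ℂ} {u : C.TLoc} (hu : C.IsSolution z u) {α β x₀ : ℝ}
    (hα : α ∈ oi a b) (hβ : β ∈ oi a b)
    (hsmall : C.sigma.real (Icc α β) * (C.chi.real (Icc α β)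
      + ‖z‖ * (C.rhoPos.real (Icc α β) + C.rhoNeg.real (Icc α β))) < 1)
    (hx₀ : x₀ ∈ Icc α β) (h0 : u.fn x₀ = 0) (h1 : u.qd x₀ = 0) :
    ∀ x ∈ Icc α β, u.fn x = 0 ∧ u.qd x = 0 := by
  obtain ⟨K, hK⟩ := u.exists_norm_qd_le hn hα hβ
  have hsub := Icc_subset_oi hα hβ
  have bound : ∀ {μ : Measure ℝ} {f : ℝ → ℂ} {B : ℝ}, μ (Icc α β) < ⊤ → (∀ s ∈ Icc α β, ‖f s‖ ≤ B) →
      0 ≤ B → ∀ x ∈ Icc α β, ∀ y ∈ Icc α β, ‖∫ s in Ico x y, f s ∂μ‖ ≤ B * μ.real (Icc α β) := by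
    intro μ f B hμ hB hB0 x hx y hy
    have hs : Ico x y ⊆ Icc α β := fun s hs => ⟨hx.1.trans hs.1, hs.2.le.trans hy.2⟩
    refine (norm_setIntegral_le_of_norm_le_const ((measure_mono hs).trans_lt hμ)
      fun s hs' => hB s (hs hs')).trans ?_
    exact mul_le_mul_of_nonneg_left (measureReal_mono hs hμ.ne) hB0
  set m := C.sigma.real (Icc α β) with hm
  set n := C.chi.real (Icc α β) + ‖z‖ * (C.rhoPos.real (Icc α β) + C.rhoNeg.real (Icc α β)) with hn'
  have hm0 : 0 ≤ m := measureReal_nonneg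
  have hn0 : 0 ≤ n := by positivity
  have hK0 : 0 ≤ K := (norm_nonneg _).trans (hK x₀ hx₀)
  have stepfn : ∀ B, 0 ≤ B → (∀ x ∈ Icc α β, ‖u.qd x‖ ≤ B) → ∀ x ∈ Icc α β, ‖u.fn x‖ ≤ B * m := by
    intro B hB0 hB x hx
    rcases le_total x₀ x with h | h
    · have e := u.fn_deriv.sub_eq (hsub hx₀) (hsub hx) h
      rw [h0, sub_zero] at e
      rw [e]
      exact bound (C.sigma_fin α hα β hβ) hB hB0 _ hx₀ _ hx
    · have e := u.fn_deriv.sub_eq (hsub hx) (hsub hx₀) h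
      rw [h0, zero_sub] at e
      rw [← norm_neg, e]
      exact bound (C.sigma_fin α hα β hβ) hB hB0 _ hx _ hx₀
  have total : ∀ B, 0 ≤ B → (∀ x ∈ Icc α β, ‖u.fn x‖ ≤ B) → ∀ x ∈ Icc α β, ∀ y ∈ Icc α β,
      ‖(∫ s in Ico x y, u.fn s ∂C.chi)
      - ((∫ s in Ico x y, u.tau s ∂C.rhoPos) - ∫ s in Ico x y, u.tau s ∂C.rhoNeg)‖ ≤ B * n := by
    intro B hB0 hB x hx y hy
    have hBt : ∀ s ∈ Icc α β, ‖u.tau s‖ ≤ ‖z‖ * B := fun s hs => by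
      rw [hu s (hsub hs), norm_mul]
      exact mul_le_mul_of_nonneg_left (hB s hs) (norm_nonneg _)
    refine (norm_sub_le _ _).trans ((add_le_add (bound (C.chi_fin α hα β hβ) hB hB0 _ hx _ hy)
      ((norm_sub_le _ _).trans (add_le_add
        (bound (C.rhoPos_fin α hα β hβ) hBt (by positivity) _ hx _ hy)
        (bound (C.rhoNeg_fin α hα β hβ) hBt (by positivity) _ hx _ hy)))).trans (le_of_eq ?_))
    rw [hn']
    ring
  have stepqd : ∀ B, 0 ≤ B → (∀ x ∈ Icc α β, ‖u.fn x‖ ≤ B) → ∀ x ∈ Icc α β, ‖u.qd x‖ ≤ B * n := by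
    intro B hB0 hB x hx
    rcases le_total x₀ x with h | h
    · have e := u.qd_sub_eq (hsub hx₀) (hsub hx) h
      rw [h1, sub_zero] at e
      rw [e]
      exact total B hB0 hB _ hx₀ _ hx
    · have e := u.qd_sub_eq (hsub hx) (hsub hx₀) h
      rw [h1, zero_sub] at e
      rw [← norm_neg, e]
      exact total B hB0 hB _ hx _ hx₀
  have iter : ∀ k : ℕ, ∀ x ∈ Icc α β, ‖u.qd x‖ ≤ (m * n) ^ k * K := by
    intro k
    induction k with
    | zero => simpa using hK
    | succ k ih =>
      intro x hx
      refine (stepqd _ (by positivity) (stepfn _ (by positivity) ih) x hx).trans (le_of_eq ?_)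
      ring
  have hqd : ∀ x ∈ Icc α β, ‖u.qd x‖ ≤ 0 := by
    intro x hx
    have ht := (tendsto_pow_atTop_nhds_zero_of_lt_one (by positivity) hsmall).mul_const K
    rw [zero_mul] at ht
    exact ge_of_tendsto ht (Eventually.of_forall fun k => iter k x hx)
  intro x hx
  refine ⟨norm_le_zero_iff.mp ?_, norm_le_zero_iff.mp (hqd x hx)⟩
  simpa using stepfn 0 le_rfl hqd x hx

variable (C) in
theorem exists_Icc_small (hn : C.Atomless) (z : ℂ) {x : ℝ} (hx : x ∈ oi a b) :
    ∃ α ∈ oi a b, ∃ β ∈ oi a b, α < x ∧ x < β ∧ C.sigma.real (Icc α β) * (C.chi.real (Icc α β)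
      + ‖z‖ * (C.rhoPos.real (Icc α β) + C.rhoNeg.real (Icc α β))) < 1 := by
  obtain ⟨ε, hε, hball⟩ := Metric.isOpen_iff.mp (isOpen_oi a b) x hx
  have hmem : ∀ δ, 0 < δ → δ ≤ ε / 2 → x - δ ∈ oi a b ∧ x + δ ∈ oi a b := by
    intro δ h1 h2
    constructor <;> apply hball <;> rw [Real.ball_eq_Ioo] <;> constructor <;> linarith
  obtain ⟨hA, hB⟩ := hmem (ε / 2) (by linarith) le_rfl
  set I := Icc (x - ε / 2) (x + ε / 2) with hI
  set n := C.chi.real I + ‖z‖ * (C.rhoPos.real I + C.rhoNeg.real I) with hn'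
  have hn0 : 0 ≤ n := by positivity
  have hfin : IsFiniteMeasure (C.sigma.restrict I) :=
    ⟨by rw [Measure.restrict_apply_univ]; exact C.sigma_fin _ hA _ hB⟩
  have hnull : NullSingletonClass (C.sigma.restrict I) := by
    have h0 := nullSingletonClass_restrict (a := a) (b := b) hn
    refine ⟨fun y => ?_⟩
    exact (Measure.restrict_mono (Icc_subset_oi hA hB) le_rfl).absolutelyContinuous
      (h0.measure_singleton y)
  have ht := tendsto_measure_Icc (C.sigma.restrict I) x
  have ht' : Tendsto (fun δ => (C.sigma.restrict I (Icc (x - δ) (x + δ))).toReal * n) (𝓝[>] 0)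
      (𝓝 0) := by
    have := ((ENNReal.tendsto_toReal ENNReal.zero_ne_top).comp ht).mul_const n
    simp only [ENNReal.toReal_zero, zero_mul] at this
    exact this.mono_left nhdsWithin_le_nhds
  have hev := (ht'.eventually (gt_mem_nhds zero_lt_one)).and
    (Ioo_mem_nhdsGT (show (0 : ℝ) < ε / 2 by linarith))
  obtain ⟨δ, hδ, hδ0, hδ1⟩ := hev.exists
  obtain ⟨hα, hβ⟩ := hmem δ hδ0 hδ1.le
  have hsub : Icc (x - δ) (x + δ) ⊆ I := Icc_subset_Icc (by linarith) (by linarith)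
  refine ⟨x - δ, hα, x + δ, hβ, by linarith, by linarith, lt_of_le_of_lt ?_ hδ⟩
  rw [Measure.restrict_apply measurableSet_Icc, inter_eq_self_of_subset_left hsub]
  refine mul_le_mul_of_nonneg_left ?_ ENNReal.toReal_nonneg
  rw [hn']
  gcongr
  · exact (C.chi_fin _ hA _ hB).ne
  · exact (C.rhoPos_fin _ hA _ hB).ne
  · exact (C.rhoNeg_fin _ hA _ hB).ne

theorem eq_zero_of_initial (hn : C.Atomless) {z : ℂ} {u : C.TLoc} (hu : C.IsSolution z u) {x₀ : ℝ}
    (hx₀ : x₀ ∈ oi a b) (h0 : u.fn x₀ = 0) (h1 : u.qd x₀ = 0) :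
    ∀ x ∈ oi a b, u.fn x = 0 ∧ u.qd x = 0 := by
  intro x hx
  have key := (oi_ordConnected a b).isPreconnected.induction₂
    (fun x y => (u.fn x = 0 ∧ u.qd x = 0) ↔ (u.fn y = 0 ∧ u.qd y = 0)) ?_
    (fun x y z _ _ _ h h' => h.trans h') (fun x y _ _ h => h.symm) hx₀ hx
  · exact key.mp ⟨h0, h1⟩
  · intro x hx
    obtain ⟨α, hα, β, hβ, hαx, hxβ, hs⟩ := exists_Icc_small C hn z hx
    filter_upwards [mem_nhdsWithin_of_mem_nhds (Icc_mem_nhds hαx hxβ)] with y hy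
    constructor
    · rintro ⟨p, q⟩
      exact eq_zero_on_Icc hn hu hα hβ hs ⟨hαx.le, hxβ.le⟩ p q y hy
    · rintro ⟨p, q⟩
      exact eq_zero_on_Icc hn hu hα hβ hs hy p q x ⟨hαx.le, hxβ.le⟩

end TLoc

end Coeff

end LeftDefinite

end

noncomputable section

namespace LeftDefinite

namespace Coeff

variable {a b : EReal} {C : Coeff a b}

/-! ### Limits at the left endpoint -/

theorem mem_oi_left {y : ℝ} {x : ℝ} (hy : y ∈ oi a b) (hx : x ∈ oi a y) : x ∈ oi a b :=
  oi_mono_right hy hx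

theorem lt_of_mem_oi {y x : ℝ} (hx : x ∈ oi a y) : x < y := by exact_mod_cast hx.2

theorem mem_oi_iff {x y : ℝ} (hx : x ∈ oi a b) : x ∈ oi a y ↔ x < y :=
  ⟨lt_of_mem_oi, fun h => ⟨hx.1, by exact_mod_cast h⟩⟩

theorem oi_subset_oi {x y : ℝ} (hxy : x ≤ y) : oi a x ⊆ oi a y :=
  fun _ ht => ⟨ht.1, ht.2.trans_le (by exact_mod_cast hxy)⟩

theorem oi_inter_Iio {y : ℝ} (hy : y ∈ oi a b) : oi a b ∩ Iio y = oi a y := by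
  ext x
  exact ⟨fun h => (mem_oi_iff h.1).mpr h.2, fun h => ⟨oi_mono_right hy h, lt_of_mem_oi h⟩⟩

instance : C.leftEnd.IsCountablyGenerated :=
  inferInstanceAs (comap (fun x : ℝ => (x : EReal)) (𝓝[>] a)).IsCountablyGenerated

variable (C) in
theorem eventually_mem_leftEnd {y : ℝ} (hy : y ∈ oi a b) : ∀ᶠ x in C.leftEnd, x ∈ oi a y :=
  preimage_mem_comap (Ioo_mem_nhdsGT hy.1)

theorem eventually_leftEnd_iff {P : ℝ → Prop} {d : ℝ} (hd : d ∈ oi a b) :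
    (∀ᶠ x in C.leftEnd, P x) ↔ ∃ y ∈ oi a d, ∀ x ∈ oi a y, P x := by
  constructor
  · intro h
    obtain ⟨s, hs, hsP⟩ := mem_comap.mp h
    obtain ⟨e, he, heS⟩ := (nhdsGT_basis_of_exists_gt ⟨_, hd.1⟩).mem_iff.mp hs
    obtain ⟨y, hay, hy⟩ := EReal.lt_iff_exists_real_btwn.mp (lt_min he hd.1)
    refine ⟨y, ⟨hay, hy.trans_le (min_le_right _ _)⟩, fun x hx => hsP (heS ⟨hx.1, ?_⟩)⟩
    exact hx.2.trans (hy.trans_le (min_le_left _ _))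
  · rintro ⟨y, hy, h⟩
    filter_upwards [C.eventually_mem_leftEnd (mem_oi_left hd hy)] with x hx using h x hx

theorem eventually_forall_leftEnd {P : ℝ → Prop} {d : ℝ} (hd : d ∈ oi a b)
    (h : ∀ᶠ x in C.leftEnd, P x) : ∀ᶠ x : ℝ in C.leftEnd, ∀ t ∈ oi a x, P t := by
  obtain ⟨y, hy, hP⟩ := (eventually_leftEnd_iff hd).mp h
  filter_upwards [C.eventually_mem_leftEnd (mem_oi_left hd hy)] with x hx t ht
  exact hP t (oi_subset_oi (lt_of_mem_oi hx).le ht)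

variable (C) in
theorem leftEnd_neBot {d : ℝ} (hd : d ∈ oi a b) : C.leftEnd.NeBot := by
  refine ⟨fun h => ?_⟩
  have : ∀ᶠ x in C.leftEnd, False := by
    rw [h]
    exact eventually_bot
  obtain ⟨y, hy, hP⟩ := (eventually_leftEnd_iff hd).mp this
  obtain ⟨t, hat, hty⟩ := EReal.lt_iff_exists_real_btwn.mp hy.1
  exact hP t ⟨hat, hty⟩

variable (C) in
theorem aecover_leftEnd (μ : Measure ℝ) {y : ℝ} (hy : y ∈ oi a b) :
    AECover (μ.restrict (oi a y)) C.leftEnd (fun x => Ico x y) := by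
  refine ⟨?_, fun x => measurableSet_Ico⟩
  filter_upwards [ae_restrict_mem (measurableSet_oi a y)] with t ht
  filter_upwards [C.eventually_mem_leftEnd (mem_oi_left hy ht)] with x hx
  exact ⟨(lt_of_mem_oi hx).le, lt_of_mem_oi ht⟩

theorem Ico_subset_oi_left {x y : ℝ} (hx : x ∈ oi a b) : Ico x y ⊆ oi a y :=
  fun _ ht => ⟨hx.1.trans_le (by exact_mod_cast ht.1), by exact_mod_cast ht.2⟩

theorem tendsto_setIntegral_Ico {F : Type*} [NormedAddCommGroup F] [NormedSpace ℝ F]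
    {μ : Measure ℝ} {y : ℝ} (hy : y ∈ oi a b) {k : ℝ → F} (hk : IntegrableOn k (oi a y) μ) :
    Tendsto (fun x => ∫ t in Ico x y, k t ∂μ) C.leftEnd (𝓝 (∫ t in oi a y, k t ∂μ)) := by
  refine ((C.aecover_leftEnd μ hy).integral_tendsto_of_countably_generated hk).congr' ?_
  filter_upwards [C.eventually_mem_leftEnd hy] with x hx
  rw [Measure.restrict_restrict measurableSet_Ico,
    inter_eq_self_of_subset_left (Ico_subset_oi_left (mem_oi_left hy hx))]

theorem oi_union_Ico {x y : ℝ} (hx : x ∈ oi a b) (hxy : x ≤ y) : oi a x ∪ Ico x y = oi a y := by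
  ext t
  constructor
  · rintro (h | h)
    · exact oi_subset_oi hxy h
    · exact Ico_subset_oi_left hx h
  · intro h
    rcases lt_or_ge t x with h' | h'
    · exact Or.inl ⟨h.1, by exact_mod_cast h'⟩
    · exact Or.inr ⟨h', lt_of_mem_oi h⟩

theorem disjoint_oi_Ico {x y : ℝ} : Disjoint (oi a x) (Ico x y) :=
  Set.disjoint_left.mpr fun _ ht ht' => absurd (lt_of_mem_oi ht) (not_lt.mpr ht'.1)

theorem tendsto_setIntegral_oi {F : Type*} [NormedAddCommGroup F] [NormedSpace ℝ F]
    {μ : Measure ℝ} {y : ℝ} (hy : y ∈ oi a b) {k : ℝ → F} (hk : IntegrableOn k (oi a y) μ) :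
    Tendsto (fun x : ℝ => ∫ t in oi a x, k t ∂μ) C.leftEnd (𝓝 0) := by
  have h := (tendsto_setIntegral_Ico (C := C) hy hk).const_sub (∫ t in oi a y, k t ∂μ)
  rw [sub_self] at h
  refine h.congr' ?_
  filter_upwards [C.eventually_mem_leftEnd hy] with x hx
  have hxb := mem_oi_left hy hx
  rw [← oi_union_Ico hxb (lt_of_mem_oi hx).le, setIntegral_union disjoint_oi_Ico measurableSet_Ico
    (hk.mono_set (oi_subset_oi (lt_of_mem_oi hx).le)) (hk.mono_set (Ico_subset_oi_left hxb)),
    add_sub_cancel_right]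

/-! ### The form of `H¹` on subintervals -/

variable (C) in
/-- `f ∈ L²(J; χ)` and `f₁ ∈ L²(J; ς)`. -/
def L2On (J : Set ℝ) (f f₁ : ℝ → ℂ) : Prop :=
  MemLp f 2 (C.chi.restrict J) ∧ MemLp f₁ 2 (C.sigma.restrict J)

variable (C) in
/-- `∫_J |f|² dχ + ∫_J |f₁|² dς`. -/
def energy (J : Set ℝ) (f f₁ : ℝ → ℂ) : ℝ :=
  (∫ x in J, ‖f x‖ ^ 2 ∂C.chi) + ∫ x in J, ‖f₁ x‖ ^ 2 ∂C.sigma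

variable (C) in
/-- `∫_J f g dχ + ∫_J f₁ g₁ dς`. -/
def form (J : Set ℝ) (f f₁ g g₁ : ℝ → ℂ) : ℂ :=
  (∫ x in J, f x * g x ∂C.chi) + ∫ x in J, f₁ x * g₁ x ∂C.sigma

theorem energy_nonneg (J : Set ℝ) (f f₁ : ℝ → ℂ) : 0 ≤ C.energy J f f₁ :=
  add_nonneg (integral_nonneg fun _ => sq_nonneg _) (integral_nonneg fun _ => sq_nonneg _)

theorem L2On.mono {J J' : Set ℝ} {f f₁ : ℝ → ℂ} (h : C.L2On J f f₁) (hJ : J' ⊆ J) :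
    C.L2On J' f f₁ :=
  ⟨h.1.mono_measure (Measure.restrict_mono hJ le_rfl),
    h.2.mono_measure (Measure.restrict_mono hJ le_rfl)⟩

theorem L2On.integrableOn_sq {J : Set ℝ} {f f₁ : ℝ → ℂ} (h : C.L2On J f f₁) :
    IntegrableOn (fun x => ‖f x‖ ^ 2) J C.chi ∧ IntegrableOn (fun x => ‖f₁ x‖ ^ 2) J C.sigma :=
  ⟨(memLp_two_iff_integrable_sq_norm h.1.1).mp h.1,
    (memLp_two_iff_integrable_sq_norm h.2.1).mp h.2⟩

theorem L2On.integrableOn_mul {J : Set ℝ} {f f₁ g g₁ : ℝ → ℂ} (hf : C.L2On J f f₁)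
    (hg : C.L2On J g g₁) : IntegrableOn (fun x => f x * g x) J C.chi ∧
    IntegrableOn (fun x => f₁ x * g₁ x) J C.sigma :=
  ⟨MemLp.integrable_mul (p := 2) (q := 2) hf.1 hg.1,
    MemLp.integrable_mul (p := 2) (q := 2) hf.2 hg.2⟩

theorem memLp_union {μ : Measure ℝ} {f : ℝ → ℂ} {s t : Set ℝ} (hs : MemLp f 2 (μ.restrict s))
    (ht : MemLp f 2 (μ.restrict t)) : MemLp f 2 (μ.restrict (s ∪ t)) := by
  have hm : AEStronglyMeasurable f (μ.restrict (s ∪ t)) :=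
    aestronglyMeasurable_union_iff.mpr ⟨hs.1, ht.1⟩
  rw [memLp_two_iff_integrable_sq_norm hm]
  exact IntegrableOn.union ((memLp_two_iff_integrable_sq_norm hs.1).mp hs)
    ((memLp_two_iff_integrable_sq_norm ht.1).mp ht)

theorem L2On.union {J J' : Set ℝ} {f f₁ : ℝ → ℂ} (h : C.L2On J f f₁) (h' : C.L2On J' f f₁) :
    C.L2On (J ∪ J') f f₁ := ⟨memLp_union h.1 h'.1, memLp_union h.2 h'.2⟩

theorem L2On.conj {J : Set ℝ} {f f₁ : ℝ → ℂ} (h : C.L2On J f f₁) :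
    C.L2On J (fun x => conj (f x)) (fun x => conj (f₁ x)) := ⟨h.1.star, h.2.star⟩

theorem L2On.const_mul {J : Set ℝ} {f f₁ : ℝ → ℂ} (h : C.L2On J f f₁) (r : ℂ) :
    C.L2On J (fun x => r * f x) (fun x => r * f₁ x) := ⟨h.1.const_mul r, h.2.const_mul r⟩

theorem L2On.congr {J : Set ℝ} (hJ : MeasurableSet J) {f f₁ g g₁ : ℝ → ℂ} (h : C.L2On J f f₁)
    (h0 : ∀ x ∈ J, f x = g x) (h1 : ∀ x ∈ J, f₁ x = g₁ x) : C.L2On J g g₁ := by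
  constructor
  · refine (memLp_congr_ae ?_).mp h.1
    filter_upwards [ae_restrict_mem hJ] with x hx using h0 x hx
  · refine (memLp_congr_ae ?_).mp h.2
    filter_upwards [ae_restrict_mem hJ] with x hx using h1 x hx

theorem energy_mono {J J' : Set ℝ} {f f₁ : ℝ → ℂ} (h : C.L2On J f f₁) (hJ : J' ⊆ J) :
    C.energy J' f f₁ ≤ C.energy J f f₁ :=
  add_le_add
    (setIntegral_mono_set h.integrableOn_sq.1 (Eventually.of_forall fun _ => sq_nonneg _)
      (Eventually.of_forall hJ))
    (setIntegral_mono_set h.integrableOn_sq.2 (Eventually.of_forall fun _ => sq_nonneg _)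
      (Eventually.of_forall hJ))

theorem norm_integral_mul_le {μ : Measure ℝ} {f g : ℝ → ℂ} (hf : MemLp f 2 μ) (hg : MemLp g 2 μ) :
    ‖∫ x, f x * g x ∂μ‖ ≤ √(∫ x, ‖f x‖ ^ 2 ∂μ) * √(∫ x, ‖g x‖ ^ 2 ∂μ) := by
  have hf' : MemLp (fun x => conj (f x)) 2 μ := hf.star
  have h := norm_inner_le_norm (𝕜 := ℂ) (hf'.toLp _) (hg.toLp _)
  rw [← Real.sqrt_sq (norm_nonneg (hf'.toLp _)), ← Real.sqrt_sq (norm_nonneg (hg.toLp _)),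
    sq_norm_toLp, sq_norm_toLp] at h
  simp only [RCLike.norm_conj] at h
  refine le_trans (le_of_eq (congrArg norm ?_)) h
  rw [L2.inner_def]
  refine integral_congr_ae ?_
  filter_upwards [hf'.coeFn_toLp, hg.coeFn_toLp] with x h1 h2
  rw [h1, h2, RCLike.inner_apply, Complex.conj_conj, mul_comm]

theorem sq_norm_form_le {J : Set ℝ} {f f₁ g g₁ : ℝ → ℂ} (hf : C.L2On J f f₁)
    (hg : C.L2On J g g₁) :
    ‖C.form J f f₁ g g₁‖ ^ 2 ≤ C.energy J f f₁ * C.energy J g g₁ := by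
  have h1 := norm_integral_mul_le hf.1 hg.1
  have h2 := norm_integral_mul_le hf.2 hg.2
  have h3 : ‖C.form J f f₁ g g₁‖ ≤ _ := (norm_add_le _ _).trans (add_le_add h1 h2)
  unfold energy
  set A := ∫ x in J, ‖f x‖ ^ 2 ∂C.chi
  set B := ∫ x in J, ‖f₁ x‖ ^ 2 ∂C.sigma
  set A' := ∫ x in J, ‖g x‖ ^ 2 ∂C.chi
  set B' := ∫ x in J, ‖g₁ x‖ ^ 2 ∂C.sigma
  have hA : 0 ≤ A := integral_nonneg fun _ => sq_nonneg _
  have hB : 0 ≤ B := integral_nonneg fun _ => sq_nonneg _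
  have hA' : 0 ≤ A' := integral_nonneg fun _ => sq_nonneg _
  have hB' : 0 ≤ B' := integral_nonneg fun _ => sq_nonneg _
  refine (pow_le_pow_left₀ (norm_nonneg _) h3 2).trans ?_
  have e : (A + B) * (A' + B') - (√A * √A' + √B * √B') ^ 2 = (√A * √B' - √B * √A') ^ 2 := by
    conv_lhs => rw [← Real.sq_sqrt hA, ← Real.sq_sqrt hB, ← Real.sq_sqrt hA', ← Real.sq_sqrt hB']
    simp only [Real.sqrt_sq (Real.sqrt_nonneg _)]
    ring
  linarith [sq_nonneg (√A * √B' - √B * √A')]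

theorem energy_le_of_forall {J : Set ℝ} (hJ : MeasurableSet J) {f f₁ g g₁ k k₁ : ℝ → ℂ}
    (hf : C.L2On J f f₁) (hg : C.L2On J g g₁) (hk : C.L2On J k k₁) {A B D : ℝ}
    (h0 : ∀ x ∈ J, A * ‖f x‖ ^ 2 ≤ B * ‖g x‖ ^ 2 + D * ‖k x‖ ^ 2)
    (h1 : ∀ x ∈ J, A * ‖f₁ x‖ ^ 2 ≤ B * ‖g₁ x‖ ^ 2 + D * ‖k₁ x‖ ^ 2) :
    A * C.energy J f f₁ ≤ B * C.energy J g g₁ + D * C.energy J k k₁ := by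
  have e0 := setIntegral_mono_on (hf.integrableOn_sq.1.const_mul A)
    ((hg.integrableOn_sq.1.const_mul B).add (hk.integrableOn_sq.1.const_mul D)) hJ h0
  have e1 := setIntegral_mono_on (hf.integrableOn_sq.2.const_mul A)
    ((hg.integrableOn_sq.2.const_mul B).add (hk.integrableOn_sq.2.const_mul D)) hJ h1
  simp only [Pi.add_apply] at e0 e1
  rw [integral_add (hg.integrableOn_sq.1.const_mul B) (hk.integrableOn_sq.1.const_mul D),
    integral_const_mul, integral_const_mul, integral_const_mul] at e0
  rw [integral_add (hg.integrableOn_sq.2.const_mul B) (hk.integrableOn_sq.2.const_mul D),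
    integral_const_mul, integral_const_mul, integral_const_mul] at e1
  unfold energy
  linarith

theorem tendsto_energy_oi {y : ℝ} (hy : y ∈ oi a b) {f f₁ : ℝ → ℂ} (h : C.L2On (oi a y) f f₁) :
    Tendsto (fun x : ℝ => C.energy (oi a x) f f₁) C.leftEnd (𝓝 0) := by
  have := (tendsto_setIntegral_oi (C := C) hy h.integrableOn_sq.1).add
    (tendsto_setIntegral_oi (C := C) hy h.integrableOn_sq.2)
  rwa [add_zero] at this

theorem tendsto_form_Ico {y : ℝ} (hy : y ∈ oi a b) {f f₁ g g₁ : ℝ → ℂ}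
    (hf : C.L2On (oi a y) f f₁) (hg : C.L2On (oi a y) g g₁) :
    Tendsto (fun x => C.form (Ico x y) f f₁ g g₁) C.leftEnd (𝓝 (C.form (oi a y) f f₁ g g₁)) :=
  (tendsto_setIntegral_Ico hy (hf.integrableOn_mul hg).1).add
    (tendsto_setIntegral_Ico hy (hf.integrableOn_mul hg).2)

theorem l2On_of_energy_le {y : ℝ} (hy : y ∈ oi a b) {f f₁ : ℝ → ℂ} {K : ℝ}
    (h : ∀ x ∈ oi a b, C.L2On (Icc x y) f f₁)
    (hm : AEStronglyMeasurable f (C.chi.restrict (oi a y)) ∧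
      AEStronglyMeasurable f₁ (C.sigma.restrict (oi a y)))
    (hK : ∀ x ∈ oi a y, C.energy (Ico x y) f f₁ ≤ K) : C.L2On (oi a y) f f₁ := by
  have := C.leftEnd_neBot hy
  have aux : ∀ {μ : Measure ℝ} {g : ℝ → ℂ}, AEStronglyMeasurable g (μ.restrict (oi a y)) →
      (∀ x ∈ oi a b, IntegrableOn (fun t => ‖g t‖ ^ 2) (Ico x y) μ) →
      (∀ x ∈ oi a y, ∫ t in Ico x y, ‖g t‖ ^ 2 ∂μ ≤ K) → MemLp g 2 (μ.restrict (oi a y)) := by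
    intro μ g hm h1 h2
    rw [memLp_two_iff_integrable_sq_norm hm]
    have hcov := C.aecover_leftEnd μ hy
    have hcov' : AECover (μ.restrict (oi a y)) C.leftEnd (fun x => Ico x y ∩ {_t : ℝ | x ∈ oi a b}) := by
      refine ⟨?_, fun x => measurableSet_Ico.inter (MeasurableSet.const _)⟩
      filter_upwards [hcov.ae_eventually_mem] with t ht
      filter_upwards [ht, C.eventually_mem_leftEnd hy] with x hx hx'
      exact ⟨hx, mem_oi_left hy hx'⟩
    refine hcov'.integrable_of_integral_norm_bounded K (fun x => ?_) ?_
    · by_cases hx : x ∈ oi a b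
      · have : Ico x y ∩ {_t : ℝ | x ∈ oi a b} = Ico x y := by simp [hx]
        rw [this]
        exact (h1 x hx).mono_measure Measure.restrict_le_self
      · have : Ico x y ∩ {_t : ℝ | x ∈ oi a b} = ∅ := by simp [hx]
        rw [this]
        exact integrableOn_empty
    · filter_upwards [C.eventually_mem_leftEnd hy] with x hx
      have hxb := mem_oi_left hy hx
      have : Ico x y ∩ {_t : ℝ | x ∈ oi a b} = Ico x y := by simp [hxb]
      rw [this, Measure.restrict_restrict measurableSet_Ico,
        inter_eq_self_of_subset_left (Ico_subset_oi_left hxb)]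
      simpa using h2 x hx
  have hI : ∀ x ∈ oi a b, C.L2On (Ico x y) f f₁ := fun x hx => (h x hx).mono Ico_subset_Icc_self
  constructor
  · refine aux hm.1 (fun x hx => (hI x hx).integrableOn_sq.1) fun x hx => le_trans ?_ (hK x hx)
    exact le_add_of_nonneg_right (integral_nonneg fun _ => sq_nonneg _)
  · refine aux hm.2 (fun x hx => (hI x hx).integrableOn_sq.2) fun x hx => le_trans ?_ (hK x hx)
    exact le_add_of_nonneg_left (integral_nonneg fun _ => sq_nonneg _)

theorem hasRN_aestronglyMeasurable {μ : Measure ℝ} {h : ℝ → ℂ} (hh : LocInt (oi a b) μ h) :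
    AEStronglyMeasurable h (μ.restrict (oi a b)) := by
  let J : Set (ℚ × ℚ) := {p | (p.1 : ℝ) ∈ oi a b ∧ (p.2 : ℝ) ∈ oi a b}
  have hcov : oi a b ⊆ ⋃ p : J, Icc (p.1.1 : ℝ) (p.1.2 : ℝ) := by
    intro x hx
    obtain ⟨ε, hε, hball⟩ := Metric.isOpen_iff.mp (isOpen_oi a b) x hx
    obtain ⟨p, hp1, hp2⟩ := exists_rat_btwn (show x - ε < x by linarith)
    obtain ⟨q, hq1, hq2⟩ := exists_rat_btwn (show x < x + ε by linarith)
    refine mem_iUnion.mpr ⟨⟨(p, q), hball ?_, hball ?_⟩, hp2.le, hq1.le⟩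
    · rw [Real.ball_eq_Ioo]
      exact ⟨hp1, by simp only; linarith⟩
    · rw [Real.ball_eq_Ioo]
      exact ⟨by simp only; linarith, hq2⟩
  exact (AEStronglyMeasurable.iUnion fun p : J =>
    (hh _ p.2.1 _ p.2.2).1).mono_measure (Measure.restrict_mono hcov le_rfl)

namespace TLoc

theorem l2On_Icc (hn : C.Atomless) (u : C.TLoc) {α β : ℝ} (hα : α ∈ oi a b) (hβ : β ∈ oi a b) :
    C.L2On (Icc α β) u.fn u.qd := by
  have f1 : IsFiniteMeasure (C.chi.restrict (Icc α β)) :=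
    ⟨by rw [Measure.restrict_apply_univ]; exact C.chi_fin α hα β hβ⟩
  have f2 : IsFiniteMeasure (C.sigma.restrict (Icc α β)) :=
    ⟨by rw [Measure.restrict_apply_univ]; exact C.sigma_fin α hα β hβ⟩
  obtain ⟨K, hK⟩ := u.exists_norm_qd_le hn hα hβ
  have hc := (u.continuousOn_fn hn).mono (Icc_subset_oi hα hβ)
  obtain ⟨K', hK'⟩ := isCompact_Icc.exists_bound_of_continuousOn hc
  constructor
  · refine MemLp.of_bound (hc.aestronglyMeasurable measurableSet_Icc) K' ?_
    filter_upwards [ae_restrict_mem measurableSet_Icc] with x hx using hK' x hx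
  · refine MemLp.of_bound (u.fn_deriv.1 α hα β hβ).1 K ?_
    filter_upwards [ae_restrict_mem measurableSet_Icc] with x hx using hK x hx

theorem aestronglyMeasurable (hn : C.Atomless) (u : C.TLoc) {y : ℝ} (hy : y ∈ oi a b) :
    AEStronglyMeasurable u.fn (C.chi.restrict (oi a y)) ∧
      AEStronglyMeasurable u.qd (C.sigma.restrict (oi a y)) :=
  ⟨((u.continuousOn_fn hn).mono (oi_mono_right hy)).aestronglyMeasurable (measurableSet_oi a y),
    (hasRN_aestronglyMeasurable u.fn_deriv.1).mono_measure
      (Measure.restrict_mono (oi_mono_right hy) le_rfl)⟩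

theorem l2On_of_near {f h : ℝ → ℂ} (hf : C.MemH1NearLeft f) (hh : HasRN (oi a b) C.sigma f h) :
    ∃ d ∈ oi a b, C.L2On (oi a d) f h := by
  obtain ⟨d, hd, k, hk, h1, h2⟩ := hf
  rw [oi_inter_Iio hd] at h1 h2
  refine ⟨d, hd, h1, (memLp_congr_ae ?_).mp h2⟩
  exact ae_mono (Measure.restrict_mono (oi_mono_right hd) le_rfl) (hk.ae_eq hh)

theorem l2On_oi (hn : C.Atomless) (u : C.TLoc) (hu : C.MemH1NearLeft u.fn) {y : ℝ}
    (hy : y ∈ oi a b) : C.L2On (oi a y) u.fn u.qd := by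
  obtain ⟨d, hd, h⟩ := l2On_of_near hu u.fn_deriv
  refine (h.union (u.l2On_Icc hn hd hy)).mono fun x hx => ?_
  rcases lt_or_ge x d with h' | h'
  · exact Or.inl ⟨hx.1, by exact_mod_cast h'⟩
  · exact Or.inr ⟨h', (lt_of_mem_oi hx).le⟩

theorem memH1NearLeft_of_l2On (u : C.TLoc) {y : ℝ} (hy : y ∈ oi a b)
    (h : C.L2On (oi a y) u.fn u.qd) : C.MemH1NearLeft u.fn := by
  refine ⟨y, hy, u.qd, u.fn_deriv, ?_⟩
  rw [oi_inter_Iio hy]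
  exact h

theorem tau_hasRN {z : ℂ} {u : C.TLoc} (hu : C.IsSolution z u) :
    HasRN (oi a b) C.sigma u.tau (fun x => z * u.qd x) := by
  have h := u.fn_deriv.smul z
  refine ⟨h.1, fun c hc x hx => ?_⟩
  rw [hu x hx, hu c hc]
  exact h.2 c hc x hx

/-- The Lagrange identity for solutions. -/
theorem bilinWronskian_sub_eq_form (hn : C.Atomless) {z ζ : ℂ} {f g : C.TLoc}
    (hf : C.IsSolution z f) (hg : C.IsSolution ζ g) {x y : ℝ} (hx : x ∈ oi a b) (hy : y ∈ oi a b)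
    (hxy : x ≤ y) : bilinWronskian f g y - bilinWronskian f g x
      = (z - ζ) * C.form (Ico x y) f.fn f.qd g.fn g.qd := by
  rw [bilinWronskian_sub_eq hn f g (tau_hasRN hf) (tau_hasRN hg) hx hy hxy, form, mul_add,
    ← integral_const_mul, ← integral_const_mul]
  congr 1
  · refine setIntegral_congr_fun measurableSet_Ico fun t ht => ?_
    simp only [hf t (Ico_subset_oi hx hy ht), hg t (Ico_subset_oi hx hy ht)]
    ring
  · congr 1
    ext t
    ring

theorem tendsto_bilinWronskian (hn : C.Atomless) (f g : C.TLoc) {f' g' : ℝ → ℂ}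
    (hf : HasRN (oi a b) C.sigma f.tau f') (hg : HasRN (oi a b) C.sigma g.tau g') {y : ℝ}
    (hy : y ∈ oi a b) (f0 : C.L2On (oi a y) f.fn f.qd) (f1 : C.L2On (oi a y) f.tau f')
    (g0 : C.L2On (oi a y) g.fn g.qd) (g1 : C.L2On (oi a y) g.tau g') :
    ∃ L, Tendsto (bilinWronskian f g) C.leftEnd (𝓝 L) := by
  have i1 : IntegrableOn (fun s => f.tau s * g.fn s - f.fn s * g.tau s) (oi a y) C.chi :=
    (f1.integrableOn_mul g0).1.sub (f0.integrableOn_mul g1).1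
  have i2 : IntegrableOn (fun s => f' s * g.qd s - f.qd s * g' s) (oi a y) C.sigma :=
    (f1.integrableOn_mul g0).2.sub (f0.integrableOn_mul g1).2
  refine ⟨_, (((tendsto_setIntegral_Ico (C := C) hy i1).add
    (tendsto_setIntegral_Ico hy i2)).const_sub (bilinWronskian f g y)).congr' ?_⟩
  filter_upwards [C.eventually_mem_leftEnd hy] with x hx
  rw [← bilinWronskian_sub_eq hn f g hf hg (mem_oi_left hy hx) hy (lt_of_mem_oi hx).le]
  ring

theorem tendsto_bilinWronskian_solution (hn : C.Atomless) {z ζ : ℂ} {f g : C.TLoc}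
    (hf : C.IsSolution z f) (hg : C.IsSolution ζ g) {y : ℝ}
    (hy : y ∈ oi a b) (f0 : C.L2On (oi a y) f.fn f.qd) (g0 : C.L2On (oi a y) g.fn g.qd) :
    Tendsto (bilinWronskian f g) C.leftEnd
      (𝓝 (bilinWronskian f g y - (z - ζ) * C.form (oi a y) f.fn f.qd g.fn g.qd)) := by
  refine (((tendsto_form_Ico hy f0 g0).const_mul (z - ζ)).const_sub _).congr' ?_
  filter_upwards [C.eventually_mem_leftEnd hy] with x hx
  rw [← bilinWronskian_sub_eq_form hn hf hg (mem_oi_left hy hx) hy (lt_of_mem_oi hx).le]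
  ring

end TLoc

end Coeff

end LeftDefinite

end

noncomputable section

namespace LeftDefinite

namespace Coeff

variable {a b : EReal} {C : Coeff a b}

namespace TLoc

/-! ### Complex conjugates -/

theorem orientedIntegral_conj (μ : Measure ℝ) (h : ℝ → ℂ) (c x : ℝ) :
    orientedIntegral μ (fun s => conj (h s)) c x = conj (orientedIntegral μ h c x) := by
  unfold orientedIntegral
  split_ifs
  · exact integral_conj
  · rw [map_neg]
    exact congrArg _ integral_conj

/-- The complex conjugate of a pair in `T_loc`. -/
def conjugate (u : C.TLoc) : C.TLoc where
  fn x := conj (u.fn x)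
  qd x := conj (u.qd x)
  tau x := conj (u.tau x)
  fn_deriv := u.fn_deriv.conj
  tau_ac := by
    obtain ⟨h, hh⟩ := u.tau_ac
    exact ⟨_, hh.conj⟩
  tau_eq c hc x hx := by
    rw [rhoIntegral, orientedIntegral_conj, orientedIntegral_conj, orientedIntegral_conj]
    have h := congrArg conj (u.tau_eq c hc x hx)
    rw [rhoIntegral] at h
    simpa only [map_add, map_neg, map_sub] using h

theorem wronskian_eq (f g : C.TLoc) (x : ℝ) : wronskian f g x = bilinWronskian f g.conjugate x :=
  rfl

/-! ### The boundary values of Wronskians -/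

theorem bilinWronskian_plucker (f g k l : C.TLoc) (x : ℝ) :
    bilinWronskian f g x * bilinWronskian k l x = bilinWronskian f k x * bilinWronskian g l x
      - bilinWronskian f l x * bilinWronskian g k x := by
  unfold bilinWronskian
  ring

theorem bilinWronskian_mul_tau (f g k : C.TLoc) (x : ℝ) :
    bilinWronskian f g x * k.tau x
      = bilinWronskian f k x * g.tau x - bilinWronskian g k x * f.tau x := by
  unfold bilinWronskian
  ring

theorem bilinWronskian_mul_qd (f g k : C.TLoc) (x : ℝ) :
    bilinWronskian f g x * k.qd x
      = bilinWronskian f k x * g.qd x - bilinWronskian g k x * f.qd x := by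
  unfold bilinWronskian
  ring

theorem l2On_of_memH1On {f h : ℝ → ℂ} (hf : C.MemH1On (oi a b) f)
    (hh : HasRN (oi a b) C.sigma f h) {y : ℝ} (hy : y ∈ oi a b) : C.L2On (oi a y) f h := by
  obtain ⟨k, hk, h1, h2⟩ := hf
  have : C.L2On (oi a b) f h := ⟨h1, (memLp_congr_ae (hk.ae_eq hh)).mp h2⟩
  exact this.mono (oi_mono_right hy)

theorem tendsto_bilinWronskian_limitCircle (hn : C.Atomless) (S : C.SeparatedBC)
    (hLC : C.LimitCircleLeft) {z ζ : ℂ} {f g : C.TLoc} (hf : C.IsSolution z f)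
    (hg : C.IsSolution ζ g) (hfS : S.LiesInNearLeft f) (hgS : S.LiesInNearLeft g) {y : ℝ}
    (hy : y ∈ oi a b) : Tendsto (bilinWronskian f g) C.leftEnd (𝓝 0) := by
  obtain ⟨-, k, ⟨hk0, hk1⟩, hkv⟩ := S.left_lc hLC
  obtain ⟨v', hv'⟩ := S.va.tau_ac
  obtain ⟨k', hk'⟩ := k.tau_ac
  have k0 := l2On_of_memH1On hk0 k.fn_deriv hy
  have k1 := l2On_of_memH1On hk1 hk' hy
  have v0 := (l2On_of_memH1On S.va_mem.1 S.va.fn_deriv hy).conj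
  have v1 := (l2On_of_memH1On S.va_mem.2 hv' hy).conj
  obtain ⟨L, hL⟩ := tendsto_bilinWronskian hn k S.va.conjugate hk' hv'.conj hy k0 k1 v0 v1
  have hL0 : L ≠ 0 := by
    rintro rfl
    exact hkv hL
  have sol : ∀ {w : ℂ} {h : C.TLoc}, C.IsSolution w h → S.LiesInNearLeft h →
      ∃ M, Tendsto (bilinWronskian h k) C.leftEnd (𝓝 M) := by
    intro w h hh hS
    have h0 := h.l2On_oi hn hS.1 hy
    have h1 : C.L2On (oi a y) h.tau (fun x => w * h.qd x) :=
      (h0.const_mul w).congr (measurableSet_oi a y)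
        (fun x hx => (hh x (mem_oi_left hy hx)).symm) (fun _ _ => rfl)
    exact tendsto_bilinWronskian hn h k (tau_hasRN hh) hk' hy h0 h1 k0 k1
  obtain ⟨M, hM⟩ := sol hf hfS
  obtain ⟨M', hM'⟩ := sol hg hgS
  have hfv : Tendsto (bilinWronskian f S.va.conjugate) C.leftEnd (𝓝 0) := hfS.2 hLC
  have hgv : Tendsto (bilinWronskian g S.va.conjugate) C.leftEnd (𝓝 0) := hgS.2 hLC
  have hprod : Tendsto (fun x => bilinWronskian f g x * bilinWronskian k S.va.conjugate x)
      C.leftEnd (𝓝 0) := by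
    have := (hM.mul hgv).sub (hfv.mul hM')
    simp only [mul_zero, zero_mul, sub_zero] at this
    exact this.congr fun x => (bilinWronskian_plucker f g k S.va.conjugate x).symm
  have hdiv := hprod.div hL hL0
  rw [zero_div] at hdiv
  refine hdiv.congr' ?_
  filter_upwards [hL.eventually_ne hL0] with x hx
  simp only [Pi.div_apply]
  field_simp

theorem sq_norm_sub_le_two (x y : ℂ) : ‖x - y‖ ^ 2 ≤ 2 * ‖x‖ ^ 2 + 2 * ‖y‖ ^ 2 := by
  have := norm_sub_le x y
  nlinarith [sq_nonneg (‖x‖ - ‖y‖), norm_nonneg (x - y), norm_nonneg x, norm_nonneg y]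

theorem bilinWronskian_sub_eq_form_right (hn : C.Atomless) {z₀ : ℂ} {f p : C.TLoc} {f' : ℝ → ℂ}
    (hf : HasRN (oi a b) C.sigma f.tau f') (hp : C.IsSolution z₀ p) {x y : ℝ} (hx : x ∈ oi a b)
    (hy : y ∈ oi a b) (hxy : x ≤ y) : bilinWronskian f p y - bilinWronskian f p x
      = C.form (Ico x y) (fun t => f.tau t - z₀ * f.fn t) (fun t => f' t - z₀ * f.qd t)
        p.fn p.qd := by
  rw [bilinWronskian_sub_eq hn f p hf (tau_hasRN hp) hx hy hxy, form]
  congr 1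
  · refine setIntegral_congr_fun measurableSet_Ico fun t ht => ?_
    simp only [hp t (Ico_subset_oi hx hy ht)]
    ring
  · congr 1
    ext t
    ring

variable (C) in
/-- The pair `f` and its quasi-derivatives are square integrable on `(a, d)`. -/
def L2Left (d : ℝ) (f : C.TLoc) (f' : ℝ → ℂ) : Prop :=
  HasRN (oi a b) C.sigma f.tau f' ∧ C.L2On (oi a d) f.fn f.qd ∧ C.L2On (oi a d) f.tau f'

theorem L2Left.mono {d e : ℝ} {f : C.TLoc} {f' : ℝ → ℂ} (h : L2Left C d f f') (he : e ≤ d) :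
    L2Left C e f f' :=
  ⟨h.1, h.2.1.mono (oi_subset_oi he), h.2.2.mono (oi_subset_oi he)⟩

theorem L2Left.sub_mul {d : ℝ} {f : C.TLoc} {f' : ℝ → ℂ} (h : L2Left C d f f') (z₀ : ℂ) :
    C.L2On (oi a d) (fun t => f.tau t - z₀ * f.fn t) (fun t => f' t - z₀ * f.qd t) :=
  ⟨h.2.2.1.sub (h.2.1.1.const_mul z₀), h.2.2.2.sub (h.2.1.2.const_mul z₀)⟩

theorem L2Left.div {d : ℝ} {f : C.TLoc} {f' : ℝ → ℂ} (h : L2Left C d f f') (z₀ : ℂ) :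
    C.L2On (oi a d) (fun t => z₀⁻¹ * f.tau t) f.qd :=
  ⟨h.2.2.1.const_mul _, h.2.1.2⟩

theorem L2Left.of_solution {z : ℂ} {f : C.TLoc} (hf : C.IsSolution z f) {d : ℝ}
    (hd : d ∈ oi a b) (f0 : C.L2On (oi a d) f.fn f.qd) :
    L2Left C d f (fun x => z * f.qd x) :=
  ⟨tau_hasRN hf, f0, (f0.const_mul z).congr (measurableSet_oi a d)
    (fun x hx => (hf x (mem_oi_left hd hx)).symm) (fun _ _ => rfl)⟩

theorem tendsto_bilinWronskian_right (hn : C.Atomless) {z₀ : ℂ} {f p : C.TLoc} {f' : ℝ → ℂ}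
    {y : ℝ} (hy : y ∈ oi a b) (hf : L2Left C y f f') (hp : C.IsSolution z₀ p)
    (p0 : C.L2On (oi a y) p.fn p.qd) :
    Tendsto (bilinWronskian f p) C.leftEnd (𝓝 (bilinWronskian f p y - C.form (oi a y)
      (fun t => f.tau t - z₀ * f.fn t) (fun t => f' t - z₀ * f.qd t) p.fn p.qd)) := by
  refine ((tendsto_form_Ico hy (hf.sub_mul z₀) p0).const_sub _).congr' ?_
  filter_upwards [C.eventually_mem_leftEnd hy] with x hx
  rw [← bilinWronskian_sub_eq_form_right hn hf.1 hp (mem_oi_left hy hx) hy (lt_of_mem_oi hx).le]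
  ring

/-- If the Wronskian of a pair in `H¹` near `a` and a solution in `H¹` near `a` does not vanish at
`a`, then all solutions with the same spectral parameter lie in `H¹` near `a`. -/
theorem l2On_of_tendsto_ne_zero (hn : C.Atomless) {z₀ : ℂ} (hz₀ : z₀ ≠ 0) {f p u : C.TLoc}
    {f' : ℝ → ℂ} (hp : C.IsSolution z₀ p) (hu : C.IsSolution z₀ u) {d : ℝ}
    (hd : d ∈ oi a b) (hf : L2Left C d f f') (p0 : C.L2On (oi a d) p.fn p.qd)
    {L : ℂ} (hL : Tendsto (bilinWronskian f p) C.leftEnd (𝓝 L)) (hL0 : L ≠ 0) :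
    C.MemH1NearLeft u.fn := by
  have hLpos : 0 < ‖L‖ := norm_pos_iff.mpr hL0
  set k : ℝ → ℂ := fun t => f.tau t - z₀ * f.fn t with hk
  set k' : ℝ → ℂ := fun t => f' t - z₀ * f.qd t with hk'
  have ev1 := eventually_forall_leftEnd hd
    (hL.norm.eventually_const_lt (show ‖L‖ / 2 < ‖L‖ by linarith))
  have ev2 : ∀ᶠ x : ℝ in C.leftEnd, 4 * (C.energy (oi a x) k k'
      * C.energy (oi a x) p.fn p.qd) < ‖L‖ ^ 2 / 8 := by
    have := ((tendsto_energy_oi hd (hf.sub_mul z₀)).mul (tendsto_energy_oi hd p0)).const_mul 4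
    simp only [mul_zero] at this
    exact this.eventually_lt_const (by positivity)
  have := C.leftEnd_neBot hd
  obtain ⟨x₀, hx₁, hx₂, hx₃⟩ := (ev1.and (ev2.and (C.eventually_mem_leftEnd hd))).exists
  have hx₀ : x₀ ∈ oi a b := mem_oi_left hd hx₃
  have k0 := (hf.mono (lt_of_mem_oi hx₃).le).sub_mul z₀
  have m0 := (hf.mono (lt_of_mem_oi hx₃).le).div z₀
  replace p0 := p0.mono (oi_subset_oi (lt_of_mem_oi hx₃).le)
  set Ek := C.energy (oi a x₀) k k' with hEk
  set Em := C.energy (oi a x₀) (fun t => z₀⁻¹ * f.tau t) f.qd with hEm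
  set Ep := C.energy (oi a x₀) p.fn p.qd with hEp
  have hEk0 : 0 ≤ Ek := energy_nonneg _ _ _
  have hEp0 : 0 ≤ Ep := energy_nonneg _ _ _
  set W := bilinWronskian p u x₀ with hW
  have hWc : ∀ t ∈ oi a x₀, bilinWronskian p u t = W := by
    intro t ht
    have := bilinWronskian_sub_eq_form hn hp hu (mem_oi_left hx₀ ht) hx₀ (lt_of_mem_oi ht).le
    rw [sub_self, zero_mul, sub_eq_zero] at this
    exact this.symm
  set K := ‖bilinWronskian f u x₀‖ with hK
  refine u.memH1NearLeft_of_l2On hx₀ (l2On_of_energy_le hx₀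
    (K := (4 * K ^ 2 * Ep + 2 * ‖W‖ ^ 2 * Em) / (‖L‖ ^ 2 / 8)) (fun x hx => u.l2On_Icc hn hx hx₀)
    (u.aestronglyMeasurable hn hx₀) fun y hy => ?_)
  have hyb := mem_oi_left hx₀ hy
  have hsub : Ico y x₀ ⊆ oi a x₀ := Ico_subset_oi_left hyb
  have u0 : C.L2On (Ico y x₀) u.fn u.qd := (u.l2On_Icc hn hyb hx₀).mono Ico_subset_Icc_self
  set N := C.energy (Ico y x₀) u.fn u.qd with hN
  have hN0 : 0 ≤ N := energy_nonneg _ _ _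
  have hfu : ∀ t ∈ Ico y x₀, ‖bilinWronskian f u t‖ ^ 2 ≤ 2 * K ^ 2 + 2 * (Ek * N) := by
    intro t ht
    have htb := Ico_subset_oi hyb hx₀ ht
    have h1 := bilinWronskian_sub_eq_form_right hn hf.1 hu htb hx₀ ht.2.le
    have hs1 : Ico t x₀ ⊆ Ico y x₀ := Ico_subset_Ico_left ht.1
    have h2 := sq_norm_form_le (k0.mono (hs1.trans hsub)) (u0.mono hs1)
    have h3 : C.energy (Ico t x₀) k k' * C.energy (Ico t x₀) u.fn u.qd ≤ Ek * N :=
      mul_le_mul (energy_mono k0 (hs1.trans hsub)) (energy_mono u0 hs1) (energy_nonneg _ _ _) hEk0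
    have h4 : bilinWronskian f u t = bilinWronskian f u x₀
        - C.form (Ico t x₀) k k' u.fn u.qd := by
      rw [← h1]
      ring
    rw [h4]
    refine (sq_norm_sub_le_two _ _).trans ?_
    rw [← hK]
    nlinarith [h2.trans h3]
  have hmain := energy_le_of_forall (C := C) measurableSet_Ico u0 (p0.mono hsub) (m0.mono hsub)
    (A := ‖L‖ ^ 2 / 4) (B := 2 * (2 * K ^ 2 + 2 * (Ek * N))) (D := 2 * ‖W‖ ^ 2) ?_ ?_
  · have m1 : C.energy (Ico y x₀) p.fn p.qd ≤ Ep := energy_mono p0 hsub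
    have m2 := energy_mono m0 hsub
    have m3 : ‖L‖ ^ 2 / 4 * N
        ≤ 2 * (2 * K ^ 2 + 2 * (Ek * N)) * Ep + 2 * ‖W‖ ^ 2 * Em :=
      hmain.trans (add_le_add (mul_le_mul_of_nonneg_left m1 (by positivity))
        (mul_le_mul_of_nonneg_left m2 (by positivity)))
    rw [le_div_iff₀ (by positivity)]
    nlinarith [mul_le_mul_of_nonneg_right hx₂.le hN0]
  · intro t ht
    have htb := Ico_subset_oi hyb hx₀ ht
    have e := bilinWronskian_mul_tau f p u t
    rw [hWc t (hsub ht), hp t htb, hu t htb] at e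
    have e' : bilinWronskian f p t * u.fn t
        = bilinWronskian f u t * p.fn t - W * (z₀⁻¹ * f.tau t) := by
      field_simp
      linear_combination e
    have h1 : ‖L‖ ^ 2 / 4 * ‖u.fn t‖ ^ 2 ≤ ‖bilinWronskian f p t * u.fn t‖ ^ 2 := by
      rw [norm_mul, mul_pow]
      refine mul_le_mul_of_nonneg_right ?_ (sq_nonneg _)
      nlinarith [hx₁ t (hsub ht)]
    refine h1.trans ?_
    rw [e']
    refine (sq_norm_sub_le_two _ _).trans ?_
    rw [norm_mul, norm_mul, mul_pow, mul_pow]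
    have h2 := mul_le_mul_of_nonneg_right (hfu t ht) (sq_nonneg ‖p.fn t‖)
    nlinarith
  · intro t ht
    have htb := Ico_subset_oi hyb hx₀ ht
    have e := bilinWronskian_mul_qd f p u t
    rw [hWc t (hsub ht)] at e
    have h1 : ‖L‖ ^ 2 / 4 * ‖u.qd t‖ ^ 2 ≤ ‖bilinWronskian f p t * u.qd t‖ ^ 2 := by
      rw [norm_mul, mul_pow]
      refine mul_le_mul_of_nonneg_right ?_ (sq_nonneg _)
      nlinarith [hx₁ t (hsub ht)]
    refine h1.trans ?_
    rw [e]
    refine (sq_norm_sub_le_two _ _).trans ?_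
    rw [norm_mul, norm_mul, mul_pow, mul_pow]
    have h2 := mul_le_mul_of_nonneg_right (hfu t ht) (sq_nonneg ‖p.qd t‖)
    nlinarith

theorem tendsto_bilinWronskian_limitPoint (hn : C.Atomless) {z₀ : ℂ} (hz₀ : z₀ ≠ 0)
    {f p u : C.TLoc} {f' : ℝ → ℂ} (hp : C.IsSolution z₀ p) (hu : C.IsSolution z₀ u)
    (hu' : ¬ C.MemH1NearLeft u.fn) {d : ℝ} (hd : d ∈ oi a b) (hf : L2Left C d f f')
    (p0 : C.L2On (oi a d) p.fn p.qd) : Tendsto (bilinWronskian f p) C.leftEnd (𝓝 0) := by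
  have h := tendsto_bilinWronskian_right hn hd hf hp p0
  by_contra h0
  refine hu' (l2On_of_tendsto_ne_zero hn hz₀ hp hu hd hf p0 h fun h1 => h0 ?_)
  rwa [h1] at h

/-- If the Wronskians of two pairs with a non-trivial solution vanish at `a`, then so does their
own Wronskian. -/
theorem tendsto_bilinWronskian_zero_of_third (hn : C.Atomless) {z₀ : ℂ} (hz₀ : z₀ ≠ 0)
    {f g p : C.TLoc} {f' g' : ℝ → ℂ} (hp : C.IsSolution z₀ p)
    (hp0 : ∃ x ∈ oi a b, p.fn x ≠ 0) {d : ℝ} (hd : d ∈ oi a b)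
    (hf : L2Left C d f f') (hg : L2Left C d g g') (p0 : C.L2On (oi a d) p.fn p.qd)
    (hfp : Tendsto (bilinWronskian f p) C.leftEnd (𝓝 0))
    (hgp : Tendsto (bilinWronskian g p) C.leftEnd (𝓝 0)) :
    Tendsto (bilinWronskian f g) C.leftEnd (𝓝 0) := by
  obtain ⟨M, hM⟩ := tendsto_bilinWronskian hn f g hf.1 hg.1 hd hf.2.1 hf.2.2 hg.2.1 hg.2.2
  by_cases hM0 : M = 0
  · rwa [hM0] at hM
  exfalso
  have hMpos : 0 < ‖M‖ := norm_pos_iff.mpr hM0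
  have := C.leftEnd_neBot hd
  have ev1 := eventually_forall_leftEnd hd
    (hM.norm.eventually_const_lt (show ‖M‖ / 2 < ‖M‖ by linarith))
  have ev2 : ∀ᶠ x : ℝ in C.leftEnd,
      2 * (C.energy (oi a x) (fun t => f.tau t - z₀ * f.fn t) (fun t => f' t - z₀ * f.qd t)
        * C.energy (oi a x) (fun t => z₀⁻¹ * g.tau t) g.qd)
      + 2 * (C.energy (oi a x) (fun t => g.tau t - z₀ * g.fn t) (fun t => g' t - z₀ * g.qd t)
        * C.energy (oi a x) (fun t => z₀⁻¹ * f.tau t) f.qd) < ‖M‖ ^ 2 / 4 := by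
    have := (((tendsto_energy_oi hd (hf.sub_mul z₀)).mul
      (tendsto_energy_oi hd (hg.div z₀))).const_mul 2).add
      (((tendsto_energy_oi hd (hg.sub_mul z₀)).mul
      (tendsto_energy_oi hd (hf.div z₀))).const_mul 2)
    simp only [mul_zero, add_zero] at this
    exact this.eventually_lt_const (by positivity)
  obtain ⟨x₀, hx₁, hx₂, hx₃⟩ := (ev1.and (ev2.and (C.eventually_mem_leftEnd hd))).exists
  have hx₀ : x₀ ∈ oi a b := mem_oi_left hd hx₃
  replace hf := hf.mono (lt_of_mem_oi hx₃).le
  replace hg := hg.mono (lt_of_mem_oi hx₃).le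
  replace p0 := p0.mono (oi_subset_oi (lt_of_mem_oi hx₃).le)
  set Ef := C.energy (oi a x₀) (fun t => f.tau t - z₀ * f.fn t) (fun t => f' t - z₀ * f.qd t)
    with hEf
  set Eg := C.energy (oi a x₀) (fun t => g.tau t - z₀ * g.fn t) (fun t => g' t - z₀ * g.qd t)
    with hEg
  set Ff := C.energy (oi a x₀) (fun t => z₀⁻¹ * f.tau t) f.qd with hFf
  set Fg := C.energy (oi a x₀) (fun t => z₀⁻¹ * g.tau t) g.qd with hFg
  set Ep := C.energy (oi a x₀) p.fn p.qd with hEp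
  have hEp0 : 0 ≤ Ep := energy_nonneg _ _ _
  have bound : ∀ {h : C.TLoc} {h' : ℝ → ℂ}, L2Left C x₀ h h' →
      Tendsto (bilinWronskian h p) C.leftEnd (𝓝 0) → ∀ t ∈ oi a x₀,
      ‖bilinWronskian h p t‖ ^ 2 ≤ C.energy (oi a x₀) (fun t => h.tau t - z₀ * h.fn t)
        (fun t => h' t - z₀ * h.qd t) * Ep := by
    intro h h' hh hlim t ht
    have hsub : oi a t ⊆ oi a x₀ := oi_subset_oi (lt_of_mem_oi ht).le
    have h1 := tendsto_nhds_unique hlim (tendsto_bilinWronskian_right hn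
      (mem_oi_left hx₀ ht) (hh.mono (lt_of_mem_oi ht).le) hp (p0.mono hsub))
    rw [eq_comm, sub_eq_zero] at h1
    rw [h1]
    refine (sq_norm_form_le ((hh.sub_mul z₀).mono hsub) (p0.mono hsub)).trans ?_
    exact mul_le_mul (energy_mono (hh.sub_mul z₀) hsub) (energy_mono p0 hsub)
      (energy_nonneg _ _ _) (energy_nonneg _ _ _)
  have bf := bound hf hfp
  have bg := bound hg hgp
  have hMt : ∀ t ∈ oi a x₀, ‖M‖ ^ 2 / 4 ≤ ‖bilinWronskian f g t‖ ^ 2 := fun t ht => by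
    nlinarith [hx₁ t ht]
  have hmain := energy_le_of_forall (C := C) (measurableSet_oi a x₀) p0 (hg.div z₀) (hf.div z₀)
    (A := ‖M‖ ^ 2 / 4) (B := 2 * (Ef * Ep)) (D := 2 * (Eg * Ep)) ?_ ?_
  · rw [← hEp, ← hFf, ← hFg] at hmain
    have hEp' : Ep = 0 := by
      by_contra hne
      have hpos : 0 < Ep := lt_of_le_of_ne hEp0 (Ne.symm hne)
      nlinarith [mul_lt_mul_of_pos_right hx₂ hpos]
    obtain ⟨t, hat, htx⟩ := EReal.lt_iff_exists_real_btwn.mp hx₀.1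
    have ht : t ∈ oi a x₀ := ⟨hat, htx⟩
    have htb := mem_oi_left hx₀ ht
    have zf : bilinWronskian f p t = 0 := by
      have := bf t ht
      rw [hEp', mul_zero] at this
      exact norm_eq_zero.mp (pow_eq_zero_iff two_ne_zero |>.mp (le_antisymm this (sq_nonneg _)))
    have zg : bilinWronskian g p t = 0 := by
      have := bg t ht
      rw [hEp', mul_zero] at this
      exact norm_eq_zero.mp (pow_eq_zero_iff two_ne_zero |>.mp (le_antisymm this (sq_nonneg _)))
    have hne : bilinWronskian f g t ≠ 0 := by
      intro h
      have := hx₁ t ht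
      rw [h, norm_zero] at this
      linarith
    have e1 := bilinWronskian_mul_tau f g p t
    have e2 := bilinWronskian_mul_qd f g p t
    rw [zf, zg, zero_mul, zero_mul, sub_self] at e1 e2
    have q0 : p.fn t = 0 := by
      have := (mul_eq_zero.mp e1).resolve_left hne
      rw [hp t htb] at this
      exact (mul_eq_zero.mp this).resolve_left hz₀
    have q1 : p.qd t = 0 := (mul_eq_zero.mp e2).resolve_left hne
    obtain ⟨x, hx, hx0⟩ := hp0
    exact hx0 (eq_zero_of_initial hn hp htb q0 q1 x hx).1
  · intro t ht
    have htb := mem_oi_left hx₀ ht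
    have e := bilinWronskian_mul_tau f g p t
    rw [hp t htb] at e
    have e' : bilinWronskian f g t * p.fn t = bilinWronskian f p t * (z₀⁻¹ * g.tau t)
        - bilinWronskian g p t * (z₀⁻¹ * f.tau t) := by
      field_simp
      linear_combination e
    refine (mul_le_mul_of_nonneg_right (hMt t ht) (sq_nonneg _)).trans ?_
    rw [← mul_pow, ← norm_mul, e']
    refine (sq_norm_sub_le_two _ _).trans ?_
    rw [norm_mul (bilinWronskian f p t), norm_mul (bilinWronskian g p t), mul_pow, mul_pow]
    have h1 := mul_le_mul_of_nonneg_right (bf t ht) (sq_nonneg ‖z₀⁻¹ * g.tau t‖)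
    have h2 := mul_le_mul_of_nonneg_right (bg t ht) (sq_nonneg ‖z₀⁻¹ * f.tau t‖)
    linarith
  · intro t ht
    have e := bilinWronskian_mul_qd f g p t
    refine (mul_le_mul_of_nonneg_right (hMt t ht) (sq_nonneg _)).trans ?_
    rw [← mul_pow, ← norm_mul, e]
    refine (sq_norm_sub_le_two _ _).trans ?_
    simp only [norm_mul, mul_pow]
    have h1 := mul_le_mul_of_nonneg_right (bf t ht) (sq_nonneg ‖g.qd t‖)
    have h2 := mul_le_mul_of_nonneg_right (bg t ht) (sq_nonneg ‖f.qd t‖)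
    linarith

end TLoc

open TLoc

/-- The Wronskians of the solutions `φ_z` vanish at `a`. -/
theorem SeparatedBC.IsRealEntireSolution.tendsto_bilinWronskian (hn : C.Atomless)
    {S : C.SeparatedBC} {φ : ℂ → C.TLoc} (hφ : S.IsRealEntireSolution φ) {d : ℝ}
    (hd : d ∈ oi a b) (z ζ : ℂ) :
    Tendsto (TLoc.bilinWronskian (φ z) (φ ζ)) C.leftEnd (𝓝 0) := by
  have l2 : ∀ w, C.L2On (oi a d) (φ w).fn (φ w).qd := fun w =>
    (φ w).l2On_oi hn (hφ.near_left w).1 hd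
  by_cases hLC : C.LimitCircleLeft
  · exact tendsto_bilinWronskian_limitCircle hn S hLC (hφ.solution z) (hφ.solution ζ)
      (hφ.near_left z) (hφ.near_left ζ) hd
  · unfold LimitCircleLeft at hLC
    push Not at hLC
    obtain ⟨z₀, hz₀, u, hu, hu'⟩ := hLC
    have key : ∀ w, Tendsto (TLoc.bilinWronskian (φ w) (φ z₀)) C.leftEnd (𝓝 0) := fun w =>
      tendsto_bilinWronskian_limitPoint hn hz₀ (hφ.solution z₀) hu hu' hd
        (L2Left.of_solution (hφ.solution w) hd (l2 w)) (l2 z₀)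
    exact tendsto_bilinWronskian_zero_of_third hn hz₀ (hφ.solution z₀) (hφ.nontrivial z₀) hd
      (L2Left.of_solution (hφ.solution z) hd (l2 z))
      (L2Left.of_solution (hφ.solution ζ) hd (l2 ζ)) (l2 z₀) (key z) (key ζ)

/-- The values of the form of `H¹(a,d)` on the solutions `φ_z`. -/
theorem SeparatedBC.IsRealEntireSolution.form_eq (hn : C.Atomless)
    {S : C.SeparatedBC} {φ : ℂ → C.TLoc} (hφ : S.IsRealEntireSolution φ) {d : ℝ}
    (hd : d ∈ oi a b) (z ζ : ℂ) :
    (z - ζ) * C.form (oi a d) (φ z).fn (φ z).qd (φ ζ).fn (φ ζ).qd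
      = z * (φ z).fn d * (φ ζ).qd d - (φ z).qd d * (ζ * (φ ζ).fn d) := by
  have := C.leftEnd_neBot hd
  have l2 : ∀ w, C.L2On (oi a d) (φ w).fn (φ w).qd := fun w =>
    (φ w).l2On_oi hn (hφ.near_left w).1 hd
  have h := tendsto_nhds_unique (hφ.tendsto_bilinWronskian hn hd z ζ)
    (tendsto_bilinWronskian_solution hn (hφ.solution z) (hφ.solution ζ) hd (l2 z) (l2 ζ))
  rw [bilinWronskian, hφ.solution z d hd, hφ.solution ζ d hd] at h
  linear_combination h

end Coeff

end LeftDefinite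

end

noncomputable section

namespace LeftDefinite

/-! ### Real entire functions -/

theorem RealEntire.apply_conj {F : ℂ → ℂ} (hF : RealEntire F) (z : ℂ) : F (conj z) = conj (F z) := by
  have h1 : AnalyticOnNhd ℂ F univ := fun z _ => hF.1.analyticAt z
  have h2 : AnalyticOnNhd ℂ (sharp F) univ := fun z _ => (differentiable_sharp hF.1).analyticAt z
  have hreal : ∀ x : ℝ, F x = sharp F x := fun x => by
    rw [sharp_ofReal, Complex.conj_eq_iff_im.mpr (hF.2 x)]
  have hfreq : ∃ᶠ w in 𝓝[≠] (0 : ℂ), F w = sharp F w := by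
    have ht : Tendsto (fun x : ℝ => (x : ℂ)) (𝓝[≠] 0) (𝓝[≠] (0 : ℂ)) := by
      refine tendsto_nhdsWithin_iff.mpr ⟨?_, ?_⟩
      · have := (Complex.continuous_ofReal.tendsto 0).mono_left (nhdsWithin_le_nhds (s := {0}ᶜ))
        simpa using this
      · filter_upwards [self_mem_nhdsWithin] with x hx
        simpa using hx
    exact ht.frequently (Eventually.of_forall hreal).frequently
  have h := h1.eqOn_of_preconnected_of_frequently_eq h2 isPreconnected_univ (mem_univ 0) hfreq
    (mem_univ (conj z))
  rw [h, sharp_conj]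

/-- An entire function that vanishes off the real line vanishes identically. -/
theorem eq_zero_of_forall_im_ne_zero {F : ℂ → ℂ} (hF : Continuous F)
    (h : ∀ z : ℂ, z.im ≠ 0 → F z = 0) (z : ℂ) : F z = 0 := by
  by_cases hz : z.im = 0
  · have ht : Tendsto (fun ε : ℝ => F (z + ε * Complex.I)) (𝓝[>] 0) (𝓝 (F z)) := by
      have : Continuous fun ε : ℝ => F (z + ε * Complex.I) := hF.comp (by fun_prop)
      have h := (this.tendsto 0).mono_left (nhdsWithin_le_nhds (s := Ioi 0))
      simpa using h
    refine tendsto_nhds_unique ht (tendsto_const_nhds.congr' ?_)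
    filter_upwards [self_mem_nhdsWithin] with ε hε
    have hε : 0 < ε := hε
    exact (h _ (by simp [hz, hε.ne'])).symm
  · exact h z hz

namespace Coeff

variable {a b : EReal} {C : Coeff a b}

theorem HasRN.mono_right {c : ℝ} (hc : c ∈ oi a b) {μ : Measure ℝ} {f h : ℝ → ℂ}
    (hf : HasRN (oi a b) μ f h) : HasRN (oi a c) μ ((oi a c).indicator f) h := by
  refine hasRN_of_le (fun α hα β hβ => hf.1 α (oi_mono_right hc hα) β (oi_mono_right hc hβ))
    fun x hx y hy hxy => ?_
  rw [indicator_of_mem hx, indicator_of_mem hy]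
  exact hf.sub_eq (oi_mono_right hc hx) (oi_mono_right hc hy) hxy

namespace SeparatedBC.IsRealEntireSolution

variable {S : C.SeparatedBC} {φ : ℂ → C.TLoc} (hφ : S.IsRealEntireSolution φ) (hn : C.Atomless)
  {c : ℝ} (hc : c ∈ oi a b) (hχ : C.chi (oi a c) ≠ 0)

theorem fn_conj (hφ : S.IsRealEntireSolution φ) {x : ℝ} (hx : x ∈ oi a b) (z : ℂ) :
    (φ (conj z)).fn x = conj ((φ z).fn x) := (hφ.realEntire x hx).apply_conj z

theorem qd_conj (hφ : S.IsRealEntireSolution φ) {x : ℝ} (hx : x ∈ oi a b) (z : ℂ) :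
    (φ (conj z)).qd x = conj ((φ z).qd x) := (hφ.realEntire_qd x hx).apply_conj z

theorem restrictFn_mem (hφ : S.IsRealEntireSolution φ) (hn : C.Atomless) (hc : c ∈ oi a b)
    (hχ : C.chi (oi a c) ≠ 0) (z : ℂ) :
    (φ z).restrictFn c ∈ (C.restrict c hc hχ).h1Submodule := by
  obtain ⟨h1, h2⟩ := (φ z).l2On_oi hn (hφ.near_left z).1 hc
  refine ⟨fun x hx => indicator_of_notMem hx _, (φ z).qd,
    HasRN.mono_right hc (φ z).fn_deriv, ?_, h2⟩
  refine (memLp_congr_ae ?_).mp h1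
  filter_upwards [ae_restrict_mem (measurableSet_oi a c)] with x hx
  exact (indicator_of_mem hx _).symm

/-- The restriction of `φ_z` to `(a, c)` as an element of `H¹(a, c)`. -/
def elem (z : ℂ) : (C.restrict c hc hχ).H1 := H1.ofMem (hφ.restrictFn_mem hn hc hχ z)

theorem elem_apply (z : ℂ) {x : ℝ} (hx : x ∈ oi a c) :
    hφ.elem hn hc hχ z x = (φ z).fn x := indicator_of_mem hx _

theorem elem_deriv (z : ℂ) :
    (hφ.elem hn hc hχ z).deriv =ᵐ[C.sigma.restrict (oi a c)] (φ z).qd :=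
  (hφ.elem hn hc hχ z).hasRN.ae_eq (HasRN.mono_right hc (φ z).fn_deriv)

theorem inner_elem (w : ℂ) (f : (C.restrict c hc hχ).H1) :
    inner ℂ (hφ.elem hn hc hχ w) f = transform φ c hc hχ f (conj w) := by
  rw [H1.inner_def, transform]
  congr 1
  · refine setIntegral_congr_fun (measurableSet_oi a c) fun x hx => ?_
    simp only [hφ.elem_apply hn hc hχ w hx, hφ.fn_conj (oi_mono_right hc hx)]
  · refine integral_congr_ae ?_
    filter_upwards [hφ.elem_deriv hn hc hχ w, ae_restrict_mem (measurableSet_oi a c)] with x h1 h2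
    rw [h1, hφ.qd_conj (oi_mono_right hc h2)]

theorem transform_elem (w z : ℂ) : transform φ c hc hχ (hφ.elem hn hc hχ w) z
    = C.form (oi a c) (φ z).fn (φ z).qd (φ w).fn (φ w).qd := by
  rw [transform, form]
  congr 1
  · refine setIntegral_congr_fun (measurableSet_oi a c) fun x hx => ?_
    simp only [hφ.elem_apply hn hc hχ w hx]
  · refine integral_congr_ae ?_
    filter_upwards [hφ.elem_deriv hn hc hχ w] with x h1
    rw [h1]

theorem sharp_entireE (hφ : S.IsRealEntireSolution φ) (hc : c ∈ oi a b) (z : ℂ) :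
    sharp (entireE φ c) z = z * (φ z).fn c - Complex.I * (φ z).qd c := by
  simp only [sharp, entireE, hφ.fn_conj hc, hφ.qd_conj hc, map_add, map_mul, Complex.conj_conj,
    Complex.conj_I]
  ring

theorem differentiable_entireE (hφ : S.IsRealEntireSolution φ) (hc : c ∈ oi a b) :
    Differentiable ℂ (entireE φ c) :=
  (differentiable_id.mul (hφ.realEntire c hc).1).add ((hφ.realEntire_qd c hc).1.const_mul _)

theorem kernel_identity (w z : ℂ) : 2 * Complex.I * (conj w - z)
      * transform φ c hc hχ (hφ.elem hn hc hχ (conj w)) z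
    = entireE φ c z * conj (entireE φ c w)
      - sharp (entireE φ c) z * conj (sharp (entireE φ c) w) := by
  have h := hφ.form_eq hn hc z (conj w)
  rw [transform_elem]
  rw [hφ.sharp_entireE hc, hφ.sharp_entireE hc, entireE, entireE]
  rw [hφ.fn_conj hc, hφ.qd_conj hc] at h
  simp only [map_add, map_sub, map_mul, Complex.conj_I]
  linear_combination (-2 * Complex.I) * h

theorem norm_sq_elem (z : ℂ) : 4 * z.im * ‖hφ.elem hn hc hχ z‖ ^ 2
    = ‖entireE φ c z‖ ^ 2 - ‖entireE φ c (conj z)‖ ^ 2 := by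
  have h := kernel_apply_self (hφ.kernel_identity hn hc hχ z z)
  have e : transform φ c hc hχ (hφ.elem hn hc hχ (conj z)) z
      = ((‖hφ.elem hn hc hχ (conj z)‖ ^ 2 : ℝ) : ℂ) := by
    have h1 := hφ.inner_elem hn hc hχ (conj z) (hφ.elem hn hc hχ (conj z))
    rw [Complex.conj_conj] at h1
    rw [← h1, inner_self_eq_norm_sq_to_K]
    push_cast
    rfl
  have e2 : ‖hφ.elem hn hc hχ (conj z)‖ ^ 2 = ‖hφ.elem hn hc hχ z‖ ^ 2 := by
    have h1 := hφ.inner_elem hn hc hχ (conj z) (hφ.elem hn hc hχ (conj z))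
    have h2 := hφ.inner_elem hn hc hχ z (hφ.elem hn hc hχ z)
    rw [transform_elem, inner_self_eq_norm_sq_to_K] at h1 h2
    rw [Complex.conj_conj] at h1
    have h3 : C.form (oi a c) (φ z).fn (φ z).qd (φ (conj z)).fn (φ (conj z)).qd
        = C.form (oi a c) (φ (conj z)).fn (φ (conj z)).qd (φ z).fn (φ z).qd := by
      unfold form
      simp only [mul_comm]
    have h4 := h1.trans (h3.trans h2.symm)
    exact_mod_cast h4
  rw [e, e2] at h
  exact_mod_cast h

theorem elem_ne_zero (z : ℂ) : hφ.elem hn hc hχ z ≠ 0 := by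
  intro h
  have hfn : ∀ x ∈ oi a c, (φ z).fn x = 0 := by
    intro x hx
    rw [← hφ.elem_apply hn hc hχ z hx, h]
    rfl
  have h0 : HasRN (oi a c) C.sigma ((oi a c).indicator (φ z).fn) 0 := by
    refine hasRN_of_le (fun α _ β _ => integrableOn_zero) fun x hx y hy _ => ?_
    rw [indicator_of_mem hx, indicator_of_mem hy, hfn x hx, hfn y hy]
    simp
  have hae : (φ z).qd =ᵐ[C.sigma.restrict (oi a c)] 0 :=
    (HasRN.mono_right hc (φ z).fn_deriv).ae_eq h0
  have hne : C.sigma (oi a c) ≠ 0 := by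
    obtain ⟨α, h1, h2⟩ := EReal.lt_iff_exists_real_btwn.mp hc.1
    have hα : α ∈ oi a b := oi_mono_right hc ⟨h1, h2⟩
    intro h3
    refine C.sigma_supp α hα c hc (by exact_mod_cast h2) (measure_mono_null ?_ h3)
    exact Ioo_subset_Ico_self.trans (Ico_subset_oi_left hα)
  have : (ae (C.sigma.restrict (oi a c))).NeBot := by
    rw [ae_neBot, ne_eq, Measure.restrict_eq_zero]
    exact hne
  obtain ⟨x, hx1, hx2⟩ := (hae.and (ae_restrict_mem (measurableSet_oi a c))).exists
  obtain ⟨y, hy, hy0⟩ := hφ.nontrivial z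
  exact hy0 (TLoc.eq_zero_of_initial hn (hφ.solution z) (oi_mono_right hc hx2) (hfn x hx2) hx1 y
    hy).1

theorem isDeBrangesFunction (hφ : S.IsRealEntireSolution φ) (hn : C.Atomless)
    (hc : c ∈ oi a b) (hχ : C.chi (oi a c) ≠ 0) : IsDeBrangesFunction (entireE φ c) := by
  refine ⟨hφ.differentiable_entireE hc, fun z hz => ?_⟩
  have h := hφ.norm_sq_elem hn hc hχ z
  have h1 : 0 < ‖hφ.elem hn hc hχ z‖ := norm_pos_iff.mpr (hφ.elem_ne_zero hn hc hχ z)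
  have h2 : 0 < 4 * z.im * ‖hφ.elem hn hc hχ z‖ ^ 2 := by positivity
  refine lt_of_pow_lt_pow_left₀ 2 (norm_nonneg _) ?_
  linarith

theorem tendsto_elem_apply {x : ℝ} (hx : x ∈ oi a c) (w : ℂ) {l : Filter ℂ} (hl : l ≤ 𝓝 w) :
    Tendsto (fun z => hφ.elem hn hc hχ z x) l (𝓝 (hφ.elem hn hc hχ w x)) := by
  simp only [hφ.elem_apply hn hc hχ _ hx]
  exact ((hφ.realEntire x (oi_mono_right hc hx)).1.continuous.tendsto w).mono_left hl

theorem entireE_ofReal_ne_zero (hφ : S.IsRealEntireSolution φ) (hn : C.Atomless)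
    (hc : c ∈ oi a b) (hχ : C.chi (oi a c) ≠ 0) (x : ℝ) : entireE φ c x ≠ 0 := by
  intro h0
  set G := dslope (entireE φ c) x with hG
  have hGc : Continuous G := by
    have : DifferentiableOn ℂ G univ := (Complex.differentiableOn_dslope univ_mem).mpr
      (hφ.differentiable_entireE hc).differentiableOn
    exact (differentiableOn_univ.mp this).continuous
  have hEG : ∀ z, entireE φ c z = (z - x) * G z := fun z => by
    have := sub_smul_dslope (entireE φ c) (x : ℂ) z
    rw [h0, sub_zero, smul_eq_mul] at this
    exact this.symm
  have hcont : Tendsto (fun ε : ℝ => (x : ℂ) + ε * Complex.I) (𝓝[>] 0) (𝓝 (x : ℂ)) := by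
    have : Continuous fun ε : ℝ => (x : ℂ) + ε * Complex.I := by fun_prop
    have h := (this.tendsto 0).mono_left (nhdsWithin_le_nhds (s := Ioi 0))
    simpa using h
  have hbd : ∀ᶠ ε : ℝ in 𝓝[>] 0, ‖hφ.elem hn hc hχ (x + ε * Complex.I)‖ ^ 2
      ≤ ε * ‖G (x + ε * Complex.I)‖ ^ 2 / 4 := by
    filter_upwards [self_mem_nhdsWithin] with ε hε
    have hε : 0 < ε := hε
    have h1 := hφ.norm_sq_elem hn hc hχ (x + ε * Complex.I)
    have him : ((x : ℂ) + ε * Complex.I).im = ε := by simp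
    rw [him, hEG] at h1
    have h2 : ‖(x : ℂ) + ε * Complex.I - x‖ = ε := by
      simp [abs_of_pos hε]
    rw [norm_mul, h2] at h1
    have h3 : 4 * ε * ‖hφ.elem hn hc hχ (x + ε * Complex.I)‖ ^ 2
        ≤ (ε * ‖G (x + ε * Complex.I)‖) ^ 2 := by
      linarith [sq_nonneg ‖entireE φ c (conj ((x : ℂ) + ε * Complex.I))‖]
    nlinarith
  have hlim : Tendsto (fun ε : ℝ => ε * ‖G (x + ε * Complex.I)‖ ^ 2 / 4) (𝓝[>] 0) (𝓝 0) := by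
    have h1 : Tendsto (fun ε : ℝ => ε) (𝓝[>] (0 : ℝ)) (𝓝 0) := nhdsWithin_le_nhds
    have h2 := ((h1.mul (((hGc.tendsto _).comp hcont).norm.pow 2)).div_const 4)
    simpa using h2
  have hnorm : Tendsto (fun ε : ℝ => ‖hφ.elem hn hc hχ (x + ε * Complex.I)‖) (𝓝[>] 0) (𝓝 0) := by
    have h1 := (squeeze_zero' (Eventually.of_forall fun _ => sq_nonneg _) hbd hlim).sqrt
    simpa [Real.sqrt_sq (norm_nonneg _)] using h1
  refine hφ.elem_ne_zero hn hc hχ x (H1.ext_of_forall fun y hy => ?_)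
  obtain ⟨K, hK0, hK⟩ := H1.exists_norm_apply_le (C.restrict c hc hχ) hy
  have t1 := (hφ.tendsto_elem_apply hn hc hχ hy x le_rfl).comp hcont
  have t2 : Tendsto (fun ε : ℝ => hφ.elem hn hc hχ (x + ε * Complex.I) y) (𝓝[>] 0) (𝓝 0) := by
    refine squeeze_zero_norm (fun ε => hK _) ?_
    simpa using hnorm.const_mul K
  exact tendsto_nhds_unique t1 t2

theorem exists_norm_elem_le (R : ℝ) : ∃ K, ∀ z : ℂ, ‖z‖ ≤ R → ‖hφ.elem hn hc hχ z‖ ≤ K := by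
  obtain ⟨K, hK⟩ := DeBrangesSpace.exists_abs_sq_norm_sub_le (hφ.differentiable_entireE hc) (R + 1)
  have key : ∀ z : ℂ, ‖z‖ ≤ R + 1 → z.im ≠ 0 → ‖hφ.elem hn hc hχ z‖ ≤ √(K / 4) := by
    intro z hz him
    have h := hK z hz
    rw [← hφ.norm_sq_elem hn hc hχ z, abs_mul, abs_mul,
      abs_of_nonneg (sq_nonneg ‖hφ.elem hn hc hχ z‖),
      abs_of_pos (by norm_num : (0 : ℝ) < 4)] at h
    refine Real.le_sqrt_of_sq_le ?_
    have h4 : 0 < |z.im| := abs_pos.mpr him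
    nlinarith
  refine ⟨√(K / 4), fun z hz => ?_⟩
  by_cases him : z.im = 0
  · have hpos : ∀ n : ℕ, (0 : ℝ) < 1 / ((n : ℝ) + 1) := fun n => by positivity
    refine H1.norm_le_of_tendsto
      (u := fun n : ℕ => hφ.elem hn hc hχ (z + ((1 / ((n : ℝ) + 1) : ℝ) : ℂ) * Complex.I))
      (fun n => key _ ?_ ?_) fun x hx => ?_
    · refine (norm_add_le _ _).trans ?_
      rw [norm_mul, Complex.norm_I, mul_one, Complex.norm_real, Real.norm_of_nonneg (hpos n).le]
      have : 1 / ((n : ℝ) + 1) ≤ 1 := by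
        rw [div_le_one (by positivity)]
        linarith [(Nat.cast_nonneg n : (0 : ℝ) ≤ n)]
      linarith
    · simp only [Complex.add_im, Complex.mul_im, Complex.ofReal_re, Complex.I_im, mul_one,
        Complex.ofReal_im, Complex.I_re, mul_zero, add_zero, him, zero_add]
      exact (hpos n).ne'
    · have ht : Tendsto (fun n : ℕ => z + ((1 / ((n : ℝ) + 1) : ℝ) : ℂ) * Complex.I) atTop
          (𝓝 z) := by
        have h1 := (Complex.continuous_ofReal.tendsto 0).comp
          (tendsto_one_div_add_atTop_nhds_zero_nat (𝕜 := ℝ))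
        have h2 := (h1.mul_const Complex.I).const_add z
        simpa using h2
      exact (hφ.tendsto_elem_apply hn hc hχ hx z le_rfl).comp ht
  · exact key z (by linarith) him

/-- The transform of a function in `H¹(a, c)` is entire. -/
theorem differentiable_transform (hφ : S.IsRealEntireSolution φ) (hn : C.Atomless)
    (f : (C.restrict c hc hχ).H1) : Differentiable ℂ (transform φ c hc hχ f) := by
  have h1 := H1.differentiable_inner (ψ := hφ.elem hn hc hχ) (hφ.exists_norm_elem_le hn hc hχ)
    (fun x hx => by
      simp only [hφ.elem_apply hn hc hχ _ hx]
      exact (hφ.realEntire x (oi_mono_right hc hx)).1) f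
  have h2 := differentiable_sharp h1
  have e : sharp (fun z => inner ℂ f (hφ.elem hn hc hχ z)) = transform φ c hc hχ f := by
    ext z
    simp only [sharp]
    rw [inner_conj_symm, inner_elem, Complex.conj_conj]
  rwa [e] at h2

theorem isKernel_transform (w : ℂ) :
    IsKernel (entireE φ c) w (transform φ c hc hχ (hφ.elem hn hc hχ (conj w))) :=
  ⟨differentiable_transform hc hχ hφ hn _, hφ.kernel_identity hn hc hχ w⟩

end SeparatedBC.IsRealEntireSolution

end Coeff

end LeftDefinite

end

noncomputable section

namespace LeftDefinite

/-! ### Families with equal Gram matrices -/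

section Gram

variable {ι H K : Type*} [NormedAddCommGroup H] [InnerProductSpace ℂ H] [NormedAddCommGroup K]
  [InnerProductSpace ℂ K]

theorem norm_linearCombination_eq {v : ι → H} {w : ι → K}
    (h : ∀ i j, inner ℂ (v i) (v j) = inner ℂ (w i) (w j)) (x : ι →₀ ℂ) :
    ‖Finsupp.linearCombination ℂ v x‖ = ‖Finsupp.linearCombination ℂ w x‖ := by
  have e : inner ℂ (Finsupp.linearCombination ℂ v x) (Finsupp.linearCombination ℂ v x)
      = inner ℂ (Finsupp.linearCombination ℂ w x) (Finsupp.linearCombination ℂ w x) := by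
    simp only [Finsupp.linearCombination_apply, Finsupp.sum, sum_inner, inner_sum, inner_smul_left,
      inner_smul_right, h]
  rw [inner_self_eq_norm_sq_to_K, inner_self_eq_norm_sq_to_K] at e
  exact (pow_left_inj₀ (norm_nonneg _) (norm_nonneg _) two_ne_zero).mp (by exact_mod_cast e)

theorem exists_tendsto_of_gram_eq [CompleteSpace K] {v : ι → H} {w : ι → K}
    (h : ∀ i j, inner ℂ (v i) (v j) = inner ℂ (w i) (w j)) {f : H}
    (hf : f ∈ (Submodule.span ℂ (range v)).topologicalClosure) :
    ∃ (x : ℕ → ι →₀ ℂ) (F : K),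
      Tendsto (fun n => Finsupp.linearCombination ℂ v (x n)) atTop (𝓝 f) ∧
      Tendsto (fun n => Finsupp.linearCombination ℂ w (x n)) atTop (𝓝 F) := by
  rw [← SetLike.mem_coe, Submodule.topologicalClosure_coe] at hf
  obtain ⟨u, hu, huf⟩ := mem_closure_iff_seq_limit.mp hf
  have hu' : ∀ n, ∃ x : ι →₀ ℂ, Finsupp.linearCombination ℂ v x = u n := fun n => by
    have := hu n
    rwa [SetLike.mem_coe, ← Finsupp.range_linearCombination] at this
  choose x hx using hu'
  have hcau : CauchySeq fun n => Finsupp.linearCombination ℂ w (x n) := by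
    have := huf.cauchySeq
    rw [Metric.cauchySeq_iff] at this ⊢
    intro ε hε
    obtain ⟨N, hN⟩ := this ε hε
    refine ⟨N, fun m hm n hn => ?_⟩
    have h1 := hN m hm n hn
    rwa [dist_eq_norm, ← hx, ← hx, ← map_sub, norm_linearCombination_eq h, map_sub,
      ← dist_eq_norm] at h1
  obtain ⟨F, hF⟩ := cauchySeq_tendsto_of_complete hcau
  exact ⟨x, F, huf.congr fun n => (hx n).symm, hF⟩

end Gram

namespace DeBrangesSpace

variable {E : ℂ → ℂ} {hE : IsDeBrangesFunction E}

theorem add_apply (F G : DeBrangesSpace E hE) (z : ℂ) : (F + G) z = F z + G z := rfl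

theorem smul_apply (r : ℂ) (F : DeBrangesSpace E hE) (z : ℂ) : (r • F) z = r * F z := rfl

theorem ext_of_forall {F G : DeBrangesSpace E hE} (h : ∀ z, F z = G z) : F = G :=
  Subtype.ext (funext h)

theorem tendsto_apply (hE0 : ∀ x : ℝ, E x ≠ 0) {u : ℕ → DeBrangesSpace E hE}
    {F : DeBrangesSpace E hE} (hu : Tendsto u atTop (𝓝 F)) (z : ℂ) :
    Tendsto (fun n => u n z) atTop (𝓝 (F z)) := by
  obtain ⟨K, -, hK⟩ := exists_norm_apply_le (hE := hE) hE0 ‖z‖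
  rw [tendsto_iff_norm_sub_tendsto_zero] at hu ⊢
  refine squeeze_zero (fun _ => norm_nonneg _) (fun n => hK (u n - F) z le_rfl) ?_
  simpa using hu.const_mul K

/-- The evaluation of functions at a point, as a linear map. -/
def evalLinear (z : ℂ) : DeBrangesSpace E hE →ₗ[ℂ] ℂ where
  toFun F := F z
  map_add' F G := add_apply F G z
  map_smul' r F := smul_apply r F z

end DeBrangesSpace

namespace Coeff

variable {a b : EReal} {C : Coeff a b} {S : C.SeparatedBC} {φ : ℂ → C.TLoc} {c : ℝ}

namespace SeparatedBC.IsRealEntireSolution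

variable (hφ : S.IsRealEntireSolution φ) (hn : C.Atomless)
  (hc : c ∈ oi a b) (hχ : C.chi (oi a c) ≠ 0)

theorem transform_eq_inner (f : (C.restrict c hc hχ).H1) (z : ℂ) :
    transform φ c hc hχ f z = inner ℂ (hφ.elem hn hc hχ (conj z)) f := by
  rw [inner_elem, Complex.conj_conj]

/-- The reproducing kernels of the de Branges space at non-real points. -/
def kernel (w : {w : ℂ // w.im ≠ 0}) :
    DeBrangesSpace (entireE φ c) (hφ.isDeBrangesFunction hn hc hχ) :=
  DeBrangesSpace.ofMem ((hφ.isKernel_transform hn hc hχ w).mem _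
    (hφ.entireE_ofReal_ne_zero hn hc hχ) w.2)

theorem kernel_apply (w : {w : ℂ // w.im ≠ 0}) (z : ℂ) : hφ.kernel hn hc hχ w z
    = transform φ c hc hχ (hφ.elem hn hc hχ (conj (w : ℂ))) z := rfl

theorem inner_kernel (w : {w : ℂ // w.im ≠ 0})
    (F : DeBrangesSpace (entireE φ c) (hφ.isDeBrangesFunction hn hc hχ)) :
    inner ℂ (hφ.kernel hn hc hχ w) F = F w :=
  DeBrangesSpace.inner_kernel (hφ.entireE_ofReal_ne_zero hn hc hχ) w.2
    (hφ.isKernel_transform hn hc hχ w) F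

/-- The elements of `H¹(a, c)` whose transforms are the reproducing kernels. -/
def kernelElem (w : {w : ℂ // w.im ≠ 0}) : (C.restrict c hc hχ).H1 :=
  hφ.elem hn hc hχ (conj (w : ℂ))

theorem gram_eq (w v : {w : ℂ // w.im ≠ 0}) :
    inner ℂ (hφ.kernelElem hn hc hχ w) (hφ.kernelElem hn hc hχ v)
      = inner ℂ (hφ.kernel hn hc hχ w) (hφ.kernel hn hc hχ v) := by
  rw [inner_kernel, kernel_apply, kernelElem, inner_elem, Complex.conj_conj, kernelElem]

theorem linearCombination_kernel_apply (x : {w : ℂ // w.im ≠ 0} →₀ ℂ) (z : ℂ) :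
    (Finsupp.linearCombination ℂ (hφ.kernel hn hc hχ) x) z
      = transform φ c hc hχ (Finsupp.linearCombination ℂ (hφ.kernelElem hn hc hχ) x) z := by
  rw [transform_eq_inner hφ hn]
  change DeBrangesSpace.evalLinear z (Finsupp.linearCombination ℂ (hφ.kernel hn hc hχ) x) = _
  simp only [Finsupp.linearCombination_apply, Finsupp.sum, map_sum, map_smul, inner_sum,
    inner_smul_right, smul_eq_mul]
  refine Finset.sum_congr rfl fun w _ => ?_
  rw [kernelElem, inner_elem, Complex.conj_conj]
  rfl

/-- The closed span of the `φ_z` with non-real `z`. -/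
def closedSpan : Submodule ℂ (C.restrict c hc hχ).H1 :=
  (Submodule.span ℂ (range (hφ.kernelElem hn hc hχ))).topologicalClosure

theorem transform_eq_of_tendsto {u : ℕ → (C.restrict c hc hχ).H1} {f : (C.restrict c hc hχ).H1}
    {F : DeBrangesSpace (entireE φ c) (hφ.isDeBrangesFunction hn hc hχ)}
    {U : ℕ → DeBrangesSpace (entireE φ c) (hφ.isDeBrangesFunction hn hc hχ)}
    (hu : Tendsto u atTop (𝓝 f)) (hU : Tendsto U atTop (𝓝 F))
    (huU : ∀ n z, U n z = transform φ c hc hχ (u n) z) (z : ℂ) :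
    F z = transform φ c hc hχ f z := by
  have h1 := DeBrangesSpace.tendsto_apply (hφ.entireE_ofReal_ne_zero hn hc hχ) hU z
  refine tendsto_nhds_unique h1 ?_
  simp only [huU, transform_eq_inner hφ hn]
  exact tendsto_const_nhds.inner hu

theorem exists_of_mem_closedSpan {f : (C.restrict c hc hχ).H1} (hf : f ∈ hφ.closedSpan hn hc hχ) :
    ∃ F : DeBrangesSpace (entireE φ c) (hφ.isDeBrangesFunction hn hc hχ),
      (∀ z, F z = transform φ c hc hχ f z) ∧ ‖F‖ = ‖f‖ := by
  have := DeBrangesSpace.completeSpace (hE := hφ.isDeBrangesFunction hn hc hχ)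
    (hφ.entireE_ofReal_ne_zero hn hc hχ)
  obtain ⟨x, F, h1, h2⟩ := exists_tendsto_of_gram_eq (hφ.gram_eq hn hc hχ) hf
  refine ⟨F, hφ.transform_eq_of_tendsto hn hc hχ h1 h2
    fun n z => hφ.linearCombination_kernel_apply hn hc hχ (x n) z, ?_⟩
  refine tendsto_nhds_unique h2.norm (h1.norm.congr fun n => ?_)
  exact norm_linearCombination_eq (hφ.gram_eq hn hc hχ) (x n)

theorem exists_of_apply
    (F : DeBrangesSpace (entireE φ c) (hφ.isDeBrangesFunction hn hc hχ)) :
    ∃ f : (C.restrict c hc hχ).H1, ∀ z, F z = transform φ c hc hχ f z := by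
  have := H1.completeSpace (C.restrict c hc hχ)
  have := DeBrangesSpace.completeSpace (hE := hφ.isDeBrangesFunction hn hc hχ)
    (hφ.entireE_ofReal_ne_zero hn hc hχ)
  have htop : (Submodule.span ℂ (range (hφ.kernel hn hc hχ))).topologicalClosure = ⊤ := by
    rw [Submodule.topologicalClosure_eq_top_iff, Submodule.eq_bot_iff]
    intro G hG
    have h0 : ∀ z : ℂ, z.im ≠ 0 → G z = 0 := by
      intro z hz
      rw [← hφ.inner_kernel hn hc hχ ⟨z, hz⟩ G]
      exact (Submodule.mem_orthogonal _ _).mp hG _ (Submodule.subset_span (mem_range_self _))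
    exact DeBrangesSpace.ext_of_forall fun z =>
      eq_zero_of_forall_im_ne_zero G.2.1.continuous h0 z
  have hF : F ∈ (Submodule.span ℂ (range (hφ.kernel hn hc hχ))).topologicalClosure := by
    rw [htop]
    trivial
  obtain ⟨x, f, h1, h2⟩ := exists_tendsto_of_gram_eq
    (fun i j => (hφ.gram_eq hn hc hχ i j).symm) hF
  exact ⟨f, hφ.transform_eq_of_tendsto hn hc hχ h2 h1
    fun n z => hφ.linearCombination_kernel_apply hn hc hχ (x n) z⟩

theorem transform_eq_zero_of_mem_orthogonal {f : (C.restrict c hc hχ).H1}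
    (hf : f ∈ (hφ.closedSpan hn hc hχ)ᗮ) (z : ℂ) : transform φ c hc hχ f z = 0 := by
  refine eq_zero_of_forall_im_ne_zero (differentiable_transform hc hχ hφ hn f).continuous ?_ z
  intro w hw
  rw [transform_eq_inner hφ hn]
  exact (Submodule.mem_orthogonal _ _).mp hf _
    (Submodule.le_topologicalClosure _ (Submodule.subset_span ⟨⟨w, hw⟩, rfl⟩))

theorem closedSpan_eq : hφ.closedSpan hn hc hχ
    = (Submodule.span ℂ (range (hφ.elem hn hc hχ))).topologicalClosure := by
  have := H1.completeSpace (C.restrict c hc hχ)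
  refine le_antisymm (Submodule.topologicalClosure_mono (Submodule.span_mono ?_)) ?_
  · rintro _ ⟨w, rfl⟩
    exact ⟨conj (w : ℂ), rfl⟩
  · refine Submodule.topologicalClosure_minimal _ (Submodule.span_le.mpr ?_)
      (Submodule.isClosed_topologicalClosure _)
    rintro _ ⟨w, rfl⟩
    have hcl : (hφ.closedSpan hn hc hχ)ᗮᗮ = hφ.closedSpan hn hc hχ := by
      rw [Submodule.orthogonal_orthogonal_eq_closure]
      exact (Submodule.isClosed_topologicalClosure _).submodule_topologicalClosure_eq
    rw [SetLike.mem_coe]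
    rw [← hcl, Submodule.mem_orthogonal']
    intro g hg
    rw [inner_elem]
    exact hφ.transform_eq_zero_of_mem_orthogonal hn hc hχ hg _

/-- The transform as an operator from `H¹(a, c)` onto the de Branges space. -/
theorem exists_transform_operator :
    ∃ T : (C.restrict c hc hχ).H1 →L[ℂ]
        DeBrangesSpace (entireE φ c) (hφ.isDeBrangesFunction hn hc hχ),
      (∀ f z, T f z = transform φ c hc hχ f z) ∧
      (∀ f ∈ hφ.closedSpan hn hc hχ, ‖T f‖ = ‖f‖) ∧
      LinearMap.ker (T : (C.restrict c hc hχ).H1 →ₗ[ℂ]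
        DeBrangesSpace (entireE φ c) (hφ.isDeBrangesFunction hn hc hχ)) = (hφ.closedSpan hn hc hχ)ᗮ := by
  have := H1.completeSpace (C.restrict c hc hχ)
  set D := hφ.closedSpan hn hc hχ with hD
  have hDc : IsClosed (D : Set (C.restrict c hc hχ).H1) :=
    Submodule.isClosed_topologicalClosure _
  have : CompleteSpace D := hDc.completeSpace_coe
  have hex : ∀ f : (C.restrict c hc hχ).H1,
      ∃ F : DeBrangesSpace (entireE φ c) (hφ.isDeBrangesFunction hn hc hχ),
        (∀ z, F z = transform φ c hc hχ f z) ∧ ‖F‖ = ‖D.starProjection f‖ := by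
    intro f
    obtain ⟨F, hF, hFn⟩ := hφ.exists_of_mem_closedSpan hn hc hχ
      (f := D.starProjection f) (D.starProjection_apply_mem f)
    refine ⟨F, fun z => ?_, hFn⟩
    have h0 := hφ.transform_eq_zero_of_mem_orthogonal hn hc hχ
      (D.sub_starProjection_mem_orthogonal f) z
    rw [hF z]
    rw [transform_eq_inner hφ hn, inner_sub_right, sub_eq_zero] at h0
    rw [transform_eq_inner hφ hn, transform_eq_inner hφ hn, h0]
  choose T hT hTn using hex
  let L : (C.restrict c hc hχ).H1 →ₗ[ℂ]
      DeBrangesSpace (entireE φ c) (hφ.isDeBrangesFunction hn hc hχ) :=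
    { toFun := T
      map_add' := fun f g => DeBrangesSpace.ext_of_forall fun z => by
        rw [DeBrangesSpace.add_apply, hT, hT, hT, transform_eq_inner hφ hn,
          transform_eq_inner hφ hn, transform_eq_inner hφ hn, inner_add_right]
      map_smul' := fun r f => DeBrangesSpace.ext_of_forall fun z => by
        rw [RingHom.id_apply, DeBrangesSpace.smul_apply, hT, hT, transform_eq_inner hφ hn,
          transform_eq_inner hφ hn, inner_smul_right] }
  have hL : ∀ f, ‖L f‖ ≤ 1 * ‖f‖ := fun f => by
    rw [one_mul]
    exact (hTn f).le.trans (D.norm_starProjection_apply_le f)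
  refine ⟨L.mkContinuous 1 hL, hT, fun f hf => ?_, ?_⟩
  · exact (hTn f).trans (by rw [Submodule.starProjection_eq_self_iff.mpr hf])
  · ext f
    rw [LinearMap.mem_ker]
    change T f = 0 ↔ _
    rw [← norm_eq_zero, hTn, norm_eq_zero, Submodule.starProjection_apply_eq_zero_iff]

end SeparatedBC.IsRealEntireSolution

end Coeff

end LeftDefinite

end

noncomputable section

namespace LeftDefinite

/-! ### Primitives -/

theorem setIntegral_Ico_add {μ : Measure ℝ} {h : ℝ → ℂ} {x y w : ℝ} (hxy : x ≤ y) (hyw : y ≤ w)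
    (hh : IntegrableOn h (Icc x w) μ) :
    ∫ s in Ico x w, h s ∂μ = (∫ s in Ico x y, h s ∂μ) + ∫ s in Ico y w, h s ∂μ := by
  rw [← Ico_union_Ico_eq_Ico hxy hyw]
  refine setIntegral_union ?_ measurableSet_Ico ?_ ?_
  · exact Set.disjoint_left.mpr fun t h1 h2 => (h1.2.trans_le h2.1).false
  · exact hh.mono_set fun t ht => ⟨ht.1, ht.2.le.trans hyw⟩
  · exact hh.mono_set fun t ht => ⟨hxy.trans ht.1, ht.2.le⟩

theorem hasRN_orientedIntegral {I : Set ℝ} {μ : Measure ℝ} {h : ℝ → ℂ} (hh : LocInt I μ h) {c : ℝ}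
    (hc : c ∈ I) : HasRN I μ (orientedIntegral μ h c) h := by
  refine hasRN_of_le hh fun x hx y hy hxy => ?_
  unfold orientedIntegral
  split_ifs with h1 h2 h2
  · rw [setIntegral_Ico_add h2 hxy (hh c hc y hy)]
    ring
  · rw [setIntegral_Ico_add (not_le.mp h2).le h1 (hh x hx y hy)]
    ring
  · exact absurd (h2.trans hxy) h1
  · rw [setIntegral_Ico_add hxy (not_le.mp h1).le (hh x hx c hc)]
    ring

theorem orientedIntegral_self (μ : Measure ℝ) (h : ℝ → ℂ) (c : ℝ) :
    orientedIntegral μ h c c = 0 := by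
  simp [orientedIntegral]

theorem orientedIntegral_congr {a b : EReal} (μ : Measure ℝ) {h k : ℝ → ℂ} {c x : ℝ}
    (hc : c ∈ oi a b) (hx : x ∈ oi a b) (hk : ∀ t ∈ oi a b, h t = k t) :
    orientedIntegral μ h c x = orientedIntegral μ k c x := by
  unfold orientedIntegral
  split_ifs
  · exact setIntegral_congr_fun measurableSet_Ico fun t ht => hk t (Ico_subset_oi hc hx ht)
  · exact congrArg _ (setIntegral_congr_fun measurableSet_Ico fun t ht =>
      hk t (Ico_subset_oi hx hc ht))

/-- The half-open interval between two points. -/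
def between (x y : ℝ) : Set ℝ := Ico (min x y) (max x y)

theorem norm_orientedIntegral_le {μ : Measure ℝ} {h : ℝ → ℂ} {c x : ℝ} {g : ℝ → ℝ}
    (hg : IntegrableOn g (between c x) μ) (hh : ∀ t ∈ between c x, ‖h t‖ ≤ g t) :
    ‖orientedIntegral μ h c x‖ ≤ ∫ t in between c x, g t ∂μ := by
  have key : ‖∫ t in between c x, h t ∂μ‖ ≤ ∫ t in between c x, g t ∂μ :=
    norm_integral_le_of_norm_le hg ((ae_restrict_iff' measurableSet_Ico).mpr
      (Eventually.of_forall hh))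
  unfold orientedIntegral
  unfold between at *
  split_ifs with h1
  · rwa [min_eq_left h1, max_eq_right h1] at *
  · rw [norm_neg]
    rwa [min_eq_right (not_le.mp h1).le, max_eq_left (not_le.mp h1).le] at *

section Primitive

variable {a b : EReal} {μ : Measure ℝ}

theorem exists_gt_mem_oi {x : ℝ} (hx : x ∈ oi a b) : ∃ y ∈ oi a b, x < y := by
  obtain ⟨y, h1, h2⟩ := EReal.lt_iff_exists_real_btwn.mp hx.2
  exact ⟨y, ⟨hx.1.trans h1, h2⟩, by exact_mod_cast h1⟩

theorem locInt_const (hfin : ∀ α ∈ oi a b, ∀ β ∈ oi a b, μ (Icc α β) < ⊤) (r : ℂ) :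
    LocInt (oi a b) μ (fun _ => r) := fun α hα β hβ =>
  integrableOn_const (hfin α hα β hβ).ne

/-- A primitive with respect to one measure is locally integrable with respect to another one. -/
theorem HasRN.locInt (hμ : ∀ x ∈ oi a b, μ {x} = 0)
    (hfin : ∀ α ∈ oi a b, ∀ β ∈ oi a b, μ (Icc α β) < ⊤) {ν : Measure ℝ}
    (hν : ∀ α ∈ oi a b, ∀ β ∈ oi a b, ν (Icc α β) < ⊤) {g h : ℝ → ℂ}
    (hg : HasRN (oi a b) ν g h) : LocInt (oi a b) μ g := by
  intro α hα β hβ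
  obtain ⟨w, hw, hβw⟩ := exists_gt_mem_oi hβ
  have h1 := (HasRN.integral_mul_primitive hμ
    (hasRN_orientedIntegral (locInt_const hfin 1) hα) hα hw (hfin α hα w hw) (hν α hα w hw)
    (hg.1 α hα w hw)).1
  have h2 : IntegrableOn (fun _ : ℝ => g α) (Ico α w) μ :=
    ((locInt_const hfin (g α)) α hα w hw).mono_set Ico_subset_Icc_self
  have h3 : IntegrableOn g (Ico α w) μ := by
    refine (h2.add h1).congr_fun (fun s hs => ?_) measurableSet_Ico
    have := hg.sub_eq hα (Ico_subset_oi hα hw hs) hs.1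
    simp only [Pi.add_apply, one_mul, ← this]
    ring
  exact h3.mono_set fun t ht => ⟨ht.1, ht.2.trans_lt hβw⟩

/-- The product rule. -/
theorem HasRN.mul (hμ : ∀ x ∈ oi a b, μ {x} = 0)
    (hfin : ∀ α ∈ oi a b, ∀ β ∈ oi a b, μ (Icc α β) < ⊤) {f g h k : ℝ → ℂ}
    (hf : HasRN (oi a b) μ f h) (hg : HasRN (oi a b) μ g k) :
    HasRN (oi a b) μ (fun x => f x * g x) (fun x => h x * g x + f x * k x) := by
  have l1 : LocInt (oi a b) μ (fun x => h x * g x) := fun α hα β hβ =>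
    (hf.1 α hα β hβ).mul_continuousOn ((hg.continuousOn hμ).mono (Icc_subset_oi hα hβ))
      isCompact_Icc
  have l2 : LocInt (oi a b) μ (fun x => f x * k x) := fun α hα β hβ =>
    (hg.1 α hα β hβ).continuousOn_mul ((hf.continuousOn hμ).mono (Icc_subset_oi hα hβ))
      isCompact_Icc
  refine hasRN_of_le (fun α hα β hβ => (l1 α hα β hβ).add (l2 α hα β hβ)) fun x hx y hy hxy => ?_
  have hI : Ico x y ⊆ Icc x y := Ico_subset_Icc_self
  have i1 := (l1 x hx y hy).mono_set hI
  have i2 := (l2 x hx y hy).mono_set hI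
  have i3 := (hf.1 x hx y hy).mono_set hI
  have i4 := (hg.1 x hx y hy).mono_set hI
  have e := (HasRN.integral_mul_primitive hμ hf hx hy (hfin x hx y hy) (hfin x hx y hy)
    (hg.1 x hx y hy)).2
  have e1 : ∫ s in Ico x y, h s * (∫ t in Ico x s, k t ∂μ) ∂μ
      = (∫ s in Ico x y, h s * g s ∂μ) - (f y - f x) * g x := by
    rw [hf.sub_eq hx hy hxy, ← integral_mul_const, ← integral_sub i1 (i3.mul_const _)]
    refine setIntegral_congr_fun measurableSet_Ico fun s hs => ?_
    simp only [← hg.sub_eq hx (Ico_subset_oi hx hy hs) hs.1]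
    ring
  have e2 : ∫ t in Ico x y, k t * (f y - f t) ∂μ
      = f y * (g y - g x) - ∫ t in Ico x y, f t * k t ∂μ := by
    rw [hg.sub_eq hx hy hxy, ← integral_const_mul, ← integral_sub (i4.const_mul _) i2]
    refine setIntegral_congr_fun measurableSet_Ico fun s hs => ?_
    ring
  rw [integral_add i1 i2]
  linear_combination e1 - e2 - e

variable (μ) in
/-- The primitive `x ↦ μ([c, x))`, with a minus sign to the left of `c`. -/
def mass (c : ℝ) : ℝ → ℂ := orientedIntegral μ (fun _ => 1) c

theorem mass_of_le {c x : ℝ} (h : c ≤ x) : mass μ c x = (μ.real (Ico c x) : ℂ) := by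
  simp [mass, orientedIntegral, h]

theorem mass_of_lt {c x : ℝ} (h : x < c) : mass μ c x = -(μ.real (Ico x c) : ℂ) := by
  simp [mass, orientedIntegral, not_le.mpr h]

theorem norm_mass (c x : ℝ) : ‖mass μ c x‖ = μ.real (between c x) := by
  rcases le_or_gt c x with h | h
  · rw [mass_of_le h, between, min_eq_left h, max_eq_right h, Complex.norm_real, Real.norm_eq_abs,
      abs_of_nonneg measureReal_nonneg]
  · rw [mass_of_lt h, between, min_eq_right h.le, max_eq_left h.le, norm_neg, Complex.norm_real,
      Real.norm_eq_abs, abs_of_nonneg measureReal_nonneg]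

theorem between_subset {c s x : ℝ} (hs : s ∈ between c x) : between c s ⊆ between c x := by
  unfold between at *
  rintro t ⟨h1, h2⟩
  constructor <;> grind

theorem between_subset_Icc {α β c x : ℝ} (hc : c ∈ Icc α β) (hx : x ∈ Icc α β) :
    between c x ⊆ Icc α β := by
  unfold between
  rintro t ⟨h1, h2⟩
  exact ⟨(le_min hc.1 hx.1).trans h1, h2.le.trans (max_le hc.2 hx.2)⟩

theorem hasRN_mass (hfin : ∀ α ∈ oi a b, ∀ β ∈ oi a b, μ (Icc α β) < ⊤) {c : ℝ}
    (hc : c ∈ oi a b) : HasRN (oi a b) μ (mass μ c) (fun _ => 1) :=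
  hasRN_orientedIntegral (locInt_const hfin 1) hc

theorem hasRN_mass_pow (hμ : ∀ x ∈ oi a b, μ {x} = 0)
    (hfin : ∀ α ∈ oi a b, ∀ β ∈ oi a b, μ (Icc α β) < ⊤) {c : ℝ} (hc : c ∈ oi a b) (n : ℕ) :
    HasRN (oi a b) μ (fun x => mass μ c x ^ (n + 1)) (fun x => (n + 1 : ℂ) * mass μ c x ^ n) := by
  induction n with
  | zero => simpa using hasRN_mass hfin hc
  | succ n ih =>
    have := ih.mul hμ hfin (hasRN_mass hfin hc)
    have e1 : (fun x => mass μ c x ^ (n + 1) * mass μ c x)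
        = fun x => mass μ c x ^ (n + 1 + 1) := by
      ext x
      ring
    have e2 : (fun x => (n + 1 : ℂ) * mass μ c x ^ n * mass μ c x + mass μ c x ^ (n + 1) * 1)
        = fun x => (((n + 1 : ℕ) : ℂ) + 1) * mass μ c x ^ (n + 1) := by
      ext x
      push_cast
      ring
    rwa [e1, e2] at this

theorem integral_norm_mass_pow (hμ : ∀ x ∈ oi a b, μ {x} = 0)
    (hfin : ∀ α ∈ oi a b, ∀ β ∈ oi a b, μ (Icc α β) < ⊤) {c x : ℝ} (hc : c ∈ oi a b)
    (hx : x ∈ oi a b) (n : ℕ) : IntegrableOn (fun t => ‖mass μ c t‖ ^ n) (between c x) μ ∧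
    ∫ t in between c x, ‖mass μ c t‖ ^ n ∂μ = ‖mass μ c x‖ ^ (n + 1) / (n + 1) := by
  have hcont := (hasRN_mass hfin hc).continuousOn hμ
  have hn : ((n : ℂ) + 1) ≠ 0 := by exact_mod_cast Nat.succ_ne_zero n
  constructor
  · have h1 : ContinuousOn (fun t => ‖mass μ c t‖ ^ n) (oi a b) := hcont.norm.pow n
    have aux : ∀ α ∈ oi a b, ∀ β ∈ oi a b, IntegrableOn (fun t => ‖mass μ c t‖ ^ n) (Ico α β) μ :=
      fun α hα β hβ => ((h1.mono (Icc_subset_oi hα hβ)).integrableOn_of_subset_isCompact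
        isCompact_Icc measurableSet_Icc subset_rfl (hfin α hα β hβ).ne).mono_set
          Ico_subset_Icc_self
    unfold between
    rcases le_total c x with h | h
    · rw [min_eq_left h, max_eq_right h]
      exact aux c hc x hx
    · rw [min_eq_right h, max_eq_left h]
      exact aux x hx c hc
  · have hr := hasRN_mass_pow hμ hfin hc n
    have hcc : mass μ c c = 0 := orientedIntegral_self _ _ _
    apply Complex.ofReal_injective
    rcases le_or_gt c x with h | h
    · have e := hr.sub_eq hc hx h
      rw [hcc, integral_const_mul] at e
      unfold between
      rw [min_eq_left h, max_eq_right h, ← integral_complex_ofReal]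
      have e2 : ∫ t in Ico c x, ((‖mass μ c t‖ ^ n : ℝ) : ℂ) ∂μ
          = ∫ t in Ico c x, mass μ c t ^ n ∂μ :=
        setIntegral_congr_fun measurableSet_Ico fun t ht => by
          simp only [mass_of_le ht.1, Complex.norm_real, Real.norm_eq_abs,
            abs_of_nonneg measureReal_nonneg]
          push_cast
          rfl
      rw [e2]
      have e3 : ((‖mass μ c x‖ : ℝ) : ℂ) = mass μ c x := by
        rw [mass_of_le h, Complex.norm_real, Real.norm_eq_abs, abs_of_nonneg measureReal_nonneg]
      push_cast
      rw [e3, eq_div_iff hn]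
      simp at e
      linear_combination -e
    · have e := hr.sub_eq hx hc h.le
      rw [hcc, integral_const_mul] at e
      unfold between
      rw [min_eq_right h.le, max_eq_left h.le, ← integral_complex_ofReal]
      have e3 : ∀ t < c, ((‖mass μ c t‖ : ℝ) : ℂ) = -mass μ c t := fun t ht => by
        rw [mass_of_lt ht, norm_neg, Complex.norm_real, Real.norm_eq_abs,
          abs_of_nonneg measureReal_nonneg, neg_neg]
      have e2 : ∫ t in Ico x c, ((‖mass μ c t‖ ^ n : ℝ) : ℂ) ∂μ
          = (-1) ^ n * ∫ t in Ico x c, mass μ c t ^ n ∂μ := by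
        rw [← integral_const_mul]
        refine setIntegral_congr_fun measurableSet_Ico fun t ht => ?_
        push_cast
        rw [e3 t ht.2, neg_pow]
      rw [e2]
      push_cast
      rw [e3 x h, eq_div_iff hn, neg_pow (mass μ c x)]
      simp at e
      linear_combination -(-1) ^ n * e

/-! ### Volterra operators -/

theorem _root_.ContinuousOn.locInt {f : ℝ → ℂ} (hf : ContinuousOn f (oi a b))
    (hfin : ∀ α ∈ oi a b, ∀ β ∈ oi a b, μ (Icc α β) < ⊤) : LocInt (oi a b) μ f :=
  fun α hα β hβ => hf.integrableOn_Icc_oi hα hβ (hfin α hα β hβ)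

variable (a b) in
/-- The functions that are continuous on `(a, b)`. -/
def contOn : Submodule ℂ (ℝ → ℂ) where
  carrier := {f | ContinuousOn f (oi a b)}
  zero_mem' := continuousOn_const
  add_mem' := fun hf hg => ContinuousOn.add hf hg
  smul_mem' := fun r _ hf => ContinuousOn.const_smul hf r

variable {ν : Measure ℝ} {c : ℝ}

theorem hasRN_iterated (hμ : ∀ x ∈ oi a b, μ {x} = 0)
    (hfin : ∀ α ∈ oi a b, ∀ β ∈ oi a b, μ (Icc α β) < ⊤)
    (hν : ∀ α ∈ oi a b, ∀ β ∈ oi a b, ν (Icc α β) < ⊤) (hc : c ∈ oi a b) {h : ℝ → ℂ}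
    (hh : ContinuousOn h (oi a b)) :
    HasRN (oi a b) μ (orientedIntegral μ (orientedIntegral ν h c) c) (orientedIntegral ν h c) :=
  hasRN_orientedIntegral ((hasRN_orientedIntegral (hh.locInt hν) hc).locInt hμ hfin hν) hc

/-- The operator `h ↦ ∫_c^x ∫_c^t h dν dμ(t)`. -/
def volterra (hμ : ∀ x ∈ oi a b, μ {x} = 0)
    (hfin : ∀ α ∈ oi a b, ∀ β ∈ oi a b, μ (Icc α β) < ⊤)
    (hν : ∀ α ∈ oi a b, ∀ β ∈ oi a b, ν (Icc α β) < ⊤) (hc : c ∈ oi a b) :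
    contOn a b →ₗ[ℂ] contOn a b where
  toFun h := ⟨(oi a b).indicator (orientedIntegral μ (orientedIntegral ν h c) c),
    ((hasRN_iterated hμ hfin hν hc h.2).continuousOn hμ).congr fun _ hx => indicator_of_mem hx _⟩
  map_add' f g := by
    apply Subtype.ext
    funext x
    by_cases hx : x ∈ oi a b
    · simp only [Submodule.coe_add, Pi.add_apply, indicator_of_mem hx]
      have e : orientedIntegral μ (orientedIntegral ν ((f : ℝ → ℂ) + g) c) c x
          = orientedIntegral μ (orientedIntegral ν f c + orientedIntegral ν g c) c x :=
        orientedIntegral_congr μ hc hx fun t ht =>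
          orientedIntegral_add (f.2.locInt hν) (g.2.locInt hν) hc ht
      rw [e, orientedIntegral_add (hasRN_iterated hμ hfin hν hc f.2).1
        (hasRN_iterated hμ hfin hν hc g.2).1 hc hx]
    · simp only [Submodule.coe_add, Pi.add_apply, indicator_of_notMem hx, add_zero]
  map_smul' r f := by
    apply Subtype.ext
    funext x
    by_cases hx : x ∈ oi a b
    · simp only [Submodule.coe_smul, Pi.smul_apply, indicator_of_mem hx, RingHom.id_apply]
      have e : orientedIntegral μ (orientedIntegral ν (r • (f : ℝ → ℂ)) c) c x
          = orientedIntegral μ (r • orientedIntegral ν f c) c x :=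
        orientedIntegral_congr μ hc hx fun t _ => orientedIntegral_smul ν r f c t
      rw [e, orientedIntegral_smul, smul_eq_mul]
    · simp only [Submodule.coe_smul, Pi.smul_apply, indicator_of_notMem hx, smul_zero]

variable {hμ : ∀ x ∈ oi a b, μ {x} = 0} {hfin : ∀ α ∈ oi a b, ∀ β ∈ oi a b, μ (Icc α β) < ⊤}
  {hν : ∀ α ∈ oi a b, ∀ β ∈ oi a b, ν (Icc α β) < ⊤} {hc : c ∈ oi a b}

theorem volterra_apply (h : contOn a b) {x : ℝ} (hx : x ∈ oi a b) :
    (volterra hμ hfin hν hc h : ℝ → ℂ) x = orientedIntegral μ (orientedIntegral ν h c) c x :=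
  indicator_of_mem hx _

theorem norm_volterra_le {α β : ℝ} (hα : α ∈ oi a b) (hβ : β ∈ oi a b) (hcI : c ∈ Icc α β)
    {h : contOn a b} {K : ℝ} (hK : 0 ≤ K) {n : ℕ}
    (hh : ∀ t ∈ Icc α β, ‖(h : ℝ → ℂ) t‖ ≤ K * ‖mass μ c t‖ ^ n) {x : ℝ} (hx : x ∈ Icc α β) :
    ‖(volterra hμ hfin hν hc h : ℝ → ℂ) x‖
      ≤ K * ν.real (Icc α β) * (‖mass μ c x‖ ^ (n + 1) / (n + 1)) := by
  have hxo := Icc_subset_oi hα hβ hx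
  obtain ⟨i1, i2⟩ := integral_norm_mass_pow hμ hfin hc hxo n
  rw [volterra_apply h hxo, ← i2, ← integral_const_mul]
  refine norm_orientedIntegral_le (i1.const_mul _) fun t ht => ?_
  have htI := between_subset_Icc hcI hx ht
  have hsub : between c t ⊆ Icc α β := between_subset_Icc hcI htI
  have hfinI : ν (between c t) ≠ ⊤ := ((measure_mono hsub).trans_lt (hν α hα β hβ)).ne
  refine (norm_orientedIntegral_le (g := fun _ => K * ‖mass μ c t‖ ^ n)
    (integrableOn_const hfinI) fun s hs => ?_).trans ?_
  · refine (hh s (hsub hs)).trans ?_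
    refine mul_le_mul_of_nonneg_left (pow_le_pow_left₀ (norm_nonneg _) ?_ n) hK
    rw [norm_mass, norm_mass]
    exact measureReal_mono (between_subset hs) ((measure_mono hsub).trans_lt (hfin α hα β hβ)).ne
  · rw [setIntegral_const, smul_eq_mul]
    have : ν.real (between c t) ≤ ν.real (Icc α β) :=
      measureReal_mono hsub (hν α hα β hβ).ne
    calc ν.real (between c t) * (K * ‖mass μ c t‖ ^ n)
        ≤ ν.real (Icc α β) * (K * ‖mass μ c t‖ ^ n) := by gcongr
      _ = _ := by ring

end Primitive

end LeftDefinite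

end

noncomputable section

namespace LeftDefinite

theorem exists_lt_mem_oi {a b : EReal} {x : ℝ} (hx : x ∈ oi a b) : ∃ y ∈ oi a b, y < x := by
  obtain ⟨y, h1, h2⟩ := EReal.lt_iff_exists_real_btwn.mp hx.1
  exact ⟨y, ⟨h1, h2.trans hx.2⟩, by exact_mod_cast h2⟩

theorem exists_Icc_mem_nhds {a b : EReal} {c x : ℝ} (hc : c ∈ oi a b) (hx : x ∈ oi a b) :
    ∃ α ∈ oi a b, ∃ β ∈ oi a b, c ∈ Icc α β ∧ Icc α β ∈ 𝓝 x := by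
  have h1 : min c x ∈ oi a b := by
    rcases min_choice c x with h | h <;> rwa [h]
  have h2 : max c x ∈ oi a b := by
    rcases max_choice c x with h | h <;> rwa [h]
  obtain ⟨α, hα, hα'⟩ := exists_lt_mem_oi h1
  obtain ⟨β, hβ, hβ'⟩ := exists_gt_mem_oi h2
  refine ⟨α, hα, β, hβ, ⟨(hα'.trans_le (min_le_left _ _)).le, ((le_max_left _ _).trans_lt hβ').le⟩,
    Icc_mem_nhds (hα'.trans_le (min_le_right _ _)) ((le_max_right _ _).trans_lt hβ')⟩

namespace Coeff

variable {a b : EReal} {C : Coeff a b} {c : ℝ}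

/-! ### The initial value problem -/

section InitialValue

variable (hn : C.Atomless) (hc : c ∈ oi a b)

/-- The operator `h ↦ ∫_c^x (∫_c^t h dχ - z ∫_c^t h dϱ) dς(t)`. -/
def ivpStep (z : ℂ) : contOn a b →ₗ[ℂ] contOn a b :=
  volterra hn C.sigma_fin C.chi_fin hc
    - z • (volterra hn C.sigma_fin C.rhoPos_fin hc - volterra hn C.sigma_fin C.rhoNeg_fin hc)

theorem ivpStep_apply (z : ℂ) (h : contOn a b) (x : ℝ) :
    (ivpStep hn hc z h : ℝ → ℂ) x = (volterra hn C.sigma_fin C.chi_fin hc h : ℝ → ℂ) x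
      - z * ((volterra hn C.sigma_fin C.rhoPos_fin hc h : ℝ → ℂ) x
        - (volterra hn C.sigma_fin C.rhoNeg_fin hc h : ℝ → ℂ) x) := rfl

theorem ivpStep_eq (z : ℂ) (h : contOn a b) {x : ℝ} (hx : x ∈ oi a b) :
    (ivpStep hn hc z h : ℝ → ℂ) x = orientedIntegral C.sigma (orientedIntegral C.chi h c) c x
      - z * (orientedIntegral C.sigma (orientedIntegral C.rhoPos h c) c x
        - orientedIntegral C.sigma (orientedIntegral C.rhoNeg h c) c x) := by
  have e1 := volterra_apply (hμ := hn) (hfin := C.sigma_fin) (hν := C.chi_fin) (hc := hc) h hx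
  have e2 := volterra_apply (hμ := hn) (hfin := C.sigma_fin) (hν := C.rhoPos_fin) (hc := hc) h hx
  have e3 := volterra_apply (hμ := hn) (hfin := C.sigma_fin) (hν := C.rhoNeg_fin) (hc := hc) h hx
  exact congrArg₂ (fun p q : ℂ => p - z * q) e1 (congrArg₂ (fun p q : ℂ => p - q) e2 e3)

/-- The terms of the Neumann series. -/
def ivpTerm (P Q : contOn a b) (z : ℂ) (n : ℕ) : contOn a b := (ivpStep hn hc z ^ n) (P - z • Q)

theorem differentiable_ivpTerm (P Q : contOn a b) (n : ℕ) (ℓ : contOn a b →ₗ[ℂ] ℂ) :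
    Differentiable ℂ fun z => ℓ (ivpTerm hn hc P Q z n) := by
  induction n generalizing ℓ with
  | zero =>
    simp only [ivpTerm, pow_zero, Module.End.one_apply, map_sub, map_smul, smul_eq_mul]
    fun_prop
  | succ n ih =>
    have e : ∀ z, ℓ (ivpTerm hn hc P Q z (n + 1))
        = (ℓ ∘ₗ volterra hn C.sigma_fin C.chi_fin hc) (ivpTerm hn hc P Q z n)
          - z * (ℓ ∘ₗ (volterra hn C.sigma_fin C.rhoPos_fin hc
            - volterra hn C.sigma_fin C.rhoNeg_fin hc)) (ivpTerm hn hc P Q z n) := by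
      intro z
      rw [ivpTerm, pow_succ', Module.End.mul_apply, ← ivpTerm, ivpStep]
      simp only [LinearMap.sub_apply, LinearMap.smul_apply, map_sub, map_smul, smul_eq_mul,
        LinearMap.comp_apply]
    simp only [e]
    exact (ih _).sub (differentiable_id.mul (ih _))

theorem norm_ivpStep_le {α β : ℝ} (hα : α ∈ oi a b) (hβ : β ∈ oi a b) (hcI : c ∈ Icc α β) {R : ℝ}
    {z : ℂ} (hz : ‖z‖ ≤ R) {h : contOn a b} {K : ℝ} (hK : 0 ≤ K) {n : ℕ}
    (hh : ∀ t ∈ Icc α β, ‖(h : ℝ → ℂ) t‖ ≤ K * ‖mass C.sigma c t‖ ^ n) {x : ℝ} (hx : x ∈ Icc α β) :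
    ‖(ivpStep hn hc z h : ℝ → ℂ) x‖ ≤ K * (C.chi.real (Icc α β)
      + R * (C.rhoPos.real (Icc α β) + C.rhoNeg.real (Icc α β)))
        * (‖mass C.sigma c x‖ ^ (n + 1) / (n + 1)) := by
  have h1 := norm_volterra_le (hμ := hn) (hfin := C.sigma_fin) (hν := C.chi_fin) (hc := hc)
    hα hβ hcI hK hh hx
  have h2 := norm_volterra_le (hμ := hn) (hfin := C.sigma_fin) (hν := C.rhoPos_fin) (hc := hc)
    hα hβ hcI hK hh hx
  have h3 := norm_volterra_le (hμ := hn) (hfin := C.sigma_fin) (hν := C.rhoNeg_fin) (hc := hc)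
    hα hβ hcI hK hh hx
  rw [ivpStep_apply]
  refine (norm_sub_le _ _).trans ?_
  rw [norm_mul]
  have h4 := (norm_sub_le _ _).trans (add_le_add h2 h3)
  have h5 := mul_le_mul hz h4 (norm_nonneg _) ((norm_nonneg _).trans hz)
  refine (add_le_add h1 h5).trans (le_of_eq ?_)
  ring

theorem exists_norm_ivpTerm_le (P Q : contOn a b) {α β : ℝ} (hα : α ∈ oi a b) (hβ : β ∈ oi a b)
    (hcI : c ∈ Icc α β) (R : ℝ) : ∃ K S : ℝ, ∀ z : ℂ, ‖z‖ ≤ R → ∀ n, ∀ x ∈ Icc α β,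
      ‖(ivpTerm hn hc P Q z n : ℝ → ℂ) x‖ ≤ K * (S ^ n / n.factorial) := by
  obtain ⟨p, hp⟩ := isCompact_Icc.exists_bound_of_continuousOn (P.2.mono (Icc_subset_oi hα hβ))
  obtain ⟨q, hq⟩ := isCompact_Icc.exists_bound_of_continuousOn (Q.2.mono (Icc_subset_oi hα hβ))
  rcases lt_or_ge R 0 with hR | hR
  · exact ⟨0, 0, fun z hz => absurd ((norm_nonneg z).trans hz) (not_le.mpr hR)⟩
  have hp0 : 0 ≤ p := (norm_nonneg _).trans (hp c hcI)
  have hq0 : 0 ≤ q := (norm_nonneg _).trans (hq c hcI)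
  set N := C.chi.real (Icc α β) + R * (C.rhoPos.real (Icc α β) + C.rhoNeg.real (Icc α β)) with hN
  have hN0 : 0 ≤ N := by positivity
  set K := p + R * q with hK
  have hK0 : 0 ≤ K := by positivity
  have main : ∀ z : ℂ, ‖z‖ ≤ R → ∀ n, ∀ x ∈ Icc α β, ‖(ivpTerm hn hc P Q z n : ℝ → ℂ) x‖
      ≤ K * (N ^ n / n.factorial) * ‖mass C.sigma c x‖ ^ n := by
    intro z hz n
    induction n with
    | zero =>
      intro x hx
      simp only [ivpTerm, pow_zero, Module.End.one_apply, Nat.factorial_zero, Nat.cast_one,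
        div_one, mul_one]
      change ‖(P : ℝ → ℂ) x - z * (Q : ℝ → ℂ) x‖ ≤ K
      refine (norm_sub_le _ _).trans (add_le_add (hp x hx) ?_)
      rw [norm_mul]
      exact mul_le_mul hz (hq x hx) (norm_nonneg _) hR
    | succ n ih =>
      intro x hx
      have := norm_ivpStep_le hn hc hα hβ hcI hz (by positivity) ih hx
      rw [ivpTerm, pow_succ', Module.End.mul_apply, ← ivpTerm]
      refine this.trans (le_of_eq ?_)
      rw [← hN, Nat.factorial_succ]
      push_cast
      field_simp
      ring
  refine ⟨K, N * C.sigma.real (Icc α β), fun z hz n x hx => (main z hz n x hx).trans ?_⟩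
  rw [mul_assoc]
  refine mul_le_mul_of_nonneg_left ?_ hK0
  rw [mul_pow, div_mul_eq_mul_div]
  refine div_le_div_of_nonneg_right ?_ (by positivity)
  refine mul_le_mul_of_nonneg_left (pow_le_pow_left₀ (norm_nonneg _) ?_ n) (by positivity)
  rw [norm_mass]
  exact measureReal_mono (between_subset_Icc hcI hx) (C.sigma_fin α hα β hβ).ne

/-- The sum of the Neumann series. -/
def ivpSum (P Q : contOn a b) (z : ℂ) (x : ℝ) : ℂ := ∑' n, (ivpTerm hn hc P Q z n : ℝ → ℂ) x

theorem summable_factorial (K S : ℝ) : Summable fun n : ℕ => K * (S ^ n / n.factorial) :=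
  (Real.summable_pow_div_factorial S).mul_left K

theorem continuousOn_ivpSum (P Q : contOn a b) (z : ℂ) :
    ContinuousOn (ivpSum hn hc P Q z) (oi a b) := by
  intro x hx
  obtain ⟨α, hα, β, hβ, hcI, hxI⟩ := exists_Icc_mem_nhds hc hx
  obtain ⟨K, S, hKS⟩ := exists_norm_ivpTerm_le hn hc P Q hα hβ hcI ‖z‖
  have : ContinuousOn (ivpSum hn hc P Q z) (Icc α β) :=
    continuousOn_tsum (fun n => (ivpTerm hn hc P Q z n).2.mono (Icc_subset_oi hα hβ))
      (summable_factorial K S) fun n t ht => hKS z le_rfl n t ht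
  exact (this.continuousAt hxI).continuousWithinAt

theorem differentiable_ivpSum (P Q : contOn a b) {x : ℝ} (hx : x ∈ oi a b) :
    Differentiable ℂ fun z => ivpSum hn hc P Q z x := by
  intro z
  obtain ⟨α, hα, β, hβ, hcI, hxI⟩ := exists_Icc_mem_nhds hc hx
  obtain ⟨K, S, hKS⟩ := exists_norm_ivpTerm_le hn hc P Q hα hβ hcI (‖z‖ + 1)
  have hd : DifferentiableOn ℂ (fun z => ivpSum hn hc P Q z x) (Metric.ball 0 (‖z‖ + 1)) := by
    refine Complex.differentiableOn_tsum_of_summable_norm (summable_factorial K S) (fun n => ?_)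
      Metric.isOpen_ball fun n w hw => hKS w ?_ n x (mem_of_mem_nhds hxI)
    · exact (differentiable_ivpTerm hn hc P Q n
        ((LinearMap.proj x).comp (contOn a b).subtype)).differentiableOn
    · simpa using (mem_ball_zero_iff.mp hw).le
  exact hd.differentiableAt (Metric.isOpen_ball.mem_nhds (by simp))

theorem ivpSum_eq (P Q : contOn a b) (z : ℂ) {x : ℝ} (hx : x ∈ oi a b) :
    ivpSum hn hc P Q z x = (P : ℝ → ℂ) x - z * (Q : ℝ → ℂ) x
      + (ivpStep hn hc z ⟨ivpSum hn hc P Q z, continuousOn_ivpSum hn hc P Q z⟩ : ℝ → ℂ) x := by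
  obtain ⟨α, hα, β, hβ, hcI, hxI⟩ := exists_Icc_mem_nhds hc hx
  have hx' := mem_of_mem_nhds hxI
  obtain ⟨K, S, hKS⟩ := exists_norm_ivpTerm_le hn hc P Q hα hβ hcI ‖z‖
  set F : contOn a b := ⟨ivpSum hn hc P Q z, continuousOn_ivpSum hn hc P Q z⟩ with hF
  set s : ℕ → contOn a b := fun n => ∑ k ∈ Finset.range n, ivpTerm hn hc P Q z k with hs
  have hsx : ∀ n t, (s n : ℝ → ℂ) t
      = ∑ k ∈ Finset.range n, (ivpTerm hn hc P Q z k : ℝ → ℂ) t := fun n t => by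
    simp [hs, Finset.sum_apply]
  have hunif : TendstoUniformlyOn (fun n t => (s n : ℝ → ℂ) t) (F : ℝ → ℂ) atTop (Icc α β) := by
    simp only [hsx]
    exact tendstoUniformlyOn_tsum_nat (summable_factorial K S) fun n t ht => hKS z le_rfl n t ht
  have hstep : ∀ n, s (n + 1) = (P - z • Q) + ivpStep hn hc z (s n) := by
    intro n
    simp only [hs]
    rw [Finset.sum_range_succ', map_sum, add_comm]
    congr 1
    refine Finset.sum_congr rfl fun k _ => ?_
    rw [ivpTerm, pow_succ', Module.End.mul_apply, ← ivpTerm]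
  have hlim1 : Tendsto (fun n => (s (n + 1) : ℝ → ℂ) x) atTop (𝓝 ((F : ℝ → ℂ) x)) :=
    (hunif.tendsto_at hx').comp (tendsto_add_atTop_nat 1)
  set N := C.chi.real (Icc α β) + ‖z‖ * (C.rhoPos.real (Icc α β) + C.rhoNeg.real (Icc α β))
    with hN
  have hlim2 : Tendsto (fun n => (ivpStep hn hc z (s n) : ℝ → ℂ) x) atTop
      (𝓝 ((ivpStep hn hc z F : ℝ → ℂ) x)) := by
    rw [Metric.tendsto_atTop]
    intro ε hε
    set D := N * ‖mass C.sigma c x‖ + 1 with hD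
    have hD0 : 0 < D := by positivity
    obtain ⟨n₀, hn₀⟩ := eventually_atTop.mp
      (Metric.tendstoUniformlyOn_iff.mp hunif (ε / D) (by positivity))
    refine ⟨n₀, fun n hnn => ?_⟩
    have h1 : ∀ t ∈ Icc α β, ‖((s n - F : contOn a b) : ℝ → ℂ) t‖
        ≤ ε / D * ‖mass C.sigma c t‖ ^ 0 := fun t ht => by
      have := hn₀ n hnn t ht
      rw [dist_comm, dist_eq_norm] at this
      rw [pow_zero, mul_one]
      exact this.le
    have h2 := norm_ivpStep_le hn hc hα hβ hcI (le_refl ‖z‖) (by positivity) h1 hx'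
    rw [map_sub] at h2
    rw [dist_eq_norm]
    refine lt_of_le_of_lt h2 ?_
    rw [← hN]
    simp only [zero_add, pow_one, Nat.cast_zero, div_one]
    calc ε / D * N * ‖mass C.sigma c x‖ = ε / D * (N * ‖mass C.sigma c x‖) := by ring
      _ < ε / D * D := by
        refine mul_lt_mul_of_pos_left ?_ (by positivity)
        rw [hD]
        linarith
      _ = ε := div_mul_cancel₀ _ hD0.ne'
  refine tendsto_nhds_unique hlim1 ?_
  have : (fun n => (s (n + 1) : ℝ → ℂ) x) = fun n => ((P : ℝ → ℂ) x - z * (Q : ℝ → ℂ) x)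
      + (ivpStep hn hc z (s n) : ℝ → ℂ) x := by
    funext n
    rw [hstep]
    rfl
  rw [this]
  exact hlim2.const_add _

theorem rhoIntegral_add_apply {f g : ℝ → ℂ} (hf : ContinuousOn f (oi a b))
    (hg : ContinuousOn g (oi a b)) {x : ℝ} (hc : c ∈ oi a b) (hx : x ∈ oi a b) :
    C.rhoIntegral (f + g) c x = C.rhoIntegral f c x + C.rhoIntegral g c x := by
  rw [rhoIntegral, orientedIntegral_add (hf.locInt C.rhoPos_fin) (hg.locInt C.rhoPos_fin) hc hx,
    orientedIntegral_add (hf.locInt C.rhoNeg_fin) (hg.locInt C.rhoNeg_fin) hc hx, rhoIntegral,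
    rhoIntegral]
  ring

theorem rhoIntegral_sub_eq {f : ℝ → ℂ} (hf : ContinuousOn f (oi a b)) {x y : ℝ}
    (hc : c ∈ oi a b) (hx : x ∈ oi a b) (hy : y ∈ oi a b) :
    C.rhoIntegral f c y - C.rhoIntegral f c x = C.rhoIntegral f x y := by
  have h1 := (hasRN_orientedIntegral (hf.locInt C.rhoPos_fin) hc).2 x hx y hy
  have h2 := (hasRN_orientedIntegral (hf.locInt C.rhoNeg_fin) hc).2 x hx y hy
  simp only [rhoIntegral]
  linear_combination h1 - h2

/-- Solvability of the inhomogeneous equation `(τ - z) u = z q` with initial values at `c`; the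
solution depends on `z` analytically. -/
theorem exists_ivp (hn : C.Atomless) (hc : c ∈ oi a b) (α β : ℂ) {q q' : ℝ → ℂ}
    (hq : HasRN (oi a b) C.sigma q q') :
    ∃ u : ℂ → C.TLoc, (∀ z, (u z).fn c = α ∧ (u z).qd c = β ∧
      ∀ x ∈ oi a b, (u z).tau x = z * ((u z).fn x + q x)) ∧
      ∀ x ∈ oi a b, Differentiable ℂ fun z => (u z).fn x := by
  have hqc := hq.continuousOn hn
  have hm := hasRN_mass C.sigma_fin hc
  set q₀ : contOn a b := ⟨q, hqc⟩ with hq₀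
  let P : contOn a b := ⟨fun x => α + β * mass C.sigma c x,
    continuousOn_const.add (continuousOn_const.mul (hm.continuousOn hn))⟩
  let Q : contOn a b := volterra hn C.sigma_fin C.rhoPos_fin hc q₀
    - volterra hn C.sigma_fin C.rhoNeg_fin hc q₀
  have hQ : ∀ x ∈ oi a b, (Q : ℝ → ℂ) x
      = orientedIntegral C.sigma (orientedIntegral C.rhoPos q c) c x
        - orientedIntegral C.sigma (orientedIntegral C.rhoNeg q c) c x := fun x hx =>
    congrArg₂ (fun p q : ℂ => p - q)
      (volterra_apply (hμ := hn) (hfin := C.sigma_fin) (hν := C.rhoPos_fin) (hc := hc) q₀ hx)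
      (volterra_apply (hμ := hn) (hfin := C.sigma_fin) (hν := C.rhoNeg_fin) (hc := hc) q₀ hx)
  set F := ivpSum hn hc P Q with hF
  have hFc : ∀ z, ContinuousOn (F z) (oi a b) := continuousOn_ivpSum hn hc P Q
  let G : ℂ → ℝ → ℂ := fun z x =>
    β + orientedIntegral C.chi (F z) c x - z * C.rhoIntegral (F z + q) c x
  have lχ : ∀ {h : ℝ → ℂ}, ContinuousOn h (oi a b) →
      LocInt (oi a b) C.sigma (orientedIntegral C.chi h c) := fun h =>
    (hasRN_iterated hn C.sigma_fin C.chi_fin hc h).1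
  have lp : ∀ {h : ℝ → ℂ}, ContinuousOn h (oi a b) →
      LocInt (oi a b) C.sigma (orientedIntegral C.rhoPos h c) := fun h =>
    (hasRN_iterated hn C.sigma_fin C.rhoPos_fin hc h).1
  have ln : ∀ {h : ℝ → ℂ}, ContinuousOn h (oi a b) →
      LocInt (oi a b) C.sigma (orientedIntegral C.rhoNeg h c) := fun h =>
    (hasRN_iterated hn C.sigma_fin C.rhoNeg_fin hc h).1
  have key : ∀ z, HasRN (oi a b) C.sigma (F z) (G z) := by
    intro z
    have h1 : HasRN (oi a b) C.sigma (orientedIntegral C.sigma (orientedIntegral C.chi (F z) c) c)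
        (orientedIntegral C.chi (F z) c) := hasRN_orientedIntegral (lχ (hFc z)) hc
    have h2 := hasRN_orientedIntegral (lp (hFc z)) hc
    have h3 := hasRN_orientedIntegral (ln (hFc z)) hc
    have h4 := hasRN_orientedIntegral (lp hqc) hc
    have h5 := hasRN_orientedIntegral (ln hqc) hc
    have hs := (((hm.smul β).add h1).add (((h2.add h4).smul (-z)))).add ((h3.add h5).smul z)
    have hFx : ∀ x ∈ oi a b, F z x = α + (β • mass C.sigma c
        + orientedIntegral C.sigma (orientedIntegral C.chi (F z) c) c
        + -z • (orientedIntegral C.sigma (orientedIntegral C.rhoPos (F z) c) c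
          + orientedIntegral C.sigma (orientedIntegral C.rhoPos q c) c)
        + z • (orientedIntegral C.sigma (orientedIntegral C.rhoNeg (F z) c) c
          + orientedIntegral C.sigma (orientedIntegral C.rhoNeg q c) c)) x := by
      intro x hx
      have e := ivpSum_eq hn hc P Q z hx
      rw [ivpStep_eq hn hc z _ hx] at e
      rw [hQ x hx] at e
      simp only [Pi.add_apply, Pi.smul_apply, smul_eq_mul]
      rw [hF, e]
      change α + β * mass C.sigma c x - _ + _ = _
      ring
    have hGx : ∀ x ∈ oi a b, (β • (fun _ : ℝ => (1 : ℂ)) + orientedIntegral C.chi (F z) c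
        + -z • (orientedIntegral C.rhoPos (F z) c + orientedIntegral C.rhoPos q c)
        + z • (orientedIntegral C.rhoNeg (F z) c + orientedIntegral C.rhoNeg q c) : ℝ → ℂ) x = G z x := by
      intro x hx
      simp only [G, rhoIntegral_add_apply (hFc z) hqc hc hx, Pi.add_apply,
        Pi.smul_apply, smul_eq_mul]
      simp only [rhoIntegral]
      ring
    refine ⟨fun x hx y hy => (hs.1 x hx y hy).congr_fun
      (fun t ht => hGx t (Icc_subset_oi hx hy ht)) measurableSet_Icc, fun x hx y hy => ?_⟩
    rw [hFx x hx, hFx y hy, hs.2 x hx y hy, orientedIntegral_congr C.sigma hx hy hGx]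
    ring
  have hFq : ∀ z, ContinuousOn (F z + q) (oi a b) := fun z => (hFc z).add hqc
  refine ⟨fun z => ⟨F z, G z, z • (F z + q), key z, ⟨_, ((key z).add hq).smul z⟩,
    fun x hx y hy => ?_⟩, fun z => ⟨?_, ?_, fun x _ => rfl⟩, fun x hx =>
      differentiable_ivpSum hn hc P Q hx⟩
  · have h1 := (hasRN_orientedIntegral ((hFc z).locInt C.chi_fin) hc).2 x hx y hy
    have h2 := rhoIntegral_sub_eq (C := C) (hFq z) hc hx hy
    rw [rhoIntegral, orientedIntegral_smul, orientedIntegral_smul]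
    rw [rhoIntegral] at h2
    simp only [G]
    rw [rhoIntegral] at h2 ⊢
    rw [rhoIntegral] at h2 ⊢
    linear_combination -h1 + z * h2
  · have := ivpSum_eq hn hc P Q z hc
    rw [ivpStep_eq hn hc z _ hc] at this
    have eP : (P : ℝ → ℂ) c = α := by
      change α + β * mass C.sigma c c = α
      rw [mass, orientedIntegral_self, mul_zero, add_zero]
    rw [eP, hQ c hc] at this
    simp only [orientedIntegral_self] at this
    simpa using this
  · simp [G, rhoIntegral, orientedIntegral_self]

end InitialValue

end Coeff

end LeftDefinite

end

noncomputable section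

namespace LeftDefinite

theorem between_comm (x y : ℝ) : between x y = between y x := by
  rw [between, between, min_comm, max_comm]

theorem between_of_le {x y : ℝ} (h : x ≤ y) : between x y = Ico x y := by
  rw [between, min_eq_left h, max_eq_right h]

theorem between_subset_of_mem_uIcc {x y w : ℝ} (h : y ∈ uIcc x w) :
    between x y ⊆ between x w ∧ between y w ⊆ between x w := by
  rw [uIcc, mem_Icc] at h
  unfold between
  constructor
  · exact Ico_subset_Ico (le_min (min_le_left _ _) h.1) (max_le (le_max_left _ _) h.2)
  · exact Ico_subset_Ico (le_min h.1 (min_le_right _ _)) (max_le h.2 (le_max_right _ _))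

namespace Coeff

variable {a b : EReal} {C : Coeff a b}

theorem form_conj_self (J : Set ℝ) (f f₁ : ℝ → ℂ) :
    C.form J (fun x => conj (f x)) (fun x => conj (f₁ x)) f f₁ = (C.energy J f f₁ : ℂ) := by
  rw [form, integral_conj_mul_self_re, integral_conj_mul_self_re, energy]
  push_cast
  rfl

namespace TLoc

/-! ### Homogeneous solutions -/

/-- The Wronskian `f g^{[1]} - f^{[1]} g`. -/
def homWronskian (f g : C.TLoc) (x : ℝ) : ℂ := f.fn x * g.qd x - f.qd x * g.fn x

theorem fn_mul_homWronskian (f g h : C.TLoc) (x : ℝ) :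
    f.fn x * homWronskian g h x
      = g.fn x * homWronskian f h x - h.fn x * homWronskian f g x := by
  unfold homWronskian
  ring

theorem qd_mul_homWronskian (f g h : C.TLoc) (x : ℝ) :
    f.qd x * homWronskian g h x
      = g.qd x * homWronskian f h x - h.qd x * homWronskian f g x := by
  unfold homWronskian
  ring

theorem mul_qd_sub_eq_form (hn : C.Atomless) {u : C.TLoc} {f h : ℝ → ℂ}
    (hf : HasRN (oi a b) C.sigma f h) {x y : ℝ} (hx : x ∈ oi a b) (hy : y ∈ oi a b) (hxy : x ≤ y)
    (hu : ∀ t ∈ Ico x y, u.tau t = 0) :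
    f y * u.qd y - f x * u.qd x = C.form (Ico x y) f h u.fn u.qd := by
  have e : ∀ μ : Measure ℝ, ∫ s in Ico x y, f s * u.tau s ∂μ = 0 := fun μ =>
    setIntegral_eq_zero_of_forall_eq_zero fun t ht => by rw [hu t ht, mul_zero]
  rw [u.mul_qd_sub_eq hn hf hx hy hxy, form, e, e]
  ring

theorem tau_eq_zero {u : C.TLoc} (hu : C.IsSolution 0 u) {x : ℝ} (hx : x ∈ oi a b) :
    u.tau x = 0 := by
  rw [hu x hx, zero_mul]

theorem norm_mul_qd_sub_eq (hn : C.Atomless) {u : C.TLoc} (hu : C.IsSolution 0 u) {f h : ℝ → ℂ}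
    (hf : HasRN (oi a b) C.sigma f h) {x y : ℝ} (hx : x ∈ oi a b) (hy : y ∈ oi a b) :
    ‖f y * u.qd y - f x * u.qd x‖ = ‖C.form (between x y) f h u.fn u.qd‖ := by
  rcases le_total x y with h1 | h1
  · rw [between_of_le h1, mul_qd_sub_eq_form hn hf hx hy h1
      fun t ht => tau_eq_zero hu (Ico_subset_oi hx hy ht)]
  · rw [between_comm, between_of_le h1, ← mul_qd_sub_eq_form hn hf hy hx h1
      fun t ht => tau_eq_zero hu (Ico_subset_oi hy hx ht), norm_sub_rev]

theorem energy_between_eq (hn : C.Atomless) {u : C.TLoc} (hu : C.IsSolution 0 u) {x y : ℝ}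
    (hx : x ∈ oi a b) (hy : y ∈ oi a b) : C.energy (between x y) u.fn u.qd
      = ‖conj (u.fn y) * u.qd y - conj (u.fn x) * u.qd x‖ := by
  rw [norm_mul_qd_sub_eq hn hu u.fn_deriv.conj hx hy, form_conj_self, Complex.norm_real,
    Real.norm_eq_abs, abs_of_nonneg (energy_nonneg _ _ _)]

theorem homWronskian_eq (hn : C.Atomless) {f g : C.TLoc} (hf : C.IsSolution 0 f)
    (hg : C.IsSolution 0 g) {x y : ℝ} (hx : x ∈ oi a b) (hy : y ∈ oi a b) :
    homWronskian f g x = homWronskian f g y := by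
  wlog hxy : x ≤ y generalizing x y
  · exact (this hy hx (le_of_not_ge hxy)).symm
  have h1 := mul_qd_sub_eq_form hn f.fn_deriv hx hy hxy
    fun t ht => tau_eq_zero hg (Ico_subset_oi hx hy ht)
  have h2 := mul_qd_sub_eq_form hn g.fn_deriv hx hy hxy
    fun t ht => tau_eq_zero hf (Ico_subset_oi hx hy ht)
  have h3 : C.form (Ico x y) f.fn f.qd g.fn g.qd = C.form (Ico x y) g.fn g.qd f.fn f.qd := by
    simp only [form, mul_comm]
  unfold homWronskian
  linear_combination h2 - h1 - h3

theorem exists_homogeneous (hn : C.Atomless) {x₀ : ℝ} (hx₀ : x₀ ∈ oi a b) (s t : ℂ) :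
    ∃ f : C.TLoc, C.IsSolution 0 f ∧ f.fn x₀ = s ∧ f.qd x₀ = t := by
  have h0 : HasRN (oi a b) C.sigma (fun _ => 0) (fun _ => 0) :=
    ⟨fun α _ β _ => integrableOn_zero, fun c _ x _ => by simp [orientedIntegral]⟩
  obtain ⟨u, hu, -⟩ := exists_ivp hn hx₀ s t h0
  obtain ⟨h1, h2, h3⟩ := hu 0
  exact ⟨u 0, fun x hx => by rw [h3 x hx, zero_mul, zero_mul], h1, h2⟩

theorem l2On_between (hn : C.Atomless) (u : C.TLoc) {x y : ℝ} (hx : x ∈ oi a b)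
    (hy : y ∈ oi a b) : C.L2On (between x y) u.fn u.qd := by
  rcases le_total x y with h | h
  · rw [between_of_le h]
    exact (u.l2On_Icc hn hx hy).mono Ico_subset_Icc_self
  · rw [between_comm, between_of_le h]
    exact (u.l2On_Icc hn hy hx).mono Ico_subset_Icc_self

/-- A non-trivial homogeneous solution that satisfies the natural boundary condition at an
endpoint. -/
theorem exists_minimal (hn : C.Atomless) {l : Filter ℝ} [l.NeBot] (hl : ∀ᶠ x in l, x ∈ oi a b)
    {x₀ : ℝ} (hx₀ : x₀ ∈ oi a b) :
    ∃ f : C.TLoc, C.IsSolution 0 f ∧ (f.fn x₀ ≠ 0 ∨ f.qd x₀ ≠ 0) ∧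
      ∀ y ∈ oi a b, (∀ᶠ x in l, y ∈ uIcc x₀ x) →
        C.energy (between x₀ y) f.fn f.qd ≤ 1 ∧
        ∀ (h h' : ℝ → ℂ) (T : Set ℝ), HasRN (oi a b) C.sigma h h' →
          (∀ᶠ x in l, between y x ⊆ T) → C.L2On T h h' →
          ‖h y * f.qd y‖ ^ 2 ≤ C.energy T h h' := by
  obtain ⟨p, hp, hp0, hp1⟩ := exists_homogeneous hn hx₀ 1 0
  obtain ⟨q, hq, hq0, hq1⟩ := exists_homogeneous hn hx₀ 0 1
  have hW : ∀ x ∈ oi a b, homWronskian p q x = 1 := fun x hx => by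
    rw [homWronskian_eq hn hp hq hx hx₀, homWronskian, hp0, hp1, hq0, hq1]
    ring
  have rep : ∀ {f : C.TLoc}, C.IsSolution 0 f → ∀ y ∈ oi a b,
      f.fn y = p.fn y * f.fn x₀ + q.fn y * f.qd x₀ ∧
      f.qd y = p.qd y * f.fn x₀ + q.qd y * f.qd x₀ := by
    intro f hf y hy
    have e1 := fn_mul_homWronskian f p q y
    have e2 := qd_mul_homWronskian f p q y
    have w1 : homWronskian f q y = f.fn x₀ := by
      rw [homWronskian_eq hn hf hq hy hx₀, homWronskian, hq0, hq1]
      ring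
    have w2 : homWronskian f p y = -f.qd x₀ := by
      rw [homWronskian_eq hn hf hp hy hx₀, homWronskian, hp0, hp1]
      ring
    rw [hW y hy, w1, w2] at e1 e2
    exact ⟨by linear_combination e1, by linear_combination e2⟩
  let r : ℝ → ℂ × ℂ := fun x => (q.qd x, -p.qd x)
  have hr : ∀ x ∈ oi a b, r x ≠ 0 := by
    intro x hx h0
    have h1 : q.qd x = 0 := congrArg Prod.fst h0
    have h2 : p.qd x = 0 := neg_eq_zero.mp (congrArg Prod.snd h0)
    have := hW x hx
    rw [homWronskian, h1, h2, mul_zero, zero_mul, sub_zero] at this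
    exact zero_ne_one this
  let s : ℝ → ℂ × ℂ := fun x => ((‖r x‖⁻¹ : ℝ) : ℂ) • r x
  have hs : ∀ x ∈ oi a b, ‖s x‖ = 1 := fun x hx => by
    rw [norm_smul, Complex.norm_real, norm_inv, norm_norm,
      inv_mul_cancel₀ (norm_ne_zero_iff.mpr (hr x hx))]
  choose g hg hg0 hg1 using fun x => exists_homogeneous hn hx₀ (s x).1 (s x).2
  have hgx : ∀ x ∈ oi a b, (g x).qd x = 0 := by
    intro x hx
    rw [(rep (hg x) x hx).2, hg0, hg1]
    change p.qd x * (((‖r x‖⁻¹ : ℝ) : ℂ) * q.qd x)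
      + q.qd x * (((‖r x‖⁻¹ : ℝ) : ℂ) * -p.qd x) = 0
    ring
  have hE : ∀ x ∈ oi a b, C.energy (between x₀ x) (g x).fn (g x).qd ≤ 1 := by
    intro x hx
    rw [energy_between_eq hn (hg x) hx₀ hx, hgx x hx, mul_zero, zero_sub, norm_neg, norm_mul,
      RCLike.norm_conj, hg0, hg1]
    have h1 := norm_fst_le (s x)
    have h2 := norm_snd_le (s x)
    rw [hs x hx] at h1 h2
    exact mul_le_one₀ h1 (norm_nonneg _) h2
  let U := Ultrafilter.of l
  have hU : (U : Filter ℝ) ≤ l := Ultrafilter.of_le l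
  obtain ⟨w, hw, hUw⟩ := (isCompact_sphere (0 : ℂ × ℂ) 1).ultrafilter_le_nhds (U.map s) (by
    rw [Ultrafilter.coe_map, le_principal_iff, mem_map]
    filter_upwards [hU hl] with x hx
    exact mem_sphere_zero_iff_norm.mpr (hs x hx))
  have hlim : Tendsto s U (𝓝 w) := hUw
  have hl1 : Tendsto (fun x => (s x).1) U (𝓝 w.1) := (continuous_fst.tendsto w).comp hlim
  have hl2 : Tendsto (fun x => (s x).2) U (𝓝 w.2) := (continuous_snd.tendsto w).comp hlim
  obtain ⟨f, hf, hf0, hf1⟩ := exists_homogeneous hn hx₀ w.1 w.2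
  have lfn : ∀ y ∈ oi a b, Tendsto (fun x => (g x).fn y) U (𝓝 (f.fn y)) := by
    intro y hy
    rw [(rep hf y hy).1, hf0, hf1]
    refine ((hl1.const_mul _).add (hl2.const_mul _)).congr fun x => ?_
    rw [(rep (hg x) y hy).1, hg0, hg1]
  have lqd : ∀ y ∈ oi a b, Tendsto (fun x => (g x).qd y) U (𝓝 (f.qd y)) := by
    intro y hy
    rw [(rep hf y hy).2, hf0, hf1]
    refine ((hl1.const_mul _).add (hl2.const_mul _)).congr fun x => ?_
    rw [(rep (hg x) y hy).2, hg0, hg1]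
  refine ⟨f, hf, ?_, fun y hy hyl => ⟨?_, fun h h' T hh hT hhT => ?_⟩⟩
  · by_contra hcon
    push Not at hcon
    rw [hf0, hf1] at hcon
    have : w = 0 := Prod.ext hcon.1 hcon.2
    rw [this] at hw
    simp at hw
  · rw [energy_between_eq hn hf hx₀ hy]
    have cj : Tendsto (fun x => conj ((g x).fn y) * (g x).qd y
        - conj ((g x).fn x₀) * (g x).qd x₀) U
        (𝓝 (conj (f.fn y) * f.qd y - conj (f.fn x₀) * f.qd x₀)) :=
      (((Complex.continuous_conj.tendsto _).comp (lfn y hy)).mul (lqd y hy)).sub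
        (((Complex.continuous_conj.tendsto _).comp (lfn x₀ hx₀)).mul (lqd x₀ hx₀))
    refine le_of_tendsto cj.norm ?_
    filter_upwards [hU hl, hU hyl] with x hx hyx
    rw [← energy_between_eq hn (hg x) hx₀ hy]
    exact (energy_mono ((g x).l2On_between hn hx₀ hx)
      (between_subset_of_mem_uIcc hyx).1).trans (hE x hx)
  · refine le_of_tendsto (((lqd y hy).const_mul (h y)).norm.pow 2) ?_
    filter_upwards [hU hl, hU hyl, hU hT] with x hx hyx hxT
    have e := norm_mul_qd_sub_eq hn (hg x) hh hy hx
    rw [hgx x hx, mul_zero, zero_sub, norm_neg] at e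
    rw [e]
    have hsub := (between_subset_of_mem_uIcc hyx).2
    have l2 := ((g x).l2On_between hn hx₀ hx)
    refine (sq_norm_form_le (hhT.mono hxT) (l2.mono hsub)).trans ?_
    calc _ ≤ C.energy T h h' * 1 := mul_le_mul (energy_mono hhT hxT)
          ((energy_mono l2 hsub).trans (hE x hx)) (energy_nonneg _ _ _) (energy_nonneg _ _ _)
      _ = _ := mul_one _

/-! ### The right endpoint -/

end TLoc

variable (C) in
theorem eventually_mem_rightEnd {y : ℝ} (hy : y ∈ oi a b) :
    ∀ᶠ x in C.rightEnd, x ∈ oi a b ∧ y < x := by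
  have : ∀ᶠ x : ℝ in C.rightEnd, (x : EReal) ∈ Ioo (y : EReal) b :=
    preimage_mem_comap (Ioo_mem_nhdsLT hy.2)
  filter_upwards [this] with x hx
  exact ⟨⟨hy.1.trans hx.1, hx.2⟩, by exact_mod_cast hx.1⟩

variable (C) in
theorem rightEnd_neBot {d : ℝ} (hd : d ∈ oi a b) : C.rightEnd.NeBot := by
  refine ⟨fun h => ?_⟩
  have hm : (∅ : Set ℝ) ∈ C.rightEnd := by
    rw [h]
    exact mem_bot
  obtain ⟨s, hs, hsP⟩ := mem_comap.mp hm
  obtain ⟨e, he, heS⟩ := (nhdsLT_basis_of_exists_lt ⟨_, hd.2⟩).mem_iff.mp hs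
  obtain ⟨y, hy, hyb⟩ := EReal.lt_iff_exists_real_btwn.mp he
  exact hsP (heS ⟨hy, hyb⟩ : y ∈ (fun x : ℝ => (x : EReal)) ⁻¹' s)

instance : C.rightEnd.IsCountablyGenerated :=
  inferInstanceAs (comap (fun x : ℝ => (x : EReal)) (𝓝[<] b)).IsCountablyGenerated

variable (C) in
theorem aecover_rightEnd (μ : Measure ℝ) (y : ℝ) :
    AECover (μ.restrict (Ici y ∩ oi a b)) C.rightEnd
      (fun x => Ico y x ∩ {_t : ℝ | x ∈ oi a b}) := by
  refine ⟨?_, fun x => measurableSet_Ico.inter (MeasurableSet.const _)⟩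
  filter_upwards [ae_restrict_mem (measurableSet_Ici.inter (measurableSet_oi a b))] with t ht
  filter_upwards [C.eventually_mem_rightEnd ht.2] with x hx
  exact ⟨⟨ht.1, hx.2⟩, hx.1⟩

theorem l2On_right_of_energy_le {y : ℝ} (hy : y ∈ oi a b) {f f₁ : ℝ → ℂ} {K : ℝ}
    (h : ∀ x ∈ oi a b, C.L2On (Ico y x) f f₁)
    (hm : AEStronglyMeasurable f (C.chi.restrict (oi a b)) ∧
      AEStronglyMeasurable f₁ (C.sigma.restrict (oi a b)))
    (hK : ∀ x ∈ oi a b, y < x → C.energy (Ico y x) f f₁ ≤ K) :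
    C.L2On (Ici y ∩ oi a b) f f₁ := by
  have := C.rightEnd_neBot hy
  have aux : ∀ {μ : Measure ℝ} {g : ℝ → ℂ}, AEStronglyMeasurable g (μ.restrict (oi a b)) →
      (∀ x ∈ oi a b, IntegrableOn (fun t => ‖g t‖ ^ 2) (Ico y x) μ) →
      (∀ x ∈ oi a b, y < x → ∫ t in Ico y x, ‖g t‖ ^ 2 ∂μ ≤ K) →
      MemLp g 2 (μ.restrict (Ici y ∩ oi a b)) := by
    intro μ g hm h1 h2
    rw [memLp_two_iff_integrable_sq_norm
      (hm.mono_measure (Measure.restrict_mono inter_subset_right le_rfl))]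
    refine (C.aecover_rightEnd μ y).integrable_of_integral_norm_bounded K (fun x => ?_) ?_
    · by_cases hx : x ∈ oi a b
      · have : Ico y x ∩ {_t : ℝ | x ∈ oi a b} = Ico y x := by simp [hx]
        rw [this]
        exact (h1 x hx).mono_measure Measure.restrict_le_self
      · have : Ico y x ∩ {_t : ℝ | x ∈ oi a b} = ∅ := by simp [hx]
        rw [this]
        exact integrableOn_empty
    · filter_upwards [C.eventually_mem_rightEnd hy] with x hx
      have : Ico y x ∩ {_t : ℝ | x ∈ oi a b} = Ico y x := by simp [hx.1]
      have hs : Ico y x ⊆ Ici y ∩ oi a b := fun t ht => ⟨ht.1, Ico_subset_oi hy hx.1 ht⟩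
      rw [this, Measure.restrict_restrict measurableSet_Ico, inter_eq_self_of_subset_left hs]
      simpa using h2 x hx.1 hx.2
  constructor
  · refine aux hm.1 (fun x hx => (h x hx).integrableOn_sq.1) fun x hx hyx =>
      le_trans ?_ (hK x hx hyx)
    exact le_add_of_nonneg_right (integral_nonneg fun _ => sq_nonneg _)
  · refine aux hm.2 (fun x hx => (h x hx).integrableOn_sq.2) fun x hx hyx =>
      le_trans ?_ (hK x hx hyx)
    exact le_add_of_nonneg_left (integral_nonneg fun _ => sq_nonneg _)

theorem tendsto_setIntegral_right {μ : Measure ℝ} {y : ℝ} (hy : y ∈ oi a b) {k : ℝ → ℝ}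
    (hk : IntegrableOn k (Ici y ∩ oi a b) μ) :
    Tendsto (fun x : ℝ => ∫ t in Ici x ∩ oi a b, k t ∂μ) C.rightEnd (𝓝 0) := by
  have h := ((C.aecover_rightEnd μ y).integral_tendsto_of_countably_generated hk).const_sub
    (∫ t in Ici y ∩ oi a b, k t ∂μ)
  rw [sub_self] at h
  refine h.congr' ?_
  filter_upwards [C.eventually_mem_rightEnd hy] with x hx
  have e : Ico y x ∩ {_t : ℝ | x ∈ oi a b} = Ico y x := by simp [hx.1]
  have hs : Ico y x ⊆ Ici y ∩ oi a b := fun t ht => ⟨ht.1, Ico_subset_oi hy hx.1 ht⟩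
  have hu : Ico y x ∪ (Ici x ∩ oi a b) = Ici y ∩ oi a b := by
    ext t
    constructor
    · rintro (ht | ht)
      · exact hs ht
      · exact ⟨hx.2.le.trans ht.1, ht.2⟩
    · rintro ⟨h1, h2⟩
      rcases lt_or_ge t x with h3 | h3
      · exact Or.inl ⟨h1, h3⟩
      · exact Or.inr ⟨h3, h2⟩
  rw [e, Measure.restrict_restrict measurableSet_Ico, inter_eq_self_of_subset_left hs, ← hu,
    setIntegral_union (Set.disjoint_left.mpr fun t h1 h2 => (h1.2.trans_le h2.1).false)
      (measurableSet_Ici.inter (measurableSet_oi a b)) (hk.mono_set hs)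
      (hk.mono_set (hu ▸ subset_union_right)), add_sub_cancel_left]

theorem tendsto_energy_right {y : ℝ} (hy : y ∈ oi a b) {f f₁ : ℝ → ℂ}
    (h : C.L2On (Ici y ∩ oi a b) f f₁) :
    Tendsto (fun x : ℝ => C.energy (Ici x ∩ oi a b) f f₁) C.rightEnd (𝓝 0) := by
  have := (tendsto_setIntegral_right (C := C) hy h.integrableOn_sq.1).add
    (tendsto_setIntegral_right (C := C) hy h.integrableOn_sq.2)
  rwa [add_zero] at this

namespace TLoc

theorem exists_minimal_right (hn : C.Atomless) {x₀ : ℝ} (hx₀ : x₀ ∈ oi a b) :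
    ∃ f : C.TLoc, C.IsSolution 0 f ∧ (f.fn x₀ ≠ 0 ∨ f.qd x₀ ≠ 0) ∧
      C.L2On (Ici x₀ ∩ oi a b) f.fn f.qd ∧ ∀ h h' : ℝ → ℂ, HasRN (oi a b) C.sigma h h' →
        C.L2On (Ici x₀ ∩ oi a b) h h' →
        Tendsto (fun x => h x * f.qd x) C.rightEnd (𝓝 0) := by
  have := C.rightEnd_neBot hx₀
  obtain ⟨f, hf, hf0, hfy⟩ := exists_minimal hn
    ((C.eventually_mem_rightEnd hx₀).mono fun x hx => hx.1) hx₀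
  have hu : ∀ y ∈ oi a b, x₀ < y → ∀ᶠ x in C.rightEnd, y ∈ uIcc x₀ x := fun y hy hxy => by
    filter_upwards [C.eventually_mem_rightEnd hy] with x hx
    rw [uIcc_of_le (hxy.trans hx.2).le]
    exact ⟨hxy.le, hx.2.le⟩
  refine ⟨f, hf, hf0, l2On_right_of_energy_le hx₀ (K := 1)
    (fun x hx => (f.l2On_Icc hn hx₀ hx).mono Ico_subset_Icc_self)
    ⟨hasRN_aestronglyMeasurable ((f.continuousOn_fn hn).locInt C.chi_fin),
      hasRN_aestronglyMeasurable f.fn_deriv.1⟩ fun x hx hxx => ?_, fun h h' hh hL => ?_⟩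
  · have := (hfy x hx (hu x hx hxx)).1
    rwa [between_of_le hxx.le] at this
  · have key : Tendsto (fun x => ‖h x * f.qd x‖ ^ 2) C.rightEnd (𝓝 0) := by
      refine squeeze_zero' (Eventually.of_forall fun _ => sq_nonneg _) ?_
        (tendsto_energy_right hx₀ hL)
      filter_upwards [C.eventually_mem_rightEnd hx₀] with y hy
      refine (hfy y hy.1 (hu y hy.1 hy.2)).2 h h' _ hh ?_
        (hL.mono fun t ht => ⟨hy.2.le.trans ht.1, ht.2⟩)
      filter_upwards [C.eventually_mem_rightEnd hy.1] with x hx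
      rw [between_of_le hx.2.le]
      exact fun t ht => ⟨ht.1, Ico_subset_oi hy.1 hx.1 ht⟩
    have := key.sqrt
    simp only [Real.sqrt_sq (norm_nonneg _), Real.sqrt_zero] at this
    exact tendsto_zero_iff_norm_tendsto_zero.mpr this

theorem exists_minimal_left (hn : C.Atomless) {x₀ : ℝ} (hx₀ : x₀ ∈ oi a b) :
    ∃ f : C.TLoc, C.IsSolution 0 f ∧ (f.fn x₀ ≠ 0 ∨ f.qd x₀ ≠ 0) ∧
      C.L2On (oi a x₀) f.fn f.qd ∧ ∀ h h' : ℝ → ℂ, HasRN (oi a b) C.sigma h h' →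
        C.L2On (oi a x₀) h h' → Tendsto (fun x => h x * f.qd x) C.leftEnd (𝓝 0) := by
  have := C.leftEnd_neBot hx₀
  obtain ⟨f, hf, hf0, hfy⟩ := exists_minimal hn
    ((C.eventually_mem_leftEnd hx₀).mono fun x hx => mem_oi_left hx₀ hx) hx₀
  have hu : ∀ y ∈ oi a x₀, ∀ᶠ x in C.leftEnd, y ∈ uIcc x₀ x := fun y hy => by
    filter_upwards [C.eventually_mem_leftEnd (mem_oi_left hx₀ hy)] with x hx
    rw [uIcc_of_ge ((lt_of_mem_oi hx).trans (lt_of_mem_oi hy)).le]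
    exact ⟨(lt_of_mem_oi hx).le, (lt_of_mem_oi hy).le⟩
  refine ⟨f, hf, hf0, l2On_of_energy_le hx₀ (K := 1) (fun x hx => f.l2On_Icc hn hx hx₀)
    (f.aestronglyMeasurable hn hx₀) fun x hx => ?_, fun h h' hh hL => ?_⟩
  · have := (hfy x (mem_oi_left hx₀ hx) (hu x hx)).1
    rwa [between_comm, between_of_le (lt_of_mem_oi hx).le] at this
  · have key : Tendsto (fun x => ‖h x * f.qd x‖ ^ 2) C.leftEnd (𝓝 0) := by
      refine squeeze_zero' (Eventually.of_forall fun _ => sq_nonneg _) ?_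
        (tendsto_energy_oi hx₀ hL)
      filter_upwards [C.eventually_mem_leftEnd hx₀] with y hy
      have hyb := mem_oi_left hx₀ hy
      refine (hfy y hyb (hu y hy)).2 h h' _ hh ?_ (hL.mono (oi_subset_oi (lt_of_mem_oi hy).le))
      filter_upwards [C.eventually_mem_leftEnd hyb] with x hx
      rw [between_comm, between_of_le (lt_of_mem_oi hx).le]
      exact Ico_subset_oi_left (mem_oi_left hyb hx)
    have := key.sqrt
    simp only [Real.sqrt_sq (norm_nonneg _), Real.sqrt_zero] at this
    exact tendsto_zero_iff_norm_tendsto_zero.mpr this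

end TLoc

end Coeff

end LeftDefinite

end

noncomputable section

namespace LeftDefinite

namespace Coeff

variable {a b : EReal} {C : Coeff a b} {S : C.SeparatedBC} {φ : ℂ → C.TLoc} {d : ℝ}

open TLoc

theorem oi_subset_union (d : ℝ) : oi a b ⊆ oi a d ∪ (Ici d ∩ oi a b) := by
  intro x hx
  rcases lt_or_ge x d with h | h
  · exact Or.inl ⟨hx.1, by exact_mod_cast h⟩
  · exact Or.inr ⟨h, hx⟩

namespace TLoc

theorem _root_.LeftDefinite.tendsto_setIntegral_Ico_left {μ : Measure ℝ} {f : ℝ → ℂ} {α x : ℝ}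
    (hα : α < x) (hf : IntegrableOn f (Ico α x) μ) :
    Tendsto (fun t => ∫ s in Ico t x, f s ∂μ) (𝓝[<] x) (𝓝 0) := by
  have hlim : Tendsto (fun t => ∫ s in Ico α x, (Ico t x).indicator f s ∂μ) (𝓝[<] x)
      (𝓝 (∫ s in Ico α x, (0 : ℂ) ∂μ)) := by
    refine tendsto_integral_filter_of_dominated_convergence (fun s => ‖f s‖) ?_ ?_ hf.norm ?_
    · exact Eventually.of_forall fun t => hf.1.indicator measurableSet_Ico
    · exact Eventually.of_forall fun t => Eventually.of_forall fun s => norm_indicator_le_norm_self _ _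
    · filter_upwards [ae_restrict_mem measurableSet_Ico] with s hs
      refine tendsto_const_nhds.congr' ?_
      filter_upwards [Ioo_mem_nhdsLT hs.2] with t ht
      rw [indicator_of_notMem fun h => (ht.1.trans_le h.1).false]
  rw [integral_zero] at hlim
  refine hlim.congr' ?_
  filter_upwards [Ioo_mem_nhdsLT hα] with t ht
  rw [setIntegral_indicator measurableSet_Ico,
    inter_eq_self_of_subset_right (Ico_subset_Ico_left ht.1.le)]

/-- The quasi-derivative is left-continuous. -/
theorem tendsto_qd_left (hn : C.Atomless) (u : C.TLoc) {x : ℝ} (hx : x ∈ oi a b) :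
    Tendsto u.qd (𝓝[<] x) (𝓝 (u.qd x)) := by
  obtain ⟨α, hα, hαx⟩ := exists_lt_mem_oi hx
  have aux : ∀ {μ : Measure ℝ} {f : ℝ → ℂ}, LocInt (oi a b) μ f →
      Tendsto (fun t => ∫ s in Ico t x, f s ∂μ) (𝓝[<] x) (𝓝 0) := fun hf =>
    tendsto_setIntegral_Ico_left hαx ((hf α hα x hx).mono_set Ico_subset_Icc_self)
  have h1 := aux ((u.continuousOn_fn hn).locInt C.chi_fin)
  have h2 := aux ((u.continuousOn_tau hn).locInt C.rhoPos_fin)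
  have h3 := aux ((u.continuousOn_tau hn).locInt C.rhoNeg_fin)
  have key := (h1.sub (h2.sub h3)).const_sub (u.qd x)
  simp only [sub_zero] at key
  refine key.congr' ?_
  filter_upwards [Ioo_mem_nhdsLT hαx] with t ht
  rw [← u.qd_sub_eq (Icc_subset_oi hα hx ⟨ht.1.le, ht.2.le⟩) hx ht.2.le]
  ring

theorem qd_eq_zero (hn : C.Atomless) (u : C.TLoc) {c : EReal} (hcb : c ≤ b)
    (h0 : ∀ x ∈ oi a c, u.fn x = 0) : ∀ x ∈ oi a c, u.qd x = 0 := by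
  have hsub : oi a c ⊆ oi a b := fun x hx => ⟨hx.1, hx.2.trans_le hcb⟩
  intro x hx
  by_contra hne
  have ev := (u.tendsto_qd_left hn (hsub hx)).eventually_ne hne
  obtain ⟨α, hα, hαx⟩ := exists_lt_mem_oi hx
  obtain ⟨β, hβ, hβP⟩ := (mem_nhdsLT_iff_exists_Ioo_subset' hαx).mp ev
  set γ := max α β with hγ
  have hγx : γ < x := max_lt hαx hβ
  have hγo : γ ∈ oi a c := (oi_ordConnected a c).out hα hx ⟨le_max_left _ _, hγx.le⟩
  have r1 : HasRN (oi a c) C.sigma u.fn u.qd :=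
    ⟨fun p hp q hq => u.fn_deriv.1 p (hsub hp) q (hsub hq),
      fun p hp q hq => u.fn_deriv.2 p (hsub hp) q (hsub hq)⟩
  have r2 : HasRN (oi a c) C.sigma u.fn (fun _ => 0) :=
    ⟨fun p _ q _ => integrableOn_zero, fun p hp q hq => by
      rw [h0 p hp, h0 q hq]
      simp [orientedIntegral]⟩
  have hae := r1.ae_eq r2
  have h2 : u.qd =ᵐ[C.sigma.restrict (Ioo γ x)] fun _ => 0 :=
    ae_mono (Measure.restrict_mono (Ioo_subset_Icc_self.trans (Icc_subset_oi hγo hx)) le_rfl) hae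
  have h3 := (ae_restrict_iff' measurableSet_Ioo).mp h2
  refine C.sigma_supp γ (hsub hγo) x (hsub hx) hγx ?_
  rw [ae_iff] at h3
  refine measure_mono_null (fun t ht => ?_) h3
  simp only [Set.mem_ofPred_eq, not_forall]
  exact ⟨ht, hβP ⟨(le_max_right _ _).trans_lt ht.1, ht.2⟩⟩

end TLoc

namespace SeparatedBC.IsRealEntireSolution

/-! ### The homogeneous solution at `a` -/

/-- The solutions `φ_z` satisfy the boundary condition at `a`, also in the limit-point case. -/
theorem wronskianZeroLeft (hφ : S.IsRealEntireSolution φ) (hn : C.Atomless) (hd : d ∈ oi a b)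
    (z : ℂ) : C.WronskianZeroLeft (φ z) S.va := by
  by_cases hLC : C.LimitCircleLeft
  · exact (hφ.near_left z).2 hLC
  unfold LimitCircleLeft at hLC
  push Not at hLC
  obtain ⟨z₀, hz₀, u, hu, hu'⟩ := hLC
  obtain ⟨v', hv', m1, m2⟩ := S.va_mem.2
  have hv : L2Left C d S.va.conjugate (fun x => conj (v' x)) :=
    ⟨hv'.conj, (l2On_of_memH1On S.va_mem.1 S.va.fn_deriv hd).conj,
      (L2On.mono ⟨m1, m2⟩ (oi_mono_right hd)).conj⟩
  have l2 : ∀ w, C.L2On (oi a d) (φ w).fn (φ w).qd := fun w =>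
    (φ w).l2On_oi hn (hφ.near_left w).1 hd
  have key := tendsto_bilinWronskian_zero_of_third hn hz₀ (hφ.solution z₀) (hφ.nontrivial z₀) hd
    (L2Left.of_solution (hφ.solution z) hd (l2 z)) hv (l2 z₀)
    (hφ.tendsto_bilinWronskian hn hd z z₀)
    (tendsto_bilinWronskian_limitPoint hn hz₀ (hφ.solution z₀) hu hu' hd hv (l2 z₀))
  unfold WronskianZeroLeft
  exact key.congr fun x => (wronskian_eq (φ z) S.va x).symm

theorem wronskian_homogeneous {u v : C.TLoc} (hu : C.IsSolution 0 u) {x : ℝ} (hx : x ∈ oi a b) :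
    wronskian u v x = -(conj (v.tau x) * u.qd x) := by
  rw [wronskian, tau_eq_zero hu hx]
  ring

/-- As zero is not an eigenvalue, `φ₀` satisfies the natural boundary condition at `a`. -/
theorem tendsto_mul_qd_zero (hφ : S.IsRealEntireSolution φ) (hS : ¬ S.IsEigenvalue 0)
    (hn : C.Atomless) (hd : d ∈ oi a b) {h h' : ℝ → ℂ} (hh : HasRN (oi a b) C.sigma h h')
    (hL : C.L2On (oi a d) h h') : Tendsto (fun x => h x * (φ 0).qd x) C.leftEnd (𝓝 0) := by
  have h0 := hφ.solution 0
  obtain ⟨m, hm, hm0, hmL, hmt⟩ := exists_minimal_left hn hd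
  by_cases hκ : homWronskian (φ 0) m d = 0
  · obtain ⟨t, ht, ht0, ht1⟩ := exists_homogeneous hn hd (-conj (m.qd d)) (conj (m.fn d))
    have hW : homWronskian m t d ≠ 0 := by
      rw [homWronskian, ht0, ht1, mul_neg, sub_neg_eq_add, Complex.mul_conj, Complex.mul_conj,
        ← Complex.ofReal_add, Complex.ofReal_ne_zero]
      rcases hm0 with h | h
      · exact (add_pos_of_pos_of_nonneg (Complex.normSq_pos.mpr h) (Complex.normSq_nonneg _)).ne'
      · exact (add_pos_of_nonneg_of_pos (Complex.normSq_nonneg _) (Complex.normSq_pos.mpr h)).ne'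
    have key := (hmt h h' hh hL).const_mul (homWronskian (φ 0) t d / homWronskian m t d)
    rw [mul_zero] at key
    refine key.congr' ?_
    filter_upwards [C.eventually_mem_leftEnd hd] with x hx
    have hxb := mem_oi_left hd hx
    have e := qd_mul_homWronskian (φ 0) m t x
    rw [homWronskian_eq hn hm ht hxb hd, homWronskian_eq hn h0 ht hxb hd,
      homWronskian_eq hn h0 hm hxb hd, hκ, mul_zero, sub_zero] at e
    rw [eq_comm, ← div_eq_iff hW] at e
    rw [← e]
    ring
  · exfalso
    obtain ⟨f, hf, hf0, hfL, hft⟩ := exists_minimal_right hn hd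
    set κ := homWronskian (φ 0) m d with hκd
    have rep : ∀ x ∈ oi a b,
        f.fn x = homWronskian f m d / κ * (φ 0).fn x - homWronskian f (φ 0) d / κ * m.fn x ∧
        f.qd x = homWronskian f m d / κ * (φ 0).qd x - homWronskian f (φ 0) d / κ * m.qd x := by
      intro x hx
      have e1 := fn_mul_homWronskian f (φ 0) m x
      have e2 := qd_mul_homWronskian f (φ 0) m x
      rw [homWronskian_eq hn hf hm hx hd, homWronskian_eq hn h0 hm hx hd,
        homWronskian_eq hn hf h0 hx hd, ← hκd] at e1 e2
      constructor
      · field_simp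
        linear_combination e1
      · field_simp
        linear_combination e2
    have hfl : C.L2On (oi a d) f.fn f.qd := by
      have l0 := (φ 0).l2On_oi hn (hφ.near_left 0).1 hd
      have h1 := l0.const_mul (homWronskian f m d / κ)
      have h2 := hmL.const_mul (homWronskian f (φ 0) d / κ)
      exact L2On.congr (measurableSet_oi a d) ⟨h1.1.sub h2.1, h1.2.sub h2.2⟩
        (fun x hx => (rep x (mem_oi_left hd hx)).1.symm)
        (fun x hx => (rep x (mem_oi_left hd hx)).2.symm)
    have hfall : C.L2On (oi a b) f.fn f.qd := (hfl.union hfL).mono (oi_subset_union d)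
    have hmem : C.MemTmax f := by
      refine ⟨⟨f.qd, f.fn_deriv, hfall⟩, ⟨_, tau_hasRN hf, ?_⟩⟩
      exact (hfall.const_mul 0).congr (measurableSet_oi a b) (fun x hx => (hf x hx).symm)
        fun _ _ => rfl
    obtain ⟨v', hv', m1, m2⟩ := S.va_mem.2
    have hva : C.L2On (oi a b) S.va.tau v' := ⟨m1, m2⟩
    obtain ⟨w', hw', n1, n2⟩ := S.vb_mem.2
    have hvb : C.L2On (oi a b) S.vb.tau w' := ⟨n1, n2⟩
    refine hS ⟨f, ⟨hmem, ?_, ?_⟩, hf, ?_⟩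
    · have t1 : Tendsto (wronskian (φ 0) S.va) C.leftEnd (𝓝 0) := hφ.wronskianZeroLeft hn hd 0
      have t2 := hmt _ _ hv'.conj ((hva.mono (oi_mono_right hd)).conj)
      have key := (t1.const_mul (homWronskian f m d / κ)).add
        (t2.const_mul (homWronskian f (φ 0) d / κ))
      rw [mul_zero, mul_zero, add_zero] at key
      refine key.congr' ?_
      filter_upwards [C.eventually_mem_leftEnd hd] with x hx
      have hxb := mem_oi_left hd hx
      rw [wronskian_homogeneous h0 hxb, wronskian_homogeneous hf hxb, (rep x hxb).2]
      ring
    · have key := (hft _ _ hw'.conj ((hvb.mono inter_subset_right).conj)).neg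
      rw [neg_zero] at key
      refine key.congr' ?_
      filter_upwards [C.eventually_mem_rightEnd hd] with x hx
      rw [wronskian_homogeneous hf hx.1]
    · by_contra! hcon
      rcases hf0 with h | h
      · exact h (hcon d hd)
      · exact h (f.qd_eq_zero hn le_rfl hcon d hd)

end SeparatedBC.IsRealEntireSolution

end Coeff

end LeftDefinite

end

noncomputable section

namespace LeftDefinite

/-- An entire function bounded by a multiple of `|z| / |Im z|` is constant. -/
theorem apply_eq_apply_of_norm_mul_im_le {G : ℂ → ℂ} (hG : Differentiable ℂ G) {M : ℝ}
    (hM : ∀ z : ℂ, z.im ≠ 0 → ‖G z‖ * |z.im| ≤ M * ‖z‖) (z w : ℂ) : G z = G w := by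
  have hM0 : 0 ≤ M := by
    have := hM Complex.I (by simp)
    simp at this
    exact (norm_nonneg _).trans this
  refine hG.apply_eq_apply_of_bounded ?_ z w
  refine isBounded_iff_forall_norm_le.mpr ⟨8 / 3 * M, ?_⟩
  rintro _ ⟨z, rfl⟩
  set R := 2 * ‖z‖ + 1 with hR
  have hR0 : 0 < R := by positivity
  set h : ℂ → ℂ := fun w => (w ^ 2 - (R : ℂ) ^ 2) * G w with hh
  have hd : Differentiable ℂ h := by
    have : Differentiable ℂ fun w : ℂ => w ^ 2 - (R : ℂ) ^ 2 := by fun_prop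
    exact this.mul hG
  have hcirc : ∀ w ∈ frontier (Metric.ball (0 : ℂ) R), ‖h w‖ ≤ 2 * M * R ^ 2 := by
    intro w hw
    rw [frontier_ball (0 : ℂ) hR0.ne', mem_sphere_zero_iff_norm] at hw
    have e : ‖w ^ 2 - (R : ℂ) ^ 2‖ = 2 * R * |w.im| := by
      have h1 : (R : ℂ) ^ 2 = w * conj w := by
        rw [Complex.mul_conj', hw]
      have h2 : w ^ 2 - (R : ℂ) ^ 2 = w * (((2 * w.im : ℝ) : ℂ) * Complex.I) := by
        rw [h1, ← Complex.sub_conj]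
        ring
      rw [h2, norm_mul, norm_mul, hw, Complex.norm_real, Complex.norm_I, Real.norm_eq_abs, abs_mul,
        abs_two]
      ring
    rw [hh]
    simp only
    rw [norm_mul, e]
    by_cases him : w.im = 0
    · rw [him, abs_zero, mul_zero, zero_mul]
      positivity
    · have := hM w him
      rw [hw] at this
      nlinarith
  have hmax := Complex.norm_le_of_forall_mem_frontier_norm_le Metric.isBounded_ball
    hd.diffContOnCl hcirc (subset_closure (mem_ball_zero_iff.mpr (show ‖z‖ < R by
      rw [hR]
      linarith [norm_nonneg z])))
  have hlow : 3 / 4 * R ^ 2 ≤ ‖z ^ 2 - (R : ℂ) ^ 2‖ := by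
    have h1 : ‖(R : ℂ) ^ 2‖ - ‖z ^ 2‖ ≤ ‖z ^ 2 - (R : ℂ) ^ 2‖ := by
      rw [norm_sub_rev]
      exact norm_sub_norm_le _ _
    rw [norm_pow, norm_pow, Complex.norm_real, Real.norm_eq_abs, abs_of_pos hR0] at h1
    have h2 : ‖z‖ ≤ R / 2 := by
      rw [hR]
      linarith
    nlinarith [norm_nonneg z]
  rw [hh] at hmax
  simp only at hmax
  rw [norm_mul] at hmax
  have h3 := (mul_le_mul_of_nonneg_right hlow (norm_nonneg (G z))).trans hmax
  have hR2 : 0 < R ^ 2 := by positivity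
  by_contra hcon
  nlinarith [mul_lt_mul_of_pos_left (not_le.mp hcon) hR2]

namespace Coeff

variable {a b : EReal} {C : Coeff a b} {S : C.SeparatedBC} {φ : ℂ → C.TLoc} {c : ℝ}

namespace TLoc

/-- The linear combination `u + r p`. -/
def addSMul (hn : C.Atomless) (u : C.TLoc) (r : ℂ) (p : C.TLoc) : C.TLoc where
  fn := u.fn + r • p.fn
  qd := u.qd + r • p.qd
  tau := u.tau + r • p.tau
  fn_deriv := u.fn_deriv.add (p.fn_deriv.smul r)
  tau_ac := by
    obtain ⟨h, hh⟩ := u.tau_ac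
    obtain ⟨k, hk⟩ := p.tau_ac
    exact ⟨_, hh.add (hk.smul r)⟩
  tau_eq x hx y hy := by
    have h1 := u.tau_eq x hx y hy
    have h2 := p.tau_eq x hx y hy
    have e1 := (u.continuousOn_fn hn)
    have e2 := (p.continuousOn_fn hn).const_smul r
    have e3 := (u.continuousOn_tau hn)
    have e4 := (p.continuousOn_tau hn).const_smul r
    rw [rhoIntegral] at h1 h2 ⊢
    have i1 := orientedIntegral_add (e1.locInt C.chi_fin) (e2.locInt C.chi_fin) hx hy
    have i2 := orientedIntegral_add (e3.locInt C.rhoPos_fin) (e4.locInt C.rhoPos_fin) hx hy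
    have i3 := orientedIntegral_add (e3.locInt C.rhoNeg_fin) (e4.locInt C.rhoNeg_fin) hx hy
    have j1 := orientedIntegral_smul C.chi r p.fn x y
    have j2 := orientedIntegral_smul C.rhoPos r p.tau x y
    have j3 := orientedIntegral_smul C.rhoNeg r p.tau x y
    simp only [Pi.add_apply, Pi.smul_apply, smul_eq_mul]
    change -(u.qd y + r * p.qd y) + orientedIntegral C.chi (u.fn + r • p.fn) x y = _
    rw [show orientedIntegral C.chi (u.fn + r • p.fn) x y = _ from i1,
      show orientedIntegral C.rhoPos (u.tau + r • p.tau) x y = _ from i2,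
      show orientedIntegral C.rhoNeg (u.tau + r • p.tau) x y = _ from i3, j1, j2, j3]
    linear_combination h1 + r * h2

theorem exists_eq_mul_of_mul_eq {p q r s : ℂ} (h : p * s - q * r = 0) (h0 : r ≠ 0 ∨ s ≠ 0) :
    ∃ t, p = t * r ∧ q = t * s := by
  rcases h0 with h0 | h0
  · refine ⟨p / r, by field_simp, ?_⟩
    field_simp
    linear_combination -h
  · refine ⟨q / s, ?_, by field_simp⟩
    field_simp
    linear_combination h

/-- The energy estimate for the equation `(τ - z) w = z g`. -/
theorem energy_le_of_forced (hn : C.Atomless) {z : ℂ} {w : C.TLoc} {g g' : ℝ → ℂ}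
    (hg : HasRN (oi a b) C.sigma g g') (hw : ∀ x ∈ oi a b, w.tau x = z * (w.fn x + g x))
    {y c : ℝ} (hy : y ∈ oi a b) (hc : c ∈ oi a b) (hyc : y ≤ c)
    (hgL : C.L2On (Ico y c) g g') (h0 : w.tau c = 0)
    {E : ℝ} (hE : 0 ≤ E) (hwy : bilinWronskian w w.conjugate y = (z - conj z) * (E : ℂ)) :
    C.energy (Ico y c) w.fn w.qd * z.im ^ 2 ≤ ‖z‖ ^ 2 * C.energy (Ico y c) g g' := by
  have hw' : HasRN (oi a b) C.sigma w.tau (fun x => z * (w.qd x + g' x)) := by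
    have h := (w.fn_deriv.add hg).smul z
    refine ⟨h.1, fun p hp q hq => ?_⟩
    rw [hw p hp, hw q hq]
    exact h.2 p hp q hq
  have hL := bilinWronskian_sub_eq hn w w.conjugate hw' hw'.conj hy hc hyc
  have w0 : C.L2On (Ico y c) w.fn w.qd := (w.l2On_Icc hn hy hc).mono Ico_subset_Icc_self
  set W := C.energy (Ico y c) w.fn w.qd with hW
  set N := C.form (Ico y c) g g' (fun x => conj (w.fn x)) (fun x => conj (w.qd x)) with hN
  have hNn : ‖N‖ ^ 2 ≤ C.energy (Ico y c) g g' * W := by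
    have := sq_norm_form_le hgL w0.conj
    have e : C.energy (Ico y c) (fun x => conj (w.fn x)) (fun x => conj (w.qd x)) = W := by
      simp only [energy, RCLike.norm_conj, hW]
    rwa [e] at this
  have hsum : bilinWronskian w w.conjugate c - bilinWronskian w w.conjugate y
      = z * ((W : ℂ) + N) - conj (z * ((W : ℂ) + N)) := by
    have i1 := (w0.conj.integrableOn_mul w0)
    have i2 := (hgL.integrableOn_mul w0.conj)
    have split : ∀ {μ : Measure ℝ} {p q : ℝ → ℂ},
        IntegrableOn (fun x => conj (p x) * p x) (Ico y c) μ →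
        IntegrableOn (fun x => q x * conj (p x)) (Ico y c) μ →
        ∫ s in Ico y c, (z * (p s + q s) * conj (p s) - p s * conj (z * (p s + q s))) ∂μ
          = z * ((∫ s in Ico y c, conj (p s) * p s ∂μ) + ∫ s in Ico y c, q s * conj (p s) ∂μ)
            - conj (z * ((∫ s in Ico y c, conj (p s) * p s ∂μ)
              + ∫ s in Ico y c, q s * conj (p s) ∂μ)) := by
      intro μ p q h1 h2
      have h3 : Integrable (fun s => z * (conj (p s) * p s + q s * conj (p s)))
          (μ.restrict (Ico y c)) := (h1.add h2).const_mul z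
      have h4 : Integrable (fun s => conj (z * (conj (p s) * p s + q s * conj (p s))))
          (μ.restrict (Ico y c)) := Complex.conjCLE.toContinuousLinearMap.integrable_comp h3
      rw [← integral_add h1 h2, ← integral_const_mul, ← integral_conj, ← integral_sub h3 h4]
      refine integral_congr_ae (Eventually.of_forall fun s => ?_)
      simp only [map_mul, map_add, Complex.conj_conj]
      ring
    have s1 := split i1.1 i2.1
    have s2 := split i1.2 i2.2
    have e1 : ∫ s in Ico y c, (w.tau s * w.conjugate.fn s - w.fn s * w.conjugate.tau s) ∂C.chi
        = ∫ s in Ico y c, (z * (w.fn s + g s) * conj (w.fn s)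
          - w.fn s * conj (z * (w.fn s + g s))) ∂C.chi := by
      refine setIntegral_congr_fun measurableSet_Ico fun s hs => ?_
      change w.tau s * conj (w.fn s) - w.fn s * conj (w.tau s) = _
      rw [hw s (Ico_subset_oi hy hc hs)]
    rw [hL, e1, s1]
    change _ + ∫ s in Ico y c, (z * (w.qd s + g' s) * conj (w.qd s)
          - w.qd s * conj (z * (w.qd s + g' s))) ∂C.sigma = _
    rw [s2]
    have eW : (W : ℂ) = (∫ s in Ico y c, conj (w.fn s) * w.fn s ∂C.chi)
        + ∫ s in Ico y c, conj (w.qd s) * w.qd s ∂C.sigma := by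
      rw [hW, ← form_conj_self, form]
    rw [eW, hN, form]
    simp only [map_mul, map_add]
    ring
  have hVc : bilinWronskian w w.conjugate c = 0 := by
    change w.tau c * conj (w.qd c) - w.qd c * conj (w.tau c) = 0
    rw [h0]
    simp
  rw [hVc, hwy, zero_sub] at hsum
  have him := congrArg Complex.im hsum
  have e1 : (-((z - conj z) * (E : ℂ))).im = -(2 * z.im * E) := by
    simp only [Complex.neg_im, Complex.mul_im, Complex.sub_im, Complex.conj_im, Complex.ofReal_re,
      Complex.ofReal_im, Complex.sub_re, Complex.conj_re]
    ring
  have e2 : (z * ((W : ℂ) + N) - conj (z * ((W : ℂ) + N))).im = 2 * (z.im * W + (z * N).im) := by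
    simp
    ring
  rw [e1, e2] at him
  have hb : |z.im| * (W + E) ≤ ‖z‖ * ‖N‖ := by
    have h1 : z.im * (W + E) = -(z * N).im := by linarith
    have hWE : 0 ≤ W + E := add_nonneg (energy_nonneg _ _ _) hE
    rw [← abs_of_nonneg hWE, ← abs_mul, h1, abs_neg, ← norm_mul]
    exact Complex.abs_im_le_norm _
  have hW0 : 0 ≤ W := energy_nonneg _ _ _
  have hc1 : |z.im| * W ≤ ‖z‖ * ‖N‖ :=
    (mul_le_mul_of_nonneg_left (le_add_of_nonneg_right hE) (abs_nonneg _)).trans hb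
  have hc2 : z.im ^ 2 * W ^ 2 ≤ ‖z‖ ^ 2 * (C.energy (Ico y c) g g' * W) := by
    have h1 := pow_le_pow_left₀ (mul_nonneg (abs_nonneg _) hW0) hc1 2
    rw [mul_pow, mul_pow, sq_abs] at h1
    exact h1.trans (mul_le_mul_of_nonneg_left hNn (sq_nonneg _))
  rcases hW0.eq_or_lt with h | h
  · rw [← h, zero_mul]
    exact mul_nonneg (sq_nonneg _) (energy_nonneg _ _ _)
  · have : (W * z.im ^ 2) * W ≤ (‖z‖ ^ 2 * C.energy (Ico y c) g g') * W := by linarith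
    exact le_of_mul_le_mul_right this h

end TLoc

end Coeff

end LeftDefinite

end

noncomputable section

namespace LeftDefinite

namespace Coeff

variable {a b : EReal} {C : Coeff a b} {S : C.SeparatedBC} {φ : ℂ → C.TLoc} {c : ℝ}

/-- Every function of `H¹(a, c)` extends to `(a, b)`. -/
theorem H1.exists_extension (hc : c ∈ oi a b) (hχ : C.chi (oi a c) ≠ 0)
    (r : (C.restrict c hc hχ).H1) : ∃ g g' : ℝ → ℂ, HasRN (oi a b) C.sigma g g' ∧
      (∀ x ∈ oi a c, g x = r x) ∧ ∀ x ∈ oi a c, g' x = r.deriv x := by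
  obtain ⟨x₁, hx₁, hlt⟩ := exists_lt_mem_oi hc
  have hx₁c : x₁ ∈ oi a c := (mem_oi_iff hx₁).mpr hlt
  have hloc : LocInt (oi a b) C.sigma ((oi a c).indicator r.deriv) := by
    intro α hα β hβ
    have hfin : IsFiniteMeasure ((C.sigma.restrict (oi a c)).restrict (Icc α β)) :=
      ⟨(Measure.restrict_apply_univ _).trans_lt
        ((Measure.restrict_apply_le _ _).trans_lt (C.sigma_fin α hα β hβ))⟩
    have h1 : MemLp r.deriv 2 (C.sigma.restrict (oi a c)) := r.memLp_deriv
    have h2 : Integrable r.deriv ((C.sigma.restrict (oi a c)).restrict (Icc α β)) :=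
      (h1.restrict (Icc α β)).integrable (by norm_num)
    rw [Measure.restrict_restrict measurableSet_Icc, inter_comm,
      ← Measure.restrict_restrict (measurableSet_oi a c)] at h2
    exact (integrable_indicator_iff (measurableSet_oi a c)).mpr h2
  refine ⟨fun x => r x₁ + orientedIntegral C.sigma ((oi a c).indicator r.deriv) x₁ x,
    (oi a c).indicator r.deriv, ⟨hloc, fun p hp q hq => ?_⟩, fun x hx => ?_,
    fun x hx => indicator_of_mem hx _⟩
  · beta_reduce
    rw [add_assoc, ← (hasRN_orientedIntegral hloc hx₁).2 p hp q hq]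
  · have h := orientedIntegral_congr (a := a) (b := (c : EReal)) C.sigma
      (h := (oi a c).indicator r.deriv) (k := r.deriv) hx₁c hx fun t ht => indicator_of_mem ht _
    exact (congrArg (r x₁ + ·) h).trans (r.hasRN.2 x₁ hx₁c x hx).symm

theorem form_comm (J : Set ℝ) (f f₁ g g₁ : ℝ → ℂ) : C.form J f f₁ g g₁ = C.form J g g₁ f f₁ := by
  simp only [form, mul_comm]

theorem form_const_mul_left (J : Set ℝ) (r : ℂ) (f f₁ g g₁ : ℝ → ℂ) :
    C.form J (fun x => r * f x) (fun x => r * f₁ x) g g₁ = r * C.form J f f₁ g g₁ := by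
  simp only [form, mul_assoc, integral_const_mul, mul_add]

theorem form_congr {J : Set ℝ} (hJ : MeasurableSet J) {f f₁ g g₁ k k₁ l l₁ : ℝ → ℂ}
    (h1 : ∀ x ∈ J, f x = k x) (h2 : ∀ x ∈ J, f₁ x = k₁ x) (h3 : ∀ x ∈ J, g x = l x)
    (h4 : ∀ x ∈ J, g₁ x = l₁ x) : C.form J f f₁ g g₁ = C.form J k k₁ l l₁ := by
  rw [form, form]
  congr 1
  · exact setIntegral_congr_fun hJ fun x hx => by simp only [h1 x hx, h3 x hx]
  · exact setIntegral_congr_fun hJ fun x hx => by simp only [h2 x hx, h4 x hx]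

namespace TLoc

theorem bilinWronskian_addSMul (hn : C.Atomless) (u p q : C.TLoc) (r : ℂ) (x : ℝ) :
    bilinWronskian (addSMul hn u r p) q x = bilinWronskian u q x + r * bilinWronskian p q x := by
  change (u.tau x + r * p.tau x) * q.qd x - (u.qd x + r * p.qd x) * q.tau x = _
  rw [bilinWronskian, bilinWronskian]
  ring

end TLoc

namespace SeparatedBC.IsRealEntireSolution

theorem form_conj_eq_energy (hφ : S.IsRealEntireSolution φ) {x : ℝ} (hx : x ∈ oi a b) (z : ℂ) :
    C.form (oi a x) (φ z).fn (φ z).qd (φ (conj z)).fn (φ (conj z)).qd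
      = (C.energy (oi a x) (φ z).fn (φ z).qd : ℂ) := by
  rw [← form_conj_self, form_comm]
  exact form_congr (measurableSet_oi _ _) (fun t ht => hφ.fn_conj (mem_oi_left hx ht) z)
    (fun t ht => hφ.qd_conj (mem_oi_left hx ht) z) (fun _ _ => rfl) fun _ _ => rfl

theorem energy_ne_zero (hφ : S.IsRealEntireSolution φ) (hn : C.Atomless) (hc : c ∈ oi a b)
    (hχ : C.chi (oi a c) ≠ 0) (z : ℂ) : C.energy (oi a c) (φ z).fn (φ z).qd ≠ 0 := by
  intro h
  refine hφ.elem_ne_zero hn hc hχ z (inner_self_eq_zero (𝕜 := ℂ).mp ?_)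
  rw [hφ.inner_elem, hφ.transform_elem, form_comm, hφ.form_conj_eq_energy hc, h]
  simp

theorem qd_zero_ne_zero (hφ : S.IsRealEntireSolution φ) (hS : ¬ S.IsEigenvalue 0)
    (hn : C.Atomless) (hc : c ∈ oi a b) (hχ : C.chi (oi a c) ≠ 0) : (φ 0).qd c ≠ 0 := by
  intro h
  have h0 := hφ.form_conj_eq_energy hc 0
  have hL := (φ 0).l2On_oi hn (hφ.near_left 0).1 hc
  refine hφ.energy_ne_zero hn hc hχ 0 ?_
  have lim := tendsto_form_Ico hc hL.conj hL
  have lim2 := (hφ.tendsto_mul_qd_zero hS hn hc (φ 0).fn_deriv.conj hL.conj).neg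
  rw [neg_zero] at lim2
  have := C.leftEnd_neBot hc
  have e := tendsto_nhds_unique lim (lim2.congr' (by
    filter_upwards [C.eventually_mem_leftEnd hc] with x hx
    rw [← TLoc.mul_qd_sub_eq_form hn (φ 0).fn_deriv.conj (mem_oi_left hc hx) hc
      (lt_of_mem_oi hx).le fun t ht => TLoc.tau_eq_zero (hφ.solution 0)
        (Ico_subset_oi (mem_oi_left hc hx) hc ht), h, mul_zero, zero_sub]))
  rw [form_conj_self] at e
  exact_mod_cast e

theorem fn_ne_zero (hφ : S.IsRealEntireSolution φ) (hn : C.Atomless) (hc : c ∈ oi a b)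
    (hχ : C.chi (oi a c) ≠ 0) {z : ℂ} (hz : z.im ≠ 0) : (φ z).fn c ≠ 0 := by
  intro h
  have h1 := hφ.form_eq hn hc z (conj z)
  rw [hφ.form_conj_eq_energy hc, hφ.fn_conj hc, h] at h1
  simp only [mul_zero, map_zero, zero_mul, sub_zero, mul_eq_zero, Complex.ofReal_eq_zero,
    hφ.energy_ne_zero hn hc hχ z, or_false] at h1
  refine hz ?_
  have := congrArg Complex.im h1
  simp only [Complex.sub_im, Complex.conj_im, Complex.zero_im] at this
  linarith

/-- A function orthogonal to all `φ_z` on `(a, c)` vanishes at `c`. -/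
theorem apply_eq_zero_of_form_eq_zero (hφ : S.IsRealEntireSolution φ) (hS : ¬ S.IsEigenvalue 0)
    (hn : C.Atomless) (hc : c ∈ oi a b) (hχ : C.chi (oi a c) ≠ 0) {g g' : ℝ → ℂ}
    (hg : HasRN (oi a b) C.sigma g g') (hL : C.L2On (oi a c) g g')
    (hperp : C.form (oi a c) g g' (φ 0).fn (φ 0).qd = 0) : g c = 0 := by
  have hL0 := (φ 0).l2On_oi hn (hφ.near_left 0).1 hc
  have lim := tendsto_form_Ico hc hL hL0
  have lim2 := (hφ.tendsto_mul_qd_zero hS hn hc hg hL).const_sub (g c * (φ 0).qd c)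
  have := C.leftEnd_neBot hc
  have e := tendsto_nhds_unique lim (lim2.congr' (by
    filter_upwards [C.eventually_mem_leftEnd hc] with x hx
    rw [← TLoc.mul_qd_sub_eq_form hn hg (mem_oi_left hc hx) hc
      (lt_of_mem_oi hx).le fun t ht => TLoc.tau_eq_zero (hφ.solution 0)
        (Ico_subset_oi (mem_oi_left hc hx) hc ht)]))
  rw [hperp, sub_zero] at e
  exact (mul_eq_zero.mp e.symm).resolve_right (hφ.qd_zero_ne_zero hS hn hc hχ)

theorem tendsto_bilinWronskian_forced (hφ : S.IsRealEntireSolution φ) (hn : C.Atomless)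
    (hc : c ∈ oi a b) {g g' : ℝ → ℂ} (hg : HasRN (oi a b) C.sigma g g')
    (hL : C.L2On (oi a c) g g') {z : ℂ} (hperp : C.form (oi a c) g g' (φ z).fn (φ z).qd = 0)
    {u : C.TLoc} (hu : ∀ x ∈ oi a b, u.tau x = z * (u.fn x + g x)) (h0 : u.tau c = 0)
    (h1 : u.qd c = 0) : Tendsto (TLoc.bilinWronskian u (φ z)) C.leftEnd (𝓝 0) := by
  have hu' : HasRN (oi a b) C.sigma u.tau (fun x => z * (u.qd x + g' x)) := by
    have h := (u.fn_deriv.add hg).smul z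
    refine ⟨h.1, fun p hp q hq => ?_⟩
    rw [hu p hp, hu q hq]
    exact h.2 p hp q hq
  have lim := (tendsto_form_Ico hc hL ((φ z).l2On_oi hn (hφ.near_left z).1 hc)).const_mul (-z)
  rw [hperp, mul_zero] at lim
  refine lim.congr' ?_
  filter_upwards [C.eventually_mem_leftEnd hc] with x hx
  have hxb := mem_oi_left hc hx
  have h2 := TLoc.bilinWronskian_sub_eq_form_right hn hu' (hφ.solution z) hxb hc
    (lt_of_mem_oi hx).le
  rw [form_congr measurableSet_Ico (k := fun t => z * g t) (k₁ := fun t => z * g' t)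
    (fun t ht => by rw [hu t (Ico_subset_oi hxb hc ht)]; ring) (fun t _ => by ring)
    (fun _ _ => rfl) (fun _ _ => rfl), form_const_mul_left] at h2
  have h3 : TLoc.bilinWronskian u (φ z) c = 0 := by
    rw [TLoc.bilinWronskian, h0, h1]
    ring
  rw [h3] at h2
  linear_combination h2

/-- The resolvent estimate for the solution of `(τ - z) u = z g` with zero data at `c`. -/
theorem sq_norm_forced_le (hφ : S.IsRealEntireSolution φ) (hn : C.Atomless)
    (hc : c ∈ oi a b) (hχ : C.chi (oi a c) ≠ 0) {g g' : ℝ → ℂ}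
    (hg : HasRN (oi a b) C.sigma g g') (hL : C.L2On (oi a c) g g') {z : ℂ} (hz : z.im ≠ 0)
    (hperp : C.form (oi a c) g g' (φ z).fn (φ z).qd = 0)
    {u : C.TLoc} (hu : ∀ x ∈ oi a b, u.tau x = z * (u.fn x + g x)) (hgc : g c = 0)
    (h0 : u.fn c = 0) (h1 : u.qd c = 0) {x : ℝ} (hx : x ∈ oi a c) :
    ‖u.fn x‖ ^ 2 * z.im ^ 2 ≤ C.sigma.real (Ico x c) * (‖z‖ ^ 2 * C.energy (oi a c) g g') := by
  have hz0 : z ≠ 0 := fun h => hz (by rw [h, Complex.zero_im])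
  have hxb := mem_oi_left hc hx
  have hxc := (lt_of_mem_oi hx).le
  have ht0 : u.tau c = 0 := by rw [hu c hc, h0, hgc, add_zero, mul_zero]
  obtain ⟨Ψ, hΨ, -⟩ := exists_ivp hn hc 0 1 (q := 0) (q' := 0)
    ⟨fun α _ β _ => integrableOn_zero, fun p _ q _ => by simp [orientedIntegral]⟩
  obtain ⟨p0, p1, p2⟩ := hΨ z
  set ψ := Ψ z
  have hψ : C.IsSolution z ψ := fun t ht => by rw [p2 t ht, Pi.zero_apply, add_zero]
  have hVc : ∀ y ∈ oi a c, TLoc.bilinWronskian ψ (φ z) y = -(z * (φ z).fn c) := by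
    intro y hy
    have h := TLoc.bilinWronskian_sub_eq_form hn hψ (hφ.solution z) (mem_oi_left hc hy) hc
      (lt_of_mem_oi hy).le
    rw [sub_self, zero_mul, sub_eq_zero] at h
    rw [← h, TLoc.bilinWronskian, hψ c hc, p0, p1, hφ.solution z c hc]
    ring
  have hK0 : -(z * (φ z).fn c) ≠ 0 := neg_ne_zero.mpr (mul_ne_zero hz0 (hφ.fn_ne_zero hn hc hχ hz))
  set s : ℝ → ℂ := fun y => -(TLoc.bilinWronskian u (φ z) y / -(z * (φ z).fn c)) with hs
  have key : ∀ y ∈ oi a x, ‖u.fn x + s y * ψ.fn x‖ ^ 2 * z.im ^ 2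
      ≤ C.sigma.real (Ico x c) * (‖z‖ ^ 2 * C.energy (oi a c) g g') := by
    intro y hy
    have hyb := mem_oi_left hxb hy
    have hyx := (lt_of_mem_oi hy).le
    have hyc : y ∈ oi a c := (mem_oi_iff hyb).mpr ((lt_of_mem_oi hy).trans (lt_of_mem_oi hx))
    set w := TLoc.addSMul hn u (s y) ψ with hw
    have hwt : ∀ t ∈ oi a b, w.tau t = z * (w.fn t + g t) := by
      intro t ht
      change u.tau t + s y * ψ.tau t = z * (u.fn t + s y * ψ.fn t + g t)
      rw [hu t ht, hψ t ht]
      ring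
    have hwc : w.fn c = 0 := by
      change u.fn c + s y * ψ.fn c = 0
      rw [h0, p0, mul_zero, add_zero]
    have hV : TLoc.bilinWronskian w (φ z) y = 0 := by
      rw [hw, TLoc.bilinWronskian_addSMul, hVc y hyc, hs]
      simp only
      rw [neg_mul, div_mul_cancel₀ _ hK0, add_neg_cancel]
    have hne : (φ z).tau y ≠ 0 ∨ (φ z).qd y ≠ 0 := by
      by_contra hcon
      push Not at hcon
      have hf : (φ z).fn y = 0 := by
        have := hcon.1
        rw [hφ.solution z y hyb] at this
        exact (mul_eq_zero.mp this).resolve_left hz0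
      obtain ⟨t, ht, hnt⟩ := hφ.nontrivial z
      exact hnt (TLoc.eq_zero_of_initial hn (hφ.solution z) hyb hf hcon.2 t ht).1
    obtain ⟨l, l1, l2⟩ := TLoc.exists_eq_mul_of_mul_eq hV hne
    have hE := TLoc.energy_le_of_forced hn hg hwt hyb hc (hyx.trans hxc)
      (hL.mono (Ico_subset_oi_left hyb)) (by rw [hwt c hc, hwc, hgc, add_zero, mul_zero])
      (E := ‖l‖ ^ 2 * C.energy (oi a y) (φ z).fn (φ z).qd)
      (mul_nonneg (sq_nonneg _) (energy_nonneg _ _ _)) (by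
        have h2 := hφ.form_eq hn hyb z (conj z)
        rw [hφ.form_conj_eq_energy hyb, hφ.fn_conj hyb, hφ.qd_conj hyb] at h2
        change w.tau y * conj (w.qd y) - w.qd y * conj (w.tau y) = _
        rw [l1, l2, hφ.solution z y hyb]
        simp only [map_mul, Complex.ofReal_mul, Complex.ofReal_pow]
        rw [← Complex.mul_conj' l]
        linear_combination (-(l * conj l)) * h2)
    have hfin : IsFiniteMeasure (C.sigma.restrict (Ico x c)) :=
      isFiniteMeasure_restrict_Ico (C.sigma_fin x hxb c hc)
    have hwL := (w.l2On_Icc hn hyb hc).mono (Ico_subset_Icc_self)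
    have hb : ‖w.fn x‖ ^ 2 ≤ C.sigma.real (Ico x c) * C.energy (Ico y c) w.fn w.qd := by
      have h2 := w.fn_deriv.sub_eq hxb hc hxc
      rw [hwc, zero_sub] at h2
      have hwx := hwL.mono (Ico_subset_Ico_left hyx)
      have h3 := sq_norm_integral_le hwx.2
      rw [← h2, norm_neg, measureReal_restrict_apply_univ] at h3
      refine h3.trans (mul_le_mul_of_nonneg_left ?_ measureReal_nonneg)
      refine le_trans ?_ (energy_mono hwL (Ico_subset_Ico_left hyx))
      exact le_add_of_nonneg_left (integral_nonneg fun _ => sq_nonneg _)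
    calc ‖u.fn x + s y * ψ.fn x‖ ^ 2 * z.im ^ 2
        ≤ C.sigma.real (Ico x c) * C.energy (Ico y c) w.fn w.qd * z.im ^ 2 :=
          mul_le_mul_of_nonneg_right hb (sq_nonneg _)
      _ = C.sigma.real (Ico x c) * (C.energy (Ico y c) w.fn w.qd * z.im ^ 2) := mul_assoc _ _ _
      _ ≤ C.sigma.real (Ico x c) * (‖z‖ ^ 2 * C.energy (oi a c) g g') := by
          refine mul_le_mul_of_nonneg_left (hE.trans ?_) measureReal_nonneg
          exact mul_le_mul_of_nonneg_left (energy_mono hL (Ico_subset_oi_left hyb)) (sq_nonneg _)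
  have hs0 : Tendsto s C.leftEnd (𝓝 0) := by
    have := ((hφ.tendsto_bilinWronskian_forced hn hc hg hL hperp hu ht0 h1).div_const
      (-(z * (φ z).fn c))).neg
    simpa using this
  have lim : Tendsto (fun y => ‖u.fn x + s y * ψ.fn x‖ ^ 2 * z.im ^ 2) C.leftEnd
      (𝓝 (‖u.fn x‖ ^ 2 * z.im ^ 2)) := by
    have := (((hs0.mul_const (ψ.fn x)).const_add (u.fn x)).norm.pow 2).mul_const (z.im ^ 2)
    simpa using this
  have := C.leftEnd_neBot hc
  exact le_of_tendsto lim (by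
    filter_upwards [C.eventually_mem_leftEnd hxb] with y hy using key y hy)

/-- A function orthogonal to all `φ_z` has vanishing integrals with respect to `ϱ`. -/
theorem setIntegral_rho_eq (hφ : S.IsRealEntireSolution φ) (hS : ¬ S.IsEigenvalue 0)
    (hn : C.Atomless) (hc : c ∈ oi a b) (hχ : C.chi (oi a c) ≠ 0) {g g' : ℝ → ℂ}
    (hg : HasRN (oi a b) C.sigma g g') (hL : C.L2On (oi a c) g g')
    (hperp : ∀ z, C.form (oi a c) g g' (φ z).fn (φ z).qd = 0) {x y : ℝ} (hx : x ∈ oi a c)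
    (hy : y ∈ oi a c) (hxy : x ≤ y) :
    ∫ s in Ico x y, g s ∂C.rhoPos = ∫ s in Ico x y, g s ∂C.rhoNeg := by
  have hgc := hφ.apply_eq_zero_of_form_eq_zero hS hn hc hχ hg hL (hperp 0)
  obtain ⟨u, hu, hd⟩ := exists_ivp hn hc 0 0 hg
  have hzero : ∀ t ∈ oi a c, (u 1).fn t = 0 := by
    intro t ht
    have h0 : (u 0).fn t = 0 := by
      refine (TLoc.eq_zero_of_initial hn (z := 0) (fun s hs => ?_) hc (hu 0).1 (hu 0).2.1 t
        (mem_oi_left hc ht)).1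
      rw [(hu 0).2.2 s hs, zero_mul, zero_mul]
    rw [← h0]
    refine apply_eq_apply_of_norm_mul_im_le (hd t (mem_oi_left hc ht))
      (M := √(C.sigma.real (Ico t c) * C.energy (oi a c) g g')) (fun z hz => ?_) 1 0
    have h := hφ.sq_norm_forced_le hn hc hχ hg hL hz (hperp z) (hu z).2.2 hgc (hu z).1 (hu z).2.1 ht
    refine (pow_le_pow_iff_left₀ (by positivity) (by positivity) two_ne_zero).mp ?_
    rw [mul_pow, mul_pow, sq_abs,
      Real.sq_sqrt (mul_nonneg measureReal_nonneg (energy_nonneg _ _ _))]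
    linarith
  have hqd := (u 1).qd_eq_zero hn hc.2.le hzero
  have e := (u 1).qd_sub_eq (mem_oi_left hc hx) (mem_oi_left hc hy) hxy
  have hsub := Ico_subset_oi hx hy
  have ht : ∀ s ∈ Ico x y, (u 1).tau s = g s := fun s hs => by
    rw [(hu 1).2.2 s (mem_oi_left hc (hsub hs)), hzero s (hsub hs), zero_add, one_mul]
  rw [hqd x hx, hqd y hy, setIntegral_congr_fun measurableSet_Ico fun s hs => hzero s (hsub hs),
    setIntegral_congr_fun measurableSet_Ico ht, setIntegral_congr_fun measurableSet_Ico ht,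
    integral_zero, sub_zero, zero_sub] at e
  exact sub_eq_zero.mp (neg_eq_zero.mp e.symm)

end SeparatedBC.IsRealEntireSolution

end Coeff

end LeftDefinite

end

noncomputable section

namespace LeftDefinite

namespace Coeff

variable {a b : EReal} {C : Coeff a b} {S : C.SeparatedBC} {φ : ℂ → C.TLoc} {c : ℝ}

/-- A continuous function all of whose integrals with respect to `ϱ` over subintervals of `(a, c)`
vanish is zero almost everywhere with respect to `|ϱ|`. -/
theorem ae_eq_zero_of_setIntegral_rho_eq (hc : c ∈ oi a b) {g : ℝ → ℂ}
    (hg : ContinuousOn g (oi a b)) (h : ∀ x ∈ oi a c, ∀ y ∈ oi a c, x ≤ y →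
      ∫ s in Ico x y, g s ∂C.rhoPos = ∫ s in Ico x y, g s ∂C.rhoNeg) :
    (∀ᵐ x ∂C.rhoPos.restrict (oi a c), g x = 0) ∧ ∀ᵐ x ∂C.rhoNeg.restrict (oi a c), g x = 0 := by
  set N := C.rho_jordan.nullSet with hN
  have hNm : MeasurableSet N := C.rho_jordan.measurableSet_nullSet
  have hpos : ∀ᵐ x ∂C.rhoPos.restrict (oi a b), x ∉ N := by
    rw [ae_iff]
    simp only [not_not]
    exact C.rho_jordan.measure_nullSet
  have hneg : ∀ᵐ x ∂C.rhoNeg.restrict (oi a b), x ∈ N :=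
    C.rho_jordan.measure_compl_nullSet
  have hsub := oi_mono_right hc
  have hi1 : LocInt (oi a c) C.rhoPos g := fun α hα β hβ =>
    hg.locInt C.rhoPos_fin α (hsub hα) β (hsub hβ)
  have hi2 : LocInt (oi a c) C.rhoNeg g := fun α hα β hβ =>
    hg.locInt C.rhoNeg_fin α (hsub hα) β (hsub hβ)
  have loc : ∀ {A : Set ℝ}, MeasurableSet A →
      LocInt (oi a c) (C.rhoPos + C.rhoNeg) (A.indicator g) := by
    intro A hA α hα β hβ
    exact (((hi1 α hα β hβ).add_measure (hi2 α hα β hβ))).indicator hA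
  have split : ∀ {A : Set ℝ}, MeasurableSet A → ∀ x ∈ oi a c, ∀ y ∈ oi a c,
      ∫ s in Ico x y, A.indicator g s ∂(C.rhoPos + C.rhoNeg)
        = (∫ s in Ico x y, A.indicator g s ∂C.rhoPos)
          + ∫ s in Ico x y, A.indicator g s ∂C.rhoNeg := by
    intro A hA x hx y hy
    rw [Measure.restrict_add]
    exact integral_add_measure
      (((hi1 x hx y hy).mono_set Ico_subset_Icc_self).indicator hA)
      (((hi2 x hx y hy).mono_set Ico_subset_Icc_self).indicator hA)
  have ind : ∀ x ∈ oi a c, ∀ y ∈ oi a c,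
      ∫ s in Ico x y, Nᶜ.indicator g s ∂(C.rhoPos + C.rhoNeg) = ∫ s in Ico x y, g s ∂C.rhoPos ∧
      ∫ s in Ico x y, N.indicator g s ∂(C.rhoPos + C.rhoNeg) = ∫ s in Ico x y, g s ∂C.rhoNeg := by
    intro x hx y hy
    have hI := Ico_subset_oi (hsub hx) (hsub hy)
    have p := ae_mono (Measure.restrict_mono hI le_rfl) hpos
    have q := ae_mono (Measure.restrict_mono hI le_rfl) hneg
    rw [split hNm.compl x hx y hy, split hNm x hx y hy]
    constructor
    · have e1 : ∫ s in Ico x y, Nᶜ.indicator g s ∂C.rhoPos = ∫ s in Ico x y, g s ∂C.rhoPos :=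
        integral_congr_ae (by
          filter_upwards [p] with s hs using indicator_of_mem (show s ∈ Nᶜ from hs) g)
      have e2 : ∫ s in Ico x y, Nᶜ.indicator g s ∂C.rhoNeg = 0 :=
        integral_eq_zero_of_ae (by
          filter_upwards [q] with s hs using indicator_of_notMem (notMem_compl_iff.mpr hs) g)
      rw [e1, e2, add_zero]
    · have e1 : ∫ s in Ico x y, N.indicator g s ∂C.rhoPos = 0 :=
        integral_eq_zero_of_ae (by
          filter_upwards [p] with s hs using indicator_of_notMem hs g)
      have e2 : ∫ s in Ico x y, N.indicator g s ∂C.rhoNeg = ∫ s in Ico x y, g s ∂C.rhoNeg :=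
        integral_congr_ae (by
          filter_upwards [q] with s hs using indicator_of_mem hs g)
      rw [e1, e2, zero_add]
  obtain ⟨x₁, hx₁, hlt⟩ := exists_lt_mem_oi hc
  have hx₁c : x₁ ∈ oi a c := (mem_oi_iff hx₁).mpr hlt
  have r1 := hasRN_orientedIntegral (loc hNm.compl) hx₁c
  have r2 : HasRN (oi a c) (C.rhoPos + C.rhoNeg)
      (orientedIntegral (C.rhoPos + C.rhoNeg) (Nᶜ.indicator g) x₁) (N.indicator g) :=
    hasRN_of_le (loc hNm) fun x hx y hy hxy => by
      rw [r1.sub_eq hx hy hxy, (ind x hx y hy).1, (ind x hx y hy).2, h x hx y hy hxy]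
  have hae : ∀ᵐ x ∂(C.rhoPos + C.rhoNeg).restrict (oi a c), g x = 0 := by
    filter_upwards [r1.ae_eq r2] with x hx
    by_cases hxN : x ∈ N
    · rw [indicator_of_mem hxN, indicator_of_notMem (notMem_compl_iff.mpr hxN)] at hx
      exact hx.symm
    · rw [indicator_of_notMem hxN, indicator_of_mem (show x ∈ Nᶜ from hxN)] at hx
      exact hx
  rw [Measure.restrict_add, ae_add_measure_iff] at hae
  exact hae

theorem form_oi_add {x y : ℝ} (hx : x ∈ oi a b) (hxy : x ≤ y) {f f₁ g g₁ : ℝ → ℂ}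
    (hf : C.L2On (oi a y) f f₁) (hg : C.L2On (oi a y) g g₁) :
    C.form (oi a y) f f₁ g g₁ = C.form (oi a x) f f₁ g g₁ + C.form (Ico x y) f f₁ g g₁ := by
  obtain ⟨h1, h2⟩ := hf.integrableOn_mul hg
  rw [← oi_union_Ico hx hxy, integrableOn_union] at h1 h2
  rw [form, form, form, ← oi_union_Ico hx hxy,
    setIntegral_union disjoint_oi_Ico measurableSet_Ico h1.1 h1.2,
    setIntegral_union disjoint_oi_Ico measurableSet_Ico h2.1 h2.2]
  ring

theorem form_add_right {J : Set ℝ} {f f₁ g g₁ k k₁ : ℝ → ℂ} (hf : C.L2On J f f₁)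
    (hg : C.L2On J g g₁) (hk : C.L2On J k k₁) :
    C.form J f f₁ (fun x => g x + k x) (fun x => g₁ x + k₁ x)
      = C.form J f f₁ g g₁ + C.form J f f₁ k k₁ := by
  simp only [form, mul_add]
  rw [integral_add (hf.integrableOn_mul hg).1 (hf.integrableOn_mul hk).1,
    integral_add (hf.integrableOn_mul hg).2 (hf.integrableOn_mul hk).2]
  ring

theorem form_Ioo_eq (hn : C.Atomless) {α β : ℝ} (hα : α ∈ oi a b) {g g' u u' : ℝ → ℂ}
    (h0 : g α = 0) : C.form (Ioo α β) g g' u u' = C.form (Ico α β) g g' u u' := by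
  have hd : ∀ x ∈ Ico α β \ Ioo α β, x = α := fun x hx =>
    le_antisymm (not_lt.mp fun h => hx.2 ⟨h, hx.1.2⟩) hx.1.1
  rw [form, form]
  congr 1
  · refine (setIntegral_eq_of_subset_of_forall_sdiff_eq_zero measurableSet_Ico
      Ioo_subset_Ico_self fun x hx => ?_).symm
    rw [hd x hx, h0, zero_mul]
  · refine (setIntegral_eq_of_subset_of_ae_sdiff_eq_zero measurableSet_Ico.nullMeasurableSet
      Ioo_subset_Ico_self ?_).symm
    rw [ae_iff]
    refine measure_mono_null (fun x hx => ?_) (hn α hα)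
    simp only [Set.mem_ofPred_eq, Classical.not_imp] at hx
    exact hd x hx.1

theorem HasRN.congr_oi {a' : EReal} {β : ℝ} (hsub : oi a' β ⊆ oi a b) {μ : Measure ℝ}
    {f g h : ℝ → ℂ} (hf : HasRN (oi a b) μ f h) (hfg : ∀ x ∈ oi a' β, f x = g x) :
    HasRN (oi a' β) μ g h := by
  refine ⟨fun p hp q hq => hf.1 p (hsub hp) q (hsub hq), fun p hp q hq => ?_⟩
  rw [← hfg p hp, ← hfg q hq]
  exact hf.2 p (hsub hp) q (hsub hq)

/-- The component of `{g ≠ 0}` in `(a, c)` that contains a given point. -/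
theorem exists_component {g : ℝ → ℂ} (hg : ContinuousOn g (oi a b)) (hc : c ∈ oi a b)
    (hgc : g c = 0) {x₀ : ℝ} (hx₀ : x₀ ∈ oi a c) (h0 : g x₀ ≠ 0) :
    ∃ (a' : EReal) (β : ℝ), oi a' β ⊆ oi a c ∧ x₀ ∈ oi a' β ∧ β ∈ oi a b ∧ β ≤ c ∧ g β = 0 ∧
      (∀ x ∈ oi a' β, g x ≠ 0) ∧ (a' = a ∨ ∃ α ∈ oi a c, a' = (α : EReal) ∧ g α = 0) := by
  have hx₀b := mem_oi_left hc hx₀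
  have hx₀c := lt_of_mem_oi hx₀
  have zeros : ∀ {s t : ℝ}, s ∈ oi a b → t ∈ oi a b → IsCompact (Icc s t ∩ g ⁻¹' {0}) := by
    intro s t hs ht
    exact isCompact_Icc.of_isClosed_subset
      ((hg.mono (Icc_subset_oi hs ht)).preimage_isClosed_of_isClosed isClosed_Icc
        isClosed_singleton) inter_subset_left
  obtain ⟨β, ⟨⟨hβ1, hβ2⟩, hβ0⟩, hβ⟩ := (zeros hx₀b hc).exists_isLeast ⟨c, ⟨hx₀c.le, le_rfl⟩, hgc⟩
  have hβb : β ∈ oi a b := Icc_subset_oi hx₀b hc ⟨hβ1, hβ2⟩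
  have hlt : x₀ < β := lt_of_le_of_ne hβ1 fun h => h0 (by rw [h]; exact hβ0)
  have hright : ∀ x, x₀ ≤ x → x < β → g x ≠ 0 := fun x h1 h2 h3 =>
    absurd (hβ ⟨⟨h1, (h2.trans_le hβ2).le⟩, h3⟩) (not_le.mpr h2)
  by_cases hex : ∃ s ∈ oi a x₀, g s = 0
  · obtain ⟨s, hs, hs0⟩ := hex
    have hsb := mem_oi_left hx₀b hs
    obtain ⟨α, ⟨⟨hα1, hα2⟩, hα0⟩, hα⟩ :=
      (zeros hsb hx₀b).exists_isGreatest ⟨s, ⟨le_rfl, (lt_of_mem_oi hs).le⟩, hs0⟩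
    have hαb : α ∈ oi a b := Icc_subset_oi hsb hx₀b ⟨hα1, hα2⟩
    have hαlt : α < x₀ := lt_of_le_of_ne hα2 fun h => h0 (by rw [← h]; exact hα0)
    refine ⟨α, β, fun x hx => ⟨hαb.1.trans hx.1, hx.2.trans_le (by exact_mod_cast hβ2)⟩,
      ⟨by exact_mod_cast hαlt, by exact_mod_cast hlt⟩, hβb, hβ2, hβ0, fun x hx hx0 => ?_,
      Or.inr ⟨α, (mem_oi_iff hαb).mpr (hαlt.trans hx₀c), rfl, hα0⟩⟩
    have hx1 : α < x := by exact_mod_cast hx.1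
    have hx2 : x < β := by exact_mod_cast hx.2
    rcases le_total x₀ x with h | h
    · exact hright x h hx2 hx0
    · exact absurd (hα ⟨⟨hα1.trans hx1.le, h⟩, hx0⟩) (not_le.mpr hx1)
  · push Not at hex
    refine ⟨a, β, oi_subset_oi hβ2, ⟨hx₀.1, by exact_mod_cast hlt⟩, hβb, hβ2, hβ0,
      fun x hx => ?_, Or.inl rfl⟩
    rcases le_or_gt x₀ x with h | h
    · exact hright x h (lt_of_mem_oi hx)
    · exact hex x ((mem_oi_iff (mem_oi_left hβb hx)).mpr h)

namespace TLoc

theorem mul_qd_sub_eq_form_of_ae (hn : C.Atomless) (hc : c ∈ oi a b) (u : C.TLoc) {g g' : ℝ → ℂ}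
    (hg : HasRN (oi a b) C.sigma g g') (h1 : ∀ᵐ x ∂C.rhoPos.restrict (oi a c), g x = 0)
    (h2 : ∀ᵐ x ∂C.rhoNeg.restrict (oi a c), g x = 0) {x y : ℝ} (hx : x ∈ oi a b)
    (hxy : x ≤ y) (hyc : y ≤ c) :
    g y * u.qd y - g x * u.qd x = C.form (Ico x y) g g' u.fn u.qd := by
  have hy : y ∈ oi a b := Icc_subset_oi hx hc ⟨hxy, hyc⟩
  have hsub : Ico x y ⊆ oi a c := (Ico_subset_oi_left hx).trans (oi_subset_oi hyc)
  have e1 : ∫ s in Ico x y, g s * u.tau s ∂C.rhoPos = 0 := integral_eq_zero_of_ae (by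
    filter_upwards [ae_mono (Measure.restrict_mono hsub le_rfl) h1] with s hs
    rw [hs, zero_mul, Pi.zero_apply])
  have e2 : ∫ s in Ico x y, g s * u.tau s ∂C.rhoNeg = 0 := integral_eq_zero_of_ae (by
    filter_upwards [ae_mono (Measure.restrict_mono hsub le_rfl) h2] with s hs
    rw [hs, zero_mul, Pi.zero_apply])
  rw [u.mul_qd_sub_eq hn hg hx hy hxy, e1, e2, form]
  ring

/-- Where `|ϱ|` vanishes, every element of `T_loc` solves the homogeneous equation. -/
theorem homWronskian_eq_of_rho_eq_zero (hn : C.Atomless) (u : C.TLoc) {θ : C.TLoc}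
    (hθ : C.IsSolution 0 θ) {x y : ℝ} (hx : x ∈ oi a b) (hy : y ∈ oi a b) (hxy : x ≤ y)
    (h1 : C.rhoPos (Ico x y) = 0) (h2 : C.rhoNeg (Ico x y) = 0) :
    homWronskian u θ y = homWronskian u θ x := by
  have e1 := mul_qd_sub_eq_form hn u.fn_deriv hx hy hxy
    fun t ht => tau_eq_zero hθ (Ico_subset_oi hx hy ht)
  have e2 := u.mul_qd_sub_eq hn θ.fn_deriv hx hy hxy
  rw [Measure.restrict_eq_zero.mpr h1, Measure.restrict_eq_zero.mpr h2, integral_zero_measure,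
    sub_zero, sub_zero, add_comm] at e2
  have e3 := form_comm (C := C) (Ico x y) u.fn u.qd θ.fn θ.qd
  rw [form, form] at e3
  rw [form] at e1
  rw [homWronskian, homWronskian]
  linear_combination e1 - e2 + e3

end TLoc

end Coeff

end LeftDefinite

end

noncomputable section

namespace LeftDefinite

namespace Coeff

variable {a b : EReal} {C : Coeff a b} {S : C.SeparatedBC} {φ : ℂ → C.TLoc} {c : ℝ}

/-- A function `g` is constant on an interval on which it agrees with a function `p` such that
`p*` is orthogonal to `g`. -/
theorem eq_of_form_conj_eq_zero {a' : EReal} {β : ℝ} (hsub : oi a' β ⊆ oi a b) (hβ : β ∈ oi a b)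
    {g g' p p' : ℝ → ℂ} (hg : HasRN (oi a b) C.sigma g g') (hL : C.L2On (oi a' β) g g')
    (hp : HasRN (oi a b) C.sigma p p') (hpg : ∀ x ∈ oi a' β, p x = g x)
    (h0 : C.form (oi a' β) g g' (fun x => conj (p x)) (fun x => conj (p' x)) = 0)
    {x : ℝ} (hx : x ∈ oi a' β) : g x = g β := by
  have hae := (HasRN.congr_oi hsub hg fun _ _ => rfl).ae_eq (HasRN.congr_oi hsub hp hpg)
  have e : C.form (oi a' β) g g' (fun x => conj (p x)) (fun x => conj (p' x))
      = C.form (oi a' β) g g' (fun x => conj (g x)) (fun x => conj (g' x)) := by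
    rw [form, form]
    congr 1
    · exact setIntegral_congr_fun (measurableSet_oi _ _) fun t ht => by simp only [hpg t ht]
    · exact integral_congr_ae (by filter_upwards [hae] with t ht using by rw [ht])
  rw [e, form_comm, form_conj_self, Complex.ofReal_eq_zero, energy] at h0
  have n1 : 0 ≤ ∫ t in oi a' β, ‖g t‖ ^ 2 ∂C.chi := integral_nonneg fun _ => sq_nonneg _
  have n2 : 0 ≤ ∫ t in oi a' β, ‖g' t‖ ^ 2 ∂C.sigma := integral_nonneg fun _ => sq_nonneg _
  have z2 : ∫ t in oi a' β, ‖g' t‖ ^ 2 ∂C.sigma = 0 := by linarith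
  rw [integral_eq_zero_iff_of_nonneg (fun _ => sq_nonneg _) hL.integrableOn_sq.2] at z2
  have hxβ : x < β := by exact_mod_cast hx.2
  have hI : Ico x β ⊆ oi a' β := fun t ht =>
    ⟨hx.1.trans_le (by exact_mod_cast ht.1), by exact_mod_cast ht.2⟩
  have h1 := hg.sub_eq (hsub hx) hβ hxβ.le
  rw [integral_eq_zero_of_ae (by
    filter_upwards [ae_mono (Measure.restrict_mono hI le_rfl) z2] with t ht
    simpa using ht)] at h1
  exact (sub_eq_zero.mp h1).symm

namespace SeparatedBC.IsRealEntireSolution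

/-- The elements of the span of the functions `φ_z` on a subinterval. -/
theorem exists_of_mem_span (hφ : S.IsRealEntireSolution φ) (hn : C.Atomless) (hc : c ∈ oi a b)
    {U : Set ℝ} (hU : MeasurableSet U) (hUc : U ⊆ oi a c) {g g' : ℝ → ℂ} (hL : C.L2On U g g')
    (hform : ∀ z, C.form U g g' (φ z).fn (φ z).qd = 0) {q : U → ℂ}
    (hq : q ∈ Submodule.span ℂ (range fun (z : ℂ) (x : U) => (φ z).fn x)) :
    ∃ p p' : ℝ → ℂ, HasRN (oi a b) C.sigma p p' ∧ (∀ x : U, p x = q x) ∧ C.L2On U p p' ∧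
      C.form U g g' (fun x => conj (p x)) (fun x => conj (p' x)) = 0 := by
  induction hq using Submodule.span_induction with
  | mem q hq =>
    obtain ⟨z, rfl⟩ := hq
    refine ⟨(φ z).fn, (φ z).qd, (φ z).fn_deriv, fun x => rfl,
      ((φ z).l2On_oi hn (hφ.near_left z).1 hc).mono hUc, ?_⟩
    rw [← hform (conj z)]
    exact form_congr hU (fun _ _ => rfl) (fun _ _ => rfl)
      (fun t ht => (hφ.fn_conj (mem_oi_left hc (hUc ht)) z).symm)
      (fun t ht => (hφ.qd_conj (mem_oi_left hc (hUc ht)) z).symm)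
  | zero =>
    refine ⟨0, 0, ⟨fun α _ β _ => integrableOn_zero, fun p _ q _ => by simp [orientedIntegral]⟩,
      fun _ => rfl, ⟨MemLp.zero, MemLp.zero⟩, by simp [form]⟩
  | add q₁ q₂ _ _ h₁ h₂ =>
    obtain ⟨p, p', i1, i2, i3, i4⟩ := h₁
    obtain ⟨k, k', j1, j2, j3, j4⟩ := h₂
    refine ⟨p + k, p' + k', i1.add j1, fun x => ?_, ⟨i3.1.add j3.1, i3.2.add j3.2⟩, ?_⟩
    · rw [Pi.add_apply, Pi.add_apply, i2, j2]
    · simp only [Pi.add_apply, map_add]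
      rw [form_add_right hL i3.conj j3.conj, i4, j4, add_zero]
  | smul r q _ h =>
    obtain ⟨p, p', i1, i2, i3, i4⟩ := h
    refine ⟨r • p, r • p', i1.smul r, fun x => ?_, ⟨i3.1.const_smul r, i3.2.const_smul r⟩, ?_⟩
    · rw [Pi.smul_apply, Pi.smul_apply, i2]
    · simp only [Pi.smul_apply, smul_eq_mul, map_mul]
      rw [form_comm, form_const_mul_left, form_comm, i4, mul_zero]

/-- An element of `H¹(a, c)` that is orthogonal to all `φ_z` and a pointwise limit of linear
combinations of them vanishes. -/
theorem eq_zero_of_mem_closure (hφ : S.IsRealEntireSolution φ) (hS : ¬ S.IsEigenvalue 0)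
    (hn : C.Atomless) (hc : c ∈ oi a b) (hχ : C.chi (oi a c) ≠ 0) {r : (C.restrict c hc hχ).H1}
    (ht : ∀ z, transform φ c hc hχ r z = 0)
    (hr : (r : ℝ → ℂ) ∈ closure
      (Submodule.span ℂ (range fun z : ℂ => (φ z).restrictFn c) : Set (ℝ → ℂ))) : r = 0 := by
  refine H1.ext_of_forall fun x₀ hx₀ => ?_
  change r x₀ = 0
  by_contra hne
  obtain ⟨g, g', hg, hgr, hg'r⟩ := H1.exists_extension hc hχ r
  have hL : C.L2On (oi a c) g g' := by
    have h : C.L2On (oi a c) r r.deriv := ⟨r.memLp, r.memLp_deriv⟩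
    exact h.congr (measurableSet_oi _ _) (fun x hx => (hgr x hx).symm)
      fun x hx => (hg'r x hx).symm
  have hperp : ∀ z, C.form (oi a c) g g' (φ z).fn (φ z).qd = 0 := by
    intro z
    rw [form_comm, ← ht z]
    exact form_congr (measurableSet_oi _ _) (fun _ _ => rfl) (fun _ _ => rfl) hgr hg'r
  have hcont := hg.continuousOn hn
  have hgc := hφ.apply_eq_zero_of_form_eq_zero hS hn hc hχ hg hL (hperp 0)
  obtain ⟨hpos, hneg⟩ := ae_eq_zero_of_setIntegral_rho_eq hc hcont fun x hx y hy hxy =>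
    hφ.setIntegral_rho_eq hS hn hc hχ hg hL hperp hx hy hxy
  rw [← hgr x₀ hx₀] at hne
  obtain ⟨a', β, hUc, hxU, hβ, hβc, hβ0, hU0, ha'⟩ := exists_component hcont hc hgc hx₀ hne
  have hUb := hUc.trans (oi_mono_right hc)
  have hform : ∀ z, C.form (oi a' β) g g' (φ z).fn (φ z).qd = 0 := by
    intro z
    rcases ha' with rfl | ⟨α, hα, rfl, hα0⟩
    · have h1 := form_oi_add hβ hβc hL ((φ z).l2On_oi hn (hφ.near_left z).1 hc)
      rw [hperp, ← (φ z).mul_qd_sub_eq_form_of_ae hn hc hg hpos hneg hβ hβc le_rfl, hgc, hβ0,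
        zero_mul, zero_mul, sub_zero, add_zero] at h1
      exact h1.symm
    · have e : oi (α : EReal) β = Ioo α β := by
        ext x
        simp [oi]
      have hαβ : α ≤ β := by
        have h := hxU.1.trans hxU.2
        exact_mod_cast h.le
      rw [e, form_Ioo_eq hn (mem_oi_left hc hα) hα0, ← (φ z).mul_qd_sub_eq_form_of_ae hn hc hg hpos
        hneg (mem_oi_left hc hα) hαβ hβc, hα0, hβ0, zero_mul, zero_mul, sub_zero]
  have hnull : ∀ {μ : Measure ℝ}, (∀ᵐ x ∂μ.restrict (oi a c), g x = 0) → ∀ x ∈ oi a' β,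
      ∀ y ∈ oi a' β, μ (Ico x y) = 0 := by
    intro μ hμ x hx y hy
    have hI := Ico_subset_oi hx hy
    rw [← Measure.restrict_eq_self μ (hI.trans hUc)]
    exact measure_mono_null (fun t ht => hU0 t (hI ht)) hμ
  obtain ⟨θ, hθ, hθ0, hθ1⟩ := TLoc.exists_homogeneous hn (hUb hxU) 1 0
  obtain ⟨η, hη, hη0, hη1⟩ := TLoc.exists_homogeneous hn (hUb hxU) 0 1
  have hconst : ∀ (u : C.TLoc) {v : C.TLoc}, C.IsSolution 0 v → ∀ x ∈ oi a' β,
      TLoc.homWronskian u v x = TLoc.homWronskian u v x₀ := by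
    intro u v hv x hx
    rcases le_total x₀ x with h | h
    · exact u.homWronskian_eq_of_rho_eq_zero hn hv (hUb hxU) (hUb hx) h (hnull hpos _ hxU _ hx)
        (hnull hneg _ hxU _ hx)
    · exact (u.homWronskian_eq_of_rho_eq_zero hn hv (hUb hx) (hUb hxU) h (hnull hpos _ hx _ hxU)
        (hnull hneg _ hx _ hxU)).symm
  have hrep : ∀ z, ∀ x ∈ oi a' β,
      (φ z).fn x = (φ z).fn x₀ * θ.fn x + (φ z).qd x₀ * η.fn x := by
    intro z x hx
    have h := TLoc.fn_mul_homWronskian (φ z) θ η x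
    rw [hconst θ hη x hx, hconst (φ z) hη x hx, hconst (φ z) hθ x hx] at h
    simp only [TLoc.homWronskian, hθ0, hθ1, hη0, hη1] at h
    linear_combination h
  set Q := Submodule.span ℂ (range fun (z : ℂ) (x : oi a' β) => (φ z).fn x) with hQ
  have hQfin : FiniteDimensional ℂ Q := by
    set P := Submodule.span ℂ
      ({fun x : oi a' β => θ.fn x, fun x : oi a' β => η.fn x} : Set (oi a' β → ℂ))
    have : FiniteDimensional ℂ P := FiniteDimensional.span_of_finite ℂ (toFinite _)
    have hQP : Q ≤ P := Submodule.span_le.mpr ?_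
    · exact Submodule.finiteDimensional_of_le hQP
    rintro _ ⟨z, rfl⟩
    refine Submodule.mem_span_pair.mpr ⟨(φ z).fn x₀, (φ z).qd x₀, ?_⟩
    funext x
    exact (hrep z x x.2).symm
  have hmem : (fun x : oi a' β => r x) ∈ Q := by
    have hcl : IsClosed (Q : Set (oi a' β → ℂ)) := Q.closed_of_finiteDimensional
    rw [← SetLike.mem_coe, ← hcl.closure_eq]
    set R : (ℝ → ℂ) →ₗ[ℂ] (oi a' β → ℂ) := LinearMap.funLeft ℂ ℂ Subtype.val with hR
    have hRc : Continuous R := continuous_pi fun x => continuous_apply (x : ℝ)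
    refine map_mem_closure hRc hr fun q hq => ?_
    have hle : Submodule.span ℂ (range fun z : ℂ => (φ z).restrictFn c) ≤ Q.comap R := by
      refine Submodule.span_le.mpr ?_
      rintro _ ⟨z, rfl⟩
      refine Submodule.subset_span ⟨z, ?_⟩
      funext x
      exact (indicator_of_mem (hUc x.2) _).symm
    exact hle hq
  obtain ⟨p, p', hp, hpr, -, hp0⟩ := hφ.exists_of_mem_span hn hc (measurableSet_oi _ _) hUc
    (hL.mono hUc) hform hmem
  refine hU0 x₀ hxU ?_
  rw [← hβ0]
  refine eq_of_form_conj_eq_zero hUb hβ hg (hL.mono hUc) hp (fun x hx => ?_) hp0 hxU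
  rw [hpr ⟨x, hx⟩, hgr x (hUc hx)]

/-- The closed linear span of the functions `φ_z` in `H¹(a, c)` consists of the functions in
`H¹(a, c)` that are pointwise limits of linear combinations of them. -/
theorem mem_closedSpan_iff (hφ : S.IsRealEntireSolution φ) (hS : ¬ S.IsEigenvalue 0)
    (hn : C.Atomless) (hc : c ∈ oi a b) (hχ : C.chi (oi a c) ≠ 0) (f : (C.restrict c hc hχ).H1) :
    f ∈ hφ.closedSpan hn hc hχ ↔ (f : ℝ → ℂ) ∈ closure
      (Submodule.span ℂ (range fun z : ℂ => (φ z).restrictFn c) : Set (ℝ → ℂ)) := by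
  set N := Submodule.span ℂ (range fun z : ℂ => (φ z).restrictFn c) with hN
  have hle : ∀ k ∈ hφ.closedSpan hn hc hχ, (k : ℝ → ℂ) ∈ closure (N : Set (ℝ → ℂ)) := by
    intro k hk
    rw [hφ.closedSpan_eq hn hc hχ] at hk
    let ι : (C.restrict c hc hχ).H1 →ₗ[ℂ] (ℝ → ℂ) := (C.restrict c hc hχ).h1Submodule.subtype
    have hι : Continuous ι := by
      refine continuous_pi fun x => ?_
      by_cases hx : x ∈ oi a c
      · obtain ⟨K, -, hK⟩ := H1.exists_norm_apply_le (C.restrict c hc hχ) hx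
        exact (((LinearMap.proj x).comp ι).mkContinuous K hK).continuous
      · have h0 : (fun f : (C.restrict c hc hχ).H1 => ι f x) = fun _ => 0 :=
          funext fun f => f.2.1 x hx
        rw [h0]
        exact continuous_const
    refine map_mem_closure hι hk fun q hq => ?_
    have : Submodule.span ℂ (range (hφ.elem hn hc hχ)) ≤ N.comap ι := by
      refine Submodule.span_le.mpr ?_
      rintro _ ⟨z, rfl⟩
      exact Submodule.subset_span ⟨z, rfl⟩
    exact this hq
  refine ⟨hle f, fun hf => ?_⟩
  have := H1.completeSpace (C.restrict c hc hχ)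
  have hclosed : IsClosed (hφ.closedSpan hn hc hχ : Set (C.restrict c hc hχ).H1) :=
    Submodule.isClosed_topologicalClosure _
  have := hclosed.completeSpace_coe
  obtain ⟨k, hk, l, hl, hkl⟩ := (hφ.closedSpan hn hc hχ).exists_add_mem_mem_orthogonal f
  have hl0 : l = 0 := by
    refine hφ.eq_zero_of_mem_closure hS hn hc hχ
      (hφ.transform_eq_zero_of_mem_orthogonal hn hc hχ hl) ?_
    have hlk : (l : ℝ → ℂ) = (f : ℝ → ℂ) - (k : ℝ → ℂ) := by
      rw [hkl]
      exact (add_sub_cancel_left (k : ℝ → ℂ) (l : ℝ → ℂ)).symm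
    rw [hlk]
    exact N.topologicalClosure.sub_mem hf (hle k hk)
  rw [hkl, hl0, add_zero]
  exact hk

end SeparatedBC.IsRealEntireSolution

end Coeff

end LeftDefinite

end

theorem mainTheorem6 {a b : EReal} (C : LeftDefinite.Coeff a b)
    (hς : (C.sigma.restrict (LeftDefinite.oi a b)).AbsolutelyContinuous volume)
    (S : C.SeparatedBC) (hS : ¬ S.IsEigenvalue 0)
    (φ : ℂ → C.TLoc) (hφ : S.IsRealEntireSolution φ)
    (c : ℝ) (hc : c ∈ LeftDefinite.oi a b) (hχ : C.chi (LeftDefinite.oi a c) ≠ 0) :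
    ∃ (hE : LeftDefinite.IsDeBrangesFunction (LeftDefinite.Coeff.entireE φ c))
      (hmem : ∀ z, (φ z).restrictFn c ∈ (C.restrict c hc hχ).h1Submodule)
      (T : (C.restrict c hc hχ).H1 →L[ℂ]
        LeftDefinite.DeBrangesSpace (LeftDefinite.Coeff.entireE φ c) hE),
      CompleteSpace (C.restrict c hc hχ).H1 ∧
      CompleteSpace (LeftDefinite.DeBrangesSpace (LeftDefinite.Coeff.entireE φ c) hE) ∧
      (∀ f z, T f z = LeftDefinite.Coeff.transform φ c hc hχ f z) ∧
      LeftDefinite.IsPartialIsometry T ∧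
      Function.Surjective T ∧
      LeftDefinite.initialSubspace T =
        (Submodule.span ℂ (Set.range fun z : ℂ =>
          (⟨(φ z).restrictFn c, hmem z⟩ : (C.restrict c hc hχ).H1))).topologicalClosure := by
  have hn := LeftDefinite.Coeff.atomless_of_absolutelyContinuous hς
  have hcomp := LeftDefinite.Coeff.H1.completeSpace (C.restrict c hc hχ)
  obtain ⟨T, hT, hTn, hker⟩ := hφ.exists_transform_operator hn hc hχ
  have hspan : LeftDefinite.initialSubspace T = hφ.closedSpan hn hc hχ := by
    rw [LeftDefinite.initialSubspace, hker, Submodule.orthogonal_orthogonal_eq_closure]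
    exact (Submodule.isClosed_topologicalClosure _).submodule_topologicalClosure_eq
  refine ⟨hφ.isDeBrangesFunction hn hc hχ, hφ.restrictFn_mem hn hc hχ, T, hcomp,
    LeftDefinite.DeBrangesSpace.completeSpace (hφ.entireE_ofReal_ne_zero hn hc hχ), hT,
    fun f hf => hTn f (hspan ▸ hf), fun F => ?_, ?_⟩
  · obtain ⟨f, hf⟩ := hφ.exists_of_apply hn hc hχ F
    exact ⟨f, LeftDefinite.DeBrangesSpace.ext_of_forall fun z => (hT f z).trans (hf z).symm⟩
  · refine hspan.trans (SetLike.ext fun f => ?_)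
    have hmap := Submodule.map_span (C.restrict c hc hχ).h1Submodule.subtype
      (Set.range fun z : ℂ => ⟨(φ z).restrictFn c, hφ.restrictFn_mem hn hc hχ z⟩)
    rw [← Set.range_comp] at hmap
    have himage := congrArg (fun N : Submodule ℂ (ℝ → ℂ) => f.1 ∈ closure (N : Set (ℝ → ℂ))) hmap
    exact (hφ.mem_closedSpan_iff hS hn hc hχ f).trans
      ((Iff.of_eq himage.symm).trans closure_subtype.symm)
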